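/- **Theorem (End-to-end guarantee for the OCP-based approach).** *Setting.* An MDP has a measurable state space $\mathcal X$, a finite non-empty action set $\mathcal A$, horizon $H\ge 1$, a random initial state $x_1\sim P_0$, deterministic transitions $x_{h+1}=f_h(x_h,a_h)$, and random rewards $r_h\in[0,1]$ drawn from a distribution depending on $(x_h,a_h)$. Known measurable feature maps $\phi_h:\mathcal X\times\mathcal A\to\mathbb R^d$ ($d\ge1$, $h\in[H]$) satisfy $\|\phi_h(x,a)\|_2\le 1$, and $\mathbb E[r_h\mid x_h=x,a_h=a]=\langle w_h^\star,\phi_h(x,a)\rangle$ for unknown $w_h^\star$ with $\|w_h^\star\|\le\sqrt d$. The MDP is linear Bellman complete: with $\mathcal B_h=\{\theta:|\langle\phi_h(x,a),\theta\rangle|\le1\ \forall x,a\}$, for each $h<H$ there is $\mathcal T_h:\mathcal B_{h+1}\to\mathcal B_h$ with $\langle\phi_h(x,a),\mathcal T_h\theta\rangle=\max_{a'}\langle\phi_{h+1}(f_h(x,a),a'),\theta\rangle$ for all $\theta,x,a$. For deterministic policies $\pi=(\pi_h:\mathcal X\to\mathcal A)_{h\in[H]}$, $V_1^\pi(x)$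 is the expected total reward from $x_1=x$ and $V_1^\star=\sup_\pi V_1^\pi$. Ties in $\arg\max_{a\in\mathcal A}$ are broken by a fixed rule, all calls of subroutines use fresh episodes, and numbers of episodes are rounded up. *OCP$(r_{1:H},B,T)$.* Let $\mathcal Q$ be the set of $(Q_h)_{h\in[H]}$, $Q_h=\langle\theta_h,\phi_h\rangle$, $|Q_h|\le B$. In each of $T$ episodes draw $x_1\sim P_0$, and for $h=1,\dots,H$ put $\widehat\pi_h(\cdot)=\arg\max_a\sup_{Q\in\mathcal Q}Q_h(\cdot,a)$, $a_h=\widehat\pi_h(x_h)$; let $b^+,b^-$ be the supremum and infimum over $Q\in\mathcal Q$ of $r_h(x_h,a_h)+\max_aQ_{h+1}(x_{h+1},a)$ (both $r_h(x_h,a_h)$ if $h=H$), and replace $\mathcal Q$ by $\mathcal Q\cap\{Q:b^-\le Q_h(x_h,a_h)\le b^+\}$. Then estimate the value of each of the $T$ policies under $r_{1:H}$ by the average over $T$ fresh episodes, and return the (first) best one. *RobustSpanner$(\mathrm{LinOpt},\mathrm{Vec},C,\eta)$.* Start with $W=(e_1,\dots,e_d)$. For an index $i$ let $\theta_i=(\det(e_j,W_{-i}))_{j}$,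 where $(v,W_{-i})$ is $W$ with $i$-th column $v$, $u_i=\theta_i/\|\theta_i\|$, $z_i^\pm=\mathrm{LinOpt}(\pm u_i)$, $w_i^\pm=\mathrm{Vec}(z_i^\pm)$. First, for $i=1,\dots,d$: if $\theta_i^\top w_i^+\ge-\theta_i^\top w_i^-$ set $z_i=z_i^+$ and column $w_i=w_i^++\eta u_i$, otherwise $z_i=z_i^-$, $w_i=w_i^--\eta u_i$. Then repeat: scan $i=1,\dots,d$; if $\theta_i^\top w_i^++\eta\|\theta_i\|\ge C|\det W|$, set $z_i=z_i^+$, $w_i=w_i^++\eta u_i$ and restart the scan; else if $-\theta_i^\top w_i^-+\eta\|\theta_i\|\ge C|\det W|$, set $z_i=z_i^-$, $w_i=w_i^--\eta u_i$ and restart the scan. When a scan changes nothing, return $(z_1,\dots,z_d)$. *ComputeSpanner$_{\rm ocp}(\varepsilon,\delta)$.* Let $N=d+\lceil\frac d2\log_2\frac{400d}{\varepsilon^2}\rceil$, $\delta'=\frac{\delta}{16HN}$, $n_{\rm vec}=c_2d^2\varepsilon^{-2}\log(1/\delta')$, $T=p_1(|\mathcal A|,d,H,\frac1\varepsilon,\log\frac1\delta)$.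 For each $h\in[H]$, $\Gamma_h$ is the output of RobustSpanner with $C=2$, $\eta=\varepsilon/2$, with $\mathrm{Vec}(\pi)$ the average of $\phi_h(x_h,a_h)$ over $n_{\rm vec}$ episodes of $\pi$, and $\mathrm{LinOpt}(\theta)=\mathrm{OCP}(r_{1:H},H,T)$ for $r_h=\phi_h^\top\theta/\|\theta\|$ and $r_l=0$ for $l\ne h$. *PolicyOpt$_{\rm ocp}(\Gamma_{1:H},n,\lambda)$.* For each $\ell\in[H]$ run $n$ episodes with each of the $d$ policies in $\Gamma_\ell$, collect the data $(x_\ell,a_\ell,r_\ell)$, and set $\widehat w_\ell=(\lambda I+\sum\phi_\ell\phi_\ell^\top)^{-1}\sum\phi_\ell r_\ell$. Return $\mathrm{OCP}(\widehat r_{1:H},H\max_\ell\|\widehat w_\ell\|,T)$ with $\widehat r_\ell=\phi_\ell^\top\widehat w_\ell$ and $T=p_2(|\mathcal A|,d,H,\frac1\varepsilon,\log\frac1\delta)$, where $(\varepsilon,\delta)$ are the target accuracy and confidence. *Cost.* Samples are episodes drawn from the environment. Computation is counted in elementary steps of exact real arithmetic (evaluating one feature vector or inner product costs $O(d)$ steps,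 $d\times d$ determinants and inverses $O(d^3)$). Every $\arg\max_a$ is computed by enumerating $\mathcal A$; $\sup_{Q\in\mathcal Q}Q_h(x,a)$ is one linear program in $d$ variables, $b^+$ takes $|\mathcal A|$ of them, and $b^-$ takes one in $d+1$ variables with $|\mathcal A|$ more inequalities. A linear program over the current $\mathcal Q$ with $k$ variables and $m$ inequalities (besides the fixed bound $|Q_h|\le B$ of the class) costs $\kappa(k,m)$ steps. No argmax oracle over actions is used, and no other linear optimization routine over the features. *Claim.* For all sufficiently large universal constants $c_0,c_1,c_2$ there is a polynomial $P$ such that for all polynomials $p_1,p_2\ge P$ (with non-negative integer coefficients, inequality on $[0,\infty)^5$) and every polynomial $\kappa$ with such coefficients there are polynomials $S,K$ with the following property. For every MDP and features as above and all $\varepsilon,\delta\in(0,1)$, let $L=d+\log\frac{dH}{\delta\varepsilon}$, run ComputeSpanner$_{\rm ocp}(\varepsilon',\delta/2)$ with $\varepsilon'=\frac{\varepsilon}{c_0dHL}$ to obtain $\Gamma_{1:H}$, and then PolicyOpt$_{\rm ocp}(\Gamma_{1:H},n,1)$ with $n=c_1d^2H^2L^2/\varepsilon^2$. With probability at least $1-\delta$,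 this procedure terminates, its output $\widehat\pi$ satisfies $$\mathbb E\bigl[V_1^\star(x_1)-V_1^{\widehat\pi}(x_1)\bigr]\le\varepsilon,$$ it draws at most $S(|\mathcal A|,d,H,\frac1\varepsilon,\log\frac1\delta)$ episodes, and it takes at most $K(|\mathcal A|,d,H,\frac1\varepsilon,\log\frac1\delta)$ steps. -/

import Mathlib

open MeasureTheory
open scoped RealInnerProductSpace

noncomputable section

namespace LBC

/-- `ℝ^d` with its Euclidean norm. -/
abbrev Vec (d : ℕ) := EuclideanSpace ℝ (Fin d)

/-! ### Markov decision processes with deterministic transitions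

Layers are numbered `0, …, H - 1`; whatever is indexed by a layer is a function on `ℕ` of which
only the values below `H` are used. -/

/-- A finite-horizon MDP with random initial state, deterministic transitions and random rewards
in `[0,1]`. The reward received for action `a` in state `x` at layer `h` is `reward h x a ξ` with a
fresh draw `ξ ∼ noise`; so the reward distribution is the law of `reward h x a` under `noise`. (With
uniform noise and quantile functions, every measurable family of distributions on `[0,1]` arises.) -/
structure DetMDP (X A Ξ : Type*) [MeasurableSpace X] [MeasurableSpace Ξ] where
  H : ℕ
  init : Measure X
  next : ℕ → X → A → X
  noise : Measure Ξ
  reward : ℕ → X → A → Ξ → ℝ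
  init_prob : IsProbabilityMeasure init
  noise_prob : IsProbabilityMeasure noise
  measurable_next : ∀ h < H, ∀ a, Measurable fun x => next h x a
  measurable_reward : ∀ h < H, ∀ a, Measurable fun p : X × Ξ => reward h p.1 a p.2
  reward_mem : ∀ h < H, ∀ x a ξ, reward h x a ξ ∈ Set.Icc (0 : ℝ) 1

attribute [instance] DetMDP.init_prob DetMDP.noise_prob

/-- Deterministic policies. -/
abbrev Policy (X A : Type*) := ℕ → X → A

/-- The randomness of one episode: the initial state and the reward noise of every layer. -/
abbrev Seed (X Ξ : Type*) := X × (ℕ → Ξ)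

/-- The randomness of a whole run: i.i.d. episodes, indexed by triples. -/
abbrev Tape (X Ξ : Type*) := ℕ × ℕ × ℕ → Seed X Ξ

namespace DetMDP

variable {X A Ξ : Type*} [MeasurableSpace X] [MeasurableSpace Ξ] (M : DetMDP X A Ξ)

/-- The state reached at layer `h` from initial state `x` under `π`. -/
def state (π : Policy X A) (x : X) : ℕ → X
  | 0 => x
  | h + 1 => M.next h (state π x h) (π h (state π x h))

/-- The action taken at layer `h` from initial state `x` under `π`. -/
def action (π : Policy X A) (x : X) (h : ℕ) : A := π h (M.state π x h)

/-- `𝔼[r_h | x_h = x, a_h = a]`. -/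
def meanReward (h : ℕ) (x : X) (a : A) : ℝ := ∫ ξ, M.reward h x a ξ ∂M.noise

/-- The value `V_1^π(x; r)` under reward functions `r`. -/
def valueOf (r : ℕ → X → A → ℝ) (π : Policy X A) (x : X) : ℝ :=
  ∑ h ∈ Finset.range M.H, r h (M.state π x h) (M.action π x h)

/-- `V_1^π`. -/
def value (π : Policy X A) (x : X) : ℝ := M.valueOf M.meanReward π x

/-- `V_1^⋆`. -/
def optValue (x : X) : ℝ := ⨆ π : Policy X A, M.value π x

/-- `𝔼[V_1^⋆(x_1) - V_1^π(x_1)] ≤ ε`, the two expectations being well defined. -/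
def IsEpsOptimal (ε : ℝ) (π : Policy X A) : Prop :=
  Integrable M.optValue M.init ∧ Integrable (M.value π) M.init ∧
    ∫ x, (M.optValue x - M.value π x) ∂M.init ≤ ε

/-- The law of the tape. -/
def tapeLaw : Measure (Tape X Ξ) :=
  Measure.infinitePi fun _ => M.init.prod (Measure.infinitePi fun _ : ℕ => M.noise)

/-- `{θ : |⟨φ_h(x,a), θ⟩| ≤ 1 for all (x,a)}`. -/
def paramBall {d : ℕ} (φ : ℕ → X → A → Vec d) (h : ℕ) : Set (Vec d) :=
  {θ | ∀ x a, |⟪φ h x a, θ⟫| ≤ 1}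

/-- Linear Bellman completeness. (At the last layer the backup is `0` and nothing is required.) -/
def LinearBellmanComplete {d : ℕ} (φ : ℕ → X → A → Vec d) : Prop :=
  ∀ h, h + 1 < M.H → ∃ B : paramBall φ (h + 1) → paramBall φ h,
    ∀ (θ : paramBall φ (h + 1)) (x : X) (a : A),
      ⟪φ h x a, (B θ : Vec d)⟫ = ⨆ a', ⟪φ (h + 1) (M.next h x a) a', (θ : Vec d)⟫

/-- Measurable features of norm at most one, and mean rewards that are linear in the features with
parameters of norm at most `√d`. -/
def BoundedLinear {d : ℕ} (φ : ℕ → X → A → Vec d) : Prop :=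
  (∀ h < M.H, ∀ a, Measurable fun x => φ h x a) ∧
  (∀ h < M.H, ∀ x a, ‖φ h x a‖ ≤ 1) ∧
  (∀ h < M.H, ∃ w : Vec d, ‖w‖ ≤ √d ∧ ∀ x a, M.meanReward h x a = ⟪w, φ h x a⟫)

end DetMDP

/-! ### Computations with a resource count -/

/-- The result of a computation, together with the number of episodes (trajectories) that it draws
from the environment and the number of elementary steps that it takes. -/
structure Costed (α : Type*) where
  val : α
  samples : ℕ
  steps : ℕ

namespace Costed

def ret {α : Type*} (a : α) : Costed α := ⟨a, 0, 0⟩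

def bind {α β : Type*} (m : Costed α) (f : α → Costed β) : Costed β :=
  ⟨(f m.val).val, m.samples + (f m.val).samples, m.steps + (f m.val).steps⟩

/-- `n` further steps. -/
def tick {α : Type*} (n : ℕ) (m : Costed α) : Costed α := ⟨m.val, m.samples, m.steps + n⟩

/-- `n` further episodes. -/
def draw {α : Type*} (n : ℕ) (m : Costed α) : Costed α := ⟨m.val, m.samples + n, m.steps⟩

/-- `for i = 0, …, n - 1 do f i`. -/
def iter {σ : Type*} (f : ℕ → σ → Costed σ) : ℕ → σ → Costed σ
  | 0, s => ret s
  | n + 1, s => (iter f n s).bind (f n)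

end Costed

/-! ### RobustSpanner

Generic over the index set `Z`. The oracles are subroutines which receive the running number of the
call, so that distinct calls can use fresh randomness. -/

section Spanner

variable {Z : Type*} {d : ℕ}

structure SpanState (Z : Type*) (d : ℕ) where
  W : Fin d → Vec d
  z : Fin d → Z
  calls : ℕ

/-- The determinant of the matrix with columns `W`. -/
def detCols (W : Fin d → Vec d) : ℝ := (Matrix.of fun k c => W c k).det

/-- `θ_i = (det(e_j, W_{-i}))_j`, where `(v, W_{-i})` is `W` with its `i`-th column replaced by
`v`. -/
def cofactor (W : Fin d → Vec d) (i : Fin d) : Vec d :=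
  WithLp.toLp 2 fun j => detCols (Function.update W i (EuclideanSpace.single j (1 : ℝ)))

/-- Steps charged for the linear algebra at one index `i`: at most `d + 1` determinants (by
elimination, at most `(d + 1)^3` steps each) and some vector operations. -/
def cofactorCost (d : ℕ) : ℕ := (d + 1) * (d + 1) ^ 3 + 20 * (d + 1)

def SpanState.put (s : SpanState Z d) (i : Fin d) (z : Z) (w : Vec d) : SpanState Z d :=
  ⟨Function.update s.W i w, Function.update s.z i z, s.calls⟩

variable (linOpt : ℕ → Vec d → Costed Z) (vec : ℕ → Z → Costed (Vec d))

/-- `z = LinOpt(u)` followed by `w = Vec(z)`, as calls number `k` and `k + 1`. -/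
def probe (k : ℕ) (u : Vec d) : Costed (Z × Vec d) :=
  (linOpt k u).bind fun z => (vec (k + 1) z).bind fun w => Costed.ret (z, w)

/-- Both probes at index `i`: in directions `θ_i/‖θ_i‖` and `-θ_i/‖θ_i‖`. -/
def probes (s : SpanState Z d) (i : Fin d) : Costed ((Z × Vec d) × (Z × Vec d)) :=
  let θ := cofactor s.W i
  let u := ‖θ‖⁻¹ • θ
  (probe linOpt vec s.calls u).bind fun p =>
    (probe linOpt vec (s.calls + 2) (-u)).bind fun q =>
      (Costed.ret (p, q)).tick (cofactorCost d)

open Classical in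
/-- One pass of the initial loop. -/
def spanInit (ε : ℝ) (i : Fin d) (s : SpanState Z d) : Costed (SpanState Z d) :=
  let θ := cofactor s.W i
  let u := ‖θ‖⁻¹ • θ
  (probes linOpt vec s i).bind fun pq =>
    let s' : SpanState Z d := ⟨s.W, s.z, s.calls + 4⟩
    Costed.ret <|
      if -⟪θ, pq.2.2⟫ ≤ ⟪θ, pq.1.2⟫ then s'.put i pq.1.1 (pq.1.2 + ε • u)
      else s'.put i pq.2.1 (pq.2.2 - ε • u)

def spanInits (ε : ℝ) : List (Fin d) → SpanState Z d → Costed (SpanState Z d)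
  | [], s => Costed.ret s
  | i :: is, s => (spanInit linOpt vec ε i s).bind (spanInits ε is)

open Classical in
/-- The inner while loop: run through the indices until one column is replaced; the flag says
whether that happened. -/
def spanScan (C ε : ℝ) : List (Fin d) → SpanState Z d → Costed (SpanState Z d × Bool)
  | [], s => Costed.ret (s, false)
  | i :: is, s =>
    let θ := cofactor s.W i
    let u := ‖θ‖⁻¹ • θ
    (probes linOpt vec s i).bind fun pq =>
      let s' : SpanState Z d := ⟨s.W, s.z, s.calls + 4⟩
      if C * |detCols s.W| ≤ ⟪θ, pq.1.2⟫ + ε * ‖θ‖ then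
        Costed.ret (s'.put i pq.1.1 (pq.1.2 + ε • u), true)
      else if C * |detCols s.W| ≤ -⟪θ, pq.2.2⟫ + ε * ‖θ‖ then
        Costed.ret (s'.put i pq.2.1 (pq.2.2 - ε • u), true)
      else spanScan C ε is s'

/-- The outer loop `for n = 1, 2, …`, cut off after `fuel` rounds: `none` means that it has not
stopped by then. -/
def spanLoop (C ε : ℝ) : ℕ → SpanState Z d → Costed (Option (Fin d → Z))
  | 0, _ => Costed.ret none
  | fuel + 1, s => (spanScan linOpt vec C ε (List.finRange d) s).bind fun p =>
      if p.2 then spanLoop C ε fuel p.1 else Costed.ret (some p.1.z)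

/-- RobustSpanner; `z₀` only fills the slots that the initial loop overwrites. -/
def robustSpanner (z₀ : Z) (C ε : ℝ) (fuel : ℕ) : Costed (Option (Fin d → Z)) :=
  (spanInits linOpt vec ε (List.finRange d)
    ⟨fun i => EuclideanSpace.single i (1 : ℝ), fun _ => z₀, 0⟩).bind
      (spanLoop linOpt vec C ε fuel)

end Spanner

/-! ### The learning algorithm -/

/-- The environment in which the algorithm runs: the MDP, the known feature maps, the fixed rule for
breaking ties between actions, and the price `lp k m` in elementary steps of one linear program with
`k` variables and `m` inequalities, over parameters that satisfy the fixed bound `|Q_h| ≤ B` of the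
function class (which is not counted among the `m` inequalities). -/
structure Env (X A Ξ : Type*) [MeasurableSpace X] [MeasurableSpace Ξ] (d : ℕ)
    extends DetMDP X A Ξ where
  φ : ℕ → X → A → Vec d
  tie : Finset A → A
  tie_mem : ∀ s : Finset A, s.Nonempty → tie s ∈ s
  lp : ℕ → ℕ → ℕ

/-- The constraint `lo ≤ ⟨θ_layer, vec⟩ ≤ hi`. -/
structure Row (d : ℕ) where
  layer : ℕ
  vec : Vec d
  lo : ℝ
  hi : ℝ

/-- A policy together with the number of steps that it takes to compute its action in a given state
of a given layer. -/
structure ImplPolicy (X A : Type*) where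
  act : Policy X A
  cost : ℕ → ℕ

/-- Working memory of one OCP episode: current state, constraints, and the policy so far. -/
structure EpisodeState (X A : Type*) (d : ℕ) where
  x : X
  rows : List (Row d)
  pol : ImplPolicy X A

/-- Some fixed policy, overwritten by the algorithms before it is used. -/
def somePolicy (X A : Type*) [Nonempty A] : ImplPolicy X A :=
  ⟨fun _ _ => Classical.arbitrary A, fun _ => 0⟩

/-- The arguments of the polynomials: `(|𝒜|, d, H, 1/ε, log(1/δ))`. -/
def sizes (A : Type*) [Fintype A] (d H : ℕ) (ε δ : ℝ) : Fin 5 → ℝ :=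
  ![(Fintype.card A : ℝ), (d : ℝ), (H : ℝ), 1 / ε, Real.log (1 / δ)]

namespace Env

variable {X A Ξ : Type*} [MeasurableSpace X] [MeasurableSpace Ξ] [Fintype A] {d : ℕ}
  (E : Env X A Ξ d)

/-- The feature met at layer `h` from initial state `x` under `π`. -/
def feat (π : Policy X A) (x : X) (h : ℕ) : Vec d := E.φ h (E.state π x h) (E.action π x h)

/-- Steps charged for following a policy through the layers `0, …, n - 1`. -/
def rolloutCost (π : ImplPolicy X A) (n : ℕ) : ℕ := ∑ h ∈ Finset.range n, (π.cost h + 1)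

/-- Linear `Q`-functions `Q_h = ⟨θ_h, φ_h⟩`, `h < H`, bounded by `B` everywhere and satisfying the
given constraints; a `Q`-function is represented by its parameters. -/
def versionSpace (B : ℝ) (rows : List (Row d)) : Set (ℕ → Vec d) :=
  {θ | (∀ h < E.H, ∀ x a, |⟪θ h, E.φ h x a⟫| ≤ B) ∧
    ∀ c ∈ rows, c.lo ≤ ⟪θ c.layer, c.vec⟫ ∧ ⟪θ c.layer, c.vec⟫ ≤ c.hi}

open Classical in
/-- `argmax_a g(a)`, with the fixed rule for ties. -/
def argmax (g : A → ℝ) : A := E.tie (Finset.univ.filter fun a => ∀ b, g b ≤ g a)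

/-- `argmax_a sup_{Q ∈ V} Q_h(x,a)`. -/
def greedy (V : Set (ℕ → Vec d)) (h : ℕ) (x : X) : A :=
  E.argmax fun a => sSup ((fun θ : ℕ → Vec d => ⟪θ h, E.φ h x a⟫) '' V)

/-- Greedy actions under `m` constraints are found by enumerating the actions: one feature
evaluation, one linear program in `d` variables and one comparison for each. -/
def greedyCost (m : ℕ) : ℕ := Fintype.card A * (d + E.lp d (2 * m) + 1)

/-- `sup_{Q ∈ V} (ρ + max_a Q_h(x,a))`. -/
def upper (V : Set (ℕ → Vec d)) (ρ : ℝ) (h : ℕ) (x : X) : ℝ :=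
  sSup ((fun θ : ℕ → Vec d => ρ + ⨆ a, ⟪θ h, E.φ h x a⟫) '' V)

/-- `inf_{Q ∈ V} (ρ + max_a Q_h(x,a))`. -/
def lower (V : Set (ℕ → Vec d)) (ρ : ℝ) (h : ℕ) (x : X) : ℝ :=
  sInf ((fun θ : ℕ → Vec d => ρ + ⨆ a, ⟪θ h, E.φ h x a⟫) '' V)

/-- `upper` takes one linear program in `d` variables per action; `lower` is a single linear program
in `d + 1` variables with one more inequality per action. -/
def boundsCost (m : ℕ) : ℕ :=
  Fintype.card A * (d + E.lp d (2 * m) + 1) + Fintype.card A * d +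
    E.lp (d + 1) (2 * m + Fintype.card A)

/-- Layer `h` of an OCP episode. -/
def ocpLayer (r : ℕ → X → A → ℝ) (B : ℝ) (h : ℕ) (s : EpisodeState X A d) :
    Costed (EpisodeState X A d) :=
  let V := E.versionSpace B s.rows
  let m := s.rows.length
  let a := E.greedy V h s.x
  let x' := E.next h s.x a
  let hi := if h + 1 < E.H then E.upper V (r h s.x a) (h + 1) x' else r h s.x a
  let lo := if h + 1 < E.H then E.lower V (r h s.x a) (h + 1) x' else r h s.x a
  (Costed.ret
    { x := x'
      rows := ⟨h, E.φ h s.x a, lo, hi⟩ :: s.rows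
      pol := ⟨Function.update s.pol.act h (E.greedy V h),
        Function.update s.pol.cost h (E.greedyCost m)⟩ }).tick
    (E.greedyCost m + (if h + 1 < E.H then E.boundsCost m else 0) + 4 * d + 10)

/-- OCP with rewards `r`, the class of linear `Q`-functions bounded by `B`, and `T` episodes, reading
the episodes `τ 0, τ 1, …`. Evaluating `r` is charged as an inner product. -/
def ocp [Nonempty A] (r : ℕ → X → A → ℝ) (B : ℝ) (T : ℕ) (τ : ℕ → Seed X Ξ) :
    Costed (ImplPolicy X A) :=
  let explore : Costed (List (Row d) × (ℕ → ImplPolicy X A)) :=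
    Costed.iter (fun j s =>
        ((Costed.iter (E.ocpLayer r B) E.H ⟨(τ j).1, s.1, somePolicy X A⟩).draw 1).bind fun e =>
          Costed.ret (e.rows, Function.update s.2 j e.pol))
      T ([], fun _ => somePolicy X A)
  explore.bind fun s =>
    (Costed.iter (fun i (best : WithBot ℝ × ImplPolicy X A) =>
        let J : ℝ := (T : ℝ)⁻¹ *
          ∑ j ∈ Finset.range T, E.valueOf r (s.2 i).act (τ (T + i * T + j)).1
        ((Costed.ret (open Classical in
            if best.1 < (J : WithBot ℝ) then ((J : WithBot ℝ), s.2 i) else best)).draw T).tick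
          (T * (rolloutCost (s.2 i) E.H + E.H * (3 * d + 2)) + 2))
      T (⊥, somePolicy X A)).bind fun best => Costed.ret best.2

/-- Monte Carlo estimate of `𝔼^π[φ_h(x_h,a_h)]` from `n` episodes. -/
def vecEval (h : ℕ) (π : ImplPolicy X A) (n : ℕ) (τ : ℕ → Seed X Ξ) : Costed (Vec d) :=
  ((Costed.ret ((n : ℝ)⁻¹ • ∑ m ∈ Finset.range n, E.feat π.act (τ m).1 h)).draw n).tick
    (n * (rolloutCost π (h + 1) + 2 * d) + d)

/-- Intrinsic rewards: `φ_h^⊤ θ/‖θ‖` at layer `h` and `0` at all other layers. -/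
def intrinsic (h : ℕ) (θ : Vec d) (l : ℕ) (x : X) (a : A) : ℝ :=
  if l = h then ⟪E.φ h x a, θ⟫ / ‖θ‖ else 0

/-- `N_iter = d + ⌈(d/2) log₂(400 d/ε²)⌉`. -/
def numIter (d : ℕ) (ε : ℝ) : ℕ := d + ⌈(d : ℝ) / 2 * Real.logb 2 (400 * d / ε ^ 2)⌉₊

/-- `n_vec = c d² ε⁻² log(1/δ')` with `δ' = δ/(16 H N_iter)`, rounded up. -/
def numVec (d H : ℕ) (c ε δ : ℝ) : ℕ :=
  ⌈c * (d : ℝ) ^ 2 / ε ^ 2 * Real.log (1 / (δ / (16 * H * numIter d ε)))⌉₊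

/-- The number `T` of OCP episodes prescribed by the polynomial `p`, rounded up. -/
def numEpisodes (p : MvPolynomial (Fin 5) ℕ) (ε δ : ℝ) : ℕ :=
  ⌈MvPolynomial.aeval (sizes A d E.H ε δ) p⌉₊

/-- The call of RobustSpanner at layer `h`. Call number `k` reads the tape at `(h, k, ·)`. -/
def spannerLayer [Nonempty A] (ω : Tape X Ξ) (fuel : ℕ) (c : ℝ) (p : MvPolynomial (Fin 5) ℕ)
    (ε δ : ℝ) (h : ℕ) : Costed (Option (Fin d → ImplPolicy X A)) :=
  robustSpanner
    (fun k θ => E.ocp (E.intrinsic h θ) E.H (E.numEpisodes p ε δ) fun m => ω (h, k, m))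
    (fun k π => E.vecEval h π (numVec d E.H c ε δ) fun m => ω (h, k, m))
    (somePolicy X A) 2 (ε / 2) fuel

/-- Phase I, ComputeSpanner_ocp with inputs `(ε, δ)`; `none` if some call of RobustSpanner has not
stopped after `fuel` rounds. -/
def computeSpanner [Nonempty A] (ω : Tape X Ξ) (fuel : ℕ) (c : ℝ) (p : MvPolynomial (Fin 5) ℕ)
    (ε δ : ℝ) : Costed (Option (ℕ → Fin d → ImplPolicy X A)) :=
  Costed.iter (fun h (s : Option (ℕ → Fin d → ImplPolicy X A)) =>
      match s with
      | none => Costed.ret none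
      | some Γ => (E.spannerLayer ω fuel c p ε δ h).bind fun o =>
          Costed.ret (o.map fun γ => Function.update Γ h γ))
    E.H (some fun _ _ => somePolicy X A)

/-- `λ I + Σ_l`, with `n` episodes from each of the `d` policies in `γ = Γ_l`; the tape is read at
`(H + l, j, ·)` for the `j`-th policy. -/
def gram (ω : Tape X Ξ) (γ : Fin d → ImplPolicy X A) (n : ℕ) (lam : ℝ) (l : ℕ) :
    Matrix (Fin d) (Fin d) ℝ :=
  lam • (1 : Matrix (Fin d) (Fin d) ℝ) + ∑ j : Fin d, ∑ m ∈ Finset.range n,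
    let v := E.feat (γ j).act (ω (E.H + l, j, m)).1 l
    Matrix.vecMulVec v.ofLp v.ofLp

/-- `∑ φ_l(x,a) r` over the same data. -/
def moment (ω : Tape X Ξ) (γ : Fin d → ImplPolicy X A) (n : ℕ) (l : ℕ) : Vec d :=
  ∑ j : Fin d, ∑ m ∈ Finset.range n,
    let s := ω (E.H + l, j, m)
    E.reward l (E.state (γ j).act s.1 l) (E.action (γ j).act s.1 l) (s.2 l) •
      E.feat (γ j).act s.1 l

/-- Ridge regression for the reward parameter of layer `l`. -/
def ridge (ω : Tape X Ξ) (γ : Fin d → ImplPolicy X A) (n : ℕ) (lam : ℝ) (l : ℕ) : Costed (Vec d) :=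
  ((Costed.ret (WithLp.toLp 2
      ((E.gram ω γ n lam l)⁻¹.mulVec (E.moment ω γ n l).ofLp))).draw (d * n)).tick
    ((∑ j : Fin d, n * (rolloutCost (γ j) (l + 1) + 5 * (d + 1) ^ 2)) + 10 * (d + 1) ^ 3)

/-- Phase II, PolicyOpt_ocp. The final call of OCP reads the tape at `(2H, 0, ·)`. -/
def policyOpt [Nonempty A] (ω : Tape X Ξ) (Γ : ℕ → Fin d → ImplPolicy X A) (n : ℕ) (lam : ℝ)
    (p : MvPolynomial (Fin 5) ℕ) (ε δ : ℝ) : Costed (ImplPolicy X A) :=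
  (Costed.iter (fun l (w : ℕ → Vec d) =>
      (E.ridge ω (Γ l) n lam l).bind fun v => Costed.ret (Function.update w l v))
    E.H (fun _ => 0)).bind fun w =>
      (E.ocp (fun h x a => ⟪E.φ h x a, w h⟫) (E.H * ⨆ l : Fin E.H, ‖w l‖) (E.numEpisodes p ε δ)
        fun m => ω (2 * E.H, 0, m)).tick (E.H * (2 * d + 2) + 1)

/-- `L = d + log(dH/(δε))`. -/
def logFactor (d H : ℕ) (ε δ : ℝ) : ℝ := d + Real.log (d * H / (δ * ε))

/-- The two-phase procedure with accuracy `ε` and confidence `δ`: Phase I with inputs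
`(ε/(c₀ d H L), δ/2)`, then Phase II with `λ = 1` and `n = c₁ d² H² L²/ε²`. Here `c₂` is the constant
in the number of episodes for vector estimation, and `p₁`, `p₂` are the polynomials prescribing the
numbers of OCP episodes in the two phases. -/
def procedure [Nonempty A] (ω : Tape X Ξ) (fuel : ℕ) (c₀ c₁ c₂ : ℝ)
    (p₁ p₂ : MvPolynomial (Fin 5) ℕ) (ε δ : ℝ) : Costed (Option (ImplPolicy X A)) :=
  let L := logFactor d E.H ε δ
  (E.computeSpanner ω fuel c₂ p₁ (ε / (c₀ * d * E.H * L)) (δ / 2)).bind fun o =>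
    match o with
    | none => Costed.ret none
    | some Γ =>
      (E.policyOpt ω Γ ⌈c₁ * (d : ℝ) ^ 2 * (E.H : ℝ) ^ 2 * L ^ 2 / ε ^ 2⌉₊ 1 p₂ ε δ).bind fun π =>
        Costed.ret (some π)

/-- On the tape `ω` the procedure stops and returns an `ε`-optimal policy, having drawn at most `S`
episodes and taken at most `K` steps. -/
def Succeeds [Nonempty A] (c₀ c₁ c₂ : ℝ) (p₁ p₂ : MvPolynomial (Fin 5) ℕ) (ε δ S K : ℝ)
    (ω : Tape X Ξ) : Prop :=
  ∃ (fuel : ℕ) (π : ImplPolicy X A),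
    (E.procedure ω fuel c₀ c₁ c₂ p₁ p₂ ε δ).val = some π ∧
    E.IsEpsOptimal ε π.act ∧
    ((E.procedure ω fuel c₀ c₁ c₂ p₁ p₂ ε δ).samples : ℝ) ≤ S ∧
    ((E.procedure ω fuel c₀ c₁ c₂ p₁ p₂ ε δ).steps : ℝ) ≤ K

end Env

end LBC

end

/-!
The proof rests on four facts: OCP needs few episodes, fresh randomness may be conditioned on,
RobustSpanner tolerates inexact subroutines, and accurate rewards along a spanner are accurate
along every policy.

**OCP.** By linear Bellman completeness the optimal `Q`-function of bounded linear rewards is linear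
(`exists_isOptQ`), and it satisfies every constraint that OCP adds (`IsOptQ.mem_newRows`), so the
optimistic policies overestimate the optimal value. If an episode is suboptimal at its initial
state, then the version space disagrees about one of the features met; the two bounds of the
constraint added at the last such layer coincide, so that feature vector becomes *pinned*: all `Q`
in the version space agree on it (`collapse_lt_of_suboptimal`). Pinned vectors form a subspace of
`ℝ^d`, hence at most `d` episodes per layer are suboptimal (`card_suboptimal_le`). A policy whose
expected gap exceeds `α` is suboptimal with probability of the order of `α` divided by the range of
the values. Multiplying a factor `1/2` for each suboptimal episode, the product over `T` episodes
is at least `2 ^ (-H d)`, while its expectation is exponentially small in `T` if all gaps are large;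
so some policy has a small gap (`measure_all_gaps_le`), and Hoeffding's inequality makes OCP select
one with a small gap (`measure_gap_ocpPol_le`). The values of the linear programs depend measurably
on the constraints, which makes the returned policy measurable in the data (`measPol_ocpPol`).

**Fresh randomness.** All random inputs form one product space. A bound for a subroutine, proved for
fixed values of all coordinates but those of its own block, holds for the product
(`measure_le_of_resample`); this is how adaptively chosen subroutine calls are treated.

**RobustSpanner.** Each step asks for a pair of probes in a direction `±u`. If the answers are
accurate up to a fraction of `η`, the determinant of the columns is at least `(η / 2) ^ d` after the
initial pass, because each replaced column has a component of at least `η / 2` along its probe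
direction. Each later replacement doubles the determinant, which stays below `d! 2 ^ d`; so the
procedure stops, and since no index passes the final tests, Cramer's rule writes every mean feature
vector in the final columns with coefficients at most `2` (`robustSpanner_val`). The columns are
close to mean features of the returned policies (`GoodPhase.robustSpanner`).

**Reward estimation.** Whitening the ridge regression problem turns its noise into a vector whose
squared norm has an exponential moment bounded by one depending on `d` only, which bounds the error
in the norm of the design matrix (`measure_ridge_error_le`). Along the spanner policies the
estimated reward parameters are therefore accurate in mean, and by the spanner property along all
policies (`abs_meanVal_sub_le`). A policy nearly optimal for the estimated rewards, which the final
call of OCP provides, is then nearly optimal for the true ones (`isEpsOptimal_finalPol`).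

A union bound over the good events (`measure_not_good_le`), together with a count of the episodes
and steps on these events (`procedure_spec`), gives `Env.measure_not_succeeds_le`; it remains to
bound the parameters by polynomials. Logarithms are bounded by linear functions throughout; the
constant `10 ^ 6` is a common threshold for the three universal constants.
-/


set_option linter.unusedSectionVars false

noncomputable section
namespace LBC

/-! ### Product measures: fresh randomness -/

section Product

variable {ι S : Type*}

open Classical in
/-- The configuration that reads `ω` on the coordinates in `J` and `ω₀` elsewhere. -/
def merge (J : Set ι) (ω₀ ω : ι → S) : ι → S := fun i => if i ∈ J then ω i else ω₀ i

lemma merge_of_mem {J : Set ι} {i : ι} (h : i ∈ J) (ω₀ ω : ι → S) : merge J ω₀ ω i = ω i :=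
  if_pos h

lemma merge_of_notMem {J : Set ι} {i : ι} (h : i ∉ J) (ω₀ ω : ι → S) : merge J ω₀ ω i = ω₀ i :=
  if_neg h

variable [MeasurableSpace S]

lemma measurable_merge (J : Set ι) :
    Measurable fun p : (ι → S) × (ι → S) => merge J p.1 p.2 := by
  classical
  refine measurable_pi_iff.2 fun i => ?_
  by_cases h : i ∈ J
  · simp only [merge_of_mem h]; fun_prop
  · simp only [merge_of_notMem h]; fun_prop

variable (μ : Measure S) [IsProbabilityMeasure μ]

lemma measurePreserving_merge (J : Set ι) :
    MeasurePreserving (fun p : (ι → S) × (ι → S) => merge J p.1 p.2)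
      ((Measure.infinitePi fun _ : ι => μ).prod (Measure.infinitePi fun _ : ι => μ))
      (Measure.infinitePi fun _ : ι => μ) := by
  classical
  refine ⟨measurable_merge J, Measure.eq_infinitePi _ fun s t ht => ?_⟩
  rw [Measure.map_apply (measurable_merge J) (.pi s.countable_toSet fun i _ => ht i)]
  have : (fun p : (ι → S) × (ι → S) => merge J p.1 p.2) ⁻¹' (Set.pi s t) =
      (Set.pi (s.filter (· ∉ J)) t) ×ˢ (Set.pi (s.filter (· ∈ J)) t) := by
    ext p
    simp only [Set.mem_preimage, Set.mem_pi, Finset.mem_coe, Set.mem_prod, Finset.mem_filter]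
    constructor
    · intro h
      refine ⟨fun i hi => ?_, fun i hi => ?_⟩
      · simpa [merge_of_notMem hi.2] using h i hi.1
      · simpa [merge_of_mem hi.2] using h i hi.1
    · intro h i hi
      by_cases hJ : i ∈ J
      · simpa [merge_of_mem hJ] using h.2 i ⟨hi, hJ⟩
      · simpa [merge_of_notMem hJ] using h.1 i ⟨hi, hJ⟩
  rw [this, Measure.prod_prod, Measure.infinitePi_pi _ fun i _ => ht i,
    Measure.infinitePi_pi _ fun i _ => ht i, mul_comm, Finset.prod_filter_mul_prod_filter_not]

/-- Redrawing the coordinates in `J` does not change an expectation. -/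
lemma lintegral_resample (J : Set ι) {f : (ι → S) → ENNReal} (hf : Measurable f) :
    ∫⁻ ω, f ω ∂(Measure.infinitePi fun _ : ι => μ) =
      ∫⁻ ω₀, ∫⁻ ω, f (merge J ω₀ ω) ∂(Measure.infinitePi fun _ : ι => μ)
        ∂(Measure.infinitePi fun _ : ι => μ) := by
  rw [← (measurePreserving_merge μ J).lintegral_comp hf]
  exact lintegral_prod _ (hf.comp (measurable_merge J)).aemeasurable

/-- An event whose conditional probability given the coordinates outside `J` is at most `p` has
probability at most `p`. -/
lemma measure_le_of_resample (J : Set ι) {E : Set (ι → S)} (hE : MeasurableSet E) {p : ENNReal}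
    (h : ∀ ω₀, (Measure.infinitePi fun _ : ι => μ) {ω | merge J ω₀ ω ∈ E} ≤ p) :
    (Measure.infinitePi fun _ : ι => μ) E ≤ p := by
  rw [← lintegral_indicator_one hE, lintegral_resample μ J (measurable_one.indicator hE)]
  calc _ ≤ ∫⁻ _ω₀, p ∂(Measure.infinitePi fun _ : ι => μ) := by
        refine lintegral_mono fun ω₀ => ?_
        have hm : MeasurableSet {ω | merge J ω₀ ω ∈ E} :=
          (measurable_merge J).comp (measurable_const.prodMk measurable_id) hE
        refine le_trans (le_of_eq ?_) (h ω₀)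
        rw [← lintegral_indicator_one hm]
        rfl
    _ = p := by simp

/-- An i.i.d. family of independent pairs amounts to two independent i.i.d. families. -/
lemma measurePreserving_zip {N : Type*} [MeasurableSpace N] (ν : Measure N)
    [IsProbabilityMeasure ν] :
    MeasurePreserving (fun p : (ι → S) × (ι → N) => fun i => (p.1 i, p.2 i))
      ((Measure.infinitePi fun _ : ι => μ).prod (Measure.infinitePi fun _ : ι => ν))
      (Measure.infinitePi fun _ : ι => μ.prod ν) := by
  classical
  have hmeas : Measurable (fun p : (ι → S) × (ι → N) => fun i => (p.1 i, p.2 i)) := by fun_prop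
  refine ⟨hmeas, Measure.eq_infinitePi _ fun s t ht => ?_⟩
  have hbox : MeasurableSet (Set.pi (s : Set ι) t) := .pi s.countable_toSet fun i _ => ht i
  rw [Measure.map_apply hmeas hbox, Measure.prod_apply (hmeas hbox)]
  have h1 : ∀ x : ι → S, (Measure.infinitePi fun _ : ι => ν)
      (Prod.mk x ⁻¹' ((fun p : (ι → S) × (ι → N) => fun i => (p.1 i, p.2 i)) ⁻¹' (Set.pi s t))) =
      ∏ i ∈ s, ν (Prod.mk (x i) ⁻¹' (t i)) := by
    intro x
    rw [← Measure.infinitePi_pi (μ := fun _ : ι => ν) fun i _ => measurable_prodMk_left (ht i)]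
    congr 1
  simp_rw [h1]
  rw [ProbabilityTheory.lintegral_prod_eq_prod_lintegral_of_indepFun s
    (fun i (x : ι → S) => ν (Prod.mk (x i) ⁻¹' (t i)))
    (ProbabilityTheory.iIndepFun_infinitePi (P := fun _ : ι => μ)
      (X := fun i y => ν (Prod.mk y ⁻¹' (t i)))
      fun i => measurable_measure_prodMk_left (ht i))
    fun i => (measurable_measure_prodMk_left (ht i)).comp (measurable_pi_apply i)]
  refine Finset.prod_congr rfl fun i _ => ?_
  rw [Measure.prod_apply (ht i)]
  exact (measurePreserving_eval_infinitePi (fun _ : ι => μ) i).lintegral_comp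
    (measurable_measure_prodMk_left (ht i))

end Product

/-! ### Concentration -/

section Concentration

open ProbabilityTheory

variable {Ω : Type*} [MeasurableSpace Ω]

lemma HasSubgaussianMGF.lintegral_exp_le {μ : Measure Ω} {Y : Ω → ℝ} {c : NNReal}
    (h : HasSubgaussianMGF Y c μ) :
    ∫⁻ ω, ENNReal.ofReal (Real.exp (Y ω)) ∂μ ≤ ENNReal.ofReal (Real.exp (c / 2)) := by
  have hi := h.integrable_exp_mul 1
  have hm := h.mgf_le 1
  simp only [one_mul, mgf, one_pow, mul_one] at hi hm
  rw [← ofReal_integral_eq_lintegral_ofReal hi (ae_of_all _ fun _ => (Real.exp_pos _).le)]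
  exact ENNReal.ofReal_le_ofReal hm

/-- A centred sum of independent bounded variables, read off distinct coordinates of a product
measure, is sub-Gaussian. -/
lemma hasSubgaussianMGF_sum_of_mem_Icc {ι κ S : Type*} [MeasurableSpace S] (μ : Measure S)
    [IsProbabilityMeasure μ] (s : Finset κ) {e : κ → ι} (he : Function.Injective e)
    (f : κ → S → ℝ) (hf : ∀ k, Measurable (f k)) (a b : κ → ℝ)
    (hab : ∀ k x, f k x ∈ Set.Icc (a k) (b k)) :
    HasSubgaussianMGF (fun ω : ι → S => ∑ k ∈ s, (f k (ω (e k)) - ∫ x, f k x ∂μ))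
      (∑ k ∈ s, (‖b k - a k‖₊ / 2) ^ 2) (Measure.infinitePi fun _ : ι => μ) := by
  have hind : iIndepFun (fun k (ω : ι → S) => f k (ω (e k)) - ∫ x, f k x ∂μ)
      (Measure.infinitePi fun _ : ι => μ) :=
    ((iIndepFun_infinitePi (P := fun _ : ι => μ) (X := fun _ x => x)
      fun _ => measurable_id).precomp he).comp (fun k x => f k x - ∫ x, f k x ∂μ)
      fun k => (hf k).sub_const _
  refine HasSubgaussianMGF.sum_of_iIndepFun hind fun k _ => ?_
  have h := hasSubgaussianMGF_of_mem_Icc (μ := Measure.infinitePi fun _ : ι => μ)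
    (X := fun ω : ι → S => f k (ω (e k))) (a := a k) (b := b k)
    ((hf k).comp (measurable_pi_apply _)).aemeasurable (ae_of_all _ fun ω => hab k _)
  have hint : ∫ ω : ι → S, f k (ω (e k)) ∂(Measure.infinitePi fun _ : ι => μ) =
      ∫ x, f k x ∂μ := by
    have hp := measurePreserving_eval_infinitePi (fun _ : ι => μ) (e k)
    conv_rhs => rw [← hp.map_eq]
    rw [integral_map hp.aemeasurable (hf k).aestronglyMeasurable]
  rwa [hint] at h

/-- With variance `1/2`, the Gaussian average of `exp (x a)` is `exp (a²/4)`, while `exp (x²/2)` remains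
integrable (`lintegral_exp_sq_gaussian_le`). -/
lemma lintegral_exp_mul_gaussian (a : ℝ) :
    ∫⁻ x, ENNReal.ofReal (Real.exp (x * a)) ∂(gaussianReal 0 (1 / 2)) =
      ENNReal.ofReal (Real.exp (a ^ 2 / 4)) := by
  have hm := congrFun (mgf_fun_id_gaussianReal (μ := 0) (v := (1 / 2 : NNReal))) a
  have hi := integrable_exp_mul_gaussianReal (μ := 0) (v := (1 / 2 : NNReal)) a
  simp only [mgf] at hm
  simp_rw [mul_comm _ a]
  rw [← ofReal_integral_eq_lintegral_ofReal hi (ae_of_all _ fun _ => (Real.exp_pos _).le), hm]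
  congr 2
  push_cast
  ring

lemma lintegral_exp_sq_gaussian_le :
    ∫⁻ x, ENNReal.ofReal (Real.exp (x ^ 2 / 2)) ∂(gaussianReal 0 (1 / 2)) ≤
      ENNReal.ofReal (Real.exp (1 / 2)) := by
  rw [gaussianReal_of_var_ne_zero _ (by norm_num),
    lintegral_withDensity_eq_lintegral_mul _ (measurable_gaussianPDF _ _) (by fun_prop)]
  have h : ∀ x : ℝ, (gaussianPDF 0 (1 / 2) * fun x => ENNReal.ofReal (Real.exp (x ^ 2 / 2))) x =
      ENNReal.ofReal ((√Real.pi)⁻¹ * Real.exp (-(1 / 2) * x ^ 2)) := by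
    intro x
    simp only [Pi.mul_apply, gaussianPDF, gaussianPDFReal]
    rw [← ENNReal.ofReal_mul (by positivity)]
    congr 1
    rw [mul_assoc, ← Real.exp_add]
    push_cast
    have e1 : 2 * Real.pi * (1 / 2) = Real.pi := by ring
    have e2 : -(x - 0) ^ 2 / (2 * (1 / 2)) + x ^ 2 / 2 = -(1 / 2) * x ^ 2 := by ring
    rw [e1, e2]
  simp_rw [h]
  rw [← ofReal_integral_eq_lintegral_ofReal
    ((integrable_exp_neg_mul_sq (by norm_num)).const_mul _) (ae_of_all _ fun _ => by positivity)]
  refine ENNReal.ofReal_le_ofReal ?_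
  rw [integral_const_mul, integral_gaussian]
  have hpi := Real.pi_pos
  have h2 : √(Real.pi / (1 / 2)) = √Real.pi * √2 := by
    rw [← Real.sqrt_mul hpi.le]; congr 1; ring
  rw [h2, ← mul_assoc, inv_mul_cancel₀ (by positivity), one_mul]
  have h3 : (2 : ℝ) ≤ Real.exp 1 := by have := Real.add_one_le_exp 1; linarith
  calc √2 ≤ √(Real.exp 1) := Real.sqrt_le_sqrt h3
    _ = Real.exp (1 / 2) := by rw [Real.sqrt_eq_iff_mul_self_eq] <;> first | positivity | rw [← Real.exp_add]; norm_num

/-- A random vector all of whose one-dimensional marginals are sub-Gaussian has a norm of order at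
most `√d`, with sub-Gaussian tails. The bound on `𝔼 exp⟨v, Y⟩` is averaged over a Gaussian `v`. -/
lemma measure_sum_sq_ge_le {d : ℕ} (μ : Measure Ω) [IsProbabilityMeasure μ] (Y : Ω → Fin d → ℝ)
    (hY : Measurable Y)
    (h : ∀ v : Fin d → ℝ, ∫⁻ ω, ENNReal.ofReal (Real.exp (∑ i, v i * Y ω i)) ∂μ ≤
      ENNReal.ofReal (Real.exp ((∑ i, v i ^ 2) / 2))) (t : ℝ) :
    μ {ω | t ≤ ∑ i, Y ω i ^ 2} ≤ ENNReal.ofReal (Real.exp (d / 2 - t / 4)) := by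
  set g : Measure (Fin d → ℝ) := Measure.pi fun _ => gaussianReal 0 (1 / 2) with hg
  have hprod : ∀ f : Fin d → ℝ → ENNReal, (∀ i, Measurable (f i)) →
      ∫⁻ v, ∏ i, f i (v i) ∂g = ∏ i, ∫⁻ x, f i x ∂(gaussianReal 0 (1 / 2)) := by
    intro f hf
    rw [lintegral_prod_eq_prod_lintegral_of_indepFun Finset.univ
      (fun i (v : Fin d → ℝ) => f i (v i))
      (iIndepFun_pi (μ := fun _ : Fin d => gaussianReal 0 (1 / 2)) fun i => (hf i).aemeasurable)
      fun i => (hf i).comp (measurable_pi_apply i)]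
    exact Finset.prod_congr rfl fun i _ =>
      (measurePreserving_eval (fun _ : Fin d => gaussianReal 0 (1 / 2)) i).lintegral_comp (hf i)
  have hexp : ∀ a : Fin d → ℝ, ENNReal.ofReal (Real.exp (∑ i, a i)) =
      ∏ i, ENNReal.ofReal (Real.exp (a i)) := by
    intro a
    rw [Real.exp_sum, ENNReal.ofReal_prod_of_nonneg fun i _ => (Real.exp_pos _).le]
  have hYi : ∀ i, Measurable fun ω => Y ω i := fun i => (measurable_pi_apply i).comp hY
  -- `exp (‖y‖²/4)` is the Gaussian average of `exp ⟨v, y⟩` over `v`; now exchange the expectations.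
  have key : ∫⁻ ω, ENNReal.ofReal (Real.exp ((∑ i, Y ω i ^ 2) / 4)) ∂μ ≤
      ENNReal.ofReal (Real.exp (d / 2)) := by
    calc ∫⁻ ω, ENNReal.ofReal (Real.exp ((∑ i, Y ω i ^ 2) / 4)) ∂μ
        = ∫⁻ ω, ∫⁻ v, ENNReal.ofReal (Real.exp (∑ i, v i * Y ω i)) ∂g ∂μ := by
          refine lintegral_congr fun ω => ?_
          simp_rw [hexp, Finset.sum_div]
          rw [hprod (fun i x => ENNReal.ofReal (Real.exp (x * Y ω i))) fun i => by fun_prop, hexp]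
          exact Finset.prod_congr rfl fun i _ => (lintegral_exp_mul_gaussian _).symm
      _ = ∫⁻ v, ∫⁻ ω, ENNReal.ofReal (Real.exp (∑ i, v i * Y ω i)) ∂μ ∂g := by
          refine lintegral_lintegral_swap (Measurable.aemeasurable ?_)
          refine ENNReal.measurable_ofReal.comp (Real.measurable_exp.comp ?_)
          refine Finset.measurable_sum _ fun i _ => ?_
          exact ((measurable_pi_apply i).comp measurable_snd).mul ((hYi i).comp measurable_fst)
      _ ≤ ∫⁻ v, ENNReal.ofReal (Real.exp (∑ i, v i ^ 2 / 2)) ∂g := by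
          refine lintegral_mono fun v => ?_
          rw [← Finset.sum_div]; exact h v
      _ ≤ ∏ _i : Fin d, ENNReal.ofReal (Real.exp (1 / 2)) := by
          simp_rw [hexp]
          rw [hprod (fun _ x => ENNReal.ofReal (Real.exp (x ^ 2 / 2))) fun i => by fun_prop]
          exact Finset.prod_le_prod' fun i _ => lintegral_exp_sq_gaussian_le
      _ = _ := by
          rw [← hexp]; simp [div_eq_mul_inv]
  have hmark := mul_meas_ge_le_lintegral (μ := μ)
    (f := fun ω => ENNReal.ofReal (Real.exp ((∑ i, Y ω i ^ 2) / 4))) (by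
      refine ENNReal.measurable_ofReal.comp (Real.measurable_exp.comp ?_)
      exact (Finset.measurable_sum _ fun i _ => (hYi i).pow_const 2).div_const 4)
    (ENNReal.ofReal (Real.exp (t / 4)))
  have hset : {ω | ENNReal.ofReal (Real.exp (t / 4)) ≤
      ENNReal.ofReal (Real.exp ((∑ i, Y ω i ^ 2) / 4))} = {ω | t ≤ ∑ i, Y ω i ^ 2} := by
    ext ω
    simp only [Set.mem_ofPred_eq]
    rw [ENNReal.ofReal_le_ofReal_iff (Real.exp_pos _).le, Real.exp_le_exp]
    constructor <;> intro h <;> linarith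
  rw [hset] at hmark
  have hpos : ENNReal.ofReal (Real.exp (t / 4)) ≠ 0 := by simp [Real.exp_pos]
  rw [Real.exp_sub, ENNReal.ofReal_div_of_pos (Real.exp_pos _),
    ENNReal.le_div_iff_mul_le (Or.inl hpos) (Or.inl ENNReal.ofReal_ne_top), mul_comm]
  exact hmark.trans key

lemma measure_mean_sub_integral_ge_le {ι S : Type*} [MeasurableSpace S] (μ : Measure S)
    [IsProbabilityMeasure μ] {e : ℕ → ι} (he : Function.Injective e) {f : S → ℝ}
    (hf : Measurable f) {B t : ℝ} (hB : 0 < B) (hfB : ∀ x, |f x| ≤ B) (ht : 0 ≤ t) {n : ℕ}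
    (hn : 0 < n) :
    (Measure.infinitePi fun _ : ι => μ)
      {ω | t ≤ |(n : ℝ)⁻¹ * ∑ m ∈ Finset.range n, f (ω (e m)) - ∫ x, f x ∂μ|} ≤
      ENNReal.ofReal (2 * Real.exp (-(n * t ^ 2) / (2 * B ^ 2))) := by
  set P := Measure.infinitePi fun _ : ι => μ
  have hn' : (0 : ℝ) < n := by exact_mod_cast hn
  have hsub := hasSubgaussianMGF_sum_of_mem_Icc μ (Finset.range n) he (fun _ => f) (fun _ => hf)
    (fun _ => -B) (fun _ => B) fun _ x => abs_le.1 (hfB x)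
  set Z : (ι → S) → ℝ := fun ω => ∑ m ∈ Finset.range n, (f (ω (e m)) - ∫ x, f x ∂μ)
  have hc : ((∑ _m ∈ Finset.range n, (‖B - -B‖₊ / 2) ^ 2 : NNReal) : ℝ) = n * B ^ 2 := by
    simp only [Finset.sum_const, Finset.card_range, nsmul_eq_mul]
    push_cast
    rw [Real.norm_of_nonneg (by linarith)]
    ring
  have h1 := hsub.measure_ge_le (ε := n * t) (by positivity)
  have h2 := hsub.neg.measure_ge_le (ε := n * t) (by positivity)
  have hexp : -(n * t) ^ 2 / (2 * (n * B ^ 2)) = -(n * t ^ 2) / (2 * B ^ 2) := by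
    field_simp
  rw [hc, hexp] at h1 h2
  have hZ : ∀ ω, (n : ℝ)⁻¹ * ∑ m ∈ Finset.range n, f (ω (e m)) - ∫ x, f x ∂μ = (n : ℝ)⁻¹ * Z ω := by
    intro ω
    simp only [Z, Finset.sum_sub_distrib, Finset.sum_const, Finset.card_range, nsmul_eq_mul]
    field_simp
  have hsubset : {ω | t ≤ |(n : ℝ)⁻¹ * ∑ m ∈ Finset.range n, f (ω (e m)) - ∫ x, f x ∂μ|} ⊆
      {ω | n * t ≤ Z ω} ∪ {ω | n * t ≤ (-Z) ω} := by
    intro ω hω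
    simp only [Set.mem_ofPred_eq, hZ, abs_mul, abs_inv, Nat.abs_cast] at hω
    rw [← div_eq_inv_mul, le_div_iff₀ hn', mul_comm] at hω
    rcases le_abs.1 hω with h | h
    · exact Or.inl h
    · exact Or.inr h
  calc P _ ≤ P {ω | n * t ≤ Z ω} + P {ω | n * t ≤ (-Z) ω} :=
        (measure_mono hsubset).trans (measure_union_le _ _)
    _ ≤ ENNReal.ofReal (Real.exp (-(n * t ^ 2) / (2 * B ^ 2))) +
          ENNReal.ofReal (Real.exp (-(n * t ^ 2) / (2 * B ^ 2))) := by
        rw [← ofReal_measureReal, ← ofReal_measureReal]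
        exact add_le_add (ENNReal.ofReal_le_ofReal h1) (ENNReal.ofReal_le_ofReal h2)
    _ = _ := by rw [← ENNReal.ofReal_add (Real.exp_pos _).le (Real.exp_pos _).le, ← two_mul]

lemma integrable_of_norm_le {S E : Type*} [MeasurableSpace S] [NormedAddCommGroup E]
    [MeasurableSpace E] [BorelSpace E] [SecondCountableTopology E] (μ : Measure S)
    [IsFiniteMeasure μ] {F : S → E} (hF : Measurable F) {C : ℝ} (hC : ∀ x, ‖F x‖ ≤ C) :
    Integrable F μ :=
  Integrable.of_bound hF.aestronglyMeasurable C (ae_of_all _ hC)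

/-- Concentration of the empirical mean of bounded random vectors, in Euclidean norm. -/
lemma measure_norm_mean_sub_integral_ge_le {ι S : Type*} [MeasurableSpace S] (μ : Measure S)
    [IsProbabilityMeasure μ] {d : ℕ} {e : ℕ → ι} (he : Function.Injective e) {F : S → Vec d}
    (hF : Measurable F) (hF1 : ∀ x, ‖F x‖ ≤ 1) {t : ℝ} (ht : 0 ≤ t) {n : ℕ} (hn : 0 < n) :
    (Measure.infinitePi fun _ : ι => μ)
      {ω | t ≤ ‖(n : ℝ)⁻¹ • ∑ m ∈ Finset.range n, F (ω (e m)) - ∫ x, F x ∂μ‖} ≤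
      ENNReal.ofReal (Real.exp (d / 2 - n * t ^ 2 / 4)) := by
  set P := Measure.infinitePi fun _ : ι => μ
  have hn' : (0 : ℝ) < n := by exact_mod_cast hn
  have hint : Integrable F μ := integrable_of_norm_le μ hF hF1
  set D : (ι → S) → Vec d := fun ω => ∑ m ∈ Finset.range n, (F (ω (e m)) - ∫ x, F x ∂μ) with hD
  have hDm : Measurable D := by
    refine Finset.measurable_sum _ fun m _ => (hF.comp (measurable_pi_apply _)).sub_const _
  have hinner : ∀ (v : Vec d) ω, ⟪v, D ω⟫ =
      ∑ m ∈ Finset.range n, (⟪v, F (ω (e m))⟫ - ∫ x, ⟪v, F x⟫ ∂μ) := by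
    intro v ω
    rw [hD, inner_sum]
    refine Finset.sum_congr rfl fun m _ => ?_
    rw [inner_sub_right, integral_inner hint]
  have hmain := measure_sum_sq_ge_le P (fun ω i => (√n)⁻¹ * D ω i) (by
      refine measurable_pi_iff.2 fun i => ?_
      exact ((by fun_prop : Measurable fun v : Vec d => v i).comp hDm).const_mul _) (by
      intro v
      set v' : Vec d := WithLp.toLp 2 fun i => (√n)⁻¹ * v i with hv'
      have hsub := hasSubgaussianMGF_sum_of_mem_Icc μ (Finset.range n) he (fun _ x => ⟪v', F x⟫)
        (fun _ => (by fun_prop : Measurable fun x => ⟪v', F x⟫)) (fun _ => -‖v'‖) (fun _ => ‖v'‖)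
        fun _ x => abs_le.1 <| (abs_real_inner_le_norm _ _).trans
          (mul_le_of_le_one_right (norm_nonneg _) (hF1 x))
      have hle := HasSubgaussianMGF.lintegral_exp_le hsub
      have hc : ((∑ _m ∈ Finset.range n, (‖‖v'‖ - -‖v'‖‖₊ / 2) ^ 2 : NNReal) : ℝ) =
          ∑ i, v i ^ 2 := by
        simp only [Finset.sum_const, Finset.card_range, nsmul_eq_mul]
        push_cast
        rw [Real.norm_of_nonneg (by linarith [norm_nonneg v'])]
        have : (‖v'‖ - -‖v'‖) / 2 = ‖v'‖ := by ring
        rw [this, EuclideanSpace.norm_sq_eq]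
        simp only [hv', Real.norm_eq_abs, sq_abs, mul_pow, inv_pow, Real.sq_sqrt hn'.le]
        rw [← Finset.mul_sum]
        field_simp
      rw [hc] at hle
      refine le_trans (le_of_eq (lintegral_congr fun ω => ?_)) hle
      rw [← hinner, PiLp.inner_apply]
      congr 2
      refine Finset.sum_congr rfl fun i _ => ?_
      simp [hv']; ring) (n * t ^ 2)
  refine le_trans (measure_mono fun ω hω => ?_) hmain
  simp only [Set.mem_ofPred_eq] at hω ⊢
  have hDe : (n : ℝ)⁻¹ • ∑ m ∈ Finset.range n, F (ω (e m)) - ∫ x, F x ∂μ = (n : ℝ)⁻¹ • D ω := by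
    simp only [hD, Finset.sum_sub_distrib, Finset.sum_const, Finset.card_range, smul_sub,
      ← Nat.cast_smul_eq_nsmul ℝ, smul_smul]
    rw [inv_mul_cancel₀ hn'.ne', one_smul]
  rw [hDe, norm_smul, norm_inv, RCLike.norm_natCast, ← div_eq_inv_mul, le_div_iff₀ hn'] at hω
  have hsq : ∑ i, ((√n)⁻¹ * D ω i) ^ 2 = (n : ℝ)⁻¹ * ‖D ω‖ ^ 2 := by
    rw [EuclideanSpace.norm_sq_eq, Finset.mul_sum]
    refine Finset.sum_congr rfl fun i _ => ?_
    rw [mul_pow, inv_pow, Real.sq_sqrt hn'.le, Real.norm_eq_abs, sq_abs]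
  rw [hsq, ← div_eq_inv_mul, le_div_iff₀ hn']
  calc n * t ^ 2 * n = (t * n) ^ 2 := by ring
    _ ≤ _ := by gcongr

end Concentration

end LBC
end

noncomputable section
namespace LBC
namespace Env

/-! ### Linear rewards and the optimal `Q`-function -/

section Deterministic

variable {X A Ξ : Type*} [MeasurableSpace X] [MeasurableSpace Ξ] [Fintype A] {d : ℕ}
  (E : Env X A Ξ d)

/-- The reward functions `⟨φ_h, w_h⟩`. -/
def linRew (w : ℕ → Vec d) (h : ℕ) (x : X) (a : A) : ℝ := ⟪E.φ h x a, w h⟫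

lemma intrinsic_eq_linRew (h : ℕ) (θ : Vec d) :
    E.intrinsic h θ = E.linRew fun l => if l = h then ‖θ‖⁻¹ • θ else 0 := by
  funext l x a
  by_cases hl : l = h
  · subst hl; simp [intrinsic, linRew, inner_smul_right, div_eq_inv_mul]
  · simp [intrinsic, linRew, hl]

/-- `θ` parametrizes the optimal `Q`-function of the rewards `⟨φ_h, w_h⟩`: it solves the Bellman
equations. -/
def IsOptQ (w θ : ℕ → Vec d) : Prop :=
  ∀ h < E.H, ∀ x a, ⟪θ h, E.φ h x a⟫ = E.linRew w h x a +
    if h + 1 < E.H then ⨆ a', ⟪θ (h + 1), E.φ (h + 1) (E.next h x a) a'⟫ else 0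

/-- The features of layers below the horizon have norm at most one. -/
def UnitFeatures : Prop := ∀ h < E.H, ∀ x a, ‖E.φ h x a‖ ≤ 1

variable {E}

/-- Linear Bellman completeness extends from the unit ball of parameters to all parameters, by
homogeneity. -/
lemma exists_backup [Nonempty A] (hL : E.LinearBellmanComplete E.φ) (hφ : E.UnitFeatures) {h : ℕ}
    (hh : h + 1 < E.H) (θ : Vec d) : ∃ θ' : Vec d, ∀ x a,
      ⟪θ', E.φ h x a⟫ = ⨆ a', ⟪θ, E.φ (h + 1) (E.next h x a) a'⟫ := by
  obtain ⟨B, hB⟩ := hL h hh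
  have hc : 0 < ‖θ‖ + 1 := by positivity
  have hmem : (‖θ‖ + 1)⁻¹ • θ ∈ DetMDP.paramBall E.φ (h + 1) := by
    intro x a
    rw [inner_smul_right, abs_mul, abs_of_pos (inv_pos.2 hc), inv_mul_le_iff₀ hc, mul_one]
    calc |⟪E.φ (h + 1) x a, θ⟫| ≤ ‖E.φ (h + 1) x a‖ * ‖θ‖ := abs_real_inner_le_norm _ _
      _ ≤ 1 * ‖θ‖ := by gcongr; exact hφ _ hh x a
      _ ≤ ‖θ‖ + 1 := by linarith
  refine ⟨(‖θ‖ + 1) • (B ⟨_, hmem⟩ : Vec d), fun x a => ?_⟩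
  rw [inner_smul_left, real_inner_comm, hB]
  simp only [RCLike.conj_to_real]
  rw [Real.mul_iSup_of_nonneg hc.le]
  congr 1
  funext a'
  rw [inner_smul_right, mul_inv_cancel_left₀ hc.ne', real_inner_comm]

/-- Under linear Bellman completeness the optimal `Q`-function of linear rewards is linear; its
parameters are built backwards from the last layer. -/
lemma exists_isOptQ [Nonempty A] (hL : E.LinearBellmanComplete E.φ) (hφ : E.UnitFeatures)
    (w : ℕ → Vec d) : ∃ θ, E.IsOptQ w θ := by
  suffices ∀ k ≤ E.H, ∃ θ : ℕ → Vec d, ∀ h < E.H, E.H - k ≤ h → ∀ x a,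
      ⟪θ h, E.φ h x a⟫ = E.linRew w h x a +
        if h + 1 < E.H then ⨆ a', ⟪θ (h + 1), E.φ (h + 1) (E.next h x a) a'⟫ else 0 by
    obtain ⟨θ, hθ⟩ := this E.H le_rfl
    exact ⟨θ, fun h hh => hθ h hh (by simp)⟩
  intro k
  induction k with
  | zero => exact fun _ => ⟨0, fun h hh hk => by omega⟩
  | succ k ih =>
    intro hk
    obtain ⟨θ, hθ⟩ := ih (by omega)
    obtain ⟨θ', hθ'⟩ : ∃ θ' : Vec d, ∀ x a, ⟪θ', E.φ (E.H - (k + 1)) x a⟫ =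
        if E.H - (k + 1) + 1 < E.H then
          ⨆ a', ⟪θ (E.H - (k + 1) + 1), E.φ (E.H - (k + 1) + 1) (E.next (E.H - (k + 1)) x a) a'⟫
        else 0 := by
      split_ifs with h1
      · exact exists_backup hL hφ h1 _
      · exact ⟨0, by simp⟩
    refine ⟨Function.update θ (E.H - (k + 1)) (w (E.H - (k + 1)) + θ'), fun h hh hle x a => ?_⟩
    have hne : h + 1 ≠ E.H - (k + 1) := by omega
    rw [Function.update_of_ne hne]
    by_cases hEq : h = E.H - (k + 1)
    · subst hEq
      rw [Function.update_self, inner_add_left, hθ', linRew, real_inner_comm]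
    · rw [Function.update_of_ne hEq]
      exact hθ h hh (by omega) x a

lemma IsOptQ.abs_le [Nonempty A] {w θ : ℕ → Vec d} (hθ : E.IsOptQ w θ) {R : ℝ}
    (hR : ∀ h < E.H, ∀ x a, |E.linRew w h x a| ≤ R) {h : ℕ} (hh : h < E.H) (x : X) (a : A) :
    |⟪θ h, E.φ h x a⟫| ≤ E.H * R := by
  have hR0 : 0 ≤ R := (abs_nonneg _).trans (hR h hh x a)
  suffices ∀ k h, h < E.H → E.H - h ≤ k → ∀ x a, |⟪θ h, E.φ h x a⟫| ≤ (E.H - h : ℕ) * R by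
    refine (this E.H h hh (by omega) x a).trans ?_
    gcongr
    omega
  intro k
  induction k with
  | zero => intro h hh hk; omega
  | succ k ih =>
    intro h hh hk x a
    rw [hθ h hh]
    refine (abs_add_le _ _).trans ?_
    have h1 : ((E.H - h : ℕ) : ℝ) = 1 + (E.H - (h + 1) : ℕ) := by
      rw [show E.H - h = 1 + (E.H - (h + 1)) by omega]; push_cast; ring
    rw [h1, add_mul, one_mul]
    refine add_le_add (hR h hh x a) ?_
    split_ifs with h2
    · obtain ⟨a', ha'⟩ := exists_eq_ciSup_of_finite
        (f := fun a' => ⟪θ (h + 1), E.φ (h + 1) (E.next h x a) a'⟫)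
      rw [← ha']
      exact ih (h + 1) h2 (by omega) _ _
    · simp; positivity

lemma le_argmax [Nonempty A] (g : A → ℝ) (b : A) : g b ≤ g (E.argmax g) := by
  classical
  have hne : (Finset.univ.filter fun a => ∀ b, g b ≤ g a).Nonempty := by
    obtain ⟨a, ha⟩ := Finite.exists_max g
    exact ⟨a, by simpa using ha⟩
  have := E.tie_mem _ hne
  simp only [Finset.mem_filter, Finset.mem_univ, true_and] at this
  exact this b

lemma argmax_eq_iSup [Nonempty A] (g : A → ℝ) : g (E.argmax g) = ⨆ a, g a :=
  le_antisymm (le_ciSup (Set.finite_range g).bddAbove _) (ciSup_le fun b => le_argmax g b)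

/-- The optimal value at the initial state `x` when `θ` parametrizes the optimal `Q`-function. -/
def optVal (E : Env X A Ξ d) (θ : ℕ → Vec d) (x : X) : ℝ := ⨆ a, ⟪θ 0, E.φ 0 x a⟫

/-- The performance difference formula: a policy loses, at each layer, the gap between its action
and the best one under the optimal `Q`-function. -/
lemma valueOf_eq_optVal_sub [Nonempty A] {w θ : ℕ → Vec d} (hθ : E.IsOptQ w θ) (hH : 0 < E.H)
    (π : Policy X A) (x : X) :
    E.valueOf (E.linRew w) π x = E.optVal θ x - ∑ h ∈ Finset.range E.H,
      ((⨆ a, ⟪θ h, E.φ h (E.state π x h) a⟫) -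
        ⟪θ h, E.φ h (E.state π x h) (E.action π x h)⟫) := by
  suffices ∀ k ≤ E.H, ∑ h ∈ Finset.range k, E.linRew w h (E.state π x h) (E.action π x h) =
      E.optVal θ x - ∑ h ∈ Finset.range k, ((⨆ a, ⟪θ h, E.φ h (E.state π x h) a⟫) -
        ⟪θ h, E.φ h (E.state π x h) (E.action π x h)⟫) -
        if k < E.H then ⨆ a, ⟪θ k, E.φ k (E.state π x k) a⟫ else 0 by
    simpa [DetMDP.valueOf] using this E.H le_rfl
  intro k
  induction k with
  | zero => intro _; simp [hH, optVal, DetMDP.state]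
  | succ k ih =>
    intro hk
    have hk' : k < E.H := by omega
    rw [Finset.sum_range_succ, Finset.sum_range_succ, ih hk'.le, if_pos hk', hθ k hk']
    simp only [DetMDP.state, DetMDP.action]
    ring

lemma valueOf_le_optVal [Nonempty A] {w θ : ℕ → Vec d} (hθ : E.IsOptQ w θ) (hH : 0 < E.H)
    (π : Policy X A) (x : X) : E.valueOf (E.linRew w) π x ≤ E.optVal θ x := by
  rw [valueOf_eq_optVal_sub hθ hH, sub_le_self_iff]
  exact Finset.sum_nonneg fun h _ => sub_nonneg.2
    (le_ciSup (f := fun a => ⟪θ h, E.φ h (E.state π x h) a⟫) (Set.finite_range _).bddAbove _)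

/-- The policy that is greedy with respect to `⟨θ_h, φ_h⟩`. -/
def optPol (E : Env X A Ξ d) (θ : ℕ → Vec d) : Policy X A :=
  fun h x => E.argmax fun a => ⟪θ h, E.φ h x a⟫

lemma valueOf_optPol [Nonempty A] {w θ : ℕ → Vec d} (hθ : E.IsOptQ w θ) (hH : 0 < E.H) (x : X) :
    E.valueOf (E.linRew w) (E.optPol θ) x = E.optVal θ x := by
  rw [valueOf_eq_optVal_sub hθ hH, Finset.sum_eq_zero, sub_zero]
  intro h _
  exact sub_eq_zero.2 (argmax_eq_iSup (E := E) fun a => ⟪θ h, E.φ h _ a⟫).symm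

/-! ### The version space of OCP -/

variable (E) in
/-- The greedy policy with respect to the optimistic `Q`-values of a version space. -/
def optimistic (B : ℝ) (R : List (Row d)) : Policy X A :=
  fun h x => E.greedy (E.versionSpace B R) h x

lemma versionSpace_append_subset (B : ℝ) (N R : List (Row d)) :
    E.versionSpace B (N ++ R) ⊆ E.versionSpace B R :=
  fun _ hθ => ⟨hθ.1, fun c hc => hθ.2 c (List.mem_append_right _ hc)⟩

/-- The constraints on different layers are separate, so rows of other layers do not change the
range of layer `h`. -/
lemma image_versionSpace_append {B : ℝ} {N R : List (Row d)} {h : ℕ}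
    (hne : (E.versionSpace B (N ++ R)).Nonempty) (hN : ∀ c ∈ N, c.layer ≠ h) {β : Type*}
    (F : Vec d → β) :
    (fun θ : ℕ → Vec d => F (θ h)) '' E.versionSpace B (N ++ R) =
      (fun θ : ℕ → Vec d => F (θ h)) '' E.versionSpace B R := by
  refine Set.Subset.antisymm (Set.image_mono (versionSpace_append_subset B N R)) ?_
  rintro _ ⟨θ, hθ, rfl⟩
  obtain ⟨θ', hθ'⟩ := hne
  refine ⟨Function.update θ' h (θ h), ⟨fun l hl x a => ?_, fun c hc => ?_⟩, by simp⟩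
  · by_cases hlh : l = h
    · subst hlh; simpa using hθ.1 l hl x a
    · simpa [hlh] using hθ'.1 l hl x a
  · by_cases hch : c.layer = h
    · have hcR : c ∈ R := by
        rcases List.mem_append.1 hc with h1 | h1
        · exact absurd hch (hN c h1)
        · exact h1
      have := hθ.2 c hcR
      rw [hch] at this ⊢
      simpa using this
    · simpa [hch] using hθ'.2 c hc

lemma greedy_versionSpace_append {B : ℝ} {N R : List (Row d)} {h : ℕ}
    (hne : (E.versionSpace B (N ++ R)).Nonempty) (hN : ∀ c ∈ N, c.layer ≠ h) (x : X) :
    E.greedy (E.versionSpace B (N ++ R)) h x = E.optimistic B R h x := by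
  simp only [optimistic, greedy]
  congr 1
  funext a
  exact congrArg sSup (image_versionSpace_append hne hN fun v => ⟪v, E.φ h x a⟫)

lemma upper_versionSpace_append {B : ℝ} {N R : List (Row d)} {h : ℕ}
    (hne : (E.versionSpace B (N ++ R)).Nonempty) (hN : ∀ c ∈ N, c.layer ≠ h) (ρ : ℝ) (x : X) :
    E.upper (E.versionSpace B (N ++ R)) ρ h x = E.upper (E.versionSpace B R) ρ h x :=
  congrArg sSup (image_versionSpace_append hne hN fun v => ρ + ⨆ a, ⟪v, E.φ h x a⟫)

lemma lower_versionSpace_append {B : ℝ} {N R : List (Row d)} {h : ℕ}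
    (hne : (E.versionSpace B (N ++ R)).Nonempty) (hN : ∀ c ∈ N, c.layer ≠ h) (ρ : ℝ) (x : X) :
    E.lower (E.versionSpace B (N ++ R)) ρ h x = E.lower (E.versionSpace B R) ρ h x :=
  congrArg sInf (image_versionSpace_append hne hN fun v => ρ + ⨆ a, ⟪v, E.φ h x a⟫)

variable (E) in
/-- The constraint found at layer `h` of an episode that starts in `x` with constraints `R`. -/
def newRow (r : ℕ → X → A → ℝ) (B : ℝ) (R : List (Row d)) (x : X) (h : ℕ) : Row d :=
  let π := E.optimistic B R
  let ρ := r h (E.state π x h) (E.action π x h)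
  ⟨h, E.feat π x h,
    if h + 1 < E.H then E.lower (E.versionSpace B R) ρ (h + 1) (E.state π x (h + 1)) else ρ,
    if h + 1 < E.H then E.upper (E.versionSpace B R) ρ (h + 1) (E.state π x (h + 1)) else ρ⟩

variable (E) in
/-- The constraints found at the layers below `k`. -/
def newRows (r : ℕ → X → A → ℝ) (B : ℝ) (R : List (Row d)) (x : X) : ℕ → List (Row d)
  | 0 => []
  | k + 1 => E.newRow r B R x k :: newRows r B R x k

lemma layer_newRows {r : ℕ → X → A → ℝ} {B : ℝ} {R : List (Row d)} {x : X} {k : ℕ} {c : Row d}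
    (hc : c ∈ E.newRows r B R x k) : ∃ h < k, c = E.newRow r B R x h := by
  induction k with
  | zero => simp [newRows] at hc
  | succ k ih =>
    rcases List.mem_cons.1 hc with h | h
    · exact ⟨k, by omega, h⟩
    · obtain ⟨l, hl, h⟩ := ih h
      exact ⟨l, by omega, h⟩

lemma newRow_mem_newRows {r : ℕ → X → A → ℝ} {B : ℝ} {R : List (Row d)} {x : X} {h k : ℕ}
    (hk : h < k) : E.newRow r B R x h ∈ E.newRows r B R x k := by
  induction k with
  | zero => omega
  | succ k ih =>
    rcases Nat.lt_succ_iff_lt_or_eq.1 hk with h1 | h1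
    · exact List.mem_cons_of_mem _ (ih h1)
    · subst h1; exact List.mem_cons_self

lemma length_newRows (r : ℕ → X → A → ℝ) (B : ℝ) (R : List (Row d)) (x : X) (k : ℕ) :
    (E.newRows r B R x k).length = k := by
  induction k with
  | zero => rfl
  | succ k ih => simp [newRows, ih]

lemma abs_iSup_le_of_mem [Nonempty A] {B : ℝ} {R : List (Row d)} {θ : ℕ → Vec d}
    (hθ : θ ∈ E.versionSpace B R) {h : ℕ} (hh : h < E.H) (x : X) :
    |⨆ a, ⟪θ h, E.φ h x a⟫| ≤ B := by
  obtain ⟨a, ha⟩ := exists_eq_ciSup_of_finite (f := fun a => ⟪θ h, E.φ h x a⟫)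
  rw [← ha]
  exact hθ.1 h hh x a

lemma bddAbove_upper [Nonempty A] (B : ℝ) (R : List (Row d)) {h : ℕ} (hh : h < E.H) (ρ : ℝ)
    (x : X) : BddAbove ((fun θ : ℕ → Vec d => ρ + ⨆ a, ⟪θ h, E.φ h x a⟫) '' E.versionSpace B R) := by
  refine ⟨ρ + B, ?_⟩
  rintro _ ⟨θ, hθ, rfl⟩
  exact add_le_add_right (abs_le.1 (abs_iSup_le_of_mem hθ hh x)).2 ρ

lemma bddBelow_lower [Nonempty A] (B : ℝ) (R : List (Row d)) {h : ℕ} (hh : h < E.H) (ρ : ℝ)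
    (x : X) : BddBelow ((fun θ : ℕ → Vec d => ρ + ⨆ a, ⟪θ h, E.φ h x a⟫) '' E.versionSpace B R) := by
  refine ⟨ρ + -B, ?_⟩
  rintro _ ⟨θ, hθ, rfl⟩
  exact add_le_add_right (abs_le.1 (abs_iSup_le_of_mem hθ hh x)).1 ρ

lemma bddAbove_greedy (B : ℝ) (R : List (Row d)) {h : ℕ} (hh : h < E.H) (x : X) (a : A) :
    BddAbove ((fun θ : ℕ → Vec d => ⟪θ h, E.φ h x a⟫) '' E.versionSpace B R) := by
  refine ⟨B, ?_⟩
  rintro _ ⟨θ, hθ, rfl⟩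
  exact (abs_le.1 (hθ.1 h hh x a)).2

/-- The optimal `Q`-function is never excluded: by the Bellman equation its value at the feature met
is one of the values over which the bounds of the new constraint are the supremum and infimum. -/
lemma IsOptQ.mem_newRows [Nonempty A] {w θ : ℕ → Vec d} (hθ : E.IsOptQ w θ) {B : ℝ}
    {R : List (Row d)} (hR : θ ∈ E.versionSpace B R) (x : X) {k : ℕ} (hk : k ≤ E.H) :
    θ ∈ E.versionSpace B (E.newRows (E.linRew w) B R x k ++ R) := by
  refine ⟨hR.1, fun c hc => ?_⟩
  rcases List.mem_append.1 hc with h1 | h1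
  · obtain ⟨h, hh, rfl⟩ := layer_newRows h1
    have hb := hθ h (by omega) (E.state (E.optimistic B R) x h) (E.action (E.optimistic B R) x h)
    simp only [newRow, feat]
    rw [hb]
    by_cases hH : h + 1 < E.H
    · simp only [if_pos hH]
      exact ⟨csInf_le (bddBelow_lower B R hH _ _) ⟨θ, hR, rfl⟩,
        le_csSup (bddAbove_upper B R hH _ _) ⟨θ, hR, rfl⟩⟩
    · simp [hH]
  · exact hR.2 c h1

/-- An episode of OCP in closed form: its policy is determined by the constraints `R` at its
start. -/
lemma ocpLayer_iter [Nonempty A] {w θ : ℕ → Vec d} (hθ : E.IsOptQ w θ) {B : ℝ}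
    {R : List (Row d)} (hR : θ ∈ E.versionSpace B R) (x : X) (p : ImplPolicy X A) {k : ℕ}
    (hk : k ≤ E.H) :
    (Costed.iter (E.ocpLayer (E.linRew w) B) k ⟨x, R, p⟩).val =
      ⟨E.state (E.optimistic B R) x k, E.newRows (E.linRew w) B R x k ++ R,
        ⟨fun h y => if h < k then E.optimistic B R h y else p.act h y,
          fun h => if h < k then E.greedyCost (R.length + h) else p.cost h⟩⟩ := by
  induction k with
  | zero => simp [Costed.iter, Costed.ret, DetMDP.state, newRows]
  | succ k ih =>
    have hmem : (E.versionSpace B (E.newRows (E.linRew w) B R x k ++ R)).Nonempty :=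
      ⟨θ, hθ.mem_newRows hR x (by omega)⟩
    have hl : ∀ l, k ≤ l → ∀ c ∈ E.newRows (E.linRew w) B R x k, c.layer ≠ l := by
      intro l hl c hc
      obtain ⟨h, hh, rfl⟩ := layer_newRows hc
      simp only [newRow]; omega
    simp only [Costed.iter, Costed.bind, ih (by omega)]
    simp only [ocpLayer, Costed.tick, Costed.ret, greedy_versionSpace_append hmem (hl k le_rfl),
      upper_versionSpace_append hmem (hl (k + 1) (by omega)),
      lower_versionSpace_append hmem (hl (k + 1) (by omega))]
    congr 1
    congr 1
    · funext h
      rcases lt_trichotomy h k with h1 | h1 | h1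
      · rw [Function.update_of_ne h1.ne]
        simp [h1, Nat.lt_succ_of_lt h1]
      · subst h1
        simp only [Function.update_self, Nat.lt_succ_self, if_true]
        funext y
        exact greedy_versionSpace_append hmem (hl h le_rfl) y
      · rw [Function.update_of_ne h1.ne']
        simp [show ¬ h < k by omega, show ¬ h < k + 1 by omega]
    · funext h
      rcases lt_trichotomy h k with h1 | h1 | h1
      · rw [Function.update_of_ne h1.ne]
        simp [h1, Nat.lt_succ_of_lt h1]
      · subst h1
        simp [length_newRows, add_comm]
      · rw [Function.update_of_ne h1.ne']
        simp [show ¬ h < k by omega, show ¬ h < k + 1 by omega]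

end Deterministic

end Env
end LBC
end

noncomputable section
namespace LBC

namespace Costed

variable {α β σ : Type*}

lemma ret_val (a : α) : (ret a).val = a := rfl
lemma bind_val (m : Costed α) (f : α → Costed β) : (m.bind f).val = (f m.val).val := rfl
lemma tick_val (n : ℕ) (m : Costed α) : (m.tick n).val = m.val := rfl
lemma draw_val (n : ℕ) (m : Costed α) : (m.draw n).val = m.val := rfl
lemma iter_succ (f : ℕ → σ → Costed σ) (n : ℕ) (s : σ) :
    iter f (n + 1) s = (iter f n s).bind (f n) := rfl

end Costed

namespace Env

section Deterministic

variable {X A Ξ : Type*} [MeasurableSpace X] [MeasurableSpace Ξ] [Fintype A] {d : ℕ}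
  (E : Env X A Ξ d)

/-! ### OCP in closed form -/

/-- The constraints present after `j` episodes of OCP with initial states `xs 0, xs 1, …`. -/
def rowsAt (r : ℕ → X → A → ℝ) (B : ℝ) (xs : ℕ → X) : ℕ → List (Row d)
  | 0 => []
  | j + 1 => E.newRows r B (rowsAt r B xs j) (xs j) E.H ++ rowsAt r B xs j

/-- The policy of episode `j` of OCP. -/
def episodePol [Nonempty A] (r : ℕ → X → A → ℝ) (B : ℝ) (xs : ℕ → X) (j : ℕ) : ImplPolicy X A :=
  ⟨fun h y => if h < E.H then E.optimistic B (E.rowsAt r B xs j) h y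
      else (somePolicy X A).act h y,
    fun h => if h < E.H then E.greedyCost (j * E.H + h) else 0⟩

/-- The Monte Carlo estimate of the value of the `i`-th policy. -/
def estimate [Nonempty A] (r : ℕ → X → A → ℝ) (B : ℝ) (T : ℕ) (xs : ℕ → X) (i : ℕ) : ℝ :=
  (T : ℝ)⁻¹ * ∑ j ∈ Finset.range T, E.valueOf r (E.episodePol r B xs i).act (xs (T + i * T + j))

open Classical in
/-- The first index at which `J` is maximal among `J 0, …, J (n - 1)`. -/
def bestIdx (J : ℕ → ℝ) : ℕ → ℕ
  | 0 => 0
  | n + 1 => if J (bestIdx J n) < J n then n else bestIdx J n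

lemma bestIdx_lt (J : ℕ → ℝ) {n : ℕ} (hn : 0 < n) : bestIdx J n < n := by
  induction n with
  | zero => omega
  | succ n ih =>
    rw [bestIdx]
    split_ifs
    · omega
    · rcases n.eq_zero_or_pos with rfl | h
      · simp [bestIdx]
      · have := ih h; omega

lemma le_bestIdx (J : ℕ → ℝ) {n k : ℕ} (hk : k < n) : J k ≤ J (bestIdx J n) := by
  induction n with
  | zero => omega
  | succ n ih =>
    rw [bestIdx]
    rcases Nat.lt_succ_iff_lt_or_eq.1 hk with h | h
    · split_ifs with hc
      · exact (ih h).trans hc.le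
      · exact ih h
    · subst h
      split_ifs with hc
      · exact le_rfl
      · exact not_lt.1 hc

/-- The policy returned by OCP: the one with the largest estimated value. -/
def ocpPol [Nonempty A] (r : ℕ → X → A → ℝ) (B : ℝ) (T : ℕ) (xs : ℕ → X) : ImplPolicy X A :=
  E.episodePol r B xs (bestIdx (E.estimate r B T xs) T)

variable {E}

lemma length_rowsAt (r : ℕ → X → A → ℝ) (B : ℝ) (xs : ℕ → X) (j : ℕ) :
    (E.rowsAt r B xs j).length = j * E.H := by
  induction j with
  | zero => simp [rowsAt]
  | succ j ih => simp [rowsAt, length_newRows, ih]; ring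

lemma IsOptQ.mem_rowsAt [Nonempty A] {w θ : ℕ → Vec d} (hθ : E.IsOptQ w θ) {B : ℝ}
    (hB : ∀ h < E.H, ∀ x a, |⟪θ h, E.φ h x a⟫| ≤ B) (xs : ℕ → X) (j : ℕ) :
    θ ∈ E.versionSpace B (E.rowsAt (E.linRew w) B xs j) := by
  induction j with
  | zero => exact ⟨hB, by simp [rowsAt]⟩
  | succ j ih => exact hθ.mem_newRows ih (xs j) le_rfl

variable (E) in
/-- One exploration episode of OCP. -/
def exploreStep [Nonempty A] (r : ℕ → X → A → ℝ) (B : ℝ) (τ : ℕ → Seed X Ξ) (j : ℕ)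
    (s : List (Row d) × (ℕ → ImplPolicy X A)) : Costed (List (Row d) × (ℕ → ImplPolicy X A)) :=
  ((Costed.iter (E.ocpLayer r B) E.H ⟨(τ j).1, s.1, somePolicy X A⟩).draw 1).bind fun e =>
    Costed.ret (e.rows, Function.update s.2 j e.pol)

open Classical in
variable (E) in
/-- The evaluation of the `i`-th policy in OCP. -/
def selectStep (r : ℕ → X → A → ℝ) (T : ℕ) (τ : ℕ → Seed X Ξ) (p : ℕ → ImplPolicy X A)
    (i : ℕ) (best : WithBot ℝ × ImplPolicy X A) : Costed (WithBot ℝ × ImplPolicy X A) :=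
  let J : ℝ := (T : ℝ)⁻¹ *
    ∑ j ∈ Finset.range T, E.valueOf r (p i).act (τ (T + i * T + j)).1
  ((Costed.ret (if best.1 < (J : WithBot ℝ) then ((J : WithBot ℝ), p i) else best)).draw T).tick
    (T * (rolloutCost (p i) E.H + E.H * (3 * d + 2)) + 2)

lemma ocp_eq [Nonempty A] (r : ℕ → X → A → ℝ) (B : ℝ) (T : ℕ) (τ : ℕ → Seed X Ξ) :
    E.ocp r B T τ =
      (Costed.iter (E.exploreStep r B τ) T ([], fun _ => somePolicy X A)).bind fun s =>
        (Costed.iter (E.selectStep r T τ s.2) T (⊥, somePolicy X A)).bind fun best =>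
          Costed.ret best.2 := rfl

lemma explore_val [Nonempty A] {w θ : ℕ → Vec d} (hθ : E.IsOptQ w θ) {B : ℝ}
    (hB : ∀ h < E.H, ∀ x a, |⟪θ h, E.φ h x a⟫| ≤ B) (τ : ℕ → Seed X Ξ) (n : ℕ) :
    (Costed.iter (E.exploreStep (E.linRew w) B τ) n ([], fun _ => somePolicy X A)).val =
      (E.rowsAt (E.linRew w) B (fun m => (τ m).1) n, fun j => if j < n then
        E.episodePol (E.linRew w) B (fun m => (τ m).1) j else somePolicy X A) := by
  set xs : ℕ → X := fun m => (τ m).1 with hxs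
  induction n with
  | zero => simp [Costed.iter, Costed.ret, rowsAt]
  | succ n ih =>
    rw [Costed.iter_succ, Costed.bind_val, ih]
    simp only [exploreStep, Costed.bind_val, Costed.draw_val, Costed.ret_val]
    rw [ocpLayer_iter hθ (hθ.mem_rowsAt hB xs n) (τ n).1 (somePolicy X A) le_rfl]
    refine Prod.ext rfl ?_
    funext j
    rcases lt_trichotomy j n with h1 | h1 | h1
    · simp [Function.update_of_ne h1.ne, h1, Nat.lt_succ_of_lt h1]
    · subst h1
      simp only [Function.update_self, Nat.lt_succ_self, if_true, length_rowsAt]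
      rfl
    · simp [Function.update_of_ne h1.ne', show ¬ j < n by omega, show ¬ j < n + 1 by omega]

lemma ocp_val [Nonempty A] {w θ : ℕ → Vec d} (hθ : E.IsOptQ w θ) {B : ℝ}
    (hB : ∀ h < E.H, ∀ x a, |⟪θ h, E.φ h x a⟫| ≤ B) {T : ℕ} (hT : 0 < T) (τ : ℕ → Seed X Ξ) :
    (E.ocp (E.linRew w) B T τ).val = E.ocpPol (E.linRew w) B T fun m => (τ m).1 := by
  set r := E.linRew w
  set xs : ℕ → X := fun m => (τ m).1 with hxs
  have hsel : ∀ n ≤ T, 0 < n → (Costed.iter (E.selectStep r T τ fun j => if j < T then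
      E.episodePol r B xs j else somePolicy X A) n (⊥, somePolicy X A)).val =
      ((E.estimate r B T xs (bestIdx (E.estimate r B T xs) n) : WithBot ℝ),
        E.episodePol r B xs (bestIdx (E.estimate r B T xs) n)) := by
    intro n
    induction n with
    | zero => intro _ h; omega
    | succ n ih =>
      intro hn _
      have hn' : n < T := by omega
      have hJ : (T : ℝ)⁻¹ * ∑ j ∈ Finset.range T, E.valueOf r
          (E.episodePol r B xs n).act (τ (T + n * T + j)).1 = E.estimate r B T xs n := rfl
      rw [Costed.iter_succ, Costed.bind_val]
      rcases n.eq_zero_or_pos with rfl | hpos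
      · simp only [selectStep, Costed.tick_val, Costed.draw_val, Costed.ret_val, if_pos hn', hJ,
          Costed.iter, bestIdx]
        rw [if_pos (WithBot.bot_lt_coe _)]
        simp
      · rw [ih hn'.le hpos]
        simp only [selectStep, Costed.tick_val, Costed.draw_val, Costed.ret_val, if_pos hn', hJ,
          WithBot.coe_lt_coe, bestIdx]
        split_ifs <;> rfl
  rw [ocp_eq, Costed.bind_val, explore_val hθ hB, Costed.bind_val, hsel T le_rfl hT]
  rfl

/-! ### Few episodes of OCP are suboptimal -/

/-- The features of layer `h` on which all members of the version space `V` agree. -/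
def pinned (V : Set (ℕ → Vec d)) (h : ℕ) : Submodule ℝ (Vec d) where
  carrier := {v | ∀ θ ∈ V, ∀ θ' ∈ V, ⟪θ h, v⟫ = ⟪θ' h, v⟫}
  add_mem' := by
    intro a b ha hb θ hθ θ' hθ'
    rw [inner_add_right, inner_add_right, ha θ hθ θ' hθ', hb θ hθ θ' hθ']
  zero_mem' := by intro θ _ θ' _; simp
  smul_mem' := by
    intro c a ha θ hθ θ' hθ'
    rw [inner_smul_right, inner_smul_right, ha θ hθ θ' hθ']

lemma pinned_mono {V V' : Set (ℕ → Vec d)} (h : V' ⊆ V) (l : ℕ) : pinned V l ≤ pinned V' l :=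
  fun _ hv θ hθ θ' hθ' => hv θ (h hθ) θ' (h hθ')

/-- The number of dimensions, over all layers, in which the version space has collapsed. -/
def collapse (E : Env X A Ξ d) (V : Set (ℕ → Vec d)) : ℕ :=
  ∑ h ∈ Finset.range E.H, Module.finrank ℝ (pinned V h)

lemma collapse_le (V : Set (ℕ → Vec d)) : E.collapse V ≤ E.H * d := by
  calc E.collapse V ≤ ∑ _h ∈ Finset.range E.H, d :=
        Finset.sum_le_sum fun h _ => (Submodule.finrank_le _).trans (by simp)
    _ = E.H * d := by simp

lemma collapse_mono {V V' : Set (ℕ → Vec d)} (h : V' ⊆ V) : E.collapse V ≤ E.collapse V' :=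
  Finset.sum_le_sum fun l _ => Submodule.finrank_mono (pinned_mono h l)

lemma optimistic_attains [Nonempty A] {B : ℝ} {R : List (Row d)} {θ : ℕ → Vec d}
    (hθ : θ ∈ E.versionSpace B R) {h : ℕ} (hh : h < E.H) (x : X)
    (hpin : E.φ h x (E.optimistic B R h x) ∈ pinned (E.versionSpace B R) h) (b : A) :
    ⟪θ h, E.φ h x b⟫ ≤ ⟪θ h, E.φ h x (E.optimistic B R h x)⟫ := by
  have h1 : ⟪θ h, E.φ h x b⟫ ≤
      sSup ((fun θ : ℕ → Vec d => ⟪θ h, E.φ h x b⟫) '' E.versionSpace B R) :=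
    le_csSup (bddAbove_greedy B R hh x b) ⟨θ, hθ, rfl⟩
  refine h1.trans ((le_argmax (E := E) (fun a =>
    sSup ((fun θ : ℕ → Vec d => ⟪θ h, E.φ h x a⟫) '' E.versionSpace B R)) b).trans ?_)
  refine csSup_le ⟨_, θ, hθ, rfl⟩ ?_
  rintro _ ⟨θ', hθ', rfl⟩
  exact (hpin θ' hθ' θ hθ).le

/-- If the version space agrees on all features met by the optimistic policy, then that policy is
optimal from this initial state. -/
lemma valueOf_optimistic_of_pinned [Nonempty A] {w θ : ℕ → Vec d} (hθ : E.IsOptQ w θ)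
    (hH : 0 < E.H) {B : ℝ} {R : List (Row d)} (hR : θ ∈ E.versionSpace B R) (x : X)
    (hpin : ∀ h < E.H, E.feat (E.optimistic B R) x h ∈ pinned (E.versionSpace B R) h) :
    E.valueOf (E.linRew w) (E.optimistic B R) x = E.optVal θ x := by
  rw [valueOf_eq_optVal_sub hθ hH, Finset.sum_eq_zero, sub_zero]
  intro h hh
  have hh := Finset.mem_range.1 hh
  refine sub_eq_zero.2 (le_antisymm (ciSup_le fun b => ?_)
    (le_ciSup (f := fun a => ⟪θ h, E.φ h (E.state (E.optimistic B R) x h) a⟫)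
      (Set.finite_range _).bddAbove _))
  exact optimistic_attains hR hh _ (hpin h hh) b

/-- In a suboptimal episode a further dimension of the version space collapses, namely that of the
feature met at the last layer where the version space disagrees: the two bounds of the constraint
added there coincide. -/
lemma collapse_lt_of_suboptimal [Nonempty A] {w θ : ℕ → Vec d} (hθ : E.IsOptQ w θ)
    (hH : 0 < E.H) {B : ℝ} {R : List (Row d)} (hR : θ ∈ E.versionSpace B R) (x : X)
    (hsub : E.valueOf (E.linRew w) (E.optimistic B R) x ≠ E.optVal θ x) :
    E.collapse (E.versionSpace B R) <
      E.collapse (E.versionSpace B (E.newRows (E.linRew w) B R x E.H ++ R)) := by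
  classical
  set V := E.versionSpace B R with hV
  set V' := E.versionSpace B (E.newRows (E.linRew w) B R x E.H ++ R)
  set π := E.optimistic B R with hπ
  have hex : ∃ h, h < E.H ∧ E.feat π x h ∉ pinned V h := by
    by_contra hcon
    push Not at hcon
    exact hsub (valueOf_optimistic_of_pinned hθ hH hR x hcon)
  obtain ⟨h, ⟨hh, hnot⟩, hlast⟩ : ∃ h, (h < E.H ∧ E.feat π x h ∉ pinned V h) ∧
      ∀ l, h < l → l < E.H → E.feat π x l ∈ pinned V l := by
    set s := (Finset.range E.H).filter fun h => E.feat π x h ∉ pinned V h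
    have hs : s.Nonempty := by
      obtain ⟨h, h1, h2⟩ := hex
      exact ⟨h, by simp [s, h1, h2]⟩
    refine ⟨s.max' hs, by simpa [s] using s.max'_mem hs, fun l hl hlH => ?_⟩
    by_contra hcon
    have := s.le_max' l (by simp [s, hlH, hcon])
    omega
  have hsubset : V' ⊆ V := versionSpace_append_subset _ _ _
  refine Finset.sum_lt_sum (fun l _ => Submodule.finrank_mono (pinned_mono hsubset l))
    ⟨h, Finset.mem_range.2 hh, ?_⟩
  refine Submodule.finrank_lt_finrank_of_lt (lt_of_le_of_ne (pinned_mono hsubset h) ?_)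
  intro heq
  apply hnot
  rw [heq]
  -- The bounds of the new constraint at layer `h` coincide.
  set c := E.newRow (E.linRew w) B R x h with hc
  have hmem : c ∈ E.newRows (E.linRew w) B R x E.H ++ R :=
    List.mem_append_left _ (newRow_mem_newRows hh)
  have hle : c.hi ≤ c.lo := by
    by_cases h1 : h + 1 < E.H
    · simp only [hc, newRow, if_pos h1, upper, lower]
      set ρ := E.linRew w h (E.state π x h) (E.action π x h)
      set y := E.state π x (h + 1)
      have hconst : ∀ θ' ∈ V, ρ + ⨆ a, ⟪θ' (h + 1), E.φ (h + 1) y a⟫ =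
          ρ + ⟪θ (h + 1), E.φ (h + 1) y (π (h + 1) y)⟫ := by
        intro θ' hθ'
        have hp : E.φ (h + 1) y (π (h + 1) y) ∈ pinned V (h + 1) := hlast (h + 1) (by omega) h1
        congr 1
        rw [← hp θ' hθ' θ hR]
        refine le_antisymm (ciSup_le fun b => optimistic_attains hθ' h1 y hp b) ?_
        exact le_ciSup (f := fun a => ⟪θ' (h + 1), E.φ (h + 1) y a⟫)
          (Set.finite_range _).bddAbove _
      have himg : (fun θ' : ℕ → Vec d => ρ + ⨆ a, ⟪θ' (h + 1), E.φ (h + 1) y a⟫) '' V =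
          {ρ + ⟪θ (h + 1), E.φ (h + 1) y (π (h + 1) y)⟫} := by
        ext z
        constructor
        · rintro ⟨θ', hθ', rfl⟩; exact hconst θ' hθ'
        · rintro rfl; exact ⟨θ, hR, hconst θ hR⟩
      rw [himg, csSup_singleton, csInf_singleton]
    · simp [hc, newRow, h1]
  intro θ₁ h₁ θ₂ h₂
  have e₁ := h₁.2 c hmem
  have e₂ := h₂.2 c hmem
  have hcl : c.layer = h := rfl
  have hcv : c.vec = E.feat π x h := rfl
  rw [hcl, hcv] at e₁ e₂
  linarith [e₁.1, e₁.2, e₂.1, e₂.2]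

open Classical in
/-- At most `d` episodes per layer are suboptimal. -/
lemma card_suboptimal_le [Nonempty A] {w θ : ℕ → Vec d} (hθ : E.IsOptQ w θ) (hH : 0 < E.H) {B : ℝ}
    (hB : ∀ h < E.H, ∀ x a, |⟪θ h, E.φ h x a⟫| ≤ B) (xs : ℕ → X) (n : ℕ) :
    ((Finset.range n).filter fun j => E.valueOf (E.linRew w)
      (E.optimistic B (E.rowsAt (E.linRew w) B xs j)) (xs j) ≠ E.optVal θ (xs j)).card ≤
      E.H * d := by
  refine le_trans ?_ (collapse_le (E := E) (E.versionSpace B (E.rowsAt (E.linRew w) B xs n)))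
  induction n with
  | zero => simp
  | succ n ih =>
    rw [Finset.range_add_one, Finset.filter_insert]
    split_ifs with h
    · rw [Finset.card_insert_of_notMem (by simp)]
      exact Nat.succ_le_of_lt (ih.trans_lt
        (collapse_lt_of_suboptimal hθ hH (hθ.mem_rowsAt hB xs n) (xs n) h))
    · exact ih.trans (collapse_mono (versionSpace_append_subset _ _ _))

end Deterministic

end Env
end LBC
end

noncomputable section
namespace LBC

/-! ### Measurability of OCP -/

/-- Existence of a solution `θ` of an inequality that is measurable in the data and continuous in
`θ` is a measurable condition on the data: on a compact ball, it suffices to look for approximate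
solutions in a countable dense set. -/
lemma measurableSet_exists_le_zero {Ω : Type*} [MeasurableSpace Ω] {d : ℕ} {g : Ω → Vec d → ℝ}
    (hm : ∀ θ, Measurable fun ω => g ω θ) (hc : ∀ ω, Continuous (g ω)) :
    MeasurableSet {ω | ∃ θ, g ω θ ≤ 0} := by
  have hdense : ∀ n : ℕ, ∃ q : ℕ → Vec d, (∀ k, q k ∈ Metric.closedBall (0 : Vec d) n) ∧
      ∀ U : Set (Vec d), IsOpen U → ∀ θ ∈ U, θ ∈ Metric.closedBall (0 : Vec d) n →
        ∃ k, q k ∈ U := by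
    intro n
    have : Nonempty (Metric.closedBall (0 : Vec d) n) := ⟨⟨0, by simp⟩⟩
    refine ⟨fun k => TopologicalSpace.denseSeq (Metric.closedBall (0 : Vec d) n) k,
      fun k => Subtype.coe_prop _, fun U hU θ hθ hn => ?_⟩
    exact (TopologicalSpace.denseRange_denseSeq (Metric.closedBall (0 : Vec d) n)).exists_mem_open
      (hU.preimage continuous_subtype_val) ⟨⟨θ, hn⟩, hθ⟩
  choose q hq hqd using hdense
  have hset : {ω | ∃ θ, g ω θ ≤ 0} =
      ⋃ n : ℕ, ⋂ m : ℕ, ⋃ k : ℕ, {ω | g ω (q n k) < 1 / ((m : ℝ) + 1)} := by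
    ext ω
    simp only [Set.mem_ofPred_eq, Set.mem_iUnion, Set.mem_iInter]
    constructor
    · rintro ⟨θ, hθ⟩
      obtain ⟨n, hn⟩ := exists_nat_ge ‖θ‖
      refine ⟨n, fun m => ?_⟩
      have hpos : (0 : ℝ) < 1 / ((m : ℝ) + 1) := by positivity
      exact hqd n {θ | g ω θ < 1 / ((m : ℝ) + 1)} (isOpen_lt (hc ω) continuous_const) θ
        (lt_of_le_of_lt hθ hpos) (by simpa using hn)
    · rintro ⟨n, hn⟩
      obtain ⟨θ, -, hθ⟩ := (isCompact_closedBall (0 : Vec d) (n : ℝ)).exists_isMinOn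
        ⟨0, by simp⟩ (hc ω).continuousOn
      refine ⟨θ, le_of_forall_pos_lt_add fun ε hε => ?_⟩
      obtain ⟨m, hm⟩ := exists_nat_one_div_lt hε
      obtain ⟨k, hk⟩ := hn m
      rw [zero_add]
      exact ((hθ (hq n k)).trans_lt hk).trans hm
  rw [hset]
  exact .iUnion fun n => .iInter fun m => .iUnion fun k => measurableSet_lt (hm _) measurable_const

/-- Lists of constraints that depend measurably on a parameter, in a fixed number and on fixed
layers. -/
inductive MeasRows {Ω : Type*} [MeasurableSpace Ω] {d : ℕ} : (Ω → List (Row d)) → Prop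
  | nil : MeasRows fun _ => []
  | cons (l : ℕ) {v : Ω → Vec d} {lo hi : Ω → ℝ} {R : Ω → List (Row d)} (hv : Measurable v)
      (hlo : Measurable lo) (hhi : Measurable hi) (hR : MeasRows R) :
      MeasRows fun ω => ⟨l, v ω, lo ω, hi ω⟩ :: R ω

lemma MeasRows.comp {Ω Ω' : Type*} [MeasurableSpace Ω] [MeasurableSpace Ω'] {d : ℕ}
    {R : Ω → List (Row d)} (hR : MeasRows R) {f : Ω' → Ω} (hf : Measurable f) :
    MeasRows fun ω => R (f ω) := by
  induction hR with
  | nil => exact .nil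
  | cons l hv hlo hhi _ ih => exact .cons l (hv.comp hf) (hlo.comp hf) (hhi.comp hf) ih

lemma MeasRows.append {Ω : Type*} [MeasurableSpace Ω] {d : ℕ} {R R' : Ω → List (Row d)}
    (hR : MeasRows R) (hR' : MeasRows R') : MeasRows fun ω => R ω ++ R' ω := by
  induction hR with
  | nil => exact hR'
  | cons l hv hlo hhi _ ih => exact .cons l hv hlo hhi ih

/-- The amount by which `θ` violates the constraint `c`. -/
def Row.violation {d : ℕ} (c : Row d) (θ : Vec d) : ℝ :=
  max 0 (c.lo - ⟪θ, c.vec⟫) + max 0 (⟪θ, c.vec⟫ - c.hi)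

lemma Row.violation_nonneg {d : ℕ} (c : Row d) (θ : Vec d) : 0 ≤ c.violation θ :=
  add_nonneg (le_max_left _ _) (le_max_left _ _)

lemma Row.violation_le_zero_iff {d : ℕ} (c : Row d) (θ : Vec d) :
    c.violation θ ≤ 0 ↔ c.lo ≤ ⟪θ, c.vec⟫ ∧ ⟪θ, c.vec⟫ ≤ c.hi := by
  have h1 := le_max_left 0 (c.lo - ⟪θ, c.vec⟫)
  have h2 := le_max_left 0 (⟪θ, c.vec⟫ - c.hi)
  have h3 := le_max_right 0 (c.lo - ⟪θ, c.vec⟫)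
  have h4 := le_max_right 0 (⟪θ, c.vec⟫ - c.hi)
  unfold Row.violation
  constructor
  · intro h; constructor <;> linarith
  · rintro ⟨ha, hb⟩
    rw [max_eq_left (by linarith), max_eq_left (by linarith), add_zero]

namespace Env

section Measurability

variable {X A Ξ : Type*} [MeasurableSpace X] [MeasurableSpace Ξ] [Fintype A] {d : ℕ}
  (E : Env X A Ξ d)

/-- `sup_{x,a} |⟨θ, φ_h(x,a)⟩|`. -/
def featNorm (h : ℕ) (θ : Vec d) : ℝ := ⨆ p : X × A, |⟪θ, E.φ h p.1 p.2⟫|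

/-- The total violation of the constraints on the parameter of layer `h`. -/
def violation (B : ℝ) (R : List (Row d)) (h : ℕ) (θ : Vec d) : ℝ :=
  max 0 (E.featNorm h θ - B) + (R.map fun c => if c.layer = h then c.violation θ else 0).sum

variable {E}

lemma abs_inner_le_norm (hφ : E.UnitFeatures) {h : ℕ} (hh : h < E.H) (θ : Vec d) (x : X) (a : A) :
    |⟪θ, E.φ h x a⟫| ≤ ‖θ‖ :=
  (abs_real_inner_le_norm _ _).trans (mul_le_of_le_one_right (norm_nonneg _) (hφ h hh x a))

lemma bddAbove_featNorm (hφ : E.UnitFeatures) {h : ℕ} (hh : h < E.H) (θ : Vec d) :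
    BddAbove (Set.range fun p : X × A => |⟪θ, E.φ h p.1 p.2⟫|) :=
  ⟨‖θ‖, by rintro _ ⟨p, rfl⟩; exact abs_inner_le_norm hφ hh θ _ _⟩

/-- The state space carries a probability measure. -/
lemma nonempty_X (E : Env X A Ξ d) : Nonempty X := by
  by_contra hne
  rw [not_nonempty_iff] at hne
  have := E.init_prob.measure_univ
  simp [Measure.eq_zero_of_isEmpty] at this

lemma continuous_featNorm [Nonempty A] (hφ : E.UnitFeatures) {h : ℕ} (hh : h < E.H) :
    Continuous (E.featNorm h) := by
  have := nonempty_X E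
  refine (LipschitzWith.of_le_add (f := E.featNorm h) fun θ θ' => ?_).continuous
  refine ciSup_le fun p => ?_
  have h1 : ⟪θ, E.φ h p.1 p.2⟫ = ⟪θ', E.φ h p.1 p.2⟫ + ⟪θ - θ', E.φ h p.1 p.2⟫ := by
    rw [← inner_add_left]; simp
  rw [h1, dist_eq_norm]
  exact (abs_add_le _ _).trans (add_le_add (le_ciSup (bddAbove_featNorm hφ hh θ') p)
    (abs_inner_le_norm hφ hh _ _ _))

lemma sum_violation_nonneg (R : List (Row d)) (h : ℕ) (θ : Vec d) :
    0 ≤ (R.map fun c => if c.layer = h then c.violation θ else 0).sum := by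
  refine List.sum_nonneg fun x hx => ?_
  obtain ⟨c, -, rfl⟩ := List.mem_map.1 hx
  split_ifs
  · exact c.violation_nonneg θ
  · exact le_rfl

lemma violation_le_zero_iff [Nonempty A] (hφ : E.UnitFeatures) {B : ℝ} {R : List (Row d)} {h : ℕ}
    (hh : h < E.H) (θ : Vec d) : E.violation B R h θ ≤ 0 ↔ (∀ x a, |⟪θ, E.φ h x a⟫| ≤ B) ∧
      ∀ c ∈ R, c.layer = h → c.lo ≤ ⟪θ, c.vec⟫ ∧ ⟪θ, c.vec⟫ ≤ c.hi := by
  have := nonempty_X E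
  have hsum : (R.map fun c => if c.layer = h then c.violation θ else 0).sum ≤ 0 ↔
      ∀ c ∈ R, c.layer = h → c.lo ≤ ⟪θ, c.vec⟫ ∧ ⟪θ, c.vec⟫ ≤ c.hi := by
    induction R with
    | nil => simp
    | cons c R ih =>
      have h1 := sum_violation_nonneg R h θ
      have h2 := c.violation_nonneg θ
      rw [List.map_cons, List.sum_cons, List.forall_mem_cons, ← ih, ← Row.violation_le_zero_iff]
      split_ifs with hc
      · simp only [hc, true_imp_iff]
        constructor
        · intro h; constructor <;> linarith
        · rintro ⟨ha, hb⟩; linarith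
      · simp [hc]
  have hN : max 0 (E.featNorm h θ - B) ≤ 0 ↔ ∀ x a, |⟪θ, E.φ h x a⟫| ≤ B := by
    rw [max_le_iff, and_iff_right le_rfl, sub_nonpos, featNorm,
      ciSup_le_iff (bddAbove_featNorm hφ hh θ)]
    exact ⟨fun h x a => h (x, a), fun h p => h p.1 p.2⟩
  rw [← hsum, ← hN, violation]
  have h1 := sum_violation_nonneg R h θ
  have h2 := le_max_left 0 (E.featNorm h θ - B)
  constructor
  · intro h; constructor <;> linarith
  · rintro ⟨ha, hb⟩; linarith

/-- For a function of the parameter of layer `h`, only the constraints on layer `h` matter, as long as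
those on the other layers can be satisfied. -/
lemma image_versionSpace_eq [Nonempty A] (hφ : E.UnitFeatures) {B : ℝ} {R : List (Row d)} {h : ℕ}
    (hh : h < E.H) (hne : (E.versionSpace B R).Nonempty) {β : Type*} (F : Vec d → β) :
    (fun θ : ℕ → Vec d => F (θ h)) '' E.versionSpace B R = F '' {θ | E.violation B R h θ ≤ 0} := by
  ext z
  constructor
  · rintro ⟨θ, hθ, rfl⟩
    refine ⟨θ h, (violation_le_zero_iff hφ hh _).2 ⟨hθ.1 h hh, fun c hc hl => ?_⟩, rfl⟩
    have := hθ.2 c hc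
    rwa [hl] at this
  · rintro ⟨θ, hθ, rfl⟩
    obtain ⟨h1, h2⟩ := (violation_le_zero_iff hφ hh θ).1 hθ
    obtain ⟨θ', hθ'⟩ := hne
    refine ⟨Function.update θ' h θ, ⟨fun l hl x a => ?_, fun c hc => ?_⟩, by simp⟩
    · by_cases hlh : l = h
      · subst hlh; simpa using h1 x a
      · simpa [hlh] using hθ'.1 l hl x a
    · by_cases hch : c.layer = h
      · have := h2 c hc hch
        rw [hch]
        simpa using this
      · simpa [hch] using hθ'.2 c hc

variable {Ω : Type*} [MeasurableSpace Ω]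

lemma continuous_violation [Nonempty A] (hφ : E.UnitFeatures) {h : ℕ} (hh : h < E.H) (B : ℝ)
    (R : List (Row d)) : Continuous (E.violation B R h) := by
  refine (continuous_const.max ((continuous_featNorm hφ hh).sub continuous_const)).add ?_
  induction R with
  | nil => simp only [List.map_nil, List.sum_nil]; exact continuous_const
  | cons c R ih =>
    simp only [List.map_cons, List.sum_cons]
    refine Continuous.add ?_ ih
    split_ifs
    · unfold Row.violation; fun_prop
    · fun_prop

lemma measurable_violation {B : Ω → ℝ} (hB : Measurable B) {R : Ω → List (Row d)}
    (hR : MeasRows R) (h : ℕ) (θ : Vec d) : Measurable fun ω => E.violation (B ω) (R ω) h θ := by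
  refine (measurable_const.max (measurable_const.sub hB)).add ?_
  induction hR with
  | nil => simp only [List.map_nil, List.sum_nil]; exact measurable_const
  | cons l hv hlo hhi _ ih =>
    simp only [List.map_cons, List.sum_cons]
    refine Measurable.add ?_ ih
    by_cases hl : l = h
    · simp only [hl, if_true, Row.violation]; fun_prop
    · simp only [hl, if_false]; fun_prop

/-- Suprema over a version space that depends measurably on a parameter are measurable: each strict
superlevel set is a countable union of sets as in `measurableSet_exists_le_zero`. -/
lemma measurable_sSup_versionSpace [Nonempty A] (hφ : E.UnitFeatures) {h : ℕ} (hh : h < E.H)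
    {B : Ω → ℝ} (hB : Measurable B) {R : Ω → List (Row d)} (hR : MeasRows R)
    (hne : ∀ ω, (E.versionSpace (B ω) (R ω)).Nonempty) {F : Ω → Vec d → ℝ}
    (hFm : ∀ θ, Measurable fun ω => F ω θ) (hFc : ∀ ω, Continuous (F ω))
    (hbdd : ∀ ω, BddAbove ((fun θ : ℕ → Vec d => F ω (θ h)) '' E.versionSpace (B ω) (R ω))) :
    Measurable fun ω => sSup ((fun θ : ℕ → Vec d => F ω (θ h)) '' E.versionSpace (B ω) (R ω)) := by
  refine measurable_of_Ioi fun c => ?_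
  have hset : (fun ω => sSup ((fun θ : ℕ → Vec d => F ω (θ h)) '' E.versionSpace (B ω) (R ω))) ⁻¹'
      Set.Ioi c = ⋃ m : ℕ, {ω | ∃ θ, max (E.violation (B ω) (R ω) h θ)
        (c + 1 / ((m : ℝ) + 1) - F ω θ) ≤ 0} := by
    ext ω
    simp only [Set.mem_preimage, Set.mem_Ioi, Set.mem_iUnion, Set.mem_ofPred_eq, max_le_iff]
    rw [lt_csSup_iff (hbdd ω) ((hne ω).image _), image_versionSpace_eq hφ hh (hne ω)]
    constructor
    · rintro ⟨_, ⟨θ, hθ, rfl⟩, hc⟩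
      obtain ⟨m, hm⟩ := exists_nat_one_div_lt (sub_pos.2 hc)
      exact ⟨m, θ, hθ, by linarith⟩
    · rintro ⟨m, θ, hθ, hc⟩
      have : (0 : ℝ) < 1 / ((m : ℝ) + 1) := by positivity
      exact ⟨_, ⟨θ, hθ, rfl⟩, by linarith⟩
  rw [hset]
  refine .iUnion fun m => measurableSet_exists_le_zero (fun θ => ?_) fun ω => ?_
  · exact (measurable_violation hB hR h θ).max (measurable_const.sub (hFm θ))
  · exact (continuous_violation hφ hh _ _).max (continuous_const.sub (hFc ω))

lemma measurable_sInf_versionSpace [Nonempty A] (hφ : E.UnitFeatures) {h : ℕ} (hh : h < E.H)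
    {B : Ω → ℝ} (hB : Measurable B) {R : Ω → List (Row d)} (hR : MeasRows R)
    (hne : ∀ ω, (E.versionSpace (B ω) (R ω)).Nonempty) {F : Ω → Vec d → ℝ}
    (hFm : ∀ θ, Measurable fun ω => F ω θ) (hFc : ∀ ω, Continuous (F ω))
    (hbdd : ∀ ω, BddBelow ((fun θ : ℕ → Vec d => F ω (θ h)) '' E.versionSpace (B ω) (R ω))) :
    Measurable fun ω => sInf ((fun θ : ℕ → Vec d => F ω (θ h)) '' E.versionSpace (B ω) (R ω)) := by
  have himg : ∀ ω, (fun θ : ℕ → Vec d => -F ω (θ h)) '' E.versionSpace (B ω) (R ω) =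
      -((fun θ : ℕ → Vec d => F ω (θ h)) '' E.versionSpace (B ω) (R ω)) := by
    intro ω
    rw [← Set.image_neg_eq_neg, Set.image_image]
  simp_rw [Real.sInf_def, ← himg]
  refine (measurable_sSup_versionSpace hφ hh hB hR hne (F := fun ω θ => -F ω θ)
    (fun θ => (hFm θ).neg) (fun ω => (hFc ω).neg) fun ω => ?_).neg
  rw [himg]
  exact (hbdd ω).neg

lemma continuous_iSup_inner [Nonempty A] (h : ℕ) (x : X) :
    Continuous fun θ : Vec d => ⨆ a, ⟪θ, E.φ h x a⟫ := by
  simp_rw [← Finset.sup'_univ_eq_ciSup]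
  exact Continuous.finset_sup'_apply _ fun a _ => by fun_prop

variable [MeasurableSpace A] [DiscreteMeasurableSpace A]

/-- Maximizing actions are measurable, by finiteness of the action set and the fixed rule for ties. -/
lemma measurable_argmax {g : Ω → A → ℝ} (hg : ∀ a, Measurable fun ω => g ω a) :
    Measurable fun ω => E.argmax (g ω) := by
  classical
  let _ : MeasurableSpace (Finset A) := ⊤
  have h : Measurable fun ω => Finset.univ.filter fun a => ∀ b, g ω b ≤ g ω a := by
    refine measurable_to_countable' fun s => ?_
    have : (fun ω => Finset.univ.filter fun a => ∀ b, g ω b ≤ g ω a) ⁻¹' {s} =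
        ⋂ a, {ω | (∀ b, g ω b ≤ g ω a) ↔ a ∈ s} := by
      ext ω
      simp [Finset.ext_iff]
    rw [this]
    refine .iInter fun a => ?_
    have hm : MeasurableSet {ω | ∀ b, g ω b ≤ g ω a} := by
      rw [Set.ofPred_forall]
      exact .iInter fun b => measurableSet_le (hg b) (hg a)
    by_cases ha : a ∈ s
    · simpa only [ha, iff_true] using hm
    · simp only [ha, iff_false]; exact hm.compl
  have ht : Measurable E.tie := measurable_from_top
  unfold argmax
  convert! ht.comp h using 1

/-- The measurability assumptions on the environment. -/
def MeasFeatures (E : Env X A Ξ d) : Prop := ∀ h < E.H, ∀ a, Measurable fun x => E.φ h x a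

/-- Families of policies whose action depends jointly measurably on the parameter and the state. -/
def MeasPol (E : Env X A Ξ d) (π : Ω → Policy X A) : Prop :=
  ∀ h < E.H, Measurable fun p : Ω × X => π p.1 h p.2

lemma MeasPol.comp {Ω' : Type*} [MeasurableSpace Ω'] {π : Ω → Policy X A} (hπ : E.MeasPol π)
    {f : Ω' → Ω} (hf : Measurable f) : E.MeasPol fun ω => π (f ω) :=
  fun h hh => (hπ h hh).comp (hf.prodMap measurable_id)

lemma measurable_apply_action {β : Type*} [MeasurableSpace β] {f : X → A → β}
    (hf : ∀ a, Measurable fun x => f x a) {x : Ω → X} {a : Ω → A} (hx : Measurable x)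
    (ha : Measurable a) : Measurable fun ω => f (x ω) (a ω) := by
  have : Measurable fun p : X × A => f p.1 p.2 :=
    measurable_from_prod_countable_left fun a => hf a
  exact this.comp (hx.prodMk ha)

lemma MeasPol.measurable_state {π : Ω → Policy X A} (hπ : E.MeasPol π) {x : Ω → X}
    (hx : Measurable x) {h : ℕ} (hh : h ≤ E.H) :
    Measurable fun ω => E.state (π ω) (x ω) h := by
  induction h with
  | zero => exact hx
  | succ h ih =>
    have hs := ih (by omega)
    exact measurable_apply_action (fun a => E.measurable_next h (by omega) a) hs
      ((hπ h (by omega)).comp (measurable_id.prodMk hs))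

lemma MeasPol.measurable_action {π : Ω → Policy X A} (hπ : E.MeasPol π) {x : Ω → X}
    (hx : Measurable x) {h : ℕ} (hh : h < E.H) :
    Measurable fun ω => E.action (π ω) (x ω) h :=
  (hπ h hh).comp (measurable_id.prodMk (hπ.measurable_state hx hh.le))

lemma MeasPol.measurable_feat (hφm : E.MeasFeatures) {π : Ω → Policy X A} (hπ : E.MeasPol π)
    {x : Ω → X} (hx : Measurable x) {h : ℕ} (hh : h < E.H) :
    Measurable fun ω => E.feat (π ω) (x ω) h :=
  measurable_apply_action (hφm h hh) (hπ.measurable_state hx hh.le) (hπ.measurable_action hx hh)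

lemma MeasPol.measurable_valueOf (hφm : E.MeasFeatures) {π : Ω → Policy X A} (hπ : E.MeasPol π)
    {x : Ω → X} (hx : Measurable x) {w : Ω → ℕ → Vec d} (hw : ∀ h, Measurable fun ω => w ω h) :
    Measurable fun ω => E.valueOf (E.linRew (w ω)) (π ω) (x ω) := by
  refine Finset.measurable_sum _ fun h hh => ?_
  exact (hπ.measurable_feat hφm hx (Finset.mem_range.1 hh)).inner (hw h)

lemma measurable_optimistic [Nonempty A] (hφ : E.UnitFeatures) (hφm : E.MeasFeatures)
    {B : Ω → ℝ} (hB : Measurable B) {R : Ω → List (Row d)} (hR : MeasRows R)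
    (hne : ∀ ω, (E.versionSpace (B ω) (R ω)).Nonempty) :
    E.MeasPol fun ω => E.optimistic (B ω) (R ω) := by
  intro h hh
  refine measurable_argmax fun a => ?_
  refine measurable_sSup_versionSpace hφ hh (hB.comp measurable_fst) (hR.comp measurable_fst)
    (fun p => hne p.1) (F := fun p θ => ⟪θ, E.φ h p.2 a⟫) (fun θ => ?_) (fun p => by fun_prop)
    fun p => bddAbove_greedy _ _ hh _ _
  exact measurable_const.inner ((hφm h hh a).comp measurable_snd)

/-- The optimal `Q`-function of the rewards `⟨φ_h, w_h⟩` is linear and bounded by `B`. -/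
def Realizable (E : Env X A Ξ d) (w : ℕ → Vec d) (B : ℝ) : Prop :=
  ∃ θ, E.IsOptQ w θ ∧ ∀ h < E.H, ∀ x a, |⟪θ h, E.φ h x a⟫| ≤ B

lemma measurable_iSup_inner (hφm : E.MeasFeatures) {h : ℕ} (hh : h < E.H) {x : Ω → X}
    (hx : Measurable x) (θ : Vec d) : Measurable fun ω => ⨆ a, ⟪θ, E.φ h (x ω) a⟫ :=
  Measurable.iSup fun a => measurable_const.inner ((hφm h hh a).comp hx)

lemma measRows_newRows [Nonempty A] (hφ : E.UnitFeatures) (hφm : E.MeasFeatures)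
    {w : Ω → ℕ → Vec d} (hw : ∀ h, Measurable fun ω => w ω h)
    {B : Ω → ℝ} (hB : Measurable B) {R : Ω → List (Row d)} (hR : MeasRows R)
    (hne : ∀ ω, (E.versionSpace (B ω) (R ω)).Nonempty) {x : Ω → X} (hx : Measurable x) {k : ℕ}
    (hk : k ≤ E.H) : MeasRows fun ω => E.newRows (E.linRew (w ω)) (B ω) (R ω) (x ω) k := by
  have hπ := measurable_optimistic hφ hφm hB hR hne
  induction k with
  | zero => exact .nil
  | succ k ih =>
    have hk' : k < E.H := by omega
    have hρ : Measurable fun ω => E.linRew (w ω) k (E.state (E.optimistic (B ω) (R ω)) (x ω) k)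
        (E.action (E.optimistic (B ω) (R ω)) (x ω) k) :=
      (hπ.measurable_feat hφm hx hk').inner (hw k)
    refine .cons k (hπ.measurable_feat hφm hx hk') ?_ ?_ (ih (by omega))
    · by_cases h1 : k + 1 < E.H
      · simp only [if_pos h1]
        refine measurable_sInf_versionSpace hφ h1 hB hR hne (F := fun ω θ => E.linRew (w ω) k
          (E.state (E.optimistic (B ω) (R ω)) (x ω) k)
          (E.action (E.optimistic (B ω) (R ω)) (x ω) k) + ⨆ a, ⟪θ, E.φ (k + 1)
            (E.state (E.optimistic (B ω) (R ω)) (x ω) (k + 1)) a⟫) (fun θ => ?_) (fun ω => ?_)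
          fun ω => bddBelow_lower _ _ h1 _ _
        · exact hρ.add (measurable_iSup_inner hφm h1 (hπ.measurable_state hx h1.le) θ)
        · exact continuous_const.add (continuous_iSup_inner _ _)
      · simpa only [if_neg h1] using hρ
    · by_cases h1 : k + 1 < E.H
      · simp only [if_pos h1]
        refine measurable_sSup_versionSpace hφ h1 hB hR hne (F := fun ω θ => E.linRew (w ω) k
          (E.state (E.optimistic (B ω) (R ω)) (x ω) k)
          (E.action (E.optimistic (B ω) (R ω)) (x ω) k) + ⨆ a, ⟪θ, E.φ (k + 1)
            (E.state (E.optimistic (B ω) (R ω)) (x ω) (k + 1)) a⟫) (fun θ => ?_) (fun ω => ?_)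
          fun ω => bddAbove_upper _ _ h1 _ _
        · exact hρ.add (measurable_iSup_inner hφm h1 (hπ.measurable_state hx h1.le) θ)
        · exact continuous_const.add (continuous_iSup_inner _ _)
      · simpa only [if_neg h1] using hρ

lemma measRows_rowsAt [Nonempty A] (hφ : E.UnitFeatures) (hφm : E.MeasFeatures)
    {w : Ω → ℕ → Vec d} (hw : ∀ h, Measurable fun ω => w ω h)
    {B : Ω → ℝ} (hB : Measurable B) (hreal : ∀ ω, E.Realizable (w ω) (B ω)) {xs : Ω → ℕ → X}
    (hxs : ∀ j, Measurable fun ω => xs ω j) (n : ℕ) :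
    MeasRows fun ω => E.rowsAt (E.linRew (w ω)) (B ω) (xs ω) n := by
  induction n with
  | zero => exact .nil
  | succ n ih =>
    refine (measRows_newRows hφ hφm hw hB ih (fun ω => ?_) (hxs n) le_rfl).append ih
    obtain ⟨θ, hθ, hb⟩ := hreal ω
    exact ⟨θ, hθ.mem_rowsAt hb _ _⟩

lemma measPol_rowsAt [Nonempty A] (hφ : E.UnitFeatures) (hφm : E.MeasFeatures)
    {w : Ω → ℕ → Vec d} (hw : ∀ h, Measurable fun ω => w ω h)
    {B : Ω → ℝ} (hB : Measurable B) (hreal : ∀ ω, E.Realizable (w ω) (B ω)) {xs : Ω → ℕ → X}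
    (hxs : ∀ j, Measurable fun ω => xs ω j) (j : ℕ) :
    E.MeasPol fun ω => E.optimistic (B ω) (E.rowsAt (E.linRew (w ω)) (B ω) (xs ω) j) := by
  refine measurable_optimistic hφ hφm hB (measRows_rowsAt hφ hφm hw hB hreal hxs j) fun ω => ?_
  obtain ⟨θ, hθ, hb⟩ := hreal ω
  exact ⟨θ, hθ.mem_rowsAt hb _ _⟩

lemma measPol_episodePol [Nonempty A] (hφ : E.UnitFeatures) (hφm : E.MeasFeatures)
    {w : Ω → ℕ → Vec d} (hw : ∀ h, Measurable fun ω => w ω h)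
    {B : Ω → ℝ} (hB : Measurable B) (hreal : ∀ ω, E.Realizable (w ω) (B ω)) {xs : Ω → ℕ → X}
    (hxs : ∀ j, Measurable fun ω => xs ω j) (j : ℕ) :
    E.MeasPol fun ω => (E.episodePol (E.linRew (w ω)) (B ω) (xs ω) j).act := by
  intro h hh
  simpa only [episodePol, if_pos hh] using measPol_rowsAt hφ hφm hw hB hreal hxs j h hh

lemma measurable_bestIdx {J : Ω → ℕ → ℝ} (hJ : ∀ i, Measurable fun ω => J ω i) (n : ℕ) :
    Measurable fun ω => bestIdx (J ω) n := by
  induction n with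
  | zero => exact measurable_const
  | succ n ih =>
    simp only [bestIdx]
    have h : Measurable fun ω => J ω (bestIdx (J ω) n) := by
      have : Measurable fun p : Ω × ℕ => J p.1 p.2 := measurable_from_prod_countable_left fun i => hJ i
      exact this.comp (measurable_id.prodMk ih)
    exact Measurable.ite (measurableSet_lt h (hJ n)) measurable_const ih

lemma measurable_estimate [Nonempty A] (hφ : E.UnitFeatures) (hφm : E.MeasFeatures)
    {w : Ω → ℕ → Vec d} (hw : ∀ h, Measurable fun ω => w ω h)
    {B : Ω → ℝ} (hB : Measurable B) (hreal : ∀ ω, E.Realizable (w ω) (B ω)) {xs : Ω → ℕ → X}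
    (hxs : ∀ j, Measurable fun ω => xs ω j) (T i : ℕ) :
    Measurable fun ω => E.estimate (E.linRew (w ω)) (B ω) T (xs ω) i :=
  (Finset.measurable_sum _ fun _ _ => (measPol_episodePol hφ hφm hw hB hreal hxs i).measurable_valueOf
    hφm (hxs _) hw).const_mul _

/-- The output of OCP is jointly measurable in the reward parameters, the bound, the initial states of
the episodes, and the state to act in. -/
lemma measPol_ocpPol [Nonempty A] (hφ : E.UnitFeatures) (hφm : E.MeasFeatures)
    {w : Ω → ℕ → Vec d} (hw : ∀ h, Measurable fun ω => w ω h)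
    {B : Ω → ℝ} (hB : Measurable B) (hreal : ∀ ω, E.Realizable (w ω) (B ω)) {xs : Ω → ℕ → X}
    (hxs : ∀ j, Measurable fun ω => xs ω j) (T : ℕ) :
    E.MeasPol fun ω => (E.ocpPol (E.linRew (w ω)) (B ω) T (xs ω)).act := by
  intro h hh
  have h2 : Measurable fun ω => bestIdx (E.estimate (E.linRew (w ω)) (B ω) T (xs ω)) T :=
    measurable_bestIdx (fun i => measurable_estimate hφ hφm hw hB hreal hxs T i) T
  have h0 : ∀ i, Measurable fun p : Ω × X =>
      (E.episodePol (E.linRew (w p.1)) (B p.1) (xs p.1) i).act h p.2 :=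
    fun i => measPol_episodePol hφ hφm hw hB hreal hxs i h hh
  generalize hf : (fun (i : ℕ) (p : Ω × X) =>
    (E.episodePol (E.linRew (w p.1)) (B p.1) (xs p.1) i).act h p.2) = f
  have hf' : ∀ i, Measurable (f i) := fun i => hf ▸ h0 i
  have h1 : Measurable fun q : (Ω × X) × ℕ => f q.2 q.1 :=
    measurable_from_prod_countable_left hf'
  have h3 : Measurable fun p : Ω × X =>
      (p, bestIdx (E.estimate (E.linRew (w p.1)) (B p.1) T (xs p.1)) T) :=
    measurable_id.prodMk (h2.comp measurable_fst)
  have h4 := h1.comp h3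
  subst hf
  exact h4

end Measurability

end Env
end LBC
end

noncomputable section
namespace LBC
namespace Env

section Guarantee

variable {X A Ξ : Type*} [MeasurableSpace X] [MeasurableSpace Ξ] [Fintype A] {d : ℕ}
  (E : Env X A Ξ d)

/-! ### The guarantee of OCP -/

/-- The optimal total reward of the layers `h, …, h + k - 1` under the rewards `⟨φ_h, w_h⟩`, by
backward recursion. -/
def maxVal (w : ℕ → Vec d) : ℕ → ℕ → X → ℝ
  | 0, _, _ => 0
  | k + 1, h, x => ⨆ a, (E.linRew w h x a + maxVal w k (h + 1) (E.next h x a))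

/-- The optimal value at the initial state `x` under the rewards `⟨φ_h, w_h⟩`. -/
def bestVal (w : ℕ → Vec d) (x : X) : ℝ := E.maxVal w E.H 0 x

/-- The expected value of `π` under the rewards `⟨φ_h, w_h⟩`. -/
def meanVal (w : ℕ → Vec d) (π : Policy X A) : ℝ := ∫ x, E.valueOf (E.linRew w) π x ∂E.init

/-- The expected suboptimality of `π` under the rewards `⟨φ_h, w_h⟩`. -/
def gap (w : ℕ → Vec d) (π : Policy X A) : ℝ :=
  ∫ x, (E.bestVal w x - E.valueOf (E.linRew w) π x) ∂E.init

/-- All rewards `⟨φ_h, w_h⟩` are at most `B / H` in absolute value, so that all values are at most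
`B`. -/
def BoundedVal (w : ℕ → Vec d) (B : ℝ) : Prop :=
  ∃ R : ℝ, (∀ h < E.H, ∀ x a, |E.linRew w h x a| ≤ R) ∧ E.H * R ≤ B

variable {E}

lemma BoundedVal.realizable [Nonempty A] (hL : E.LinearBellmanComplete E.φ) (hφ : E.UnitFeatures)
    {w : ℕ → Vec d} {B : ℝ} (h : E.BoundedVal w B) : E.Realizable w B := by
  obtain ⟨R, hR, hB⟩ := h
  obtain ⟨θ, hθ⟩ := exists_isOptQ hL hφ w
  exact ⟨θ, hθ, fun h hh x a => (hθ.abs_le hR hh x a).trans hB⟩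

lemma BoundedVal.abs_valueOf_le {w : ℕ → Vec d} {B : ℝ} (h : E.BoundedVal w B) (π : Policy X A)
    (x : X) : |E.valueOf (E.linRew w) π x| ≤ B := by
  obtain ⟨R, hR, hB⟩ := h
  calc |E.valueOf (E.linRew w) π x| ≤ ∑ h ∈ Finset.range E.H,
        |E.linRew w h (E.state π x h) (E.action π x h)| := Finset.abs_sum_le_sum_abs _ _
    _ ≤ ∑ _h ∈ Finset.range E.H, R :=
        Finset.sum_le_sum fun h hh => hR h (Finset.mem_range.1 hh) _ _
    _ ≤ B := by simpa using hB

lemma maxVal_eq_iSup {w θ : ℕ → Vec d} (hθ : E.IsOptQ w θ) {k h : ℕ} (hk : h + k = E.H)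
    (hpos : 0 < k) (x : X) : E.maxVal w k h x = ⨆ a, ⟪θ h, E.φ h x a⟫ := by
  induction k generalizing h x with
  | zero => omega
  | succ k ih =>
    rw [maxVal]
    congr 1
    funext a
    rw [hθ h (by omega)]
    rcases k.eq_zero_or_pos with rfl | hk0
    · simp [maxVal, show ¬ h + 1 < E.H by omega]
    · rw [if_pos (by omega), ih (by omega) hk0]

lemma bestVal_eq_optVal {w θ : ℕ → Vec d} (hθ : E.IsOptQ w θ) (hH : 0 < E.H) (x : X) :
    E.bestVal w x = E.optVal θ x :=
  maxVal_eq_iSup hθ (by simp) hH x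

lemma valueOf_le_bestVal [Nonempty A] {w : ℕ → Vec d} {B : ℝ} (hw : E.Realizable w B)
    (hH : 0 < E.H) (π : Policy X A) (x : X) : E.valueOf (E.linRew w) π x ≤ E.bestVal w x := by
  obtain ⟨θ, hθ, -⟩ := hw
  rw [bestVal_eq_optVal hθ hH]
  exact valueOf_le_optVal hθ hH π x

lemma bestVal_eq_valueOf [Nonempty A] {w : ℕ → Vec d} {B : ℝ} (hw : E.Realizable w B)
    (hH : 0 < E.H) : ∃ θ, ∀ x, E.bestVal w x = E.valueOf (E.linRew w) (E.optPol θ) x := by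
  obtain ⟨θ, hθ, -⟩ := hw
  exact ⟨θ, fun x => by rw [bestVal_eq_optVal hθ hH, valueOf_optPol hθ hH]⟩

lemma rowsAt_congr {r : ℕ → X → A → ℝ} {B : ℝ} {xs ys : ℕ → X} {n : ℕ}
    (h : ∀ j < n, xs j = ys j) : E.rowsAt r B xs n = E.rowsAt r B ys n := by
  induction n with
  | zero => rfl
  | succ n ih => rw [rowsAt, rowsAt, ih fun j hj => h j (by omega), h n (by omega)]

variable {Ω : Type*} [MeasurableSpace Ω] [MeasurableSpace A] [DiscreteMeasurableSpace A]

lemma measurable_maxVal (hφm : E.MeasFeatures) {w : Ω → ℕ → Vec d}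
    (hw : ∀ h, Measurable fun ω => w ω h) {k h : ℕ} (hk : h + k ≤ E.H) :
    Measurable fun p : Ω × X => E.maxVal (w p.1) k h p.2 := by
  induction k generalizing h with
  | zero => exact measurable_const
  | succ k ih =>
    simp only [maxVal]
    refine Measurable.iSup fun a => Measurable.add ?_ ?_
    · exact ((hφm h (by omega) a).comp measurable_snd).inner ((hw h).comp measurable_fst)
    · exact (ih (h := h + 1) (by omega)).comp
        (measurable_fst.prodMk ((E.measurable_next h (by omega) a).comp measurable_snd))

lemma measurable_valueOf_prod (hφm : E.MeasFeatures) {π : Ω → Policy X A} (hπ : E.MeasPol π)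
    {w : Ω → ℕ → Vec d} (hw : ∀ h, Measurable fun ω => w ω h) :
    Measurable fun p : Ω × X => E.valueOf (E.linRew (w p.1)) (π p.1) p.2 :=
  (hπ.comp measurable_fst).measurable_valueOf hφm measurable_snd fun h => (hw h).comp measurable_fst

lemma measurable_gap (hφm : E.MeasFeatures) {π : Ω → Policy X A} (hπ : E.MeasPol π)
    {w : Ω → ℕ → Vec d} (hw : ∀ h, Measurable fun ω => w ω h) :
    Measurable fun ω => E.gap (w ω) (π ω) := by
  have : Measurable fun p : Ω × X =>
      E.bestVal (w p.1) p.2 - E.valueOf (E.linRew (w p.1)) (π p.1) p.2 :=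
    (measurable_maxVal hφm hw (by simp)).sub (measurable_valueOf_prod hφm hπ hw)
  exact (StronglyMeasurable.integral_prod_right' this.stronglyMeasurable).measurable

/-- A single measurable policy. -/
def MeasurablePolicy (E : Env X A Ξ d) (π : Policy X A) : Prop :=
  ∀ h < E.H, Measurable (π h)

lemma MeasPol.section {π : Ω → Policy X A} (hπ : E.MeasPol π) (ω : Ω) :
    E.MeasurablePolicy (π ω) :=
  fun h hh => (hπ h hh).comp measurable_prodMk_left

lemma MeasurablePolicy.const {π : Policy X A} (hπ : E.MeasurablePolicy π) :
    E.MeasPol fun _ : Ω => π :=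
  fun h hh => (hπ h hh).comp measurable_snd

lemma MeasurablePolicy.measurable_valueOf (hφm : E.MeasFeatures) {π : Policy X A}
    (hπ : E.MeasurablePolicy π) (w : ℕ → Vec d) :
    Measurable fun x => E.valueOf (E.linRew w) π x :=
  MeasPol.measurable_valueOf hφm (hπ.const (Ω := X)) measurable_id (w := fun _ => w)
    fun _ => measurable_const

lemma MeasurablePolicy.integrable_valueOf (hφm : E.MeasFeatures) {π : Policy X A}
    (hπ : E.MeasurablePolicy π) {w : ℕ → Vec d} {B : ℝ} (hw : E.BoundedVal w B) :
    Integrable (fun x => E.valueOf (E.linRew w) π x) E.init :=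
  integrable_of_norm_le _ (hπ.measurable_valueOf hφm w) fun x => hw.abs_valueOf_le π x

lemma measurablePolicy_optPol (hφm : E.MeasFeatures) (θ : ℕ → Vec d) :
    E.MeasurablePolicy (E.optPol θ) :=
  fun h hh => measurable_argmax fun a => measurable_const.inner (hφm h hh a)

section

variable [Nonempty A] (hφ : E.UnitFeatures) (hφm : E.MeasFeatures) (hH : 0 < E.H)
  {w : ℕ → Vec d} {B Bv : ℝ} (hw : E.Realizable w B) (hb : E.BoundedVal w Bv)
include hφm hH hw hb

lemma integrable_bestVal : Integrable (E.bestVal w) E.init := by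
  obtain ⟨θ, hθ⟩ := bestVal_eq_valueOf hw hH
  exact ((measurablePolicy_optPol hφm θ).integrable_valueOf hφm hb).congr
    (ae_of_all _ fun x => (hθ x).symm)

lemma abs_bestVal_le (x : X) : |E.bestVal w x| ≤ Bv := by
  obtain ⟨θ, hθ⟩ := bestVal_eq_valueOf hw hH
  rw [hθ]; exact hb.abs_valueOf_le _ _

lemma gap_eq {π : Policy X A} (hπ : E.MeasurablePolicy π) :
    E.gap w π = ∫ x, E.bestVal w x ∂E.init - E.meanVal w π :=
  integral_sub (integrable_bestVal hφm hH hw hb) (hπ.integrable_valueOf hφm hb)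

lemma meanVal_le_add_gap {π π' : Policy X A} (hπ : E.MeasurablePolicy π)
    (hπ' : E.MeasurablePolicy π') : E.meanVal w π' ≤ E.meanVal w π + E.gap w π := by
  rw [gap_eq hφm hH hw hb hπ, add_sub_cancel]
  exact integral_mono (hπ'.integrable_valueOf hφm hb) (integrable_bestVal hφm hH hw hb)
    fun x => valueOf_le_bestVal hw hH π' x

/-- A policy with a large gap is suboptimal with a substantial probability. -/
lemma gap_le_measure_suboptimal {π : Policy X A} (hπ : E.MeasurablePolicy π) :
    E.gap w π ≤ 2 * Bv * E.init.real {x | E.valueOf (E.linRew w) π x ≠ E.bestVal w x} := by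
  have hBv : 0 ≤ Bv := (abs_nonneg _).trans (abs_bestVal_le hφm hH hw hb (nonempty_X E).some)
  have hms : Measurable fun x => E.bestVal w x :=
    (measurable_maxVal hφm (Ω := Unit) (w := fun _ => w) (fun _ => measurable_const)
      (k := E.H) (h := 0) (by simp)).comp
      (measurable_const.prodMk measurable_id : Measurable fun x => ((), x))
  have hm : MeasurableSet {x | E.valueOf (E.linRew w) π x ≠ E.bestVal w x} :=
    (measurableSet_eq_fun (hπ.measurable_valueOf hφm w) hms).compl
  calc E.gap w π ≤ ∫ x, Set.indicator {x | E.valueOf (E.linRew w) π x ≠ E.bestVal w x}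
        (fun _ => 2 * Bv) x ∂E.init := by
        refine integral_mono ((integrable_bestVal hφm hH hw hb).sub
          (hπ.integrable_valueOf hφm hb)) ((integrable_const _).indicator hm) fun x => ?_
        by_cases hx : E.valueOf (E.linRew w) π x = E.bestVal w x
        · simp [Set.indicator, hx]
        · have h1 := abs_le.1 (abs_bestVal_le hφm hH hw hb x)
          have h2 := abs_le.1 (hb.abs_valueOf_le π x)
          simp only [Set.indicator, Set.mem_ofPred_eq, ne_eq, hx, not_false_iff, if_true]
          linarith
    _ = _ := by
        rw [integral_indicator_const _ hm, smul_eq_mul, mul_comm]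

end

end Guarantee

end Env
end LBC
end

noncomputable section
namespace LBC

/-! ### High-probability analysis of OCP -/

namespace Env

section OcpProbability

variable {X A Ξ : Type*} [MeasurableSpace X] [MeasurableSpace Ξ] [Fintype A] {d : ℕ}
  {E : Env X A Ξ d}

lemma state_congr {π π' : Policy X A} (h : ∀ l < E.H, π l = π' l) (x : X) {k : ℕ} (hk : k ≤ E.H) :
    E.state π x k = E.state π' x k := by
  induction k with
  | zero => rfl
  | succ k ih => rw [DetMDP.state, DetMDP.state, ih (by omega), h k (by omega)]

lemma action_congr {π π' : Policy X A} (h : ∀ l < E.H, π l = π' l) (x : X) {k : ℕ} (hk : k < E.H) :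
    E.action π x k = E.action π' x k := by
  rw [DetMDP.action, DetMDP.action, state_congr h x hk.le, h k hk]

lemma valueOf_congr (r : ℕ → X → A → ℝ) {π π' : Policy X A} (h : ∀ l < E.H, π l = π' l) (x : X) :
    E.valueOf r π x = E.valueOf r π' x := by
  refine Finset.sum_congr rfl fun k hk => ?_
  have hk := Finset.mem_range.1 hk
  rw [state_congr h x hk.le, action_congr h x hk]

lemma episodePol_act [Nonempty A] (r : ℕ → X → A → ℝ) (B : ℝ) (xs : ℕ → X) (j : ℕ) {l : ℕ}
    (hl : l < E.H) : (E.episodePol r B xs j).act l = E.optimistic B (E.rowsAt r B xs j) l := by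
  funext y
  simp [episodePol, hl]

lemma valueOf_episodePol [Nonempty A] (r r' : ℕ → X → A → ℝ) (B : ℝ) (xs : ℕ → X) (j : ℕ) (x : X) :
    E.valueOf r' (E.episodePol r B xs j).act x =
      E.valueOf r' (E.optimistic B (E.rowsAt r B xs j)) x :=
  valueOf_congr _ (fun _ hl => episodePol_act _ _ _ _ hl) x

open Classical in
variable (E) in
/-- The weight of an episode with constraints `R` and initial state `y`: it is `0` unless the
policy of the episode has a gap above `α`, and `1/2` if the episode is suboptimal. -/
def weight (w : ℕ → Vec d) (B α : ℝ) (R : List (Row d)) (y : X) : ℝ :=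
  if α < E.gap w (E.optimistic B R) then
    if E.valueOf (E.linRew w) (E.optimistic B R) y ≠ E.bestVal w y then 1 / 2 else 1
  else 0

lemma weight_nonneg (w : ℕ → Vec d) (B α : ℝ) (R : List (Row d)) (y : X) :
    0 ≤ E.weight w B α R y := by
  unfold weight; split_ifs <;> norm_num

variable [MeasurableSpace A] [DiscreteMeasurableSpace A] [Nonempty A]
  (hφ : E.UnitFeatures) (hφm : E.MeasFeatures) (hH : 0 < E.H)
  {w : ℕ → Vec d} {B Bv : ℝ} (hw : E.Realizable w B) (hb : E.BoundedVal w Bv) (hBv : 0 < Bv)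
  {α : ℝ} (hα : 0 < α)
include hφm hH hw hb

lemma measurable_bestVal : Measurable fun x => E.bestVal w x := by
  obtain ⟨θ, hθ⟩ := bestVal_eq_valueOf hw hH
  simp_rw [hθ]
  exact (measurablePolicy_optPol hφm θ).measurable_valueOf hφm w

include hBv in
/-- Given the constraints at its start, the weight of an episode is at most `exp (-α/(4 Bv))` on
average. -/
lemma lintegral_weight_le {R : List (Row d)} (hπ : E.MeasurablePolicy (E.optimistic B R)) :
    ∫⁻ y, ENNReal.ofReal (E.weight w B α R y) ∂E.init ≤
      ENNReal.ofReal (Real.exp (-(α / (4 * Bv)))) := by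
  classical
  by_cases hg : α < E.gap w (E.optimistic B R)
  swap
  · simp [weight, hg]
  set s := {y | E.valueOf (E.linRew w) (E.optimistic B R) y ≠ E.bestVal w y} with hs
  have hm : MeasurableSet s := (measurableSet_eq_fun (hπ.measurable_valueOf hφm w)
    (measurable_bestVal hφm hH hw hb)).compl
  have hwt : ∀ y, E.weight w B α R y = 1 - s.indicator (fun _ => (1 / 2 : ℝ)) y := by
    intro y
    by_cases hy : y ∈ s
    · have hy' := hy
      rw [hs, Set.mem_ofPred_eq] at hy'
      rw [weight, if_pos hg, if_pos hy', Set.indicator_of_mem hy]; norm_num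
    · have hy' := hy
      rw [hs, Set.mem_ofPred_eq] at hy'
      rw [weight, if_pos hg, if_neg hy', Set.indicator_of_notMem hy]; norm_num
  have hi : Integrable (s.indicator fun _ => (1 / 2 : ℝ)) E.init :=
    (integrable_const _).indicator hm
  rw [← ofReal_integral_eq_lintegral_ofReal _ (ae_of_all _ fun y => weight_nonneg w B α R y)]
  · refine ENNReal.ofReal_le_ofReal ?_
    simp_rw [hwt]
    rw [integral_sub (integrable_const _) hi, integral_indicator_const _ hm]
    have h1 := hg.trans_le (gap_le_measure_suboptimal hφm hH hw hb hπ)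
    have h2 : α / (4 * Bv) ≤ E.init.real s / 2 := by
      rw [div_le_div_iff₀ (by positivity) (by norm_num)]
      nlinarith
    have h3 := Real.add_one_le_exp (-(α / (4 * Bv)))
    simp only [integral_const, probReal_univ, smul_eq_mul]
    refine le_trans ?_ h3
    linarith
  · simp_rw [hwt]
    exact (integrable_const _).sub hi

include hφ hBv hα in
/-- It is unlikely that all episodes use a policy with a large gap: such policies are suboptimal
with a probability bounded from below, but only few episodes are suboptimal. -/
lemma measure_all_gaps_le (T : ℕ) :
    (Measure.infinitePi fun _ : ℕ => E.init)
      {xs | ∀ j < T, α < E.gap w (E.optimistic B (E.rowsAt (E.linRew w) B xs j))} ≤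
      ENNReal.ofReal (Real.exp (E.H * d - α * T / (4 * Bv))) := by
  classical
  set P := Measure.infinitePi fun _ : ℕ => E.init with hP
  set r := E.linRew w
  obtain ⟨θ, hθ, hθb⟩ := id hw
  have hmeasπ : ∀ j, E.MeasPol fun xs : ℕ → X => E.optimistic B (E.rowsAt r B xs j) := fun j =>
    measPol_rowsAt hφ hφm (w := fun _ => w) (fun _ => measurable_const) measurable_const
      (fun _ => hw) (fun j => measurable_pi_apply j) j
  set f : ℕ → (ℕ → X) → ENNReal := fun j xs =>
    ENNReal.ofReal (E.weight w B α (E.rowsAt r B xs j) (xs j)) with hf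
  have hfm : ∀ j, Measurable (f j) := by
    intro j
    refine ENNReal.measurable_ofReal.comp ?_
    unfold weight
    refine Measurable.ite (measurableSet_lt measurable_const
      (measurable_gap hφm (hmeasπ j) (w := fun _ => w) fun _ => measurable_const))
      (Measurable.ite ?_ measurable_const measurable_const) measurable_const
    refine (measurableSet_eq_fun ?_ ?_).compl
    · exact (hmeasπ j).measurable_valueOf hφm (measurable_pi_apply j) (w := fun _ => w)
        fun _ => measurable_const
    · exact (measurable_bestVal hφm hH hw hb).comp (measurable_pi_apply j)
  set Z : ℕ → (ℕ → X) → ENNReal := fun n xs => ∏ j ∈ Finset.range n, f j xs with hZ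
  have hZm : ∀ n, Measurable (Z n) := fun n => Finset.measurable_prod _ fun j _ => hfm j
  -- Given the episodes before it, each factor is small on average.
  have hint : ∀ n, ∫⁻ xs, Z n xs ∂P ≤ ENNReal.ofReal (Real.exp (-(α / (4 * Bv)))) ^ n := by
    intro n
    induction n with
    | zero => simp [hZ]
    | succ n ih =>
      rw [hP, lintegral_resample E.init {n} (hZm (n + 1)), pow_succ]
      have hstep : ∀ xs₀ : ℕ → X, ∫⁻ xs, Z (n + 1) (merge {n} xs₀ xs) ∂P ≤
          Z n xs₀ * ENNReal.ofReal (Real.exp (-(α / (4 * Bv)))) := by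
        intro xs₀
        have hrows : ∀ j ≤ n, ∀ xs, E.rowsAt r B (merge {n} xs₀ xs) j = E.rowsAt r B xs₀ j := by
          intro j hj xs
          refine rowsAt_congr fun i hi => merge_of_notMem ?_ _ _
          simp; omega
        have hZe : ∀ xs, Z (n + 1) (merge {n} xs₀ xs) = Z n xs₀ *
            ENNReal.ofReal (E.weight w B α (E.rowsAt r B xs₀ n) (xs n)) := by
          intro xs
          simp only [hZ, Finset.prod_range_succ]
          congr 1
          · refine Finset.prod_congr rfl fun j hj => ?_
            have hj := Finset.mem_range.1 hj
            simp only [hf, hrows j hj.le]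
            rw [merge_of_notMem (by simp; omega)]
          · simp only [hf, hrows n le_rfl]
            rw [merge_of_mem (by simp)]
        simp_rw [hZe]
        have hπ := (hmeasπ n).section xs₀
        have hwm : Measurable fun y => ENNReal.ofReal (E.weight w B α (E.rowsAt r B xs₀ n) y) := by
          refine ENNReal.measurable_ofReal.comp ?_
          unfold weight
          refine Measurable.ite (.const _) (Measurable.ite ?_ measurable_const measurable_const)
            measurable_const
          exact (measurableSet_eq_fun (hπ.measurable_valueOf hφm w)
            (measurable_bestVal hφm hH hw hb)).compl
        have hwm' : Measurable fun xs : ℕ → X =>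
            ENNReal.ofReal (E.weight w B α (E.rowsAt r B xs₀ n) (xs n)) :=
          hwm.comp (measurable_pi_apply (X := fun _ : ℕ => X) n)
        rw [lintegral_const_mul _ hwm']
        gcongr
        refine le_trans (le_of_eq ?_) (lintegral_weight_le hφm hH hw hb hBv hπ (α := α))
        exact (measurePreserving_eval_infinitePi (fun _ : ℕ => E.init) n).lintegral_comp hwm
      refine (lintegral_mono hstep).trans ?_
      rw [lintegral_mul_const _ (hZm n)]
      gcongr
  -- When all policies have a large gap, only the at most `H d` suboptimal episodes have weight `1/2`
  -- and all others weight `1`, so that `Z T` is at least `2^(-H d)`.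
  have hmark := (mul_meas_ge_le_lintegral (μ := P) (hZm T)
    (ENNReal.ofReal ((1 / 2) ^ (E.H * d)))).trans (hint T)
  have hsub : {xs | ∀ j < T, α < E.gap w (E.optimistic B (E.rowsAt r B xs j))} ⊆
      {xs | ENNReal.ofReal ((1 / 2) ^ (E.H * d)) ≤ Z T xs} := by
    intro xs hxs
    have hZT : Z T xs = ENNReal.ofReal (∏ j ∈ Finset.range T,
        if E.valueOf r (E.optimistic B (E.rowsAt r B xs j)) (xs j) ≠ E.optVal θ (xs j)
          then (1 / 2 : ℝ) else 1) := by
      rw [ENNReal.ofReal_prod_of_nonneg fun j _ => by split_ifs <;> norm_num]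
      refine Finset.prod_congr rfl fun j hj => ?_
      simp only [hf, weight]
      rw [if_pos (hxs j (Finset.mem_range.1 hj)), bestVal_eq_optVal hθ hH]
    simp only [Set.mem_ofPred_eq]
    rw [hZT]
    refine ENNReal.ofReal_le_ofReal ?_
    rw [Finset.prod_ite, Finset.prod_const_one, mul_one, Finset.prod_const]
    exact pow_le_pow_of_le_one (by norm_num) (by norm_num) (card_suboptimal_le hθ hH hθb xs T)
  have hpos : (0 : ℝ) < (1 / 2) ^ (E.H * d) := by positivity
  have h1 : P {xs | ENNReal.ofReal ((1 / 2) ^ (E.H * d)) ≤ Z T xs} ≤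
      ENNReal.ofReal (Real.exp (-(α / (4 * Bv))) ^ T / (1 / 2) ^ (E.H * d)) := by
    rw [ENNReal.ofReal_div_of_pos hpos, ENNReal.le_div_iff_mul_le
      (Or.inl (by simp)) (Or.inl ENNReal.ofReal_ne_top), mul_comm,
      ENNReal.ofReal_pow (Real.exp_pos _).le]
    exact hmark
  refine (measure_mono hsub).trans (h1.trans (ENNReal.ofReal_le_ofReal ?_))
  rw [← Real.exp_nat_mul, one_div, inv_pow, div_inv_eq_mul, sub_eq_add_neg, Real.exp_add, mul_comm]
  have h2 : (2 : ℝ) ^ (E.H * d) ≤ Real.exp (E.H * d) := by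
    have h3 : (2 : ℝ) ≤ Real.exp 1 := by have := Real.add_one_le_exp 1; linarith
    calc (2 : ℝ) ^ (E.H * d) ≤ Real.exp 1 ^ (E.H * d) := by gcongr
      _ = _ := by rw [← Real.exp_nat_mul]; push_cast; rw [mul_one]
  refine mul_le_mul h2 (le_of_eq ?_) (Real.exp_pos _).le (Real.exp_pos _).le
  congr 1
  field_simp

include hφ hBv hα in
/-- The Monte Carlo estimate of the value of the `i`-th policy is accurate. -/
lemma measure_estimate_le {T : ℕ} (hT : 0 < T) {i : ℕ} (hi : i < T) :
    (Measure.infinitePi fun _ : ℕ => E.init)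
      {xs | α ≤ |E.estimate (E.linRew w) B T xs i -
        E.meanVal w (E.episodePol (E.linRew w) B xs i).act|} ≤
      ENNReal.ofReal (2 * Real.exp (-(T * α ^ 2) / (2 * Bv ^ 2))) := by
  set r := E.linRew w
  have hmπ := measPol_episodePol (Ω := ℕ → X) hφ hφm (w := fun _ => w) (fun _ => measurable_const)
    (measurable_const (a := B)) (fun _ => hw) (xs := fun xs => xs) (fun j => measurable_pi_apply j) i
  have hmE := measurable_estimate (Ω := ℕ → X) hφ hφm (w := fun _ => w) (fun _ => measurable_const)
    (measurable_const (a := B)) (fun _ => hw) (xs := fun xs => xs) (fun j => measurable_pi_apply j)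
    T i
  have hmM : Measurable fun xs : ℕ → X => E.meanVal w (E.episodePol r B xs i).act :=
    (StronglyMeasurable.integral_prod_right' (measurable_valueOf_prod hφm hmπ (w := fun _ => w)
      fun _ => measurable_const).stronglyMeasurable).measurable
  -- The evaluation uses episodes that are fresh after the exploration episodes.
  refine measure_le_of_resample E.init {m | T ≤ m} (measurableSet_le measurable_const
    (measurable_norm.comp (hmE.sub hmM))) fun xs₀ => ?_
  have hrows : ∀ xs, E.rowsAt r B (merge {m | T ≤ m} xs₀ xs) i = E.rowsAt r B xs₀ i := by
    intro xs
    refine rowsAt_congr fun j hj => merge_of_notMem ?_ _ _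
    simp; omega
  have hpol : ∀ xs, E.episodePol r B (merge {m | T ≤ m} xs₀ xs) i = E.episodePol r B xs₀ i := by
    intro xs; simp only [episodePol, hrows]
  refine le_trans (measure_mono ?_) (measure_mean_sub_integral_ge_le E.init
    (e := fun j => T + i * T + j) (fun a b h => by simpa using h)
    ((hmπ.section xs₀).measurable_valueOf hφm w) hBv
    (fun x => hb.abs_valueOf_le (E.episodePol r B xs₀ i).act x) hα.le hT)
  intro xs hxs
  have hmg : ∀ j, merge {m | T ≤ m} xs₀ xs (T + i * T + j) = xs (T + i * T + j) := fun j =>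
    merge_of_mem (by simp only [Set.mem_ofPred_eq]; rw [add_assoc]; exact Nat.le_add_right _ _) _ _
  have hxs' : α ≤ |E.estimate r B T (merge {m | T ≤ m} xs₀ xs) i -
      E.meanVal w (E.episodePol r B (merge {m | T ≤ m} xs₀ xs) i).act| := hxs
  simp only [estimate, hpol, hmg] at hxs'
  exact hxs'

include hφ hBv hα in
/-- With high probability, OCP returns a policy with a small gap. -/
lemma measure_gap_ocpPol_le {T : ℕ} (hT : 0 < T) :
    (Measure.infinitePi fun _ : ℕ => E.init)
      {xs | 3 * α < E.gap w (E.ocpPol (E.linRew w) B T xs).act} ≤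
      ENNReal.ofReal (Real.exp (E.H * d - α * T / (4 * Bv)) +
        T * (2 * Real.exp (-(T * α ^ 2) / (2 * Bv ^ 2)))) := by
  set r := E.linRew w
  set P := Measure.infinitePi fun _ : ℕ => E.init
  have hmπ : ∀ xs i, E.MeasurablePolicy (E.episodePol r B xs i).act := fun xs i =>
    (measPol_episodePol (Ω := ℕ → X) hφ hφm (w := fun _ => w) (fun _ => measurable_const)
      (measurable_const (a := B)) (fun _ => hw) (xs := fun xs => xs)
      (fun j => measurable_pi_apply j) i).section xs
  have hsub : {xs | 3 * α < E.gap w (E.ocpPol r B T xs).act} ⊆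
      {xs | ∀ j < T, α < E.gap w (E.optimistic B (E.rowsAt r B xs j))} ∪
      ⋃ i ∈ Finset.range T, {xs | α ≤ |E.estimate r B T xs i -
        E.meanVal w (E.episodePol r B xs i).act|} := by
    intro xs hxs
    by_contra hcon
    simp only [Set.mem_union, Set.mem_iUnion, Set.mem_ofPred_eq, not_or, not_forall, not_exists,
      Finset.mem_range, not_lt, not_le] at hcon hxs
    obtain ⟨⟨j, hj, hgap⟩, hest⟩ := hcon
    have hgap' : E.gap w (E.episodePol r B xs j).act ≤ α := by
      refine le_trans (le_of_eq ?_) hgap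
      simp only [gap, valueOf_episodePol, r]
    set k := bestIdx (E.estimate r B T xs) T with hk
    have hkT : k < T := bestIdx_lt _ hT
    have h1 := abs_lt.1 (hest j hj)
    have h2 := abs_lt.1 (hest k hkT)
    have h3 : E.estimate r B T xs j ≤ E.estimate r B T xs k := le_bestIdx _ hj
    have h4 := gap_eq hφm hH hw hb (hmπ xs j)
    have h5 := gap_eq hφm hH hw hb (hmπ xs k)
    have h6 : E.ocpPol r B T xs = E.episodePol r B xs k := rfl
    rw [h6] at hxs
    linarith
  refine (measure_mono hsub).trans ((measure_union_le _ _).trans ?_)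
  rw [ENNReal.ofReal_add (Real.exp_pos _).le (by positivity)]
  refine add_le_add (measure_all_gaps_le hφ hφm hH hw hb hBv hα T) ?_
  refine (measure_biUnion_finset_le _ _).trans ?_
  calc _ ≤ ∑ _i ∈ Finset.range T,
        ENNReal.ofReal (2 * Real.exp (-(T * α ^ 2) / (2 * Bv ^ 2))) :=
        Finset.sum_le_sum fun i hi =>
          measure_estimate_le hφ hφm hH hw hb hBv hα hT (Finset.mem_range.1 hi)
    _ = _ := by
        rw [Finset.sum_const, Finset.card_range, nsmul_eq_mul,
          ENNReal.ofReal_mul (Nat.cast_nonneg T), ENNReal.ofReal_natCast]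

end OcpProbability

end Env
end LBC
end

noncomputable section
namespace LBC

/-! ### Determinants and cofactors -/

section Cofactor

variable {d : ℕ}

lemma detCols_eq (W : Fin d → Vec d) :
    detCols W = Matrix.detRowAlternating fun c => (W c).ofLp := by
  rw [detCols, ← Matrix.det_transpose]
  rfl

/-- The determinant is linear in column `i`, with coefficients given by the cofactors. -/
lemma inner_cofactor (W : Fin d → Vec d) (i : Fin d) (v : Vec d) :
    ⟪cofactor W i, v⟫ = detCols (Function.update W i v) := by
  classical
  set L : (Fin d → ℝ) →ₗ[ℝ] ℝ :=
    (Matrix.detRowAlternating (n := Fin d) (R := ℝ)).toMultilinearMap.toLinearMap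
      (fun c => (W c).ofLp) i
  have hL : ∀ v : Vec d, detCols (Function.update W i v) = L v.ofLp := by
    intro v
    rw [detCols_eq]
    simp only [L, MultilinearMap.toLinearMap_apply, AlternatingMap.coe_multilinearMap]
    congr 1
    funext c
    by_cases hc : c = i
    · subst hc; simp
    · simp [hc]
  rw [hL, LinearMap.pi_apply_eq_sum_univ, PiLp.inner_apply]
  refine Finset.sum_congr rfl fun j _ => ?_
  simp only [cofactor, hL, smul_eq_mul, RCLike.inner_apply, conj_trivial]
  congr 2
  funext k
  by_cases hk : j = k
  · subst hk; simp
  · have hk' : k ≠ j := fun h => hk h.symm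
    simp [hk, hk']

lemma inner_cofactor_self (W : Fin d → Vec d) (i : Fin d) : ⟪cofactor W i, W i⟫ = detCols W := by
  rw [inner_cofactor, Function.update_eq_self]

/-- Cramer's rule. -/
lemma detCols_smul_eq_sum (W : Fin d → Vec d) (hW : detCols W ≠ 0) (v : Vec d) :
    v = ∑ i, (⟪cofactor W i, v⟫ / detCols W) • W i := by
  have hcr := Matrix.mulVec_cramer (Matrix.of fun k c => W c k : Matrix (Fin d) (Fin d) ℝ) v.ofLp
  have hc : ∀ i, Matrix.cramer (Matrix.of fun k c => W c k) v.ofLp i = ⟪cofactor W i, v⟫ := by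
    intro i
    rw [inner_cofactor, Matrix.cramer_apply, detCols]
    congr 1
    ext k c
    by_cases h : c = i
    · subst h; simp
    · simp [h]
  ext k
  have hk := congrFun hcr k
  simp only [Matrix.mulVec, dotProduct, hc, Matrix.of_apply, Pi.smul_apply, smul_eq_mul] at hk
  change ∑ x, W x k * ⟪cofactor W x, v⟫ = detCols W * v k at hk
  simp only [WithLp.ofLp_sum, WithLp.ofLp_smul, Finset.sum_apply, Pi.smul_apply, smul_eq_mul]
  rw [eq_comm, ← mul_right_inj' hW, ← hk, Finset.mul_sum]
  refine Finset.sum_congr rfl fun i _ => ?_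
  field_simp

lemma continuous_detCols : Continuous (detCols : (Fin d → Vec d) → ℝ) := by
  unfold detCols
  refine Continuous.matrix_det ?_
  refine continuous_matrix fun k c => ?_
  simp only [Matrix.of_apply]
  fun_prop

lemma continuous_cofactor (i : Fin d) : Continuous fun W : Fin d → Vec d => cofactor W i := by
  unfold cofactor
  refine (PiLp.continuous_toLp 2 _).comp (continuous_pi fun j => ?_)
  exact continuous_detCols.comp (continuous_id.update i continuous_const)

/-- A bound from the Leibniz formula. -/
lemma abs_detCols_le (W : Fin d → Vec d) {c : ℝ} (hW : ∀ i, ‖W i‖ ≤ c) :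
    |detCols W| ≤ d.factorial * c ^ d := by
  have h := Matrix.det_le (A := (Matrix.of fun k c => W c k : Matrix (Fin d) (Fin d) ℝ))
    (abv := AbsoluteValue.abs) (x := c) fun k i => by
      have := (PiLp.norm_apply_le (W i) k).trans (hW i)
      simpa using this
  simpa [detCols, nsmul_eq_mul] using h

/-- The probing direction at index `i`. -/
def probeDir (W : Fin d → Vec d) (i : Fin d) : Vec d := ‖cofactor W i‖⁻¹ • cofactor W i

lemma inner_probeDir (W : Fin d → Vec d) (i : Fin d) :
    ⟪cofactor W i, probeDir W i⟫ = ‖cofactor W i‖ := by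
  rw [probeDir, inner_smul_right, real_inner_self_eq_norm_sq]
  by_cases h : ‖cofactor W i‖ = 0
  · simp [h]
  · field_simp

lemma inner_cofactor_eq (W : Fin d → Vec d) (i : Fin d) (v : Vec d) :
    ⟪cofactor W i, v⟫ = ‖cofactor W i‖ * ⟪probeDir W i, v⟫ := by
  rw [probeDir, inner_smul_left]
  by_cases h : ‖cofactor W i‖ = 0
  · rw [norm_eq_zero] at h; simp [h]
  · simp [h]

lemma norm_probeDir_le (W : Fin d → Vec d) (i : Fin d) : ‖probeDir W i‖ ≤ 1 := by
  rw [probeDir, norm_smul, norm_inv, norm_norm]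
  exact inv_mul_le_one

end Cofactor

/-! ### RobustSpanner as a sequence of probes -/

section Machine

variable {d : ℕ}

/-- The control state of RobustSpanner: where the current entries of the spanner come from (number
of the probe and its sign), the indices still to be visited, and whether the initial loop is
running. -/
structure Ctl (d : ℕ) where
  ptr : Fin d → ℕ × Bool
  todo : List (Fin d)
  start : Bool

/-- There are countably many control states; all sets of them are measurable. -/
instance : MeasurableSpace (Ctl d) := ⊤

instance : Countable (Ctl d) := by
  have : Function.Injective fun c : Ctl d => (c.ptr, c.todo, c.start) := by
    rintro ⟨p, t, s⟩ ⟨p', t', s'⟩ h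
    simp only [Prod.mk.injEq] at h
    obtain ⟨rfl, rfl, rfl⟩ := h
    rfl
  exact this.countable

/-- The state of RobustSpanner between two pairs of probes. -/
abbrev Mach (d : ℕ) := (Fin d → Vec d) × Ctl d

namespace Mach

/-- The direction probed next. -/
def query (st : Mach d) : Vec d :=
  match st.2.todo with
  | [] => 0
  | i :: _ => probeDir st.1 i

/-- Replace column `i` by `w`, obtained by probe `n` with sign `b`, and continue with `todo`. -/
def put (st : Mach d) (i : Fin d) (w : Vec d) (n : ℕ) (b : Bool) (todo : List (Fin d))
    (start : Bool) : Mach d :=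
  (Function.update st.1 i w, ⟨Function.update st.2.ptr i (n, b), todo, start⟩)

/-- The indices visited after one pass of the initial loop, when `is` remain. -/
def nextTodo (is : List (Fin d)) : List (Fin d) := if is = [] then List.finRange d else is

open Classical in
/-- Process the answers `wp`, `wm` to the `n`-th pair of probes, with `C = 2`. -/
def step (η : ℝ) (n : ℕ) (st : Mach d) (wp wm : Vec d) : Mach d :=
  match st.2.todo with
  | [] => st
  | i :: is =>
    let θ := cofactor st.1 i
    let u := probeDir st.1 i
    if st.2.start then
      if -⟪θ, wm⟫ ≤ ⟪θ, wp⟫ then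
        st.put i (wp + η • u) n true (nextTodo is) (!is.isEmpty)
      else st.put i (wm - η • u) n false (nextTodo is) (!is.isEmpty)
    else if 2 * |detCols st.1| ≤ ⟪θ, wp⟫ + η * ‖θ‖ then
      st.put i (wp + η • u) n true (List.finRange d) false
    else if 2 * |detCols st.1| ≤ -⟪θ, wm⟫ + η * ‖θ‖ then
      st.put i (wm - η • u) n false (List.finRange d) false
    else (st.1, ⟨st.2.ptr, is, false⟩)

/-- The states of RobustSpanner when `a n u` are the answers to the `n`-th pair of probes, in
directions `u` and `-u`. -/
def run (η : ℝ) (a : ℕ → Vec d → Vec d × Vec d) : ℕ → Mach d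
  | 0 => (fun i => EuclideanSpace.single i (1 : ℝ), ⟨fun _ => (0, true), List.finRange d, true⟩)
  | n + 1 => (run η a n).step η n (a n (run η a n).query).1 (a n (run η a n).query).2

/-- After RobustSpanner has stopped, the machine stays where it is. -/
lemma run_eq_of_done {η : ℝ} {a : ℕ → Vec d → Vec d × Vec d} {n : ℕ}
    (h : (run η a n).2.todo = []) (m : ℕ) : run η a (n + m) = run η a n := by
  induction m with
  | zero => rfl
  | succ m ih => rw [← add_assoc, run, ih, step, h]

lemma run_congr {η : ℝ} {a a' : ℕ → Vec d → Vec d × Vec d} {n : ℕ}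
    (h : ∀ k < n, a k = a' k) : run η a n = run η a' n := by
  induction n with
  | zero => rfl
  | succ n ih => rw [run, run, ih fun k hk => h k (by omega), h n (by omega)]

lemma measurable_query : Measurable (query : Mach d → Vec d) := by
  refine measurable_from_prod_countable_left fun c => ?_
  rcases c with ⟨p, _ | ⟨i, is⟩, b⟩
  · exact measurable_const
  · have hc := (continuous_cofactor (d := d) i).measurable
    exact hc.norm.inv.smul hc

lemma measurable_step (η : ℝ) (n : ℕ) :
    Measurable fun q : Mach d × (Vec d × Vec d) => q.1.step η n q.2.1 q.2.2 := by
  have key : ∀ c : Ctl d, Measurable fun q : (Fin d → Vec d) × (Vec d × Vec d) =>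
      step η n (q.1, c) q.2.1 q.2.2 := by
    rintro ⟨p, _ | ⟨i, is⟩, b⟩
    · exact measurable_fst.prodMk measurable_const
    · have hθ : Measurable fun q : (Fin d → Vec d) × (Vec d × Vec d) => cofactor q.1 i :=
        (continuous_cofactor (d := d) i).measurable.comp measurable_fst
      have hu : Measurable fun q : (Fin d → Vec d) × (Vec d × Vec d) => probeDir q.1 i :=
        hθ.norm.inv.smul hθ
      have hdet : Measurable fun q : (Fin d → Vec d) × (Vec d × Vec d) => detCols q.1 :=
        continuous_detCols.measurable.comp measurable_fst
      have hwp : Measurable fun q : (Fin d → Vec d) × (Vec d × Vec d) => q.2.1 := by fun_prop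
      have hwm : Measurable fun q : (Fin d → Vec d) × (Vec d × Vec d) => q.2.2 := by fun_prop
      have hput : ∀ (f : (Fin d → Vec d) × (Vec d × Vec d) → Vec d), Measurable f →
          ∀ (b' : Bool) (todo : List (Fin d)) (s : Bool),
          Measurable fun q : (Fin d → Vec d) × (Vec d × Vec d) =>
            put (q.1, (⟨p, i :: is, b⟩ : Ctl d)) i (f q) n b' todo s := by
        intro f hf b' todo s
        change Measurable fun q : (Fin d → Vec d) × (Vec d × Vec d) =>
          (Function.update q.1 i (f q), (⟨Function.update p i (n, b'), todo, s⟩ : Ctl d))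
        refine Measurable.prodMk ?_ measurable_const
        refine measurable_pi_iff.2 fun c => ?_
        by_cases hc : c = i
        · subst hc; simpa using hf
        · simp only [Function.update_of_ne hc]
          fun_prop
      have h1 : MeasurableSet {q : (Fin d → Vec d) × (Vec d × Vec d) |
          -⟪cofactor q.1 i, q.2.2⟫ ≤ ⟪cofactor q.1 i, q.2.1⟫} :=
        measurableSet_le (hθ.inner hwm).neg (hθ.inner hwp)
      have h2 : MeasurableSet {q : (Fin d → Vec d) × (Vec d × Vec d) |
          2 * |detCols q.1| ≤ ⟪cofactor q.1 i, q.2.1⟫ + η * ‖cofactor q.1 i‖} :=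
        measurableSet_le (measurable_norm.comp hdet |>.const_mul 2)
          ((hθ.inner hwp).add (hθ.norm.const_mul η))
      have h3 : MeasurableSet {q : (Fin d → Vec d) × (Vec d × Vec d) |
          2 * |detCols q.1| ≤ -⟪cofactor q.1 i, q.2.2⟫ + η * ‖cofactor q.1 i‖} :=
        measurableSet_le (measurable_norm.comp hdet |>.const_mul 2)
          ((hθ.inner hwm).neg.add (hθ.norm.const_mul η))
      have hp := hput _ (hwp.add (hu.const_smul η))
      have hm := hput _ (hwm.sub (hu.const_smul η))
      simp only [step]
      cases b
      · simp only [Bool.false_eq_true, if_false]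
        exact Measurable.ite h2 (hp _ _ _) (Measurable.ite h3 (hm _ _ _)
          (measurable_fst.prodMk measurable_const))
      · simp only [if_true]
        exact Measurable.ite h1 (hp _ _ _) (hm _ _ _)
  have h : Measurable fun q : ((Fin d → Vec d) × (Vec d × Vec d)) × Ctl d =>
      step η n (q.1.1, q.2) q.1.2.1 q.1.2.2 :=
    measurable_from_prod_countable_left key
  exact h.comp (g := fun q : ((Fin d → Vec d) × (Vec d × Vec d)) × Ctl d =>
      step η n (q.1.1, q.2) q.1.2.1 q.1.2.2)
    (f := fun q : Mach d × (Vec d × Vec d) => ((q.1.1, q.2), q.1.2)) (by fun_prop)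

lemma measurable_run {Ω : Type*} [MeasurableSpace Ω] {η : ℝ} {a : Ω → ℕ → Vec d → Vec d × Vec d}
    {N : ℕ} (ha : ∀ n < N, ∀ u : Ω → Vec d, Measurable u → Measurable fun ω => a ω n (u ω))
    {n : ℕ} (hn : n ≤ N) : Measurable fun ω => run η (a ω) n := by
  induction n with
  | zero => exact measurable_const
  | succ n ih =>
    have h1 := ih (by omega)
    have h2 := ha n (by omega) _ (measurable_query.comp h1)
    exact (measurable_step η n).comp (h1.prodMk h2)

end Mach

end Machine
end LBC
end

noncomputable section
namespace LBC

/-! ### Analysis of RobustSpanner -/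

section SpannerRun

variable {d : ℕ}

namespace Mach

variable {η : ℝ} {a : ℕ → Vec d → Vec d × Vec d}

/-- The vector returned by the probe that `p` points to. -/
def answer (η : ℝ) (a : ℕ → Vec d → Vec d × Vec d) (p : ℕ × Bool) : Vec d :=
  if p.2 then (a p.1 (run η a p.1).query).1 else (a p.1 (run η a p.1).query).2

lemma query_of_todo {st : Mach d} {i : Fin d} {is : List (Fin d)} (h : st.2.todo = i :: is) :
    st.query = probeDir st.1 i := by
  rw [query, h]

lemma det_put_add (W : Fin d → Vec d) (i : Fin d) (w : Vec d) :
    detCols (Function.update W i (w + η • probeDir W i)) =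
      ⟪cofactor W i, w⟫ + η * ‖cofactor W i‖ := by
  rw [← inner_cofactor, inner_add_right, inner_smul_right, inner_probeDir]

lemma det_put_sub (W : Fin d → Vec d) (i : Fin d) (w : Vec d) :
    detCols (Function.update W i (w - η • probeDir W i)) =
      ⟪cofactor W i, w⟫ - η * ‖cofactor W i‖ := by
  rw [← inner_cofactor, inner_sub_right, inner_smul_right, inner_probeDir]

/-- The probes in directions `± u` are accurate to `η/2` for linear optimization over `Ψ`. -/
def Accurate (η : ℝ) (a : ℕ → Vec d → Vec d × Vec d) (Ψ : Set (Vec d)) (n : ℕ) : Prop :=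
  ∀ ψ ∈ Ψ, ⟪(run η a n).query, ψ⟫ ≤ ⟪(run η a n).query, (a n (run η a n).query).1⟫ + η / 2 ∧
    -⟪(run η a n).query, ψ⟫ ≤ -⟪(run η a n).query, (a n (run η a n).query).2⟫ + η / 2

/-- The columns stay within distance `η` of the probe answers that they come from. -/
lemma run_near (hη : 0 ≤ η) (n : ℕ) (i : Fin d)
    (hi : (run η a n).2.start = true → i ∉ (run η a n).2.todo) :
    ((run η a n).2.ptr i).1 < n ∧ ‖(run η a n).1 i - answer η a ((run η a n).2.ptr i)‖ ≤ η := by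
  induction n with
  | zero => exact absurd (List.mem_finRange i) (hi rfl)
  | succ n ih =>
    have hu : ∀ j, ‖η • probeDir (run η a n).1 j‖ ≤ η := fun j => by
      rw [norm_smul, Real.norm_of_nonneg hη]
      exact mul_le_of_le_one_right hη (norm_probeDir_le _ _)
    rw [run, step] at hi ⊢
    rcases htodo : (run η a n).2.todo with _ | ⟨j, js⟩
    · simp only [htodo] at hi ih ⊢
      have := ih hi
      exact ⟨by omega, this.2⟩
    · have hcase : ∀ (w : Vec d) (b : Bool) (todo : List (Fin d)) (s : Bool),
          (i ≠ j → ((run η a n).2.start = true → i ∉ (run η a n).2.todo)) →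
          ‖w - answer η a (n, b)‖ ≤ η →
          (((run η a n).put j w n b todo s).2.ptr i).1 < n + 1 ∧
          ‖((run η a n).put j w n b todo s).1 i -
            answer η a (((run η a n).put j w n b todo s).2.ptr i)‖ ≤ η := by
        intro w b todo s h1 h2
        by_cases hij : i = j
        · subst hij; simpa [put] using h2
        · have := ih (h1 hij)
          simp only [put, Function.update_of_ne hij]
          exact ⟨by omega, this.2⟩
      have hp : ‖(a n (run η a n).query).1 + η • probeDir (run η a n).1 j - answer η a (n, true)‖
          ≤ η := by simpa [answer] using hu j
      have hm : ‖(a n (run η a n).query).2 - η • probeDir (run η a n).1 j - answer η a (n, false)‖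
          ≤ η := by simpa [answer] using hu j
      simp only [htodo] at hi ih hcase ⊢
      by_cases hs : (run η a n).2.start = true
      · simp only [hs, if_true] at hi ih hcase ⊢
        have hmem : ∀ (w : Vec d) (b : Bool),
            ((((run η a n).put j w n b (nextTodo js) (!js.isEmpty)).2.start = true →
              i ∉ ((run η a n).put j w n b (nextTodo js) (!js.isEmpty)).2.todo)) →
            i ≠ j → True → i ∉ j :: js := by
          intro w b h hij _ hmem
          rcases js with _ | ⟨k, ks⟩
          · simp [hij] at hmem
          · simp only [put, nextTodo] at h
            refine h (by simp) ?_
            simpa [hij] using hmem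
        split_ifs at hi ⊢
        · exact hcase _ _ _ _ (hmem _ _ hi) hp
        · exact hcase _ _ _ _ (hmem _ _ hi) hm
      · simp only [hs, if_false, Bool.false_eq_true] at hi ih hcase ⊢
        split_ifs
        · exact hcase _ _ _ _ (fun _ h => h.elim) hp
        · exact hcase _ _ _ _ (fun _ h => h.elim) hm
        · have := ih (fun h => h.elim)
          exact ⟨by simpa using Nat.lt_succ_of_lt this.1, by simpa using this.2⟩

/-- All columns have norm at most `1 + η`, so the determinant cannot double for ever. -/
lemma norm_run_le (hη : 0 ≤ η) (ha : ∀ n u, ‖(a n u).1‖ ≤ 1 ∧ ‖(a n u).2‖ ≤ 1) (n : ℕ) (i : Fin d) :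
    ‖(run η a n).1 i‖ ≤ 1 + η := by
  induction n with
  | zero => simp [run, hη]
  | succ n ih =>
    have hu : ∀ j, ‖η • probeDir (run η a n).1 j‖ ≤ η := fun j => by
      rw [norm_smul, Real.norm_of_nonneg hη]
      exact mul_le_of_le_one_right hη (norm_probeDir_le _ _)
    have hcase : ∀ (j : Fin d) (w : Vec d) (b : Bool) (todo : List (Fin d)) (s : Bool),
        ‖w‖ ≤ 1 + η → ‖((run η a n).put j w n b todo s).1 i‖ ≤ 1 + η := by
      intro j w b todo s h
      by_cases hij : i = j
      · subst hij; simpa [put] using h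
      · simpa [put, Function.update_of_ne hij] using ih
    have hp : ∀ j, ‖(a n (run η a n).query).1 + η • probeDir (run η a n).1 j‖ ≤ 1 + η := fun j =>
      (norm_add_le _ _).trans (add_le_add (ha _ _).1 (hu j))
    have hm : ∀ j, ‖(a n (run η a n).query).2 - η • probeDir (run η a n).1 j‖ ≤ 1 + η := fun j =>
      (norm_sub_le _ _).trans (add_le_add (ha _ _).2 (hu j))
    rw [run, step]
    rcases (run η a n).2.todo with _ | ⟨j, js⟩
    · exact ih
    · simp only
      split_ifs
      · exact hcase _ _ _ _ _ (hp _)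
      · exact hcase _ _ _ _ _ (hm _)
      · exact hcase _ _ _ _ _ (hp _)
      · exact hcase _ _ _ _ _ (hm _)
      · exact ih

/-- One step of the initial loop, replacing a column of norm at most one: some vector `ψ` of `Ψ` gives
`⟪u, wp⟫ - ⟪u, wm⟫ ≥ -η`, so the better of the two signs and the shift by `η u` together secure `η/2`. -/
lemma le_abs_det_put {W : Fin d → Vec d} {i : Fin d} {wp wm ψ : Vec d} (hη : 0 ≤ η)
    (hi : ‖W i‖ ≤ 1)
    (h1 : ⟪probeDir W i, ψ⟫ ≤ ⟪probeDir W i, wp⟫ + η / 2)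
    (h2 : -⟪probeDir W i, ψ⟫ ≤ -⟪probeDir W i, wm⟫ + η / 2) :
    (-⟪cofactor W i, wm⟫ ≤ ⟪cofactor W i, wp⟫ →
      η / 2 * |detCols W| ≤ |detCols (Function.update W i (wp + η • probeDir W i))|) ∧
    (⟪cofactor W i, wp⟫ ≤ -⟪cofactor W i, wm⟫ →
      η / 2 * |detCols W| ≤ |detCols (Function.update W i (wm - η • probeDir W i))|) := by
  have hdet : |detCols W| ≤ ‖cofactor W i‖ := by
    rw [← inner_cofactor_self W i]
    exact (abs_real_inner_le_norm _ _).trans (mul_le_of_le_one_right (norm_nonneg _) hi)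
  have h0 := norm_nonneg (cofactor W i)
  have hηd : η / 2 * |detCols W| ≤ η / 2 * ‖cofactor W i‖ := by gcongr
  rw [det_put_add, det_put_sub, inner_cofactor_eq, inner_cofactor_eq]
  constructor
  · intro h
    refine le_trans ?_ (le_abs_self _)
    nlinarith
  · intro h
    refine le_trans ?_ (neg_le_abs _)
    nlinarith

/-- While the probes are accurate, the determinant loses at most a factor `η/2` with each index of
the initial loop and never decreases afterwards. -/
lemma le_abs_det_run (hη : 0 ≤ η) {Ψ : Set (Vec d)} (hΨ : Ψ.Nonempty) {n : ℕ}
    (hacc : ∀ k < n, Accurate η a Ψ k) :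
    ((run η a n).2.start = true → (run η a n).2.todo.Nodup ∧
      (∀ i ∈ (run η a n).2.todo, (run η a n).1 i = EuclideanSpace.single i (1 : ℝ)) ∧
      (η / 2) ^ (d - (run η a n).2.todo.length) ≤ |detCols (run η a n).1|) ∧
    ((run η a n).2.start = false → (η / 2) ^ d ≤ |detCols (run η a n).1|) := by
  induction n with
  | zero =>
    refine ⟨fun _ => ⟨List.nodup_finRange d, fun i _ => rfl, ?_⟩, fun h => by simp [run] at h⟩
    have : (Matrix.of fun k c => (EuclideanSpace.single c (1 : ℝ) : Vec d) k :
        Matrix (Fin d) (Fin d) ℝ) = 1 := by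
      ext k c
      simp [Matrix.one_apply]
    simp only [run, detCols, this, List.length_finRange, Nat.sub_self, pow_zero, Matrix.det_one,
      abs_one, le_refl]
  | succ n ih =>
    have ih := ih fun k hk => hacc k (by omega)
    have hn := hacc n (by omega)
    obtain ⟨ψ, hψ⟩ := hΨ
    have hq := hn ψ hψ
    rw [run, step]
    rcases htodo : (run η a n).2.todo with _ | ⟨j, js⟩
    · simpa only using ih
    · rw [query_of_todo htodo] at hq ⊢
      simp only [htodo] at ih ⊢
      by_cases hs : (run η a n).2.start = true
      · simp only [hs, if_true, true_implies, Bool.true_eq_false, false_implies, and_true] at ih ⊢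
        obtain ⟨hnd, he, hdet⟩ := ih
        have hWj : ‖(run η a n).1 j‖ ≤ 1 := by rw [he j (by simp)]; simp
        have hput := le_abs_det_put hη hWj hq.1 hq.2
        have hlen : js.length + 1 ≤ d := by simpa using hnd.length_le_card
        have hcase : ∀ (w : Vec d) (b : Bool),
            η / 2 * |detCols (run η a n).1| ≤ |detCols (Function.update (run η a n).1 j w)| →
            (((run η a n).put j w n b (nextTodo js) (!js.isEmpty)).2.start = true →
              ((run η a n).put j w n b (nextTodo js) (!js.isEmpty)).2.todo.Nodup ∧
              (∀ i ∈ ((run η a n).put j w n b (nextTodo js) (!js.isEmpty)).2.todo,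
                ((run η a n).put j w n b (nextTodo js) (!js.isEmpty)).1 i =
                  EuclideanSpace.single i (1 : ℝ)) ∧
              (η / 2) ^ (d - ((run η a n).put j w n b (nextTodo js) (!js.isEmpty)).2.todo.length) ≤
                |detCols ((run η a n).put j w n b (nextTodo js) (!js.isEmpty)).1|) ∧
            (((run η a n).put j w n b (nextTodo js) (!js.isEmpty)).2.start = false →
              (η / 2) ^ d ≤
                |detCols ((run η a n).put j w n b (nextTodo js) (!js.isEmpty)).1|) := by
          intro w b h
          have hpow : (η / 2) ^ (d - js.length) ≤ |detCols (Function.update (run η a n).1 j w)| := by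
            refine le_trans ?_ h
            have : d - js.length = (d - (j :: js).length) + 1 := by simp; omega
            rw [this, pow_succ']
            gcongr
          rcases js with _ | ⟨k, ks⟩
          · refine ⟨fun h => by simp [put] at h, fun _ => ?_⟩
            simpa [put] using hpow
          · refine ⟨fun _ => ⟨hnd.of_cons, ?_, ?_⟩, fun h => by simp [put] at h⟩
            · intro i hi
              have hij : i ≠ j := by
                rintro rfl
                exact (List.nodup_cons.1 hnd).1 hi
              simp only [put, Function.update_of_ne hij]
              exact he i (List.mem_cons_of_mem _ hi)
            · simpa [put, nextTodo] using hpow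
        split_ifs with h1
        · exact hcase _ _ (hput.1 h1)
        · exact hcase _ _ (hput.2 (le_of_not_ge h1))
      · have hs' : (run η a n).2.start = false := by simpa using hs
        have hdet := ih.2 hs'
        have h0 := abs_nonneg (detCols (run η a n).1)
        simp only [hs', if_false, Bool.false_eq_true, put]
        split_ifs with h1 h2
        · refine ⟨fun h => h.elim, fun _ => ?_⟩
          rw [det_put_add]
          exact (by linarith : _ ≤ _).trans (le_abs_self _)
        · refine ⟨fun h => h.elim, fun _ => ?_⟩
          rw [det_put_sub]
          exact (by linarith : _ ≤ _).trans (neg_le_abs _)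
        · exact ⟨fun h => h.elim, fun _ => hdet⟩

open Classical in
lemma run_succ_of_start {n : ℕ} {i : Fin d} {is : List (Fin d)}
    (ht : (run η a n).2.todo = i :: is) (hs : (run η a n).2.start = true) :
    run η a (n + 1) =
      if -⟪cofactor (run η a n).1 i, (a n (run η a n).query).2⟫ ≤
        ⟪cofactor (run η a n).1 i, (a n (run η a n).query).1⟫ then
        (run η a n).put i ((a n (run η a n).query).1 + η • probeDir (run η a n).1 i) n true
          (nextTodo is) (!is.isEmpty)
      else
        (run η a n).put i ((a n (run η a n).query).2 - η • probeDir (run η a n).1 i) n false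
          (nextTodo is) (!is.isEmpty) := by
  rw [run, step]
  simp only [ht, hs, if_true]

open Classical in
lemma run_succ_of_scan {n : ℕ} {i : Fin d} {is : List (Fin d)}
    (ht : (run η a n).2.todo = i :: is) (hs : (run η a n).2.start = false) :
    run η a (n + 1) =
      if 2 * |detCols (run η a n).1| ≤ ⟪cofactor (run η a n).1 i, (a n (run η a n).query).1⟫ +
        η * ‖cofactor (run η a n).1 i‖ then
        (run η a n).put i ((a n (run η a n).query).1 + η • probeDir (run η a n).1 i) n true
          (List.finRange d) false
      else if 2 * |detCols (run η a n).1| ≤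
        -⟪cofactor (run η a n).1 i, (a n (run η a n).query).2⟫ +
          η * ‖cofactor (run η a n).1 i‖ then
        (run η a n).put i ((a n (run η a n).query).2 - η • probeDir (run η a n).1 i) n false
          (List.finRange d) false
      else ((run η a n).1, ⟨(run η a n).2.ptr, is, false⟩) := by
  rw [run, step]
  simp only [ht, hs, if_false, Bool.false_eq_true]

end Mach

section Simulation

variable {Z : Type*} (linOpt : ℕ → Vec d → Costed Z) (vec : ℕ → Z → Costed (Vec d)) (η : ℝ)

/-- The answers to the `n`-th pair of probes, as a function of the direction. -/
def probeAnswer (n : ℕ) (u : Vec d) : Vec d × Vec d :=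
  ((vec (4 * n + 1) (linOpt (4 * n) u).val).val,
    (vec (4 * n + 3) (linOpt (4 * n + 2) (-u)).val).val)

/-- The element of `Z` found by the probe that `p` points to. -/
def probeIndex (p : ℕ × Bool) : Z :=
  if p.2 then (linOpt (4 * p.1) (Mach.run η (probeAnswer linOpt vec) p.1).query).val
  else (linOpt (4 * p.1 + 2) (-(Mach.run η (probeAnswer linOpt vec) p.1).query)).val

/-- The state `s` of RobustSpanner is described by the machine after `n` pairs of probes. -/
def Simulates (n : ℕ) (s : SpanState Z d) : Prop :=
  s.W = (Mach.run η (probeAnswer linOpt vec) n).1 ∧ s.calls = 4 * n ∧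
    ∀ i, ((Mach.run η (probeAnswer linOpt vec) n).2.start = true →
      i ∉ (Mach.run η (probeAnswer linOpt vec) n).2.todo) →
      s.z i = probeIndex linOpt vec η ((Mach.run η (probeAnswer linOpt vec) n).2.ptr i)

variable {linOpt vec η}

lemma probes_val (s : SpanState Z d) (i : Fin d) :
    (probes linOpt vec s i).val =
      (((linOpt s.calls (probeDir s.W i)).val,
        (vec (s.calls + 1) (linOpt s.calls (probeDir s.W i)).val).val),
        ((linOpt (s.calls + 2) (-probeDir s.W i)).val,
        (vec (s.calls + 2 + 1) (linOpt (s.calls + 2) (-probeDir s.W i)).val).val)) := rfl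

open Classical in
lemma spanInit_val (s : SpanState Z d) (i : Fin d) : (spanInit linOpt vec η i s).val =
    let pq := (probes linOpt vec s i).val
    if -⟪cofactor s.W i, pq.2.2⟫ ≤ ⟪cofactor s.W i, pq.1.2⟫ then
      (⟨s.W, s.z, s.calls + 4⟩ : SpanState Z d).put i pq.1.1 (pq.1.2 + η • probeDir s.W i)
    else
      (⟨s.W, s.z, s.calls + 4⟩ : SpanState Z d).put i pq.2.1 (pq.2.2 - η • probeDir s.W i) := rfl

open Classical in
lemma spanScan_cons_val (s : SpanState Z d) (i : Fin d) (is : List (Fin d)) :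
    (spanScan linOpt vec 2 η (i :: is) s).val =
      let pq := (probes linOpt vec s i).val
      if 2 * |detCols s.W| ≤ ⟪cofactor s.W i, pq.1.2⟫ + η * ‖cofactor s.W i‖ then
        ((⟨s.W, s.z, s.calls + 4⟩ : SpanState Z d).put i pq.1.1
          (pq.1.2 + η • probeDir s.W i), true)
      else if 2 * |detCols s.W| ≤ -⟪cofactor s.W i, pq.2.2⟫ + η * ‖cofactor s.W i‖ then
        ((⟨s.W, s.z, s.calls + 4⟩ : SpanState Z d).put i pq.2.1
          (pq.2.2 - η • probeDir s.W i), true)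
      else (spanScan linOpt vec 2 η is ⟨s.W, s.z, s.calls + 4⟩).val := by
  rw [spanScan, Costed.bind_val]
  simp only
  split_ifs <;> rfl

lemma Simulates.probes_val {n : ℕ} {s : SpanState Z d} (h : Simulates linOpt vec η n s) {i : Fin d}
    {is : List (Fin d)} (ht : (Mach.run η (probeAnswer linOpt vec) n).2.todo = i :: is) :
    (probes linOpt vec s i).val =
      ((probeIndex linOpt vec η (n, true),
        (probeAnswer linOpt vec n (Mach.run η (probeAnswer linOpt vec) n).query).1),
       (probeIndex linOpt vec η (n, false),
        (probeAnswer linOpt vec n (Mach.run η (probeAnswer linOpt vec) n).query).2)) := by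
  rw [LBC.probes_val, h.1, h.2.1]
  simp [probeIndex, probeAnswer, Mach.query_of_todo ht]

lemma Simulates.put {n : ℕ} {s : SpanState Z d} (h : Simulates linOpt vec η n s) {i : Fin d}
    {is : List (Fin d)} (ht : (Mach.run η (probeAnswer linOpt vec) n).2.todo = i :: is)
    {w : Vec d} {b : Bool} {todo : List (Fin d)} {start : Bool}
    (hrun : Mach.run η (probeAnswer linOpt vec) (n + 1) =
      (Mach.run η (probeAnswer linOpt vec) n).put i w n b todo start)
    (hstart : (Mach.run η (probeAnswer linOpt vec) n).2.start = true →
      start = true ∧ todo = is ∨ start = false ∧ is = []) :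
    Simulates linOpt vec η (n + 1)
      ((⟨s.W, s.z, s.calls + 4⟩ : SpanState Z d).put i (probeIndex linOpt vec η (n, b)) w) := by
  refine ⟨?_, ?_, fun j hj => ?_⟩
  · rw [hrun, SpanState.put, Mach.put, h.1]
  · rw [SpanState.put, h.2.1]; ring
  · rw [hrun] at hj ⊢
    by_cases hij : j = i
    · subst hij; simp [SpanState.put, Mach.put]
    · simp only [SpanState.put, Mach.put, Function.update_of_ne hij] at hj ⊢
      refine h.2.2 j fun hs => ?_
      rw [ht]
      rcases hstart hs with ⟨h1, h2⟩ | ⟨h1, h2⟩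
      · subst h2
        simpa [hij] using hj h1
      · simp [h2, hij]

lemma Simulates.spanInit {n : ℕ} {s : SpanState Z d} (h : Simulates linOpt vec η n s) {i : Fin d}
    {is : List (Fin d)} (ht : (Mach.run η (probeAnswer linOpt vec) n).2.todo = i :: is)
    (hs : (Mach.run η (probeAnswer linOpt vec) n).2.start = true) :
    Simulates linOpt vec η (n + 1) (spanInit linOpt vec η i s).val ∧
    (Mach.run η (probeAnswer linOpt vec) (n + 1)).2.todo = Mach.nextTodo is ∧
    (Mach.run η (probeAnswer linOpt vec) (n + 1)).2.start = !is.isEmpty := by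
  have hstart : (Mach.run η (probeAnswer linOpt vec) n).2.start = true →
      (!is.isEmpty) = true ∧ Mach.nextTodo is = is ∨ (!is.isEmpty) = false ∧ is = [] := by
    intro _
    rcases is with _ | ⟨k, ks⟩ <;> simp [Mach.nextTodo]
  obtain ⟨W, z, c⟩ := s
  obtain rfl : W = _ := h.1
  rw [spanInit_val, h.probes_val ht]
  dsimp only
  have hrun := Mach.run_succ_of_start ht hs
  split_ifs at hrun ⊢ with hc
  · exact ⟨h.put ht hrun hstart, by rw [hrun]; rfl, by rw [hrun]; rfl⟩
  · exact ⟨h.put ht hrun hstart, by rw [hrun]; rfl, by rw [hrun]; rfl⟩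

lemma Simulates.spanInits {is : List (Fin d)} (his : is ≠ []) {n : ℕ} {s : SpanState Z d}
    (h : Simulates linOpt vec η n s)
    (ht : (Mach.run η (probeAnswer linOpt vec) n).2.todo = is)
    (hs : (Mach.run η (probeAnswer linOpt vec) n).2.start = true) :
    Simulates linOpt vec η (n + is.length) (spanInits linOpt vec η is s).val ∧
    (Mach.run η (probeAnswer linOpt vec) (n + is.length)).2.todo = List.finRange d ∧
    (Mach.run η (probeAnswer linOpt vec) (n + is.length)).2.start = false := by
  induction is generalizing n s with
  | nil => exact absurd rfl his
  | cons i is ih =>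
    obtain ⟨h1, h2, h3⟩ := h.spanInit ht hs
    rcases is with _ | ⟨k, ks⟩
    · exact ⟨h1, by simpa [Mach.nextTodo] using h2, by simpa using h3⟩
    · have := ih (by simp) h1 (by simpa [Mach.nextTodo] using h2) (by simpa using h3)
      have e : n + (i :: k :: ks).length = n + 1 + (k :: ks).length := by simp; omega
      rw [e]
      exact this

/-- Index `i` fails both tests of the scan at the `m`-th pair of probes, for columns `W`. -/
def ScanFails (a : ℕ → Vec d → Vec d × Vec d) (η : ℝ) (W : Fin d → Vec d) (m : ℕ) (i : Fin d) :
    Prop :=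
  (Mach.run η a m).query = probeDir W i ∧
    ⟪cofactor W i, (a m (probeDir W i)).1⟫ + η * ‖cofactor W i‖ < 2 * |detCols W| ∧
    -⟪cofactor W i, (a m (probeDir W i)).2⟫ + η * ‖cofactor W i‖ < 2 * |detCols W|

/-- A scan either replaces a column and doubles the determinant, or finds that all indices fail. -/
lemma Simulates.spanScan {is : List (Fin d)} {n : ℕ} {s : SpanState Z d}
    (h : Simulates linOpt vec η n s)
    (ht : (Mach.run η (probeAnswer linOpt vec) n).2.todo = is)
    (hs : (Mach.run η (probeAnswer linOpt vec) n).2.start = false) :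
    ∃ n' ≤ n + is.length,
      Simulates linOpt vec η n' (spanScan linOpt vec 2 η is s).val.1 ∧
      (Mach.run η (probeAnswer linOpt vec) n').2.start = false ∧
      (((spanScan linOpt vec 2 η is s).val.2 = true ∧
        (Mach.run η (probeAnswer linOpt vec) n').2.todo = List.finRange d ∧
        2 * |detCols (Mach.run η (probeAnswer linOpt vec) n).1| ≤
          |detCols (Mach.run η (probeAnswer linOpt vec) n').1|) ∨
       ((spanScan linOpt vec 2 η is s).val.2 = false ∧
        (Mach.run η (probeAnswer linOpt vec) n').2.todo = [] ∧
        (Mach.run η (probeAnswer linOpt vec) n').1 = (Mach.run η (probeAnswer linOpt vec) n).1 ∧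
        ∀ i ∈ is, ∃ m < n + is.length, ScanFails (probeAnswer linOpt vec) η
          (Mach.run η (probeAnswer linOpt vec) n).1 m i)) := by
  induction is generalizing n s with
  | nil => exact ⟨n, le_rfl, h, hs, Or.inr ⟨rfl, ht, rfl, by simp⟩⟩
  | cons i is ih =>
    obtain ⟨W, z, c⟩ := s
    obtain rfl : W = _ := h.1
    rw [spanScan_cons_val, h.probes_val ht]
    dsimp only
    have hrun := Mach.run_succ_of_scan ht hs
    have hq := Mach.query_of_todo ht
    have h0 := abs_nonneg (detCols (Mach.run η (probeAnswer linOpt vec) n).1)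
    have hno : (Mach.run η (probeAnswer linOpt vec) n).2.start = true →
      false = true ∧ List.finRange d = is ∨ false = false ∧ is = [] := by simp [hs]
    split_ifs at hrun ⊢ with hc1 hc2
    · refine ⟨n + 1, by simp, h.put ht hrun hno, by rw [hrun]; rfl,
        Or.inl ⟨rfl, by rw [hrun]; rfl, ?_⟩⟩
      rw [hrun, Mach.put, Mach.det_put_add]
      exact hc1.trans (le_abs_self _)
    · refine ⟨n + 1, by simp, h.put ht hrun hno, by rw [hrun]; rfl,
        Or.inl ⟨rfl, by rw [hrun]; rfl, ?_⟩⟩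
      rw [hrun, Mach.put, Mach.det_put_sub]
      exact (by linarith : _ ≤ _).trans (neg_le_abs _)
    · have hsim : Simulates linOpt vec η (n + 1)
          (⟨(Mach.run η (probeAnswer linOpt vec) n).1, z, c + 4⟩ : SpanState Z d) := by
        refine ⟨by rw [hrun], ?_, fun j hj => ?_⟩
        · have := h.2.1
          simp only at this ⊢
          omega
        · rw [hrun]
          exact h.2.2 j (by simp [hs])
      obtain ⟨n', hn', h1, h2, h3⟩ := ih hsim (by rw [hrun]) (by rw [hrun])
      have hW : (Mach.run η (probeAnswer linOpt vec) (n + 1)).1 =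
          (Mach.run η (probeAnswer linOpt vec) n).1 := by rw [hrun]
      rw [hW] at h3
      refine ⟨n', by simp; omega, h1, h2, ?_⟩
      rcases h3 with h3 | ⟨h3, h4, h5, h6⟩
      · exact Or.inl (h3)
      · refine Or.inr ⟨h3, h4, h5, fun j hj => ?_⟩
        rcases List.mem_cons.1 hj with rfl | hj
        · refine ⟨n, ?_, hq, ?_, ?_⟩
          · simp
          · rw [← hq]; exact not_le.1 hc1
          · rw [← hq]; exact not_le.1 hc2
        · obtain ⟨m, hm, hf⟩ := h6 j hj
          exact ⟨m, by simp; omega, hf⟩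

/-- Each round of the outer loop but the last doubles the determinant, which is at most `U`; so the
loop stops within `fuel` rounds as soon as `2 ^ fuel` times the initial determinant exceeds `U`. -/
lemma Simulates.spanLoop {U : ℝ}
    (hU : ∀ m, |detCols (Mach.run η (probeAnswer linOpt vec) m).1| ≤ U)
    {fuel n : ℕ} {s : SpanState Z d} (h : Simulates linOpt vec η n s)
    (ht : (Mach.run η (probeAnswer linOpt vec) n).2.todo = List.finRange d)
    (hs : (Mach.run η (probeAnswer linOpt vec) n).2.start = false)
    (hfuel : U < 2 ^ fuel * |detCols (Mach.run η (probeAnswer linOpt vec) n).1|) :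
    ∃ n' ≤ n + d * fuel, ∃ γ, (LBC.spanLoop linOpt vec 2 η fuel s).val = some γ ∧
      (∀ i, γ i = probeIndex linOpt vec η
        ((Mach.run η (probeAnswer linOpt vec) n').2.ptr i)) ∧
      (Mach.run η (probeAnswer linOpt vec) n').2.todo = [] ∧
      (Mach.run η (probeAnswer linOpt vec) n').2.start = false ∧
      ∀ i, ∃ m < n + d * fuel, ScanFails (probeAnswer linOpt vec) η
        (Mach.run η (probeAnswer linOpt vec) n').1 m i := by
  induction fuel generalizing n s with
  | zero => exact absurd hfuel (not_lt.2 (by simpa using hU n))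
  | succ fuel ih =>
    obtain ⟨n', hn', h1, h2, h3⟩ := h.spanScan ht hs
    rw [List.length_finRange] at hn'
    have e : n + d * (fuel + 1) = n + d + d * fuel := by ring
    rw [LBC.spanLoop, Costed.bind_val, e]
    rcases h3 with ⟨h3, h4, h5⟩ | ⟨h3, h4, h5, h6⟩
    · rw [h3, if_pos rfl]
      obtain ⟨n'', hn'', γ, hγ⟩ := ih h1 h4 h2 (hfuel.trans_le (by
        rw [pow_succ, mul_assoc]; gcongr))
      refine ⟨n'', by omega, γ, hγ.1, hγ.2.1, hγ.2.2.1, hγ.2.2.2.1, fun i => ?_⟩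
      obtain ⟨m, hm, hf⟩ := hγ.2.2.2.2 i
      exact ⟨m, by omega, hf⟩
    · rw [h3]
      refine ⟨n', by omega, _, rfl, fun i => h1.2.2 i (by simp [h2]), h4, h2, fun i => ?_⟩
      obtain ⟨m, hm, hf⟩ := h6 i (List.mem_finRange i)
      rw [List.length_finRange] at hm
      exact ⟨m, by omega, h5 ▸ hf⟩

/-- If all probes are accurate, RobustSpanner stops, every vector of `Ψ` is a combination of the
final columns with coefficients at most `2`, and the columns are close to the answers to the probes
that found the elements returned. -/
theorem robustSpanner_val (hd : 0 < d) (hη : 0 < η) (hη1 : η ≤ 1) (z₀ : Z) {Ψ : Set (Vec d)}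
    (hΨ : Ψ.Nonempty) {fuel : ℕ} (hfuel : d.factorial * 2 ^ d < 2 ^ fuel * (η / 2) ^ d)
    (ha : ∀ n u, ‖(probeAnswer linOpt vec n u).1‖ ≤ 1 ∧ ‖(probeAnswer linOpt vec n u).2‖ ≤ 1)
    (hacc : ∀ n < d + d * fuel, Mach.Accurate η (probeAnswer linOpt vec) Ψ n) :
    ∃ γ, (robustSpanner linOpt vec z₀ 2 η fuel).val = some γ ∧ ∃ st : Mach d,
      st = Mach.run η (probeAnswer linOpt vec) (d + d * fuel) ∧
      (∀ i, γ i = probeIndex linOpt vec η (st.2.ptr i)) ∧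
      (∀ i, (st.2.ptr i).1 < d + d * fuel ∧
        ‖st.1 i - Mach.answer η (probeAnswer linOpt vec) (st.2.ptr i)‖ ≤ η) ∧
      ∀ ψ ∈ Ψ, ∃ β : Fin d → ℝ, (∀ i, |β i| ≤ 2) ∧ ψ = ∑ i, β i • st.1 i := by
  have h0 : Simulates linOpt vec η 0
      ⟨fun i => EuclideanSpace.single i (1 : ℝ), fun _ => z₀, 0⟩ :=
    ⟨rfl, rfl, fun i hi => absurd (List.mem_finRange i) (hi rfl)⟩
  have hne : List.finRange d ≠ [] := by
    rw [← List.length_pos_iff, List.length_finRange]; exact hd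
  obtain ⟨h1, h2, h3⟩ := h0.spanInits hne rfl rfl
  rw [List.length_finRange, zero_add] at h1 h2 h3
  have hU : ∀ m, |detCols (Mach.run η (probeAnswer linOpt vec) m).1| ≤ d.factorial * 2 ^ d := by
    intro m
    exact abs_detCols_le _ fun i => (Mach.norm_run_le hη.le ha m i).trans (by linarith)
  have hdet : ∀ m ≤ d + d * fuel, (Mach.run η (probeAnswer linOpt vec) m).2.start = false →
      (η / 2) ^ d ≤ |detCols (Mach.run η (probeAnswer linOpt vec) m).1| := fun m hm h =>
    (Mach.le_abs_det_run hη.le hΨ fun k hk => hacc k (by omega)).2 h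
  obtain ⟨n', hn', γ, hγ, hz, htodo, hstart, hfail⟩ := h1.spanLoop hU h2 h3
    (hfuel.trans_le (by gcongr; exact hdet d (by omega) h3))
  obtain ⟨m, hm⟩ := Nat.exists_eq_add_of_le hn'
  have hend : Mach.run η (probeAnswer linOpt vec) (d + d * fuel) =
      Mach.run η (probeAnswer linOpt vec) n' := by rw [hm, Mach.run_eq_of_done htodo]
  refine ⟨γ, hγ, _, rfl, ?_, fun i => ?_, fun ψ hψ => ?_⟩
  · rw [hend]; exact hz
  · exact Mach.run_near hη.le _ i (by rw [hend]; simp [hstart])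
  · rw [hend]
    set W := (Mach.run η (probeAnswer linOpt vec) n').1
    have hpos : 0 < |detCols W| := lt_of_lt_of_le (by positivity) (hdet n' hn' hstart)
    -- The coefficients of `ψ` are given by Cramer's rule, and bounded as every index fails both tests.
    refine ⟨fun i => ⟪cofactor W i, ψ⟫ / detCols W, fun i => ?_,
      detCols_smul_eq_sum W (abs_pos.1 hpos) ψ⟩
    rw [abs_div, div_le_iff₀ hpos]
    obtain ⟨k, hk, hq, hf1, hf2⟩ := hfail i
    obtain ⟨ha1, ha2⟩ := hacc k hk ψ hψ
    rw [hq] at ha1 ha2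
    have hθ := norm_nonneg (cofactor W i)
    rw [inner_cofactor_eq] at hf1 hf2 ⊢
    rw [abs_le]
    constructor <;> nlinarith [mul_nonneg hη.le hθ]

end Simulation

end SpannerRun
end LBC
end

noncomputable section
namespace LBC

/-! ### Subroutines that read a fresh block of initial states -/

section Block

variable {S ι : Type*} [MeasurableSpace S] (μ : Measure S) [IsProbabilityMeasure μ]

/-- A block of coordinates of an i.i.d. family is an i.i.d. sequence. -/
lemma measurePreserving_block {b : ℕ → ι} (hb : Function.Injective b) :
    MeasurePreserving (fun (ξ : ι → S) m => ξ (b m)) (Measure.infinitePi fun _ : ι => μ)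
      (Measure.infinitePi fun _ : ℕ => μ) :=
  ⟨by fun_prop, Measure.map_infinitePi_infinitePi_of_inj hb⟩

/-- If, whatever happens outside a block, the values of the block are bad with probability at most
`p`, then the bad event has probability at most `p`. -/
lemma measure_le_of_block {b : ℕ → ι} (hb : Function.Injective b) {E : Set (ι → S)}
    (hE : MeasurableSet E) {p : ENNReal} {bad : (ι → S) → Set (ℕ → S)}
    (hbad : ∀ ω₀, (Measure.infinitePi fun _ : ℕ => μ) (bad ω₀) ≤ p)
    (h : ∀ ω₀ ω, merge (Set.range b) ω₀ ω ∈ E → (fun m => ω (b m)) ∈ bad ω₀) :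
    (Measure.infinitePi fun _ : ι => μ) E ≤ p := by
  refine measure_le_of_resample μ (Set.range b) hE fun ω₀ => (measure_mono (h ω₀)).trans ?_
  have hm := measurePreserving_block μ hb
  refine (Measure.le_map_apply hm.measurable.aemeasurable (bad ω₀)).trans ?_
  rw [hm.map_eq]
  exact hbad ω₀

/-- `f` does not depend on the coordinates in `J`. -/
def IndepOf {β : Type*} (J : Set ι) (f : (ι → S) → β) : Prop := ∀ ω₀ ω, f (merge J ω₀ ω) = f ω₀

end Block

namespace Env

variable {X A Ξ : Type*} [MeasurableSpace X] [MeasurableSpace Ξ] [Fintype A] [Nonempty A] {d : ℕ}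
  {E : Env X A Ξ d} [MeasurableSpace A] [DiscreteMeasurableSpace A] {ι : Type*}

/-- `𝔼^π[φ_h(x_h,a_h)]`. -/
def meanFeat (E : Env X A Ξ d) (π : Policy X A) (h : ℕ) : Vec d := ∫ x, E.feat π x h ∂E.init

/-- The empirical mean of the features met by `π` from the initial states `xs`. -/
def empFeat (E : Env X A Ξ d) (n : ℕ) (xs : ℕ → X) (π : Policy X A) (h : ℕ) : Vec d :=
  (n : ℝ)⁻¹ • ∑ m ∈ Finset.range n, E.feat π (xs m) h

lemma norm_feat_le (hφ : E.UnitFeatures) {h : ℕ} (hh : h < E.H) (π : Policy X A) (x : X) :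
    ‖E.feat π x h‖ ≤ 1 := hφ h hh _ _

lemma norm_empFeat_le (hφ : E.UnitFeatures) {h : ℕ} (hh : h < E.H) (n : ℕ) (xs : ℕ → X)
    (π : Policy X A) : ‖E.empFeat n xs π h‖ ≤ 1 := by
  rw [empFeat, norm_smul, norm_inv, RCLike.norm_natCast]
  refine inv_mul_le_one_of_le₀ ?_ (by positivity)
  refine (norm_sum_le _ _).trans ?_
  simpa using Finset.sum_le_card_nsmul (Finset.range n) _ 1 fun m _ =>
    norm_feat_le hφ hh π (xs m)

lemma measurable_meanFeat (hφm : E.MeasFeatures) {Ω : Type*} [MeasurableSpace Ω]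
    {π : Ω → Policy X A} (hπ : E.MeasPol π) {h : ℕ} (hh : h < E.H) :
    Measurable fun ω => E.meanFeat (π ω) h := by
  have : Measurable fun p : Ω × X => E.feat (π p.1) p.2 h :=
    (hπ.comp measurable_fst).measurable_feat hφm measurable_snd hh
  exact (StronglyMeasurable.integral_prod_right' this.stronglyMeasurable).measurable

lemma measurable_empFeat (hφm : E.MeasFeatures) {Ω : Type*} [MeasurableSpace Ω]
    {π : Ω → Policy X A} (hπ : E.MeasPol π) {h : ℕ} (hh : h < E.H) (n : ℕ) {xs : Ω → ℕ → X}
    (hxs : ∀ m, Measurable fun ω => xs ω m) : Measurable fun ω => E.empFeat n (xs ω) (π ω) h :=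
  (measurable_const_smul (n : ℝ)⁻¹).comp
    (Finset.measurable_fun_sum _ fun m _ => hπ.measurable_feat hφm (hxs m) hh)

lemma MeasurablePolicy.measurable_feat (hφm : E.MeasFeatures) {π : Policy X A}
    (hπ : E.MeasurablePolicy π) {h : ℕ} (hh : h < E.H) : Measurable fun x => E.feat π x h :=
  MeasPol.measurable_feat hφm (hπ.const (Ω := X)) measurable_id hh

lemma MeasurablePolicy.integrable_feat (hφ : E.UnitFeatures) (hφm : E.MeasFeatures)
    {π : Policy X A} (hπ : E.MeasurablePolicy π) {h : ℕ} (hh : h < E.H) :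
    Integrable (fun x => E.feat π x h) E.init :=
  integrable_of_norm_le _ (hπ.measurable_feat hφm hh) fun x => norm_feat_le hφ hh π x

/-- Values are linear in the expected features. -/
lemma meanVal_eq_sum (hφ : E.UnitFeatures) (hφm : E.MeasFeatures) {π : Policy X A}
    (hπ : E.MeasurablePolicy π) (w : ℕ → Vec d) :
    E.meanVal w π = ∑ h ∈ Finset.range E.H, ⟪w h, E.meanFeat π h⟫ := by
  have h1 : ∀ h ∈ Finset.range E.H, Integrable (fun x => ⟪w h, E.feat π x h⟫) E.init :=
    fun h hh => (hπ.integrable_feat hφ hφm (Finset.mem_range.1 hh)).const_inner _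
  have h2 : ∀ x, E.valueOf (E.linRew w) π x =
      ∑ h ∈ Finset.range E.H, ⟪w h, E.feat π x h⟫ := fun x =>
    Finset.sum_congr rfl fun h _ => real_inner_comm _ _
  simp_rw [meanVal, h2]
  rw [integral_finsetSum _ h1]
  refine Finset.sum_congr rfl fun h hh => ?_
  exact integral_inner (hπ.integrable_feat hφ hφm (Finset.mem_range.1 hh)) _

/-- The parameters of the intrinsic rewards: direction `u` at layer `h`. -/
def dirParam (h : ℕ) (u : Vec d) (l : ℕ) : Vec d := if l = h then u else 0

lemma meanVal_dirParam (hφ : E.UnitFeatures) (hφm : E.MeasFeatures) {π : Policy X A}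
    (hπ : E.MeasurablePolicy π) {h : ℕ} (hh : h < E.H) (u : Vec d) :
    E.meanVal (dirParam h u) π = ⟪u, E.meanFeat π h⟫ := by
  rw [meanVal_eq_sum hφ hφm hπ, Finset.sum_eq_single h]
  · simp [dirParam]
  · intro l _ hl; simp [dirParam, hl]
  · intro h'; exact absurd (Finset.mem_range.2 hh) h'

lemma BoundedVal.dirParam (hφ : E.UnitFeatures) {h : ℕ} {u : Vec d} (hu : ‖u‖ ≤ 1) :
    E.BoundedVal (dirParam h u) E.H := by
  refine ⟨1, fun l hl x a => ?_, by simp⟩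
  rw [linRew, Env.dirParam]
  split_ifs
  · exact (abs_real_inner_le_norm _ _).trans (mul_le_one₀ (hφ l hl x a) (norm_nonneg _) hu)
  · simp

lemma measurable_dirParam {Ω : Type*} [MeasurableSpace Ω] (h : ℕ) {u : Ω → Vec d}
    (hu : Measurable u) (l : ℕ) : Measurable fun ω => Env.dirParam h (u ω) l := by
  unfold Env.dirParam
  split_ifs
  · exact hu
  · exact measurable_const

/-- The failure probability of one call of OCP with `T` episodes, for values bounded by `B` and
accuracy `3 α`. -/
def ocpFail (d H : ℕ) (B α : ℝ) (T : ℕ) : ℝ :=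
  Real.exp (H * d - α * T / (4 * B)) + T * (2 * Real.exp (-(T * α ^ 2) / (2 * B ^ 2)))

/-- A call of OCP on a fresh block, with rewards chosen beforehand, is accurate. -/
lemma measure_gap_ocpPol_block_le (hφ : E.UnitFeatures) (hφm : E.MeasFeatures) (hH : 0 < E.H)
    {b : ℕ → ι} (hb : Function.Injective b) {w : (ι → X) → ℕ → Vec d}
    (hw : ∀ l, Measurable fun ξ => w ξ l) {B : (ι → X) → ℝ} (hB : Measurable B)
    (hreal : ∀ ξ, E.Realizable (w ξ) (B ξ)) {Bv : ℝ} (hBv : 0 < Bv)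
    (hbdd : ∀ ξ, E.BoundedVal (w ξ) Bv) (hwi : IndepOf (Set.range b) w)
    (hBi : IndepOf (Set.range b) B) {α : ℝ} (hα : 0 < α) {T : ℕ} (hT : 0 < T) :
    (Measure.infinitePi fun _ : ι => E.init)
      {ξ | 3 * α < E.gap (w ξ) (E.ocpPol (E.linRew (w ξ)) (B ξ) T fun m => ξ (b m)).act} ≤
      ENNReal.ofReal (ocpFail d E.H Bv α T) := by
  have hpol : E.MeasPol fun ξ : ι → X =>
      (E.ocpPol (E.linRew (w ξ)) (B ξ) T fun m => ξ (b m)).act :=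
    measPol_ocpPol hφ hφm hw hB hreal (fun m => by fun_prop) T
  refine measure_le_of_block E.init hb
    (bad := fun ω₀ => {xs | 3 * α < E.gap (w ω₀) (E.ocpPol (E.linRew (w ω₀)) (B ω₀) T xs).act})
    (measurableSet_lt measurable_const (measurable_gap hφm hpol hw))
    (fun ω₀ => measure_gap_ocpPol_le hφ hφm hH (hreal ω₀) (hbdd ω₀) hBv hα hT) ?_
  intro ω₀ ω h
  simp only [Set.mem_ofPred_eq] at h ⊢
  rw [hwi, hBi] at h
  simpa only [merge_of_mem (Set.mem_range_self _)] using h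

/-- The empirical mean of the features over a fresh block, under a policy chosen beforehand, is
accurate. -/
lemma measure_empFeat_block_le (hφ : E.UnitFeatures) (hφm : E.MeasFeatures) {b : ℕ → ι}
    (hb : Function.Injective b) {π : (ι → X) → Policy X A} (hπ : E.MeasPol π)
    (hπi : IndepOf (Set.range b) π) {h : ℕ} (hh : h < E.H) {t : ℝ} (ht : 0 ≤ t) {n : ℕ}
    (hn : 0 < n) :
    (Measure.infinitePi fun _ : ι => E.init)
      {ξ | t ≤ ‖E.empFeat n (fun m => ξ (b m)) (π ξ) h - E.meanFeat (π ξ) h‖} ≤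
      ENNReal.ofReal (Real.exp (d / 2 - n * t ^ 2 / 4)) := by
  refine measure_le_of_block E.init hb
    (bad := fun ω₀ => {xs | t ≤ ‖E.empFeat n xs (π ω₀) h - E.meanFeat (π ω₀) h‖})
    (measurableSet_le measurable_const ((measurable_empFeat hφm hπ hh n
      (fun m => by fun_prop)).sub (measurable_meanFeat hφm hπ hh)).norm) ?_ ?_
  · intro ω₀
    exact measure_norm_mean_sub_integral_ge_le E.init Function.injective_id
      ((hπ.section ω₀).measurable_feat hφm hh) (fun x => norm_feat_le hφ hh _ x) ht hn
  · intro ω₀ ω h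
    simp only [Set.mem_ofPred_eq, Pi.sub_apply] at h ⊢
    rw [hπi] at h
    simpa only [merge_of_mem (Set.mem_range_self _)] using h

end Env
end LBC
end

noncomputable section
namespace LBC

/-- The direction of `u`, or `0`. -/
def unitDir {d : ℕ} (u : Vec d) : Vec d := ‖u‖⁻¹ • u

lemma norm_unitDir_le {d : ℕ} (u : Vec d) : ‖unitDir u‖ ≤ 1 := by
  rw [unitDir, norm_smul, norm_inv, norm_norm]
  exact inv_mul_le_one

lemma unitDir_neg {d : ℕ} (u : Vec d) : unitDir (-u) = -unitDir u := by
  rw [unitDir, norm_neg, smul_neg, unitDir]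

lemma unitDir_unitDir {d : ℕ} (u : Vec d) : unitDir (unitDir u) = unitDir u := by
  by_cases h : ‖u‖ = 0
  · rw [norm_eq_zero] at h; simp [unitDir, h]
  · have : ‖unitDir u‖ = 1 := by
      rw [unitDir, norm_smul, norm_inv, norm_norm, inv_mul_cancel₀ h]
    rw [unitDir, this, inv_one, one_smul]

lemma measurable_unitDir {d : ℕ} : Measurable (unitDir : Vec d → Vec d) :=
  measurable_norm.inv.smul measurable_id

lemma Mach.unitDir_query {d : ℕ} (st : Mach d) : unitDir st.query = st.query := by
  rw [Mach.query]
  split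
  · simp [unitDir]
  · exact unitDir_unitDir _

lemma Mach.norm_query_le {d : ℕ} (st : Mach d) : ‖st.query‖ ≤ 1 := by
  rw [← st.unitDir_query]; exact norm_unitDir_le _

namespace Env

/-! ### The first phase, as a function of the initial states -/

variable {X A Ξ : Type*} [MeasurableSpace X] [MeasurableSpace Ξ] [Fintype A] [Nonempty A] {d : ℕ}

section Defs

variable (E : Env X A Ξ d) (T nv : ℕ) (η : ℝ) (h : ℕ)

/-- The policy that linear optimization in direction `u` at layer `h` finds from the initial
states `xs`. -/
def linPol (xs : ℕ → X) (u : Vec d) : ImplPolicy X A :=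
  E.ocpPol (E.linRew (dirParam h (unitDir u))) E.H T xs

/-- The answers to the `n`-th pair of probes at layer `h`, from the initial states `ξ`. -/
def layerAns (ξ : ℕ × ℕ × ℕ → X) (n : ℕ) (u : Vec d) : Vec d × Vec d :=
  (E.empFeat nv (fun m => ξ (h, 4 * n + 1, m)) (E.linPol T h (fun m => ξ (h, 4 * n, m)) u).act h,
    E.empFeat nv (fun m => ξ (h, 4 * n + 3, m))
      (E.linPol T h (fun m => ξ (h, 4 * n + 2, m)) (-u)).act h)

/-- RobustSpanner at layer `h`. -/
def layerRun (ξ : ℕ × ℕ × ℕ → X) (n : ℕ) : Mach d := Mach.run η (E.layerAns T nv h ξ) n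

/-- The number of the call of linear optimization made by probe `p`. -/
def callNo (p : ℕ × Bool) : ℕ := 4 * p.1 + if p.2 then 0 else 2

/-- The direction of probe `p`. -/
def callDir (ξ : ℕ × ℕ × ℕ → X) (p : ℕ × Bool) : Vec d :=
  if p.2 then (E.layerRun T nv η h ξ p.1).query else -(E.layerRun T nv η h ξ p.1).query

/-- The policy found by probe `p`. -/
def probePol (ξ : ℕ × ℕ × ℕ → X) (p : ℕ × Bool) : ImplPolicy X A :=
  E.linPol T h (fun m => ξ (h, callNo p, m)) (E.callDir T nv η h ξ p)

/-- The policies in the slots of RobustSpanner at layer `h` after `N` pairs of probes. -/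
def slotPol (N : ℕ) (ξ : ℕ × ℕ × ℕ → X) (i : Fin d) : ImplPolicy X A :=
  E.probePol T nv η h ξ ((E.layerRun T nv η h ξ N).2.ptr i)

end Defs

variable {E : Env X A Ξ d} {T nv : ℕ} {η : ℝ} {h : ℕ}

lemma answer_layerAns (ξ : ℕ × ℕ × ℕ → X) (p : ℕ × Bool) :
    Mach.answer η (E.layerAns T nv h ξ) p =
      E.empFeat nv (fun m => ξ (h, callNo p + 1, m)) (E.probePol T nv η h ξ p).act h := by
  rcases p with ⟨n, _ | _⟩ <;> rfl

lemma norm_callDir_le (ξ : ℕ × ℕ × ℕ → X) (p : ℕ × Bool) : ‖E.callDir T nv η h ξ p‖ ≤ 1 := by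
  rw [callDir]
  split_ifs
  · exact Mach.norm_query_le _
  · rw [norm_neg]; exact Mach.norm_query_le _

lemma unitDir_callDir (ξ : ℕ × ℕ × ℕ → X) (p : ℕ × Bool) :
    unitDir (E.callDir T nv η h ξ p) = E.callDir T nv η h ξ p := by
  rw [callDir]
  split_ifs
  · exact Mach.unitDir_query _
  · rw [unitDir_neg, Mach.unitDir_query]

lemma layerRun_congr {n : ℕ} {ξ ξ' : ℕ × ℕ × ℕ → X}
    (hξ : ∀ k < 4 * n, ∀ m, ξ (h, k, m) = ξ' (h, k, m)) :
    E.layerRun T nv η h ξ n = E.layerRun T nv η h ξ' n := by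
  refine Mach.run_congr fun k hk => ?_
  funext u
  simp only [layerAns]
  simp only [hξ (4 * k) (by omega), hξ (4 * k + 1) (by omega), hξ (4 * k + 2) (by omega),
    hξ (4 * k + 3) (by omega)]

lemma callDir_congr {p : ℕ × Bool} {ξ ξ' : ℕ × ℕ × ℕ → X}
    (hξ : ∀ k < 4 * p.1, ∀ m, ξ (h, k, m) = ξ' (h, k, m)) :
    E.callDir T nv η h ξ p = E.callDir T nv η h ξ' p := by
  rw [callDir, callDir, layerRun_congr hξ]

lemma le_callNo (p : ℕ × Bool) : 4 * p.1 ≤ callNo p := by rw [callNo]; omega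

lemma probePol_congr {p : ℕ × Bool} {ξ ξ' : ℕ × ℕ × ℕ → X}
    (hξ : ∀ k ≤ callNo p, ∀ m, ξ (h, k, m) = ξ' (h, k, m)) :
    E.probePol T nv η h ξ p = E.probePol T nv η h ξ' p := by
  rw [probePol, probePol,
    callDir_congr (ξ' := ξ') fun k hk m => hξ k (hk.le.trans (le_callNo p)) m]
  simp only [hξ (callNo p) le_rfl]

variable [MeasurableSpace A] [DiscreteMeasurableSpace A]

lemma slotPol_congr {N : ℕ} {ξ ξ' : ℕ × ℕ × ℕ → X} (hξ : ∀ k m, ξ (h, k, m) = ξ' (h, k, m))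
    (i : Fin d) : E.slotPol T nv η h N ξ i = E.slotPol T nv η h N ξ' i := by
  rw [slotPol, slotPol, layerRun_congr fun k _ m => hξ k m, probePol_congr fun k _ m => hξ k m]

lemma MeasPol.countable {Ω β : Type*} [MeasurableSpace Ω] [MeasurableSpace β] [Countable β]
    [DiscreteMeasurableSpace β] {π : β → Ω → Policy X A} (hπ : ∀ c, E.MeasPol (π c)) {f : Ω → β}
    (hf : Measurable f) : E.MeasPol fun ω => π (f ω) ω := by
  intro l hl
  have : Measurable fun q : (Ω × X) × β => π q.2 q.1.1 l q.1.2 :=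
    measurable_from_prod_countable_left fun c => hπ c l hl
  exact this.comp (measurable_id.prodMk (hf.comp measurable_fst))

section

variable (hφ : E.UnitFeatures) (hφm : E.MeasFeatures) (hL : E.LinearBellmanComplete E.φ)
include hφ hφm hL

omit hφm in
lemma realizable_dirParam (u : Vec d) : E.Realizable (dirParam h (unitDir u)) E.H :=
  (BoundedVal.dirParam hφ (norm_unitDir_le u)).realizable hL hφ

lemma measPol_linPol {Ω : Type*} [MeasurableSpace Ω] {xs : Ω → ℕ → X}
    (hxs : ∀ m, Measurable fun ω => xs ω m) {u : Ω → Vec d} (hu : Measurable u) :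
    E.MeasPol fun ω => (E.linPol T h (xs ω) (u ω)).act :=
  measPol_ocpPol hφ hφm (fun l => measurable_dirParam h (measurable_unitDir.comp hu) l)
    (measurable_const (a := (E.H : ℝ))) (fun ω => realizable_dirParam hφ hL (u ω)) hxs T

lemma measurable_layerRun (hh : h < E.H) (n : ℕ) :
    Measurable fun ξ : ℕ × ℕ × ℕ → X => E.layerRun T nv η h ξ n := by
  refine Mach.measurable_run (N := n) (fun k _ u hu => ?_) le_rfl
  have h1 := measPol_linPol (T := T) (h := h) hφ hφm hL
    (xs := fun (ξ : ℕ × ℕ × ℕ → X) m => ξ (h, 4 * k, m)) (fun m => by fun_prop) hu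
  have h2 := measPol_linPol (T := T) (h := h) hφ hφm hL
    (xs := fun (ξ : ℕ × ℕ × ℕ → X) m => ξ (h, 4 * k + 2, m)) (fun m => by fun_prop) hu.neg
  exact (measurable_empFeat hφm h1 hh nv fun m => by fun_prop).prodMk
    (measurable_empFeat hφm h2 hh nv fun m => by fun_prop)

lemma measurable_callDir (hh : h < E.H) (p : ℕ × Bool) :
    Measurable fun ξ : ℕ × ℕ × ℕ → X => E.callDir T nv η h ξ p := by
  have := Mach.measurable_query.comp
    (measurable_layerRun (T := T) (nv := nv) (η := η) hφ hφm hL hh p.1)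
  unfold callDir
  split_ifs
  · exact this
  · exact this.neg

lemma measPol_probePol (hh : h < E.H) (p : ℕ × Bool) :
    E.MeasPol fun ξ : ℕ × ℕ × ℕ → X => (E.probePol T nv η h ξ p).act :=
  measPol_linPol hφ hφm hL (fun m => by fun_prop) (measurable_callDir hφ hφm hL hh p)

lemma measPol_slotPol (hh : h < E.H) (N : ℕ) (i : Fin d) :
    E.MeasPol fun ξ : ℕ × ℕ × ℕ → X => (E.slotPol T nv η h N ξ i).act := by
  have hc : Measurable fun c : Ctl d => c.ptr i := measurable_from_top
  exact MeasPol.countable (fun p => measPol_probePol hφ hφm hL hh p)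
    (hc.comp (measurable_snd.comp (measurable_layerRun hφ hφm hL hh N)))

variable (E) in
omit hφ hφm hL in
/-- The calls made by probe `p` at layer `h` are accurate: OCP to within `δ₁`, and the estimate of
the expected features to within `δ₂`. -/
def GoodProbe (T nv : ℕ) (η : ℝ) (h : ℕ) (δ₁ δ₂ : ℝ) (ξ : ℕ × ℕ × ℕ → X) (p : ℕ × Bool) : Prop :=
  E.gap (dirParam h (unitDir (E.callDir T nv η h ξ p))) (E.probePol T nv η h ξ p).act ≤ δ₁ ∧
    ‖E.empFeat nv (fun m => ξ (h, callNo p + 1, m)) (E.probePol T nv η h ξ p).act h -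
      E.meanFeat (E.probePol T nv η h ξ p).act h‖ ≤ δ₂

lemma measure_not_goodProbe_le (hH : 0 < E.H) (hh : h < E.H) (p : ℕ × Bool) {α t : ℝ} (hα : 0 < α)
    (ht : 0 ≤ t) (hT : 0 < T) (hnv : 0 < nv) :
    (Measure.infinitePi fun _ : ℕ × ℕ × ℕ => E.init)
      {ξ | ¬ E.GoodProbe T nv η h (3 * α) t ξ p} ≤
      ENNReal.ofReal (ocpFail d E.H E.H α T) +
        ENNReal.ofReal (Real.exp (d / 2 - nv * t ^ 2 / 4)) := by
  have hinj : ∀ k : ℕ, Function.Injective fun m : ℕ => (h, k, m) := fun k m m' e => by simpa using e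
  have hrange : ∀ {k k' m : ℕ}, k' ≠ k → (h, k', m) ∉ Set.range fun m : ℕ => (h, k, m) := by
    rintro k k' m hk ⟨m', e⟩
    simp only [Prod.mk.injEq, true_and] at e
    exact hk e.1.symm
  have hd : IndepOf (Set.range fun m : ℕ => (h, callNo p, m))
      (fun ξ : ℕ × ℕ × ℕ → X => E.callDir T nv η h ξ p) := fun ω₀ ω =>
    callDir_congr fun k hk m => merge_of_notMem (hrange (by have := le_callNo p; omega)) _ _
  have hp : IndepOf (Set.range fun m : ℕ => (h, callNo p + 1, m))
      (fun ξ : ℕ × ℕ × ℕ → X => (E.probePol T nv η h ξ p).act) := fun ω₀ ω => by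
    have := probePol_congr (E := E) (T := T) (nv := nv) (η := η) (h := h) (p := p)
      (ξ := merge (Set.range fun m : ℕ => (h, callNo p + 1, m)) ω₀ ω) (ξ' := ω₀)
      fun k hk m => merge_of_notMem (hrange (by omega)) _ _
    simp only [this]
  have h1 := measure_gap_ocpPol_block_le (ι := ℕ × ℕ × ℕ) hφ hφm hH (hinj (callNo p))
    (w := fun ξ => dirParam h (unitDir (E.callDir T nv η h ξ p)))
    (fun l => measurable_dirParam h (measurable_unitDir.comp (measurable_callDir hφ hφm hL hh p)) l)
    (B := fun _ => (E.H : ℝ)) measurable_const (fun ξ => realizable_dirParam hφ hL _)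
    (Bv := E.H) (by exact_mod_cast hH) (fun ξ => BoundedVal.dirParam hφ (norm_unitDir_le _))
    (fun ω₀ ω => by
      have := hd ω₀ ω
      simp only at this ⊢
      rw [this]) (fun ω₀ ω => rfl) hα hT
  have h2 := measure_empFeat_block_le (ι := ℕ × ℕ × ℕ) hφ hφm (hinj (callNo p + 1))
    (measPol_probePol (T := T) (nv := nv) (η := η) hφ hφm hL hh p) hp hh ht hnv
  refine le_trans (measure_mono ?_) ((measure_union_le _ _).trans (add_le_add h1 h2))
  intro ξ hξ
  simp only [Set.mem_ofPred_eq, GoodProbe, not_and_or, not_le] at hξ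
  rcases hξ with hξ | hξ
  · exact Or.inl hξ
  · exact Or.inr hξ.le

/-- All calls made by the first `N` pairs of probes at every layer are accurate. -/
def GoodPhase (E : Env X A Ξ d) (T nv : ℕ) (η δ₁ δ₂ : ℝ) (N : ℕ) (ξ : ℕ × ℕ × ℕ → X) : Prop :=
  ∀ h < E.H, ∀ n < N, ∀ b, E.GoodProbe T nv η h δ₁ δ₂ ξ (n, b)

lemma measure_not_goodPhase_le (hH : 0 < E.H) {α t : ℝ} (hα : 0 < α) (ht : 0 ≤ t) (hT : 0 < T)
    (hnv : 0 < nv) (N : ℕ) {q : ℝ} (hq1 : ocpFail d E.H E.H α T ≤ q)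
    (hq2 : Real.exp (d / 2 - nv * t ^ 2 / 4) ≤ q) :
    (Measure.infinitePi fun _ : ℕ × ℕ × ℕ => E.init)
      {ξ | ¬ E.GoodPhase T nv η (3 * α) t N ξ} ≤ ENNReal.ofReal (E.H * (N * (2 * (q + q)))) := by
  have hq : 0 ≤ q := (Real.exp_nonneg _).trans hq2
  have hsub : {ξ : ℕ × ℕ × ℕ → X | ¬ E.GoodPhase T nv η (3 * α) t N ξ} ⊆
      ⋃ h ∈ Finset.range E.H, ⋃ n ∈ Finset.range N, ⋃ b ∈ (Finset.univ : Finset Bool),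
        {ξ | ¬ E.GoodProbe T nv η h (3 * α) t ξ (n, b)} := by
    intro ξ hξ
    simp only [Set.mem_ofPred_eq, GoodPhase] at hξ
    push Not at hξ
    obtain ⟨h, hh, n, hn, b, hb⟩ := hξ
    simp only [Set.mem_iUnion, Finset.mem_range]
    exact ⟨h, hh, n, hn, b, Finset.mem_univ b, hb⟩
  have hE : ENNReal.ofReal (E.H * (N * (2 * (q + q)))) =
      ∑ _h ∈ Finset.range E.H, ∑ _n ∈ Finset.range N, ∑ _b ∈ (Finset.univ : Finset Bool),
        (ENNReal.ofReal q + ENNReal.ofReal q) := by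
    simp only [Finset.sum_const, Finset.card_range, nsmul_eq_mul, Finset.card_univ,
      Fintype.card_bool]
    rw [← ENNReal.ofReal_add hq hq, ENNReal.ofReal_mul (by positivity),
      ENNReal.ofReal_mul (by positivity), ENNReal.ofReal_mul (by positivity),
      ENNReal.ofReal_natCast, ENNReal.ofReal_natCast]
    simp
  rw [hE]
  refine (measure_mono hsub).trans ((measure_biUnion_finset_le _ _).trans ?_)
  refine Finset.sum_le_sum fun h hh => (measure_biUnion_finset_le _ _).trans ?_
  refine Finset.sum_le_sum fun n _ => (measure_biUnion_finset_le _ _).trans ?_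
  refine Finset.sum_le_sum fun b _ => ?_
  refine (measure_not_goodProbe_le hφ hφm hL hH (Finset.mem_range.1 hh) (n, b) hα ht hT hnv).trans ?_
  gcongr

/-- The expected features of all measurable policies at layer `h`. -/
def featSet (E : Env X A Ξ d) (h : ℕ) : Set (Vec d) :=
  {ψ | ∃ π, E.MeasurablePolicy π ∧ ψ = E.meanFeat π h}

omit hL in
lemma featSet_nonempty : (E.featSet h).Nonempty :=
  ⟨_, _, measurablePolicy_optPol hφm 0, rfl⟩

lemma GoodProbe.le (hH : 0 < E.H) (hh : h < E.H) {δ₁ δ₂ : ℝ} {ξ : ℕ × ℕ × ℕ → X} {p : ℕ × Bool}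
    (hg : E.GoodProbe T nv η h δ₁ δ₂ ξ p) {ψ : Vec d} (hψ : ψ ∈ E.featSet h) :
    ⟪E.callDir T nv η h ξ p, ψ⟫ ≤
      ⟪E.callDir T nv η h ξ p, Mach.answer η (E.layerAns T nv h ξ) p⟫ + (δ₁ + δ₂) := by
  obtain ⟨π, hπ, rfl⟩ := hψ
  have hz := (measPol_probePol (T := T) (nv := nv) (η := η) hφ hφm hL hh p).section ξ
  rw [answer_layerAns]
  obtain ⟨h1, h2⟩ := hg
  set u := E.callDir T nv η h ξ p with hu
  have hu1 : ‖u‖ ≤ 1 := norm_callDir_le ξ p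
  rw [unitDir_callDir, ← hu] at h1
  have hb : E.BoundedVal (dirParam h u) E.H := BoundedVal.dirParam hφ hu1
  have h3 := meanVal_le_add_gap hφm hH (hb.realizable hL hφ) hb hz hπ
  rw [meanVal_dirParam hφ hφm hπ hh, meanVal_dirParam hφ hφm hz hh] at h3
  set v := E.empFeat nv (fun m => ξ (h, callNo p + 1, m)) (E.probePol T nv η h ξ p).act h
  set v' := E.meanFeat (E.probePol T nv η h ξ p).act h
  have h4 : ⟪u, v' - v⟫ ≤ δ₂ :=
    (real_inner_le_norm _ _).trans <| (mul_le_of_le_one_left (norm_nonneg _) hu1).trans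
      (by rw [norm_sub_rev]; exact h2)
  rw [inner_sub_right] at h4
  linarith

lemma GoodPhase.accurate (hH : 0 < E.H) (hh : h < E.H) {δ₁ δ₂ : ℝ} {ξ : ℕ × ℕ × ℕ → X} {N : ℕ}
    (hg : E.GoodPhase T nv η δ₁ δ₂ N ξ) (hδ : δ₁ + δ₂ ≤ η / 2) {n : ℕ} (hn : n < N) :
    Mach.Accurate η (E.layerAns T nv h ξ) (E.featSet h) n := by
  intro ψ hψ
  have h1 := GoodProbe.le hφ hφm hL hH hh (hg h hh n hn true) hψ
  have h2 := GoodProbe.le hφ hφm hL hH hh (hg h hh n hn false) hψ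
  constructor
  · refine h1.trans ?_
    change _ ≤ ⟪E.callDir T nv η h ξ (n, true), Mach.answer η (E.layerAns T nv h ξ) (n, true)⟫ + _
    gcongr
  · have e : ∀ v, ⟪E.callDir T nv η h ξ (n, false), v⟫ =
        -⟪(Mach.run η (E.layerAns T nv h ξ) n).query, v⟫ := fun v => inner_neg_left _ _
    rw [e, e] at h2
    refine h2.trans ?_
    change _ ≤ -⟪(Mach.run η (E.layerAns T nv h ξ) n).query,
      Mach.answer η (E.layerAns T nv h ξ) (n, false)⟫ + _
    gcongr

omit hφm in
lemma ocp_intrinsic_val (hT : 0 < T) (θ : Vec d) (τ : ℕ → Seed X Ξ) :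
    (E.ocp (E.intrinsic h θ) E.H T τ).val = E.linPol T h (fun m => (τ m).1) θ := by
  rw [intrinsic_eq_linRew]
  obtain ⟨θ', hθ', hb⟩ := realizable_dirParam (h := h) hφ hL θ
  exact ocp_val hθ' hb hT _

omit hφm in
lemma probeAnswer_eq_layerAns (hT : 0 < T) (ω : Tape X Ξ) :
    probeAnswer (fun k θ => E.ocp (E.intrinsic h θ) E.H T fun m => ω (h, k, m))
      (fun k π => E.vecEval h π nv fun m => ω (h, k, m)) = E.layerAns T nv h fun i => (ω i).1 := by
  funext n u
  simp only [probeAnswer, ocp_intrinsic_val hφ hL hT]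
  rfl

omit hφm in
lemma probeIndex_eq_probePol (hT : 0 < T) (ω : Tape X Ξ) (p : ℕ × Bool) :
    probeIndex (fun k θ => E.ocp (E.intrinsic h θ) E.H T fun m => ω (h, k, m))
      (fun k π => E.vecEval h π nv fun m => ω (h, k, m)) η p =
        E.probePol T nv η h (fun i => (ω i).1) p := by
  rw [probeIndex, probeAnswer_eq_layerAns hφ hL hT ω]
  rcases p with ⟨n, _ | _⟩
  · exact ocp_intrinsic_val hφ hL hT _ _
  · exact ocp_intrinsic_val hφ hL hT _ _

/-- On the good event, RobustSpanner returns at layer `h` policies whose expected features almost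
span those of all policies. -/
lemma GoodPhase.robustSpanner (hd : 0 < d) (hH : 0 < E.H) (hT : 0 < T) (hh : h < E.H) {δ₁ δ₂ : ℝ}
    {ω : Tape X Ξ} {fuel : ℕ} (hη : 0 < η) (hη1 : η ≤ 1)
    (hfuel : d.factorial * 2 ^ d < 2 ^ fuel * (η / 2) ^ d)
    (hg : E.GoodPhase T nv η δ₁ δ₂ (d + d * fuel) fun i => (ω i).1) (hδ : δ₁ + δ₂ ≤ η / 2) :
    (robustSpanner (fun k θ => E.ocp (E.intrinsic h θ) E.H T fun m => ω (h, k, m))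
      (fun k π => E.vecEval h π nv fun m => ω (h, k, m)) (somePolicy X A) 2 η fuel).val =
        some (E.slotPol T nv η h (d + d * fuel) fun i => (ω i).1) ∧
    ∀ π, E.MeasurablePolicy π → ∀ Δ : Vec d, |⟪Δ, E.meanFeat π h⟫| ≤ 2 * ∑ i,
      (|⟪Δ, E.meanFeat (E.slotPol T nv η h (d + d * fuel) (fun i => (ω i).1) i).act h⟫| +
        (η + δ₂) * ‖Δ‖) := by
  have hans := probeAnswer_eq_layerAns (h := h) (nv := nv) hφ hL hT ω
  set ξ : ℕ × ℕ × ℕ → X := fun i => (ω i).1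
  obtain ⟨γ, hγ, st, hst, hz, hnear, hspan⟩ := robustSpanner_val
    (linOpt := fun k θ => E.ocp (E.intrinsic h θ) E.H T fun m => ω (h, k, m))
    (vec := fun k π => E.vecEval h π nv fun m => ω (h, k, m)) hd hη hη1 (somePolicy X A)
    (featSet_nonempty hφ hφm (E := E) (h := h)) hfuel (by
      intro n u
      rw [hans]
      exact ⟨norm_empFeat_le hφ hh _ _ _, norm_empFeat_le hφ hh _ _ _⟩) (by
      intro n hn
      rw [hans]
      exact hg.accurate hφ hφm hL hH hh hδ hn)
  have hslot : γ = E.slotPol T nv η h (d + d * fuel) ξ := by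
    funext i
    rw [hz, hst, probeIndex_eq_probePol hφ hL hT ω, hans]
    rfl
  refine ⟨by rw [hγ, hslot], fun π hπ Δ => ?_⟩
  obtain ⟨β, hβ, hsum⟩ := hspan _ ⟨π, hπ, rfl⟩
  rw [hsum, inner_sum, Finset.mul_sum]
  refine (Finset.abs_sum_le_sum_abs _ _).trans (Finset.sum_le_sum fun i _ => ?_)
  rw [inner_smul_right, abs_mul]
  obtain ⟨h1, h2⟩ := hnear i
  rw [hans, answer_layerAns] at h2
  have h3 := (hg h hh _ h1 (st.2.ptr i).2).2
  have h4 : E.probePol T nv η h ξ (st.2.ptr i) = E.slotPol T nv η h (d + d * fuel) ξ i := by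
    rw [slotPol, hst, hans]; rfl
  simp only [Prod.mk.eta] at h3
  rw [h4] at h2 h3
  set φ' := E.meanFeat (E.slotPol T nv η h (d + d * fuel) ξ i).act h
  have h5 : ‖st.1 i - φ'‖ ≤ η + δ₂ := by
    refine (norm_sub_le_norm_sub_add_norm_sub _ _ _).trans (add_le_add h2 h3)
  have h6 : ⟪Δ, st.1 i⟫ = ⟪Δ, φ'⟫ + ⟪Δ, st.1 i - φ'⟫ := by rw [inner_sub_right]; ring
  have h7 : |⟪Δ, st.1 i⟫| ≤ |⟪Δ, φ'⟫| + (η + δ₂) * ‖Δ‖ := by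
    rw [h6]
    refine (abs_add_le _ _).trans (add_le_add le_rfl ?_)
    refine (abs_real_inner_le_norm _ _).trans ?_
    rw [mul_comm]
    gcongr
  exact mul_le_mul (hβ i) h7 (abs_nonneg _) (by norm_num)

end

end Env
end LBC
end

noncomputable section
namespace LBC

/-! ### Ridge regression -/

section Ridge

open Matrix

variable {d : ℕ} {κ : Type*}

lemma inner_eq_dotProduct (x y : Vec d) : ⟪x, y⟫ = x.ofLp ⬝ᵥ y.ofLp := by
  rw [EuclideanSpace.inner_eq_star_dotProduct, star_trivial, dotProduct_comm]

/-- `I + ∑ v v^⊤`. -/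
def designMatrix (s : Finset κ) (v : κ → Vec d) : Matrix (Fin d) (Fin d) ℝ :=
  1 + ∑ k ∈ s, vecMulVec (v k).ofLp (v k).ofLp

lemma designMatrix_mulVec (s : Finset κ) (v : κ → Vec d) (x : Vec d) :
    designMatrix s v *ᵥ x.ofLp = (x + ∑ k ∈ s, ⟪v k, x⟫ • v k).ofLp := by
  simp only [designMatrix, add_mulVec, one_mulVec, sum_mulVec, vecMulVec_mulVec,
    WithLp.ofLp_add, WithLp.ofLp_sum, WithLp.ofLp_smul, inner_eq_dotProduct, op_smul_eq_smul]

lemma dotProduct_designMatrix_mulVec (s : Finset κ) (v : κ → Vec d) (x y : Vec d) :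
    x.ofLp ⬝ᵥ designMatrix s v *ᵥ y.ofLp = ⟪x, y⟫ + ∑ k ∈ s, ⟪x, v k⟫ * ⟪v k, y⟫ := by
  rw [designMatrix_mulVec, ← inner_eq_dotProduct, inner_add_right, inner_sum]
  simp only [inner_smul_right, mul_comm]

lemma designMatrix_posDef (s : Finset κ) (v : κ → Vec d) : (designMatrix s v).PosDef := by
  refine .of_dotProduct_mulVec_pos ?_ fun x hx => ?_
  · rw [designMatrix]
    refine isHermitian_one.add ?_
    rw [IsHermitian, conjTranspose_sum]
    refine Finset.sum_congr rfl fun k _ => ?_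
    ext i j
    simp [vecMulVec_apply, mul_comm]
  · have h := dotProduct_designMatrix_mulVec s v (WithLp.toLp 2 x) (WithLp.toLp 2 x)
    simp only [star_trivial] at h ⊢
    rw [h, real_inner_self_eq_norm_sq]
    have h0 : 0 < ‖(WithLp.toLp 2 x : Vec d)‖ := by
      rw [norm_pos_iff]
      intro h
      exact hx (by simpa using congrArg WithLp.ofLp h)
    have h1 : 0 ≤ ∑ k ∈ s, ⟪(WithLp.toLp 2 x : Vec d), v k⟫ * ⟪v k, WithLp.toLp 2 x⟫ :=
      Finset.sum_nonneg fun k _ => by rw [real_inner_comm]; exact mul_self_nonneg _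
    positivity

lemma designMatrix_mul_inv_mulVec (s : Finset κ) (v : κ → Vec d) (x : Fin d → ℝ) :
    designMatrix s v *ᵥ ((designMatrix s v)⁻¹ *ᵥ x) = x := by
  rw [mulVec_mulVec, mul_nonsing_inv _ ((isUnit_iff_isUnit_det _).1 (designMatrix_posDef s v).isUnit),
    one_mulVec]

/-- A whitening matrix `G` (with `Gᵀ G = M⁻¹`) for `M = I + ∑ v v^⊤`: the squares of `⟪x, G v⟫` add
up to at most `‖x‖ ^ 2`, and the `M`-norm of a solution of `M Δ = s - w` is at most
`‖G s‖ + ‖w‖`. -/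
lemma exists_whitening (s : Finset κ) (v : κ → Vec d) : ∃ G : Matrix (Fin d) (Fin d) ℝ,
    (∀ x : Vec d, ∑ k ∈ s, ⟪WithLp.toLp 2 (Gᵀ *ᵥ x.ofLp), v k⟫ ^ 2 ≤ ‖x‖ ^ 2) ∧
    ∀ y w Δ : Vec d, designMatrix s v *ᵥ Δ.ofLp = (y - w).ofLp →
      ‖Δ‖ ^ 2 + ∑ k ∈ s, ⟪Δ, v k⟫ ^ 2 ≤
        (‖(WithLp.toLp 2 (G *ᵥ y.ofLp) : Vec d)‖ + ‖w‖) ^ 2 := by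
  -- Factor `M = Rᵀ R` and take `G` to be the inverse of `Rᵀ`.
  obtain ⟨R, hR⟩ : ∃ R : Matrix (Fin d) (Fin d) ℝ, designMatrix s v = Rᵀ * R := by
    have h := (designMatrix_posDef s v).posSemidef
    open scoped MatrixOrder in
    exact CStarAlgebra.nonneg_iff_eq_star_mul_self.1 h.nonneg
  have hdet : IsUnit R.det := by
    have h := (isUnit_iff_isUnit_det _).1 (designMatrix_posDef s v).isUnit
    rw [hR, det_mul, det_transpose] at h
    exact isUnit_of_mul_isUnit_left h
  have hq : ∀ x : Vec d, ‖x‖ ^ 2 + ∑ k ∈ s, ⟪x, v k⟫ ^ 2 =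
      ‖(WithLp.toLp 2 (R *ᵥ x.ofLp) : Vec d)‖ ^ 2 := by
    intro x
    have h := dotProduct_designMatrix_mulVec s v x x
    rw [hR, ← mulVec_mulVec, dotProduct_mulVec, vecMul_transpose] at h
    rw [← real_inner_self_eq_norm_sq, ← real_inner_self_eq_norm_sq (WithLp.toLp 2 (R *ᵥ x.ofLp)),
      inner_eq_dotProduct (WithLp.toLp 2 (R *ᵥ x.ofLp)), h]
    congr 1
    exact Finset.sum_congr rfl fun k _ => by rw [sq, real_inner_comm x]
  refine ⟨Rᵀ⁻¹, fun x => ?_, fun y w Δ h => ?_⟩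
  · rw [transpose_nonsing_inv, transpose_transpose]
    have h := hq (WithLp.toLp 2 (R⁻¹ *ᵥ x.ofLp))
    simp only [mulVec_mulVec, mul_nonsing_inv _ hdet, one_mulVec, WithLp.toLp_ofLp] at h
    rw [← h]
    exact le_add_of_nonneg_left (by positivity)
  · rw [hq]
    set r := (WithLp.toLp 2 (R *ᵥ Δ.ofLp) : Vec d) with hr
    set g := (WithLp.toLp 2 (Rᵀ⁻¹ *ᵥ y.ofLp) : Vec d) with hg
    have h1 : ‖r‖ ^ 2 = ⟪r, g⟫ - ⟪Δ, w⟫ := by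
      have e1 : ⟪r, g⟫ = ⟪Δ, y⟫ := by
        rw [inner_eq_dotProduct, inner_eq_dotProduct, hr, hg]
        simp only
        rw [← vecMul_transpose, ← dotProduct_mulVec, mulVec_mulVec, mul_nonsing_inv, one_mulVec]
        rwa [det_transpose]
      rw [e1, ← inner_sub_right, inner_eq_dotProduct, ← h, hR, ← mulVec_mulVec, dotProduct_mulVec,
        vecMul_transpose, ← real_inner_self_eq_norm_sq, inner_eq_dotProduct]
    have h2 : ‖Δ‖ ≤ ‖r‖ := by
      refine abs_le_of_sq_le_sq' ?_ (norm_nonneg _) |>.2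
      rw [← hq]
      exact le_add_of_nonneg_right (Finset.sum_nonneg fun _ _ => sq_nonneg _)
    have h3 := real_inner_le_norm r g
    have h4 := (abs_le.1 (abs_real_inner_le_norm Δ w)).1
    have h5 : ‖r‖ ≤ ‖g‖ + ‖w‖ := by
      rcases (norm_nonneg r).eq_or_lt with h0 | h0
      · rw [← h0]; positivity
      · have : ‖r‖ * ‖r‖ ≤ ‖r‖ * (‖g‖ + ‖w‖) := by
          nlinarith [mul_le_mul_of_nonneg_right h2 (norm_nonneg w)]
        exact le_of_mul_le_mul_left this h0
    gcongr

/-- The error of ridge regression with bounded independent noise. -/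
lemma measure_ridge_error_le {ι S : Type*} [MeasurableSpace S] (μ : Measure S)
    [IsProbabilityMeasure μ] (s : Finset κ) {e : κ → ι} (he : Function.Injective e)
    (v : κ → Vec d) (f : κ → S → ℝ) (hf : ∀ k, Measurable (f k))
    (hf01 : ∀ k x, f k x ∈ Set.Icc (0 : ℝ) 1) {w : Vec d}
    (hmean : ∀ k, ∫ x, f k x ∂μ = ⟪w, v k⟫) {Δ : (ι → S) → Vec d}
    (hΔ : ∀ ω, designMatrix s v *ᵥ (Δ ω + w).ofLp = (∑ k ∈ s, f k (ω (e k)) • v k : Vec d).ofLp)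
    (t : ℝ) :
    (Measure.infinitePi fun _ : ι => μ)
      {ω | (√t + ‖w‖) ^ 2 < ‖Δ ω‖ ^ 2 + ∑ k ∈ s, ⟪Δ ω, v k⟫ ^ 2} ≤
      ENNReal.ofReal (Real.exp (d / 2 - t / 4)) := by
  obtain ⟨G, hG1, hG2⟩ := exists_whitening s v
  set P := Measure.infinitePi fun _ : ι => μ
  set y : (ι → S) → Vec d := fun ω => ∑ k ∈ s, (f k (ω (e k)) - ⟪w, v k⟫) • v k with hy
  have hym : Measurable y := by
    refine Finset.measurable_fun_sum _ fun k _ => Measurable.smul_const ?_ _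
    exact ((hf k).comp (measurable_pi_apply _)).sub_const _
  have heq : ∀ ω, designMatrix s v *ᵥ (Δ ω).ofLp = (y ω - w).ofLp := by
    intro ω
    have h1 := hΔ ω
    rw [WithLp.ofLp_add, mulVec_add, designMatrix_mulVec s v w, ← eq_sub_iff_add_eq] at h1
    rw [h1, ← WithLp.ofLp_sub]
    congr 1
    simp only [hy, sub_smul, Finset.sum_sub_distrib, real_inner_comm w]
    abel
  -- The whitened noise `G y` has sub-Gaussian marginals.
  have hmain := measure_sum_sq_ge_le P (fun ω => G *ᵥ (y ω).ofLp) (by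
      refine measurable_pi_iff.2 fun i => ?_
      simp only [mulVec, dotProduct]
      fun_prop) (by
      intro x
      set c : κ → ℝ := fun k => ⟪WithLp.toLp 2 (Gᵀ *ᵥ x), v k⟫ with hc
      have hsub := hasSubgaussianMGF_sum_of_mem_Icc μ s he (fun k z => c k * f k z)
        (fun k => (hf k).const_mul _) (fun k => min 0 (c k)) (fun k => max 0 (c k)) (by
          intro k z
          obtain ⟨h0, h1⟩ := hf01 k z
          rcases le_total 0 (c k) with h | h
          · rw [min_eq_left h, max_eq_right h]
            exact ⟨by positivity, mul_le_of_le_one_right h h1⟩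
          · rw [min_eq_right h, max_eq_left h]
            exact ⟨by nlinarith, mul_nonpos_of_nonpos_of_nonneg h h0⟩)
      have hle := HasSubgaussianMGF.lintegral_exp_le hsub
      have hV : ((∑ k ∈ s, (‖max 0 (c k) - min 0 (c k)‖₊ / 2) ^ 2 : NNReal) : ℝ) ≤
          ∑ i, x i ^ 2 := by
        have h1 := hG1 (WithLp.toLp 2 x)
        rw [EuclideanSpace.norm_sq_eq] at h1
        simp only [Real.norm_eq_abs, sq_abs] at h1
        refine le_trans ?_ h1
        push_cast
        refine Finset.sum_le_sum fun k _ => ?_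
        rw [max_sub_min_eq_abs, Real.norm_eq_abs, abs_abs, sub_zero, div_pow, sq_abs]
        change c k ^ 2 / 2 ^ 2 ≤ c k ^ 2
        nlinarith [sq_nonneg (c k)]
      refine le_trans (le_of_eq (lintegral_congr fun ω => ?_)) (hle.trans ?_)
      · congr 2
        have h1 : ∑ i, x i * (G *ᵥ (y ω).ofLp) i = ⟪WithLp.toLp 2 (Gᵀ *ᵥ x), y ω⟫ := by
          rw [inner_eq_dotProduct, mulVec_transpose, ← dotProduct_mulVec]
          rfl
        rw [h1, hy, inner_sum]
        refine Finset.sum_congr rfl fun k _ => ?_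
        rw [inner_smul_right, integral_const_mul, hmean]
        ring
      · gcongr) t
  refine le_trans (measure_mono fun ω hω => ?_) hmain
  simp only [Set.mem_ofPred_eq] at hω ⊢
  by_contra hlt
  rw [not_le] at hlt
  have h1 := hG2 (y ω) w (Δ ω) (heq ω)
  have h2 : ‖(WithLp.toLp 2 (G *ᵥ (y ω).ofLp) : Vec d)‖ ≤ √t := by
    refine Real.le_sqrt_of_sq_le ?_
    rw [EuclideanSpace.norm_sq_eq]
    simpa using hlt.le
  have h3 : (‖(WithLp.toLp 2 (G *ᵥ (y ω).ofLp) : Vec d)‖ + ‖w‖) ^ 2 ≤ (√t + ‖w‖) ^ 2 := by gcongr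
  linarith

lemma measurable_inv_mulVec {Ω : Type*} [MeasurableSpace Ω] {M : Ω → Matrix (Fin d) (Fin d) ℝ}
    (hM : ∀ i j, Measurable fun ω => M ω i j) {y : Ω → Vec d} (hy : Measurable y) :
    Measurable fun ω => (WithLp.toLp 2 ((M ω)⁻¹ *ᵥ (y ω).ofLp) : Vec d) := by
  have hadj : ∀ i j, Measurable fun ω => (M ω).adjugate i j := by
    intro i j
    have hc : Continuous fun B : Fin d → Fin d → ℝ => (Matrix.of B).adjugate i j :=
      (Continuous.matrix_adjugate (continuous_matrix fun k l => by
        simp only [of_apply]; fun_prop)).matrix_elem i j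
    exact hc.measurable.comp (measurable_pi_iff.2 fun k => measurable_pi_iff.2 fun l => hM k l)
  have hdet : Measurable fun ω => (M ω).det := by
    have hc : Continuous fun B : Fin d → Fin d → ℝ => (Matrix.of B).det :=
      Continuous.matrix_det (continuous_matrix fun k l => by
        simp only [of_apply]; fun_prop)
    exact hc.measurable.comp (measurable_pi_iff.2 fun k => measurable_pi_iff.2 fun l => hM k l)
  refine (WithLp.measurable_toLp 2 _).comp (measurable_pi_iff.2 fun i => ?_)
  simp only [mulVec, dotProduct, inv_def, Ring.inverse_eq_inv', Matrix.smul_apply, smul_eq_mul]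
  refine Finset.measurable_fun_sum _ fun j _ => ?_
  exact (hdet.inv.mul (hadj i j)).mul (by fun_prop)

end Ridge

end LBC
end

noncomputable section
namespace LBC

/-! ### The second phase -/

/-- The numerical parameters of the procedure: numbers of episodes for OCP (`T`) and for vector
estimation (`nv`), distance parameter (`η`) and number of pairs of probes (`N`) in the first phase;
numbers of episodes per policy for regression (`n`) and for OCP (`T₂`) in the second phase. -/
structure Plan where
  T : ℕ
  nv : ℕ
  η : ℝ
  N : ℕ
  n : ℕ
  T₂ : ℕ

namespace Env

variable {X A Ξ : Type*} [MeasurableSpace X] [MeasurableSpace Ξ] [Fintype A] [Nonempty A] {d : ℕ}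

section Defs

variable (E : Env X A Ξ d) (P : Plan)

/-- The policies that the first phase returns for layer `l`. -/
def basePol (l : ℕ) (ξ : ℕ × ℕ × ℕ → X) (j : Fin d) : ImplPolicy X A :=
  E.slotPol P.T P.nv P.η l P.N ξ j

/-- The features in the regression data of layer `l`. -/
def dataFeat (l : ℕ) (ξ : ℕ × ℕ × ℕ → X) (k : Fin d × ℕ) : Vec d :=
  E.feat (E.basePol P l ξ k.1).act (ξ (E.H + l, k.1, k.2)) l

/-- The ridge estimate of the reward parameters from the initial states `ξ` and the noise `ζ`. -/
def rewardEst (ξ : ℕ × ℕ × ℕ → X) (ζ : ℕ × ℕ × ℕ → ℕ → Ξ) (l : ℕ) : Vec d :=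
  if l < E.H then (E.ridge (fun i => (ξ i, ζ i)) (E.basePol P l ξ) P.n 1 l).val else 0

/-- The bound on `Q`-functions in the final call of OCP. -/
def finalBound (ξ : ℕ × ℕ × ℕ → X) (ζ : ℕ × ℕ × ℕ → ℕ → Ξ) : ℝ :=
  E.H * ⨆ l : Fin E.H, ‖E.rewardEst P ξ ζ l‖

/-- The output of the procedure. -/
def finalPol (ξ : ℕ × ℕ × ℕ → X) (ζ : ℕ × ℕ × ℕ → ℕ → Ξ) : ImplPolicy X A :=
  E.ocpPol (E.linRew (E.rewardEst P ξ ζ)) (E.finalBound P ξ ζ) P.T₂ fun m => ξ (2 * E.H, 0, m)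

/-- The estimates of the reward parameters are accurate in the norm given by the data. -/
def GoodNoise (w : ℕ → Vec d) (β : ℝ) (l : ℕ) (ξ : ℕ × ℕ × ℕ → X) (ζ : ℕ × ℕ × ℕ → ℕ → Ξ) : Prop :=
  ‖E.rewardEst P ξ ζ l - w l‖ ^ 2 + ∑ k ∈ Finset.univ ×ˢ Finset.range P.n,
    ⟪E.rewardEst P ξ ζ l - w l, E.dataFeat P l ξ k⟫ ^ 2 ≤ β ^ 2

/-- The empirical means of the features in the data are accurate. -/
def GoodDesign (τ : ℝ) (l : ℕ) (j : Fin d) (ξ : ℕ × ℕ × ℕ → X) : Prop :=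
  ‖E.empFeat P.n (fun m => ξ (E.H + l, j, m)) (E.basePol P l ξ j).act l -
    E.meanFeat (E.basePol P l ξ j).act l‖ ≤ τ

/-- The final call of OCP is accurate. -/
def GoodFinal (α : ℝ) (ξ : ℕ × ℕ × ℕ → X) (ζ : ℕ × ℕ × ℕ → ℕ → Ξ) : Prop :=
  E.gap (E.rewardEst P ξ ζ) (E.finalPol P ξ ζ).act ≤ 3 * α

end Defs

variable {E : Env X A Ξ d} {P : Plan}

lemma gram_eq (l : ℕ) (ξ : ℕ × ℕ × ℕ → X) (ζ : ℕ × ℕ × ℕ → ℕ → Ξ) :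
    E.gram (fun i => (ξ i, ζ i)) (E.basePol P l ξ) P.n 1 l =
      designMatrix (Finset.univ ×ˢ Finset.range P.n) (E.dataFeat P l ξ) := by
  rw [gram, designMatrix, one_smul, Finset.sum_product]
  rfl

/-- The reward in the `k`-th regression sample of layer `l`, as a function of its noise. -/
def dataReward (E : Env X A Ξ d) (P : Plan) (l : ℕ) (ξ : ℕ × ℕ × ℕ → X) (k : Fin d × ℕ)
    (z : ℕ → Ξ) : ℝ :=
  E.reward l (E.state (E.basePol P l ξ k.1).act (ξ (E.H + l, k.1, k.2)) l)
    (E.action (E.basePol P l ξ k.1).act (ξ (E.H + l, k.1, k.2)) l) (z l)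

lemma moment_eq (l : ℕ) (ξ : ℕ × ℕ × ℕ → X) (ζ : ℕ × ℕ × ℕ → ℕ → Ξ) :
    E.moment (fun i => (ξ i, ζ i)) (E.basePol P l ξ) P.n l =
      ∑ k ∈ Finset.univ ×ˢ Finset.range P.n,
        E.dataReward P l ξ k (ζ (E.H + l, k.1, k.2)) • E.dataFeat P l ξ k := by
  rw [moment, Finset.sum_product]
  rfl

/-- The normal equations. -/
lemma designMatrix_mulVec_rewardEst {l : ℕ} (hl : l < E.H) (ξ : ℕ × ℕ × ℕ → X)
    (ζ : ℕ × ℕ × ℕ → ℕ → Ξ) :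
    (designMatrix (Finset.univ ×ˢ Finset.range P.n) (E.dataFeat P l ξ)).mulVec
      (E.rewardEst P ξ ζ l).ofLp =
      (∑ k ∈ Finset.univ ×ˢ Finset.range P.n,
        E.dataReward P l ξ k (ζ (E.H + l, k.1, k.2)) • E.dataFeat P l ξ k : Vec d).ofLp := by
  rw [rewardEst, if_pos hl]
  change Matrix.mulVec _ (Matrix.mulVec (E.gram (fun i => (ξ i, ζ i)) (E.basePol P l ξ) P.n 1 l)⁻¹
    (E.moment (fun i => (ξ i, ζ i)) (E.basePol P l ξ) P.n l).ofLp) = _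
  rw [gram_eq, moment_eq, designMatrix_mul_inv_mulVec]

lemma dataReward_mem {l : ℕ} (hl : l < E.H) (ξ : ℕ × ℕ × ℕ → X) (k : Fin d × ℕ) (z : ℕ → Ξ) :
    E.dataReward P l ξ k z ∈ Set.Icc (0 : ℝ) 1 := E.reward_mem l hl _ _ _

variable [MeasurableSpace A] [DiscreteMeasurableSpace A]

lemma norm_rewardEst_le (hφ : E.UnitFeatures) (ξ : ℕ × ℕ × ℕ → X) (ζ : ℕ × ℕ × ℕ → ℕ → Ξ) (l : ℕ) :
    ‖E.rewardEst P ξ ζ l‖ ≤ d * P.n := by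
  by_cases hl : l < E.H
  swap
  · rw [rewardEst, if_neg hl, norm_zero]; positivity
  set s := (Finset.univ : Finset (Fin d)) ×ˢ Finset.range P.n with hs
  set y : Vec d := ∑ k ∈ s,
    E.dataReward P l ξ k (ζ (E.H + l, k.1, k.2)) • E.dataFeat P l ξ k with hy
  set u := E.rewardEst P ξ ζ l with hu
  have h1 := designMatrix_mulVec_rewardEst (P := P) hl ξ ζ
  have h2 := dotProduct_designMatrix_mulVec s (E.dataFeat P l ξ) u u
  rw [h1, ← inner_eq_dotProduct, ← hy] at h2
  have h3 : ‖u‖ ^ 2 ≤ ‖u‖ * ‖y‖ := by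
    refine le_trans ?_ (real_inner_le_norm u y)
    rw [h2, real_inner_self_eq_norm_sq]
    refine le_add_of_nonneg_right (Finset.sum_nonneg fun k _ => ?_)
    rw [real_inner_comm]; exact mul_self_nonneg _
  have h4 : ‖y‖ ≤ d * P.n := by
    refine (norm_sum_le _ _).trans ?_
    have h : ∀ k ∈ s, ‖E.dataReward P l ξ k (ζ (E.H + l, k.1, k.2)) • E.dataFeat P l ξ k‖ ≤ 1 := by
      intro k _
      obtain ⟨h0, h1⟩ := dataReward_mem (P := P) hl ξ k (ζ (E.H + l, k.1, k.2))
      rw [norm_smul, Real.norm_of_nonneg h0]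
      exact mul_le_one₀ h1 (norm_nonneg _) (norm_feat_le hφ hl _ _)
    simpa [hs] using Finset.sum_le_card_nsmul s _ 1 h
  refine le_trans ?_ h4
  rcases (norm_nonneg u).eq_or_lt with h0 | h0
  · rw [← h0]; positivity
  · rw [sq] at h3
    exact le_of_mul_le_mul_left h3 h0

lemma boundedVal_finalBound (hφ : E.UnitFeatures) (ξ : ℕ × ℕ × ℕ → X) (ζ : ℕ × ℕ × ℕ → ℕ → Ξ) :
    E.BoundedVal (E.rewardEst P ξ ζ) (E.finalBound P ξ ζ) := by
  refine ⟨⨆ l : Fin E.H, ‖E.rewardEst P ξ ζ l‖, fun l hl x a => ?_, le_rfl⟩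
  rw [linRew, real_inner_comm]
  refine (abs_inner_le_norm hφ hl _ x a).trans ?_
  exact le_ciSup (f := fun l : Fin E.H => ‖E.rewardEst P ξ ζ l‖) (Set.finite_range _).bddAbove
    ⟨l, hl⟩

lemma boundedVal_rewardEst (hφ : E.UnitFeatures) (ξ : ℕ × ℕ × ℕ → X) (ζ : ℕ × ℕ × ℕ → ℕ → Ξ) :
    E.BoundedVal (E.rewardEst P ξ ζ) (E.H * (d * P.n)) := by
  refine ⟨d * P.n, fun l hl x a => ?_, le_rfl⟩
  rw [linRew, real_inner_comm]
  exact (abs_inner_le_norm hφ hl _ x a).trans (norm_rewardEst_le hφ ξ ζ l)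

section

variable (hφ : E.UnitFeatures) (hφm : E.MeasFeatures) (hL : E.LinearBellmanComplete E.φ)
include hφ hφm hL

lemma measPol_basePol {l : ℕ} (hl : l < E.H) (j : Fin d) :
    E.MeasPol fun ξ : ℕ × ℕ × ℕ → X => (E.basePol P l ξ j).act :=
  measPol_slotPol hφ hφm hL hl P.N j

lemma measurable_dataFeat {l : ℕ} (hl : l < E.H) (k : Fin d × ℕ) :
    Measurable fun ξ : ℕ × ℕ × ℕ → X => E.dataFeat P l ξ k :=
  (measPol_basePol hφ hφm hL hl k.1).measurable_feat hφm (by fun_prop) hl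

lemma measurable_dataReward {l : ℕ} (hl : l < E.H) (k : Fin d × ℕ) {Ω : Type*} [MeasurableSpace Ω]
    {ξ : Ω → ℕ × ℕ × ℕ → X} (hξ : Measurable ξ) {z : Ω → ℕ → Ξ} (hz : Measurable z) :
    Measurable fun ω => E.dataReward P l (ξ ω) k (z ω) := by
  have hx : Measurable fun ω => ξ ω (E.H + l, (k.1 : ℕ), k.2) := (measurable_pi_apply _).comp hξ
  have hπ := (measPol_basePol (P := P) hφ hφm hL hl k.1).comp hξ
  have hs := hπ.measurable_state hx hl.le
  have ha := hπ.measurable_action hx hl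
  have h : ∀ a : A, Measurable fun q : X × Ξ => E.reward l q.1 a q.2 := E.measurable_reward l hl
  exact measurable_apply_action (f := fun (q : X × Ξ) a => E.reward l q.1 a q.2) h
    (hs.prodMk ((measurable_pi_apply l).comp hz)) ha

section

variable {Ω : Type*} [MeasurableSpace Ω] {ξ : Ω → ℕ × ℕ × ℕ → X} (hξ : Measurable ξ)
  {ζ : Ω → ℕ × ℕ × ℕ → ℕ → Ξ} (hζ : Measurable ζ)
include hξ hζ

lemma measurable_rewardEst (l : ℕ) : Measurable fun ω => E.rewardEst P (ξ ω) (ζ ω) l := by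
  by_cases hl : l < E.H
  swap
  · simp only [rewardEst, if_neg hl]; exact measurable_const
  have hf : ∀ k, Measurable fun ω => E.dataFeat P l (ξ ω) k :=
    fun k => (measurable_dataFeat hφ hφm hL hl k).comp hξ
  have e : (fun ω => E.rewardEst P (ξ ω) (ζ ω) l) =
      fun ω => WithLp.toLp 2 (Matrix.mulVec
        (designMatrix (Finset.univ ×ˢ Finset.range P.n) (E.dataFeat P l (ξ ω)))⁻¹
        (∑ k ∈ Finset.univ ×ˢ Finset.range P.n,
          E.dataReward P l (ξ ω) k (ζ ω (E.H + l, k.1, k.2)) •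
            E.dataFeat P l (ξ ω) k : Vec d).ofLp) := by
    funext ω
    rw [rewardEst, if_pos hl, ← gram_eq l (ξ ω) (ζ ω), ← moment_eq]
    rfl
  rw [e]
  refine measurable_inv_mulVec (fun i j => ?_) ?_
  · simp only [designMatrix, Matrix.add_apply, Matrix.sum_apply, Matrix.vecMulVec_apply]
    refine measurable_const.add (Finset.measurable_fun_sum _ fun k _ => ?_)
    have hi : ∀ i, Measurable fun ω => E.dataFeat P l (ξ ω) k i := fun i =>
      (by fun_prop : Measurable fun v : Vec d => v i).comp (hf k)
    exact (hi i).mul (hi j)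
  · refine Finset.measurable_fun_sum _ fun k _ => ?_
    have h := measurable_dataReward (P := P) hφ hφm hL hl k hξ
      (z := fun ω => ζ ω (E.H + l, (k.1 : ℕ), k.2)) ((measurable_pi_apply _).comp hζ)
    exact h.smul (hf k)

lemma measurable_finalBound : Measurable fun ω => E.finalBound P (ξ ω) (ζ ω) :=
  (Measurable.iSup fun l : Fin E.H =>
    (measurable_rewardEst hφ hφm hL hξ hζ (l : ℕ)).norm).const_mul _

lemma measPol_finalPol : E.MeasPol fun ω => (E.finalPol P (ξ ω) (ζ ω)).act :=
  measPol_ocpPol hφ hφm (w := fun ω => E.rewardEst P (ξ ω) (ζ ω))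
    (measurable_rewardEst hφ hφm hL hξ hζ) (measurable_finalBound hφ hφm hL hξ hζ)
    (fun ω => (boundedVal_finalBound hφ (ξ ω) (ζ ω)).realizable hL hφ)
    (xs := fun ω m => ξ ω (2 * E.H, 0, m)) (fun _ => (measurable_pi_apply _).comp hξ) P.T₂

lemma measurableSet_goodNoise {w : ℕ → Vec d} {β : ℝ} {l : ℕ} (hl : l < E.H) :
    MeasurableSet {ω | E.GoodNoise P w β l (ξ ω) (ζ ω)} := by
  have h1 := (measurable_rewardEst (P := P) hφ hφm hL hξ hζ l).sub_const (w l)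
  refine measurableSet_le ((h1.norm.pow_const 2).add (Finset.measurable_fun_sum _ fun k _ => ?_))
    measurable_const
  exact (h1.inner ((measurable_dataFeat hφ hφm hL hl k).comp hξ)).pow_const 2

lemma measurableSet_goodFinal {α : ℝ} : MeasurableSet {ω | E.GoodFinal P α (ξ ω) (ζ ω)} :=
  measurableSet_le (measurable_gap hφm (measPol_finalPol hφ hφm hL hξ hζ)
    (measurable_rewardEst hφ hφm hL hξ hζ)) measurable_const

end

/-- For fixed initial states, ridge regression succeeds with high probability over the noise. -/
lemma measure_not_goodNoise_le {w : ℕ → Vec d} {l : ℕ} (hl : l < E.H)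
    (hw : ∀ x a, E.meanReward l x a = ⟪w l, E.φ l x a⟫) (hwn : ‖w l‖ ≤ √d) (t : ℝ)
    (ξ : ℕ × ℕ × ℕ → X) :
    (Measure.infinitePi fun _ : ℕ × ℕ × ℕ => Measure.infinitePi fun _ : ℕ => E.noise)
      {ζ | ¬ E.GoodNoise P w (√t + √d) l ξ ζ} ≤ ENNReal.ofReal (Real.exp (d / 2 - t / 4)) := by
  have he : Function.Injective fun k : Fin d × ℕ => (E.H + l, (k.1 : ℕ), k.2) := by
    rintro ⟨i, m⟩ ⟨i', m'⟩ h
    simp only [Prod.mk.injEq, true_and] at h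
    exact Prod.ext (Fin.ext h.1) h.2
  have hm : ∀ k, Measurable (E.dataReward P l ξ k) := fun k => by
    have h := E.measurable_reward l hl
      (E.action (E.basePol P l ξ k.1).act (ξ (E.H + l, k.1, k.2)) l)
    exact h.comp (measurable_const.prodMk (measurable_pi_apply l))
  have hmean : ∀ k, ∫ z, E.dataReward P l ξ k z ∂(Measure.infinitePi fun _ : ℕ => E.noise) =
      ⟪w l, E.dataFeat P l ξ k⟫ := by
    intro k
    set x := E.state (E.basePol P l ξ k.1).act (ξ (E.H + l, k.1, k.2)) l with hx
    set a := E.action (E.basePol P l ξ k.1).act (ξ (E.H + l, k.1, k.2)) l with ha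
    have h := measurePreserving_eval_infinitePi (fun _ : ℕ => E.noise) l
    have hr : Measurable fun z : Ξ => E.reward l x a z :=
      (E.measurable_reward l hl a).comp (measurable_const.prodMk measurable_id)
    have h2 : ∫ z, E.reward l x a z ∂((Measure.infinitePi fun _ : ℕ => E.noise).map
        (Function.eval l)) = ∫ z : ℕ → Ξ, E.reward l x a (z l) ∂(Measure.infinitePi fun _ : ℕ => E.noise) :=
      integral_map h.measurable.aemeasurable hr.aestronglyMeasurable
    rw [h.map_eq] at h2
    exact h2.symm.trans (hw x a)
  have hΔ : ∀ ζ : ℕ × ℕ × ℕ → ℕ → Ξ,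
      (designMatrix (Finset.univ ×ˢ Finset.range P.n) (E.dataFeat P l ξ)).mulVec
        (E.rewardEst P ξ ζ l - w l + w l).ofLp =
      (∑ k ∈ Finset.univ ×ˢ Finset.range P.n,
        E.dataReward P l ξ k (ζ (E.H + l, k.1, k.2)) • E.dataFeat P l ξ k : Vec d).ofLp := by
    intro ζ
    rw [sub_add_cancel]
    exact designMatrix_mulVec_rewardEst hl ξ ζ
  have h := measure_ridge_error_le (Measure.infinitePi fun _ : ℕ => E.noise)
    (Finset.univ ×ˢ Finset.range P.n) he (E.dataFeat P l ξ) (E.dataReward P l ξ) hm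
    (dataReward_mem hl ξ) hmean hΔ t
  refine le_trans (measure_mono ?_) h
  intro ζ hζ
  simp only [Set.mem_ofPred_eq, GoodNoise, not_le] at hζ ⊢
  refine lt_of_le_of_lt ?_ hζ
  gcongr

lemma basePol_indepOf {l : ℕ} {b : ℕ → ℕ × ℕ × ℕ} (hb : ∀ m, (b m).1 ≠ l) :
    IndepOf (Set.range b) fun ξ : ℕ × ℕ × ℕ → X => E.basePol P l ξ := fun ω₀ ω => by
  funext j
  refine slotPol_congr (fun k m => merge_of_notMem ?_ _ _) j
  rintro ⟨m', h⟩
  exact hb m' (by rw [h])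

lemma measure_not_goodDesign_le {l : ℕ} (hl : l < E.H) (j : Fin d) {τ : ℝ} (hτ : 0 ≤ τ)
    (hn : 0 < P.n) :
    (Measure.infinitePi fun _ : ℕ × ℕ × ℕ => E.init) {ξ | ¬ E.GoodDesign P τ l j ξ} ≤
      ENNReal.ofReal (Real.exp (d / 2 - P.n * τ ^ 2 / 4)) := by
  refine le_trans (measure_mono fun ξ hξ => ?_) (measure_empFeat_block_le (ι := ℕ × ℕ × ℕ) hφ hφm
    (b := fun m => (E.H + l, (j : ℕ), m)) (fun m m' h => by simpa using h)
    (measPol_basePol (P := P) hφ hφm hL hl j) (fun ω₀ ω => ?_) hl hτ hn)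
  · simp only [Set.mem_ofPred_eq, GoodDesign, not_le] at hξ ⊢
    exact hξ.le
  · have := basePol_indepOf (E := E) (P := P) hφ hφm hL (l := l)
      (b := fun m => (E.H + l, (j : ℕ), m)) (fun m => by simp; omega) ω₀ ω
    simp only at this ⊢
    rw [this]

lemma rewardEst_indepOf (ζ : ℕ × ℕ × ℕ → ℕ → Ξ) :
    IndepOf (Set.range fun m : ℕ => (2 * E.H, 0, m))
      fun ξ : ℕ × ℕ × ℕ → X => E.rewardEst P ξ ζ := by
  intro ω₀ ω
  funext l
  simp only [rewardEst]
  split_ifs with hl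
  · have h1 := basePol_indepOf (E := E) (P := P) hφ hφm hL (l := l)
      (b := fun m : ℕ => (2 * E.H, 0, m)) (fun m => by simp; omega) ω₀ ω
    have h2 : ∀ j m : ℕ, merge (Set.range fun m : ℕ => (2 * E.H, 0, m)) ω₀ ω (E.H + l, j, m) =
        ω₀ (E.H + l, j, m) := by
      intro j m
      refine merge_of_notMem ?_ _ _
      rintro ⟨m', h⟩
      simp only [Prod.mk.injEq] at h
      omega
    simp only at h1
    simp only [ridge, gram, moment, Costed.tick_val, Costed.draw_val, Costed.ret_val, h1, h2]
  · rfl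

/-- For fixed noise, the final call of OCP succeeds with high probability over the initial
states. -/
lemma measure_not_goodFinal_le (hH : 0 < E.H) (hd : 0 < d) (hn : 0 < P.n) {α : ℝ} (hα : 0 < α)
    (hT : 0 < P.T₂) (ζ : ℕ × ℕ × ℕ → ℕ → Ξ) :
    (Measure.infinitePi fun _ : ℕ × ℕ × ℕ => E.init) {ξ | ¬ E.GoodFinal P α ξ ζ} ≤
      ENNReal.ofReal (ocpFail d E.H (E.H * (d * P.n)) α P.T₂) := by
  have hw := rewardEst_indepOf (E := E) (P := P) hφ hφm hL ζ
  have hB : IndepOf (Set.range fun m : ℕ => (2 * E.H, 0, m))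
      fun ξ : ℕ × ℕ × ℕ → X => E.finalBound P ξ ζ := by
    intro ω₀ ω
    have := hw ω₀ ω
    simp only [finalBound] at this ⊢
    rw [this]
  have hinj : Function.Injective fun m : ℕ => (2 * E.H, 0, m) := fun m m' h => by simpa using h
  have hwm := measurable_rewardEst (P := P) hφ hφm hL (Ω := ℕ × ℕ × ℕ → X) measurable_id
    (measurable_const (a := ζ))
  have hBm := measurable_finalBound (P := P) hφ hφm hL (Ω := ℕ × ℕ × ℕ → X) measurable_id
    (measurable_const (a := ζ))
  have h := measure_gap_ocpPol_block_le hφ hφm hH hinj hwm hBm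
    (fun ξ => (boundedVal_finalBound hφ ξ ζ).realizable hL hφ) (Bv := E.H * (d * P.n))
    (by positivity) (fun ξ => boundedVal_rewardEst hφ ξ ζ) hw hB hα hT
  refine le_trans (measure_mono ?_) h
  intro ξ hξ
  exact not_le.1 hξ

end

end Env
end LBC
end

noncomputable section
namespace LBC
namespace Env

variable {X A Ξ : Type*} [MeasurableSpace X] [MeasurableSpace Ξ] [Fintype A] [Nonempty A] {d : ℕ}
  {E : Env X A Ξ d} {P : Plan}

/-! ### From good events to near-optimality -/

/-- The mean rewards are `⟨φ_h, w_h⟩` with `‖w_h‖ ≤ √d`. -/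
def RewardParam (E : Env X A Ξ d) (w : ℕ → Vec d) : Prop :=
  ∀ h < E.H, ‖w h‖ ≤ √d ∧ ∀ x a, E.meanReward h x a = ⟪w h, E.φ h x a⟫

lemma exists_rewardParam (h : E.BoundedLinear E.φ) : ∃ w, E.RewardParam w := by
  choose! w hw using h.2.2
  exact ⟨w, hw⟩

lemma RewardParam.value_eq {w : ℕ → Vec d} (hw : E.RewardParam w) (π : Policy X A) (x : X) :
    E.value π x = E.valueOf (E.linRew w) π x := by
  rw [DetMDP.value, DetMDP.valueOf, DetMDP.valueOf]
  refine Finset.sum_congr rfl fun h hh => ?_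
  rw [(hw h (Finset.mem_range.1 hh)).2, linRew, real_inner_comm]

lemma RewardParam.boundedVal (hφ : E.UnitFeatures) {w : ℕ → Vec d} (hw : E.RewardParam w) :
    E.BoundedVal w (E.H * √d) := by
  refine ⟨√d, fun h hh x a => ?_, le_rfl⟩
  rw [linRew, real_inner_comm]
  exact (abs_inner_le_norm hφ hh _ x a).trans (hw h hh).1

lemma RewardParam.optValue_eq (hφ : E.UnitFeatures) (hL : E.LinearBellmanComplete E.φ)
    (hH : 0 < E.H) {w : ℕ → Vec d} (hw : E.RewardParam w) (x : X) :
    E.optValue x = E.bestVal w x := by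
  have hr := (hw.boundedVal hφ).realizable hL hφ
  have hle : ∀ π, E.value π x ≤ E.bestVal w x := fun π => by
    rw [hw.value_eq]; exact valueOf_le_bestVal hr hH π x
  obtain ⟨θ, hθ⟩ := bestVal_eq_valueOf hr hH
  let _ : Nonempty (Policy X A) := ⟨E.optPol θ⟩
  refine le_antisymm (ciSup_le hle) ?_
  rw [hθ, ← hw.value_eq]
  exact le_ciSup (f := fun π => E.value π x) ⟨_, Set.forall_mem_range.2 hle⟩ _

variable [MeasurableSpace A] [DiscreteMeasurableSpace A]

lemma GoodNoise.norm_le {w : ℕ → Vec d} {β : ℝ} (hβ : 0 ≤ β) {l : ℕ} {ξ : ℕ × ℕ × ℕ → X}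
    {ζ : ℕ × ℕ × ℕ → ℕ → Ξ} (h : E.GoodNoise P w β l ξ ζ) :
    ‖E.rewardEst P ξ ζ l - w l‖ ≤ β := by
  refine abs_le_of_sq_le_sq' ?_ hβ |>.2
  exact (le_add_of_nonneg_right (Finset.sum_nonneg fun _ _ => sq_nonneg _)).trans h

/-- The error of the estimate is small on the empirical mean of the features of each base policy. -/
lemma GoodNoise.abs_inner_empFeat_le {w : ℕ → Vec d} {β : ℝ} (hβ : 0 ≤ β) {l : ℕ}
    {ξ : ℕ × ℕ × ℕ → X} {ζ : ℕ × ℕ × ℕ → ℕ → Ξ} (h : E.GoodNoise P w β l ξ ζ) (hn : 0 < P.n)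
    (j : Fin d) :
    |⟪E.rewardEst P ξ ζ l - w l,
      E.empFeat P.n (fun m => ξ (E.H + l, j, m)) (E.basePol P l ξ j).act l⟫| ≤ β / √P.n := by
  set Δ := E.rewardEst P ξ ζ l - w l with hΔ
  have hn' : (0 : ℝ) < P.n := by exact_mod_cast hn
  have h1 : ∑ m ∈ Finset.range P.n, ⟪Δ, E.dataFeat P l ξ (j, m)⟫ ^ 2 ≤ β ^ 2 := by
    refine le_trans ?_ h
    rw [Finset.sum_product, ← hΔ]
    refine le_trans ?_ (le_add_of_nonneg_left (by positivity))
    exact Finset.single_le_sum (f := fun j => ∑ m ∈ Finset.range P.n,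
      ⟪Δ, E.dataFeat P l ξ (j, m)⟫ ^ 2) (fun _ _ => Finset.sum_nonneg fun _ _ => sq_nonneg _)
      (Finset.mem_univ j)
  have h2 := sq_sum_le_card_mul_sum_sq (s := Finset.range P.n)
    (f := fun m => ⟪Δ, E.dataFeat P l ξ (j, m)⟫)
  rw [Finset.card_range] at h2
  have h3 : ⟪Δ, E.empFeat P.n (fun m => ξ (E.H + l, j, m)) (E.basePol P l ξ j).act l⟫ =
      (P.n : ℝ)⁻¹ * ∑ m ∈ Finset.range P.n, ⟪Δ, E.dataFeat P l ξ (j, m)⟫ := by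
    rw [empFeat, inner_smul_right, inner_sum]; rfl
  rw [h3]
  refine abs_le_of_sq_le_sq ?_ (by positivity)
  rw [mul_pow, div_pow, Real.sq_sqrt hn'.le]
  calc ((P.n : ℝ)⁻¹) ^ 2 * (∑ m ∈ Finset.range P.n, ⟪Δ, E.dataFeat P l ξ (j, m)⟫) ^ 2
      ≤ ((P.n : ℝ)⁻¹) ^ 2 * (P.n * β ^ 2) := by
        gcongr
        exact h2.trans (by gcongr)
    _ = β ^ 2 / P.n := by field_simp

section

variable (hφ : E.UnitFeatures) (hφm : E.MeasFeatures) (hL : E.LinearBellmanComplete E.φ)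
  (hH : 0 < E.H)
include hφ hφm hL hH

/-- On the good events the values under the true and the estimated rewards are close, for all
policies at once. -/
lemma abs_meanVal_sub_le {w : ℕ → Vec d} {ξ : ℕ × ℕ × ℕ → X} {ζ : ℕ × ℕ × ℕ → ℕ → Ξ}
    {β τ e : ℝ} (hβ : 0 ≤ β) (he : 0 ≤ e) (hn : 0 < P.n)
    (hspan : ∀ l < E.H, ∀ π, E.MeasurablePolicy π → ∀ Δ : Vec d, |⟪Δ, E.meanFeat π l⟫| ≤
      2 * ∑ j, (|⟪Δ, E.meanFeat (E.basePol P l ξ j).act l⟫| + e * ‖Δ‖))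
    (hnoise : ∀ l < E.H, E.GoodNoise P w β l ξ ζ)
    (hdesign : ∀ l < E.H, ∀ j, E.GoodDesign P τ l j ξ) {π : Policy X A}
    (hπ : E.MeasurablePolicy π) :
    |E.meanVal (E.rewardEst P ξ ζ) π - E.meanVal w π| ≤
      E.H * (2 * (d * (β / √P.n + τ * β + e * β))) := by
  rw [meanVal_eq_sum hφ hφm hπ, meanVal_eq_sum hφ hφm hπ, ← Finset.sum_sub_distrib]
  refine (Finset.abs_sum_le_sum_abs _ _).trans ?_
  have key : ∀ l ∈ Finset.range E.H,
      |⟪E.rewardEst P ξ ζ l, E.meanFeat π l⟫ - ⟪w l, E.meanFeat π l⟫| ≤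
        2 * (d * (β / √P.n + τ * β + e * β)) := by
    intro l hl
    have hl := Finset.mem_range.1 hl
    rw [← inner_sub_left]
    refine (hspan l hl π hπ _).trans ?_
    set Δ := E.rewardEst P ξ ζ l - w l with hΔ
    have hΔβ : ‖Δ‖ ≤ β := (hnoise l hl).norm_le hβ
    gcongr
    have hj : ∀ j ∈ (Finset.univ : Finset (Fin d)),
        |⟪Δ, E.meanFeat (E.basePol P l ξ j).act l⟫| + e * ‖Δ‖ ≤
          β / √P.n + τ * β + e * β := by
      intro j _
      have h1 := (hnoise l hl).abs_inner_empFeat_le hβ hn j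
      rw [← hΔ] at h1
      have h2 := hdesign l hl j
      rw [GoodDesign] at h2
      set v := E.empFeat P.n (fun m => ξ (E.H + l, (j : ℕ), m)) (E.basePol P l ξ j).act l
      set v' := E.meanFeat (E.basePol P l ξ j).act l
      have h3 : ⟪Δ, v'⟫ = ⟪Δ, v⟫ - ⟪Δ, v - v'⟫ := by rw [inner_sub_right]; ring
      have h4 : |⟪Δ, v - v'⟫| ≤ τ * β := by
        refine (abs_real_inner_le_norm _ _).trans ?_
        rw [mul_comm]
        exact mul_le_mul h2 hΔβ (norm_nonneg _) ((norm_nonneg _).trans h2)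
      have h5 : e * ‖Δ‖ ≤ e * β := by gcongr
      rw [h3]
      have h6 := abs_sub (⟪Δ, v⟫ : ℝ) ⟪Δ, v - v'⟫
      linarith
    exact (Finset.sum_le_card_nsmul Finset.univ _ _ hj).trans_eq
      (by rw [Finset.card_univ, Fintype.card_fin, nsmul_eq_mul])
  simpa using Finset.sum_le_card_nsmul (Finset.range E.H) _ _ key

/-- The final call of OCP is nearly optimal for the estimated rewards, hence, their values being
close to the true ones for all policies, also for the true rewards. -/
lemma isEpsOptimal_finalPol {w : ℕ → Vec d} (hw : E.RewardParam w) {ξ : ℕ × ℕ × ℕ → X}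
    {ζ : ℕ × ℕ × ℕ → ℕ → Ξ} {D α ε : ℝ}
    (hclose : ∀ π, E.MeasurablePolicy π →
      |E.meanVal (E.rewardEst P ξ ζ) π - E.meanVal w π| ≤ D)
    (hfinal : E.GoodFinal P α ξ ζ) (hε : 3 * α + 2 * D ≤ ε) :
    E.IsEpsOptimal ε (E.finalPol P ξ ζ).act := by
  have hb := hw.boundedVal hφ
  have hr := hb.realizable hL hφ
  have hbe := boundedVal_finalBound (P := P) hφ ξ ζ
  have hre := hbe.realizable hL hφ
  have hπ : E.MeasurablePolicy (E.finalPol P ξ ζ).act :=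
    (measPol_finalPol (P := P) hφ hφm hL (Ω := Unit) (measurable_const (a := ξ))
      (measurable_const (a := ζ))).section ()
  have hopt : E.optValue = E.bestVal w := funext fun x => hw.optValue_eq hφ hL hH x
  have hval : E.value (E.finalPol P ξ ζ).act =
      fun x => E.valueOf (E.linRew w) (E.finalPol P ξ ζ).act x := funext fun x => hw.value_eq _ x
  rw [DetMDP.IsEpsOptimal, hopt, hval]
  refine ⟨integrable_bestVal hφm hH hr hb, hπ.integrable_valueOf hφm hb, ?_⟩
  obtain ⟨θ, hθ⟩ := bestVal_eq_valueOf hr hH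
  have hπ' := measurablePolicy_optPol (E := E) hφm θ
  have h0 : ∫ x, (E.bestVal w x - E.valueOf (E.linRew w) (E.finalPol P ξ ζ).act x) ∂E.init =
      E.meanVal w (E.optPol θ) - E.meanVal w (E.finalPol P ξ ζ).act := by
    rw [integral_sub (integrable_bestVal hφm hH hr hb) (hπ.integrable_valueOf hφm hb)]
    simp_rw [hθ]
    rfl
  rw [h0]
  have h1 := abs_le.1 (hclose _ hπ)
  have h2 := abs_le.1 (hclose _ hπ')
  have h3 := meanVal_le_add_gap hφm hH hre hbe hπ hπ'
  rw [GoodFinal] at hfinal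
  linarith [h1.2, h2.1]

/-- The probability that one of the good events fails. -/
lemma measure_not_good_le (hd : 0 < d) {w : ℕ → Vec d} (hw : E.RewardParam w) {δ₁ δ₂ α t τ : ℝ}
    (hα : 0 < α) (hτ : 0 ≤ τ) (hn : 0 < P.n) (hT : 0 < P.T₂) {p₁ p₂ p₃ : ℝ} (hp₁ : 0 ≤ p₁)
    (h₁ : (Measure.infinitePi fun _ : ℕ × ℕ × ℕ => E.init)
      {ξ | ¬ E.GoodPhase P.T P.nv P.η δ₁ δ₂ P.N ξ} ≤ ENNReal.ofReal p₁)
    (h₂ : Real.exp (d / 2 - t / 4) ≤ p₂) (h₂' : Real.exp (d / 2 - P.n * τ ^ 2 / 4) ≤ p₂)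
    (h₃ : ocpFail d E.H (E.H * (d * P.n)) α P.T₂ ≤ p₃) :
    E.tapeLaw {ω | ¬ (E.GoodPhase P.T P.nv P.η δ₁ δ₂ P.N (fun i => (ω i).1) ∧
      (∀ l < E.H, E.GoodNoise P w (√t + √d) l (fun i => (ω i).1) (fun i => (ω i).2)) ∧
      (∀ l < E.H, ∀ j, E.GoodDesign P τ l j (fun i => (ω i).1)) ∧
      E.GoodFinal P α (fun i => (ω i).1) (fun i => (ω i).2))} ≤
      ENNReal.ofReal (p₁ + E.H * ((1 + d) * p₂) + p₃) := by
  set P₁ := Measure.infinitePi fun _ : ℕ × ℕ × ℕ => E.init with hP₁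
  set P₂ := Measure.infinitePi fun _ : ℕ × ℕ × ℕ => Measure.infinitePi fun _ : ℕ => E.noise with hP₂
  have hp₂ : 0 ≤ p₂ := (Real.exp_nonneg _).trans h₂
  have hp₃ : 0 ≤ p₃ := by
    refine le_trans ?_ h₃
    rw [ocpFail]; positivity
  have hzip := measurePreserving_zip (ι := ℕ × ℕ × ℕ) E.init (Measure.infinitePi fun _ : ℕ => E.noise)
  have hfst : MeasurePreserving (fun (ω : Tape X Ξ) i => (ω i).1) E.tapeLaw P₁ := by
    refine ⟨by fun_prop, ?_⟩
    rw [DetMDP.tapeLaw, ← hzip.map_eq, Measure.map_map (by fun_prop) hzip.measurable]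
    exact measurePreserving_fst.map_eq
  have hprod : MeasurePreserving (fun ω : Tape X Ξ => ((fun i => (ω i).1), fun i => (ω i).2))
      E.tapeLaw (P₁.prod P₂) := by
    refine ⟨by fun_prop, ?_⟩
    rw [DetMDP.tapeLaw, ← hzip.map_eq, Measure.map_map (by fun_prop) hzip.measurable]
    exact Measure.map_id
  have hone : ∀ S : Set (ℕ × ℕ × ℕ → X), E.tapeLaw {ω | (fun i => (ω i).1) ∈ S} ≤ P₁ S := by
    intro S
    refine (Measure.le_map_apply hfst.measurable.aemeasurable S).trans ?_
    rw [hfst.map_eq]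
  have htwo : ∀ S : Set ((ℕ × ℕ × ℕ → X) × (ℕ × ℕ × ℕ → ℕ → Ξ)),
      E.tapeLaw {ω | ((fun i => (ω i).1), fun i => (ω i).2) ∈ S} ≤ P₁.prod P₂ S := by
    intro S
    refine (Measure.le_map_apply hprod.measurable.aemeasurable S).trans ?_
    rw [hprod.map_eq]
  have e1 : E.tapeLaw {ω | ¬ E.GoodPhase P.T P.nv P.η δ₁ δ₂ P.N fun i => (ω i).1} ≤
      ENNReal.ofReal p₁ := (hone {ξ | ¬ E.GoodPhase P.T P.nv P.η δ₁ δ₂ P.N ξ}).trans h₁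
  have e2 : ∀ l < E.H, E.tapeLaw {ω | ¬ E.GoodNoise P w (√t + √d) l (fun i => (ω i).1)
      (fun i => (ω i).2)} ≤ ENNReal.ofReal p₂ := by
    intro l hl
    have hm := (measurableSet_goodNoise (P := P) (w := w) (β := √t + √d) hφ hφm hL
      (measurable_fst : Measurable fun q : (ℕ × ℕ × ℕ → X) × (ℕ × ℕ × ℕ → ℕ → Ξ) => q.1)
      measurable_snd hl).compl
    refine (htwo {q | ¬ E.GoodNoise P w (√t + √d) l q.1 q.2}).trans ?_
    have hE : P₁.prod P₂ {q | ¬ E.GoodNoise P w (√t + √d) l q.1 q.2} =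
        ∫⁻ ξ, P₂ {ζ | ¬ E.GoodNoise P w (√t + √d) l ξ ζ} ∂P₁ := Measure.prod_apply hm
    rw [hE]
    refine (lintegral_mono fun ξ => (measure_not_goodNoise_le hφ hφm hL hl (hw l hl).2
      (hw l hl).1 t ξ).trans (ENNReal.ofReal_le_ofReal h₂)).trans ?_
    simp
  have e3 : ∀ l < E.H, ∀ j, E.tapeLaw {ω | ¬ E.GoodDesign P τ l j fun i => (ω i).1} ≤
      ENNReal.ofReal p₂ := fun l hl j =>
    (hone {ξ | ¬ E.GoodDesign P τ l j ξ}).trans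
      ((measure_not_goodDesign_le hφ hφm hL hl j hτ hn).trans (ENNReal.ofReal_le_ofReal h₂'))
  have e4 : E.tapeLaw {ω | ¬ E.GoodFinal P α (fun i => (ω i).1) (fun i => (ω i).2)} ≤
      ENNReal.ofReal p₃ := by
    have hm := (measurableSet_goodFinal (P := P) (α := α) hφ hφm hL
      (measurable_fst : Measurable fun q : (ℕ × ℕ × ℕ → X) × (ℕ × ℕ × ℕ → ℕ → Ξ) => q.1)
      measurable_snd).compl
    refine (htwo {q | ¬ E.GoodFinal P α q.1 q.2}).trans ?_
    have hE : P₁.prod P₂ {q | ¬ E.GoodFinal P α q.1 q.2} =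
        ∫⁻ ζ, P₁ {ξ | ¬ E.GoodFinal P α ξ ζ} ∂P₂ := Measure.prod_apply_symm hm
    rw [hE]
    refine (lintegral_mono fun ζ => (measure_not_goodFinal_le hφ hφm hL hH hd hn hα hT ζ).trans
      (ENNReal.ofReal_le_ofReal h₃)).trans ?_
    simp
  have hsub : {ω : Tape X Ξ | ¬ (E.GoodPhase P.T P.nv P.η δ₁ δ₂ P.N (fun i => (ω i).1) ∧
      (∀ l < E.H, E.GoodNoise P w (√t + √d) l (fun i => (ω i).1) (fun i => (ω i).2)) ∧
      (∀ l < E.H, ∀ j, E.GoodDesign P τ l j (fun i => (ω i).1)) ∧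
      E.GoodFinal P α (fun i => (ω i).1) (fun i => (ω i).2))} ⊆
      ({ω | ¬ E.GoodPhase P.T P.nv P.η δ₁ δ₂ P.N fun i => (ω i).1} ∪
      ⋃ l ∈ Finset.range E.H, ({ω | ¬ E.GoodNoise P w (√t + √d) l (fun i => (ω i).1)
        (fun i => (ω i).2)} ∪
        ⋃ j ∈ (Finset.univ : Finset (Fin d)), {ω | ¬ E.GoodDesign P τ l j fun i => (ω i).1})) ∪
      {ω | ¬ E.GoodFinal P α (fun i => (ω i).1) (fun i => (ω i).2)} := by
    intro ω hω
    by_contra hcon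
    simp only [Set.mem_union, Set.mem_iUnion, Finset.mem_range, Set.mem_ofPred_eq, not_or,
      not_exists, not_not, Finset.mem_univ, exists_prop, true_and, not_and] at hcon
    exact hω ⟨hcon.1.1, fun l hl => (hcon.1.2 l hl).1, fun l hl j => (hcon.1.2 l hl).2 j, hcon.2⟩
  have hR : ENNReal.ofReal (p₁ + E.H * ((1 + d) * p₂) + p₃) = ENNReal.ofReal p₁ +
      ∑ _l ∈ Finset.range E.H, (ENNReal.ofReal p₂ +
        ∑ _j ∈ (Finset.univ : Finset (Fin d)), ENNReal.ofReal p₂) + ENNReal.ofReal p₃ := by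
    simp only [Finset.sum_const, Finset.card_range, nsmul_eq_mul, Finset.card_univ, Fintype.card_fin]
    rw [ENNReal.ofReal_add (by positivity) hp₃, ENNReal.ofReal_add hp₁ (by positivity),
      ENNReal.ofReal_mul (by positivity), ENNReal.ofReal_mul (by positivity),
      ENNReal.ofReal_add (by positivity) (by positivity)]
    simp [add_mul]
  rw [hR]
  refine (measure_mono hsub).trans ((measure_union_le _ _).trans (add_le_add
    ((measure_union_le _ _).trans (add_le_add e1 ?_)) e4))
  refine (measure_biUnion_finset_le _ _).trans (Finset.sum_le_sum fun l hl => ?_)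
  have hl := Finset.mem_range.1 hl
  refine (measure_union_le _ _).trans (add_le_add (e2 l hl) ?_)
  exact (measure_biUnion_finset_le _ _).trans (Finset.sum_le_sum fun j _ => e3 l hl j)

end

end Env
end LBC
end

noncomputable section
namespace LBC

/-! ### Numerical estimates -/

/-- A number of episodes that suffices for OCP, where `x` is the bound on values divided by the
accuracy and `Λ` the logarithm of the inverse failure probability. -/
def ocpNeed (d H : ℕ) (x Λ : ℝ) : ℝ := 4 * x * (H * d + Λ + 1) + 4 * x ^ 2 * (16 * x ^ 2 + Λ)

lemma exp_neg_log_inv {p : ℝ} (hp : 0 < p) : Real.exp (-Real.log (1 / p)) = p := by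
  rw [one_div, Real.log_inv, neg_neg, Real.exp_log hp]

lemma ocpFail_le {d H : ℕ} {B α p : ℝ} (hB : 0 < B) (hα : 0 < α) (hp : 0 < p) (hp1 : p ≤ 1) {T : ℕ}
    (hT : ocpNeed d H (B / α) (Real.log (1 / p)) ≤ T) : Env.ocpFail d H B α T ≤ p := by
  set Λ := Real.log (1 / p) with hΛ
  set x := B / α with hx
  have hx0 : 0 < x := by positivity
  have hΛ0 : 0 ≤ Λ := Real.log_nonneg (by rw [le_div_iff₀ hp]; linarith)
  have hep : Real.exp (-Λ) = p := exp_neg_log_inv hp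
  have hT0 : (0 : ℝ) ≤ T := by positivity
  rw [ocpNeed] at hT
  have hT1 : 4 * x * (H * d + Λ + 1) ≤ T := le_trans (le_add_of_nonneg_right (by positivity)) hT
  have hT2 : 4 * x ^ 2 * (16 * x ^ 2 + Λ) ≤ T := le_trans (le_add_of_nonneg_left (by positivity)) hT
  have hhalf : Real.exp (-1) ≤ 1 / 2 := by
    rw [Real.exp_neg, inv_eq_one_div]
    gcongr
    linarith [Real.add_one_le_exp (1 : ℝ)]
  have h1 : Real.exp (H * d - α * T / (4 * B)) ≤ p / 2 := by
    have e1 : α * T / (4 * B) = T / (4 * x) := by rw [hx]; field_simp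
    have e2 : H * d + Λ + 1 ≤ T / (4 * x) := by
      rw [le_div_iff₀ (by positivity)]; linarith
    calc Real.exp (H * d - α * T / (4 * B)) ≤ Real.exp (-Λ + -1) := by
          rw [e1]; gcongr; linarith
      _ = p * Real.exp (-1) := by rw [Real.exp_add, hep]
      _ ≤ p * (1 / 2) := by gcongr
      _ = p / 2 := by ring
  have h2 : T * (2 * Real.exp (-(T * α ^ 2) / (2 * B ^ 2))) ≤ p / 2 := by
    set y := T / (4 * x ^ 2) with hy
    have e1 : -(T * α ^ 2) / (2 * B ^ 2) = -y + -y := by rw [hy, hx]; field_simp; ring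
    have e2 : 16 * x ^ 2 + Λ ≤ y := by
      rw [hy, le_div_iff₀ (by positivity)]; linarith
    have e3 : y * Real.exp (-y) ≤ 1 := by
      rw [Real.exp_neg, ← div_eq_mul_inv, div_le_one (Real.exp_pos _)]
      linarith [Real.add_one_le_exp y]
    have e4 : T = 4 * x ^ 2 * y := by rw [hy]; field_simp
    have e5 : 16 * x ^ 2 * Real.exp (-(16 * x ^ 2)) ≤ 1 := by
      rw [Real.exp_neg, ← div_eq_mul_inv, div_le_one (Real.exp_pos _)]
      linarith [Real.add_one_le_exp (16 * x ^ 2)]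
    calc T * (2 * Real.exp (-(T * α ^ 2) / (2 * B ^ 2)))
        = 8 * x ^ 2 * (y * Real.exp (-y)) * Real.exp (-y) := by
          rw [e1, Real.exp_add, e4]; ring
      _ ≤ 8 * x ^ 2 * 1 * Real.exp (-(16 * x ^ 2) + -Λ) := by gcongr; linarith
      _ = 1 / 2 * (16 * x ^ 2 * Real.exp (-(16 * x ^ 2))) * p := by
          rw [Real.exp_add, hep]; ring
      _ ≤ 1 / 2 * 1 * p := by gcongr
      _ = p / 2 := by ring
  rw [Env.ocpFail]
  linarith

/-- Twice the nominal number of rounds of RobustSpanner is enough. -/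
lemma factorial_mul_lt {d : ℕ} (hd : 0 < d) {e : ℝ} (he : 0 < e) (he1 : e < 1) :
    d.factorial * 2 ^ d < (2 : ℝ) ^ (2 * Env.numIter d e) * (e / 2 / 2) ^ d := by
  set y : ℝ := 400 * d / e ^ 2 with hy
  have hd' : (0 : ℝ) < d := by exact_mod_cast hd
  have hy0 : 0 < y := by positivity
  have h1 : (2 * d : ℝ) + d * Real.logb 2 y ≤ (2 * Env.numIter d e : ℕ) := by
    rw [Env.numIter]
    push_cast
    have := Nat.le_ceil ((d : ℝ) / 2 * Real.logb 2 (400 * d / e ^ 2))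
    linarith
  have h2 : (4 * y) ^ d ≤ (2 : ℝ) ^ (2 * Env.numIter d e) := by
    have e1 : (4 * y) ^ d = (2 : ℝ) ^ ((2 * d : ℝ) + d * Real.logb 2 y) := by
      rw [Real.rpow_add (by norm_num), mul_comm (d : ℝ) (Real.logb 2 y),
        Real.rpow_mul (by norm_num) (Real.logb 2 y), Real.rpow_logb (by norm_num) (by norm_num) hy0,
        Real.rpow_natCast, mul_pow]
      congr 1
      rw [Real.rpow_mul (by norm_num), Real.rpow_natCast]
      norm_num
    rw [e1, ← Real.rpow_natCast]
    exact Real.rpow_le_rpow_of_exponent_le (by norm_num) h1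
  have h3 : (d.factorial : ℝ) ≤ d ^ d := by exact_mod_cast Nat.factorial_le_pow d
  calc (d.factorial : ℝ) * 2 ^ d ≤ (d : ℝ) ^ d * 2 ^ d := by gcongr
    _ = (2 * d) ^ d := by rw [← mul_pow, mul_comm]
    _ < (4 * y * (e / 2 / 2)) ^ d := by
        refine pow_lt_pow_left₀ ?_ (by positivity) hd.ne'
        have e2 : 4 * y * (e / 2 / 2) = 400 * d / e := by rw [hy]; field_simp; norm_num
        rw [e2, lt_div_iff₀ he]
        nlinarith
    _ = (4 * y) ^ d * (e / 2 / 2) ^ d := mul_pow _ _ _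
    _ ≤ (2 : ℝ) ^ (2 * Env.numIter d e) * (e / 2 / 2) ^ d := by gcongr

lemma numIter_le {d : ℕ} {e : ℝ} (he : 0 < e) (he1 : e < 1) (hd : 0 < d) :
    (Env.numIter d e : ℝ) ≤ d + (d * (400 * d / e ^ 2) + 1) := by
  have hd' : (1 : ℝ) ≤ d := by exact_mod_cast hd
  have hy : (1 : ℝ) ≤ 400 * d / e ^ 2 := by
    rw [le_div_iff₀ (by positivity)]
    nlinarith [mul_pos he he]
  have hlog : Real.logb 2 (400 * d / e ^ 2) ≤ 2 * (400 * d / e ^ 2) := by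
    rw [Real.logb, div_le_iff₀ (Real.log_pos (by norm_num))]
    have h1 := Real.log_le_self (by linarith : (0 : ℝ) ≤ 400 * d / e ^ 2)
    have h2 := Real.log_two_gt_d9
    nlinarith
  have hnn : 0 ≤ Real.logb 2 (400 * d / e ^ 2) := Real.logb_nonneg (by norm_num) hy
  rw [Env.numIter]
  push_cast
  have h3 := (Nat.ceil_lt_add_one (a := (d : ℝ) / 2 * Real.logb 2 (400 * d / e ^ 2))
    (by positivity)).le
  have h4 : (d : ℝ) / 2 * Real.logb 2 (400 * d / e ^ 2) ≤ d * (400 * d / e ^ 2) := by nlinarith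
  linarith

lemma one_le_numIter {d : ℕ} (hd : 0 < d) (e : ℝ) : 1 ≤ Env.numIter d e := by
  rw [Env.numIter]; omega

lemma le_numIter (d : ℕ) (e : ℝ) : d ≤ Env.numIter d e := by
  rw [Env.numIter]; omega

/-- The confidence parameter `δ' = δ/(16 H N_iter)` of the calls in the first phase. -/
def callDelta (d H : ℕ) (e δ : ℝ) : ℝ := δ / (16 * H * Env.numIter d e)

lemma callDelta_pos {d H : ℕ} (hd : 0 < d) (hH : 0 < H) {e δ : ℝ} (hδ : 0 < δ) :
    0 < callDelta d H e δ := by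
  have := one_le_numIter hd e
  have h1 : (0 : ℝ) < Env.numIter d e := by exact_mod_cast this
  have h2 : (0 : ℝ) < H := by exact_mod_cast hH
  rw [callDelta]; positivity

lemma callDelta_le {d H : ℕ} (hd : 0 < d) (hH : 0 < H) {e δ : ℝ} (hδ1 : δ < 1) :
    callDelta d H e δ ≤ 1 / 16 := by
  have := one_le_numIter hd e
  have h1 : (1 : ℝ) ≤ Env.numIter d e := by exact_mod_cast this
  have h2 : (1 : ℝ) ≤ H := by exact_mod_cast hH
  rw [callDelta, div_le_div_iff₀ (by positivity) (by norm_num)]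
  nlinarith

/-- The failure probabilities `δ'^2` of all calls in the first phase add up to at most `δ/2`. -/
lemma sum_callDelta_le {d H : ℕ} (hd : 0 < d) (hH : 0 < H) {e δ : ℝ} (hδ : 0 < δ) (hδ1 : δ < 1) :
    (H : ℝ) * ((d + d * (2 * Env.numIter d e) : ℕ) *
      (2 * (callDelta d H e δ ^ 2 + callDelta d H e δ ^ 2))) ≤ δ / 2 := by
  have hN := one_le_numIter hd e
  have hdN := le_numIter d e
  set N := Env.numIter d e with hNdef
  have h1 : (1 : ℝ) ≤ N := by exact_mod_cast hN
  have h2 : (1 : ℝ) ≤ H := by exact_mod_cast hH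
  have h3 : ((d + d * (2 * N) : ℕ) : ℝ) ≤ 3 * N ^ 2 := by
    have : d + d * (2 * N) ≤ 3 * N ^ 2 := by nlinarith
    exact_mod_cast this
  have h4 : callDelta d H e δ = δ / (16 * H * N) := by rw [callDelta]
  calc (H : ℝ) * ((d + d * (2 * N) : ℕ) *
        (2 * (callDelta d H e δ ^ 2 + callDelta d H e δ ^ 2)))
      ≤ H * (3 * N ^ 2 * (2 * (callDelta d H e δ ^ 2 + callDelta d H e δ ^ 2))) := by gcongr
    _ = 12 / 256 * (δ * δ) / H := by rw [h4]; field_simp; norm_num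
    _ ≤ 12 / 256 * (δ * δ) / 1 := by gcongr
    _ ≤ δ / 2 := by nlinarith

/-- The prescribed number of episodes for vector estimation is enough. -/
lemma exp_numVec_le {d H : ℕ} (hd : 0 < d) (hH : 0 < H) {c e δ : ℝ} (hc : 1000 ≤ c) (he : 0 < e)
    (hδ : 0 < δ) (hδ1 : δ < 1) :
    Real.exp (d / 2 - Env.numVec d H c e δ * (e / 8) ^ 2 / 4) ≤ callDelta d H e δ ^ 2 := by
  set q := callDelta d H e δ with hq
  have hq0 : 0 < q := callDelta_pos hd hH hδ
  have hq1 : q ≤ 1 / 16 := callDelta_le hd hH hδ1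
  set Λ := Real.log (1 / q) with hΛ
  have hΛ1 : 1 ≤ Λ := by
    rw [hΛ, Real.le_log_iff_exp_le (by positivity)]
    have h1 := Real.exp_one_lt_d9
    have h2 : (16 : ℝ) ≤ 1 / q := by rw [le_div_iff₀ hq0]; linarith
    linarith
  have hd' : (1 : ℝ) ≤ d := by exact_mod_cast hd
  have hn : c * (d : ℝ) ^ 2 / e ^ 2 * Λ ≤ Env.numVec d H c e δ := Nat.le_ceil _
  have e1 : (q : ℝ) ^ 2 = Real.exp (-(2 * Λ)) := by
    rw [two_mul, neg_add, Real.exp_add, hΛ, exp_neg_log_inv hq0, sq]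
  rw [e1]
  gcongr
  have h1 : c * (d : ℝ) ^ 2 / e ^ 2 * Λ * (e / 8) ^ 2 / 4 ≤
      Env.numVec d H c e δ * (e / 8) ^ 2 / 4 := by gcongr
  have h2 : c * (d : ℝ) ^ 2 / e ^ 2 * Λ * (e / 8) ^ 2 / 4 = c / 256 * (d ^ 2 * Λ) := by
    field_simp; norm_num
  have h3 : (d : ℝ) ≤ d ^ 2 * Λ := by nlinarith
  have h4 : Λ ≤ d ^ 2 * Λ := le_mul_of_one_le_left (by linarith) (one_le_pow₀ hd')
  have h5 : 3 * (d ^ 2 * Λ) ≤ c / 256 * (d ^ 2 * Λ) := by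
    gcongr; linarith
  linarith

lemma numVec_pos {d H : ℕ} (hd : 0 < d) (hH : 0 < H) {c e δ : ℝ} (hc : 0 < c) (he : 0 < e)
    (hδ : 0 < δ) (hδ1 : δ < 1) : 0 < Env.numVec d H c e δ := by
  have hd' : (0 : ℝ) < d := by exact_mod_cast hd
  have hq0 : 0 < callDelta d H e δ := callDelta_pos hd hH hδ
  have hq1 : callDelta d H e δ ≤ 1 / 16 := callDelta_le hd hH hδ1
  have : 0 < Real.log (1 / callDelta d H e δ) := Real.log_pos (by
    rw [lt_div_iff₀ hq0]; linarith)
  rw [callDelta] at this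
  exact Nat.ceil_pos.2 (by positivity)

/-- `L ≥ d`. -/
lemma le_logFactor {d H : ℕ} (hd : 0 < d) (hH : 0 < H) {ε δ : ℝ} (hε : 0 < ε) (hε1 : ε < 1)
    (hδ : 0 < δ) (hδ1 : δ < 1) : (d : ℝ) ≤ Env.logFactor d H ε δ := by
  have h1 : (1 : ℝ) ≤ d := by exact_mod_cast hd
  have h2 : (1 : ℝ) ≤ H := by exact_mod_cast hH
  rw [Env.logFactor]
  refine le_add_of_nonneg_right (Real.log_nonneg ?_)
  rw [le_div_iff₀ (by positivity)]
  have h3 : δ * ε ≤ 1 := mul_le_one₀ hδ1.le hε.le hε1.le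
  have h4 : (1 : ℝ) ≤ d * H := one_le_mul_of_one_le_of_one_le h1 h2
  linarith

/-- The deviation `2 d + 4 log(8 d H/δ)` exceeded with probability `δ/(8 d H)` only. -/
def deviation (d H : ℕ) (δ : ℝ) : ℝ := 2 * d + 4 * Real.log (8 * d * H / δ)

lemma deviation_nonneg {d H : ℕ} (hd : 0 < d) (hH : 0 < H) {δ : ℝ} (hδ : 0 < δ) (hδ1 : δ < 1) :
    0 ≤ deviation d H δ := by
  have h1 : (1 : ℝ) ≤ d := by exact_mod_cast hd
  have h2 : (1 : ℝ) ≤ H := by exact_mod_cast hH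
  have h3 : 0 ≤ Real.log (8 * d * H / δ) := Real.log_nonneg (by
    rw [le_div_iff₀ hδ]
    nlinarith)
  rw [deviation]; positivity

lemma exp_deviation {d H : ℕ} (hd : 0 < d) (hH : 0 < H) {δ : ℝ} (hδ : 0 < δ) :
    Real.exp (d / 2 - deviation d H δ / 4) = δ / (8 * d * H) := by
  have h1 : (0 : ℝ) < d := by exact_mod_cast hd
  have h2 : (0 : ℝ) < H := by exact_mod_cast hH
  rw [deviation, show (d : ℝ) / 2 - (2 * d + 4 * Real.log (8 * d * H / δ)) / 4 =
    -Real.log (8 * d * H / δ) by ring, Real.exp_neg, Real.exp_log (by positivity), inv_div]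

lemma deviation_le {d H : ℕ} (hd : 0 < d) (hH : 0 < H) {ε δ : ℝ} (hε : 0 < ε) (hε1 : ε < 1)
    (hδ : 0 < δ) : deviation d H δ ≤ 12 + 4 * Env.logFactor d H ε δ := by
  have h1 : (1 : ℝ) ≤ d := by exact_mod_cast hd
  have h2 : (1 : ℝ) ≤ H := by exact_mod_cast hH
  have h3 : Real.log (8 * d * H / δ) ≤ 3 + Real.log (d * H / (δ * ε)) := by
    have e1 : 8 * d * H / δ = 8 * (d * H / δ) := by ring
    rw [e1, Real.log_mul (by norm_num) (by positivity)]
    have e2 : Real.log 8 ≤ 3 := by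
      rw [show (8 : ℝ) = 2 ^ 3 by norm_num, Real.log_pow]
      push_cast
      linarith [Real.log_two_lt_d9]
    have e3 : Real.log (d * H / δ) ≤ Real.log (d * H / (δ * ε)) := by
      refine Real.log_le_log (by positivity) ?_
      gcongr
      nlinarith
    linarith
  rw [deviation, Env.logFactor]
  linarith

/-- The estimation error of the second phase, for the prescribed numbers of samples. -/
lemma estimation_error_le {d H : ℕ} (hd : 0 < d) (hH : 0 < H) {ε δ c₀ c₁ : ℝ} (hε : 0 < ε)
    (hε1 : ε < 1) (hδ : 0 < δ) (hδ1 : δ < 1) (hc₀ : 1000000 ≤ c₀) (hc₁ : 1000000 ≤ c₁) {n : ℕ}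
    (hn : c₁ * (d : ℝ) ^ 2 * (H : ℝ) ^ 2 * Env.logFactor d H ε δ ^ 2 / ε ^ 2 ≤ n)
    {e β τ : ℝ} (he : e = ε / (c₀ * d * H * Env.logFactor d H ε δ))
    (hβ : β = √(deviation d H δ) + √d) (hτ : τ = √(deviation d H δ) / √n) :
    H * (2 * (d * (β / √n + τ * β + (e / 2 + e / 8) * β))) ≤ ε / 4 := by
  have h1 : (1 : ℝ) ≤ d := by exact_mod_cast hd
  have h2 : (1 : ℝ) ≤ H := by exact_mod_cast hH
  have hdL := le_logFactor hd hH hε hε1 hδ hδ1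
  have hdev := deviation_le (H := H) hd hH hε hε1 hδ
  set L := Env.logFactor d H ε δ
  set t := deviation d H δ
  have hL1 : 1 ≤ L := h1.trans hdL
  set s := √L with hs
  have hs1 : 1 ≤ s := by rw [hs]; exact Real.one_le_sqrt.2 hL1
  have hsL : s ^ 2 = L := Real.sq_sqrt (by linarith)
  have hsL' : s ≤ L := by nlinarith
  have ht : √t ≤ 4 * s := by
    refine Real.sqrt_le_iff.2 ⟨by positivity, ?_⟩
    rw [mul_pow, hsL]; linarith
  have hd' : √d ≤ s := Real.sqrt_le_sqrt hdL
  have hβ5 : β ≤ 5 * s := by linarith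
  have hβ0 : 0 ≤ β := by rw [hβ]; positivity
  have hτβ : τ * β ≤ 20 * L / √n := by
    rw [hτ, div_mul_eq_mul_div]
    refine div_le_div_of_nonneg_right ?_ (Real.sqrt_nonneg _)
    calc √t * β ≤ (4 * s) * (5 * s) := by gcongr
      _ = 20 * L := by rw [← hsL]; ring
  have hβn : β / √n ≤ 5 * L / √n := by gcongr; linarith
  have hrn : 1000 * (d * H * L) / ε ≤ √n := by
    refine Real.le_sqrt_of_sq_le (le_trans ?_ hn)
    rw [div_pow]
    gcongr
    calc (1000 * (d * H * L)) ^ 2 = 1000000 * (d : ℝ) ^ 2 * (H : ℝ) ^ 2 * L ^ 2 := by ring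
      _ ≤ c₁ * (d : ℝ) ^ 2 * (H : ℝ) ^ 2 * L ^ 2 := by gcongr
  have hinv : 25 * L / √n ≤ ε / (40 * (d * H)) := by
    calc 25 * L / √n ≤ 25 * L / (1000 * (d * H * L) / ε) := by gcongr
      _ = ε / (40 * (d * H)) := by field_simp; norm_num
  have heβ : (e / 2 + e / 8) * β ≤ ε / (40 * (d * H)) := by
    have h3 : e ≤ ε / (1000000 * d * H * L) := by rw [he]; gcongr
    have h4 : 0 ≤ e := by
      have : 0 < c₀ := by linarith
      rw [he]; positivity
    calc (e / 2 + e / 8) * β ≤ e * (5 * L) := by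
          refine mul_le_mul (by linarith) (by linarith) hβ0 h4
      _ ≤ ε / (1000000 * d * H * L) * (5 * L) := by gcongr
      _ = ε / (200000 * (d * H)) := by field_simp; norm_num
      _ ≤ ε / (40 * (d * H)) := by gcongr; norm_num
  have hsum : β / √n + τ * β + (e / 2 + e / 8) * β ≤ ε / (20 * (d * H)) := by
    have e1 : 5 * L / √n + 20 * L / √n = 25 * L / √n := by ring
    have e2 : ε / (40 * ((d : ℝ) * H)) + ε / (40 * (d * H)) = ε / (20 * (d * H)) := by
      field_simp; norm_num
    linarith
  calc (H : ℝ) * (2 * (d * (β / √n + τ * β + (e / 2 + e / 8) * β)))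
      ≤ H * (2 * (d * (ε / (20 * (d * H))))) := by gcongr
    _ = ε / 10 := by field_simp; norm_num
    _ ≤ ε / 4 := by linarith

end LBC
end

noncomputable section
namespace LBC

/-! ### Polynomially bounded quantities -/

section Poly

open MvPolynomial

lemma aeval_nonneg {σ : Type*} {v : σ → ℝ} (hv : ∀ i, 0 ≤ v i) (p : MvPolynomial σ ℕ) :
    0 ≤ aeval v p := by
  induction p using MvPolynomial.induction_on with
  | C a => simp
  | add p q hp hq => rw [map_add]; positivity
  | mul_X p i hp => rw [map_mul, aeval_X]; exact mul_nonneg hp (hv i)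

lemma eval_mono {σ : Type*} {v w : σ → ℕ} (hvw : ∀ i, v i ≤ w i) (p : MvPolynomial σ ℕ) :
    eval v p ≤ eval w p := by
  induction p using MvPolynomial.induction_on with
  | C a => simp
  | add p q hp hq => rw [map_add, map_add]; exact add_le_add hp hq
  | mul_X p i hp => rw [map_mul, map_mul, eval_X, eval_X]; exact Nat.mul_le_mul hp (hvw i)

/-- Admissible values of the number of actions, the dimension, the horizon, the accuracy and the
confidence. -/
structure Scale where
  a : ℕ
  d : ℕ
  H : ℕ
  ε : ℝ
  δ : ℝ
  a_pos : 0 < a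
  d_pos : 0 < d
  H_pos : 0 < H
  ε_pos : 0 < ε
  ε_lt : ε < 1
  δ_pos : 0 < δ
  δ_lt : δ < 1

namespace Scale

/-- The arguments `(|𝒜|, d, H, 1/ε, log(1/δ))`. -/
def args (q : Scale) : Fin 5 → ℝ := ![(q.a : ℝ), (q.d : ℝ), (q.H : ℝ), 1 / q.ε, Real.log (1 / q.δ)]

lemma log_nonneg (q : Scale) : 0 ≤ Real.log (1 / q.δ) := Real.log_nonneg (by
  rw [le_div_iff₀ q.δ_pos]; linarith [q.δ_lt])

lemma args_nonneg (q : Scale) (i : Fin 5) : 0 ≤ q.args i := by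
  have h1 := q.log_nonneg
  have h2 := q.ε_pos
  fin_cases i
  · exact Nat.cast_nonneg _
  · exact Nat.cast_nonneg _
  · exact Nat.cast_nonneg _
  · exact (by positivity : 0 ≤ 1 / q.ε)
  · exact h1

end Scale

/-- `f` is bounded by a polynomial in `(|𝒜|, d, H, 1/ε, log(1/δ))`. -/
def PolyBdd (f : Scale → ℝ) : Prop := ∃ P : MvPolynomial (Fin 5) ℕ, ∀ q, f q ≤ aeval q.args P

namespace PolyBdd

variable {f g : Scale → ℝ}

lemma mono (hg : PolyBdd g) (h : ∀ q, f q ≤ g q) : PolyBdd f := by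
  obtain ⟨P, hP⟩ := hg
  exact ⟨P, fun q => (h q).trans (hP q)⟩

lemma add (hf : PolyBdd f) (hg : PolyBdd g) : PolyBdd fun q => f q + g q := by
  obtain ⟨P, hP⟩ := hf
  obtain ⟨Q, hQ⟩ := hg
  exact ⟨P + Q, fun q => by rw [map_add]; exact add_le_add (hP q) (hQ q)⟩

lemma mul (hf : PolyBdd f) (hg : PolyBdd g) (hg0 : ∀ q, 0 ≤ g q) :
    PolyBdd fun q => f q * g q := by
  obtain ⟨P, hP⟩ := hf
  obtain ⟨Q, hQ⟩ := hg
  exact ⟨P * Q, fun q => by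
    rw [map_mul]
    exact mul_le_mul (hP q) (hQ q) (hg0 q) (aeval_nonneg q.args_nonneg P)⟩

lemma const (c : ℝ) : PolyBdd fun _ => c :=
  ⟨C ⌈c⌉₊, fun q => by rw [aeval_C]; simpa using Nat.le_ceil c⟩

lemma pow (hf : PolyBdd f) (hf0 : ∀ q, 0 ≤ f q) (n : ℕ) : PolyBdd fun q => f q ^ n := by
  induction n with
  | zero => simpa using const 1
  | succ n ih => simpa only [pow_succ] using ih.mul hf hf0

lemma a : PolyBdd fun q => q.a := ⟨X 0, fun q => by rw [aeval_X]; rfl⟩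
lemma d : PolyBdd fun q => q.d := ⟨X 1, fun q => by rw [aeval_X]; rfl⟩
lemma H : PolyBdd fun q => q.H := ⟨X 2, fun q => by rw [aeval_X]; rfl⟩
lemma inv_ε : PolyBdd fun q => 1 / q.ε := ⟨X 3, fun q => by rw [aeval_X]; rfl⟩
lemma log_δ : PolyBdd fun q => Real.log (1 / q.δ) := ⟨X 4, fun q => by rw [aeval_X]; rfl⟩

lemma natCeil (hf : PolyBdd f) : PolyBdd fun q => (⌈f q⌉₊ : ℝ) := by
  obtain ⟨P, hP⟩ := hf
  refine ⟨P + C 1, fun q => ?_⟩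
  rw [map_add, aeval_C]
  have h := Nat.ceil_mono (hP q)
  have h2 := (Nat.ceil_lt_add_one (aeval_nonneg q.args_nonneg P)).le
  have h3 : ((⌈f q⌉₊ : ℕ) : ℝ) ≤ ⌈aeval q.args P⌉₊ := by exact_mod_cast h
  simpa using h3.trans h2

/-- Polynomials with natural coefficients preserve polynomial boundedness. -/
lemma aeval_comp {σ : Type*} {v : Scale → σ → ℝ} (hv : ∀ i, PolyBdd fun q => v q i)
    (hv0 : ∀ q i, 0 ≤ v q i) (p : MvPolynomial σ ℕ) : PolyBdd fun q => aeval (v q) p := by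
  induction p using MvPolynomial.induction_on with
  | C c => simpa using const (c : ℝ)
  | add p q hp hq => simpa only [map_add] using hp.add hq
  | mul_X p i hp => simpa only [map_mul, aeval_X] using hp.mul (hv i) fun q => hv0 q i

end PolyBdd

/-- A program bound: polynomial boundedness for quantities counted in natural numbers. -/
def PolyBddNat (f : Scale → ℕ) : Prop := PolyBdd fun q => (f q : ℝ)

namespace PolyBddNat

variable {f g : Scale → ℕ}

lemma add (hf : PolyBddNat f) (hg : PolyBddNat g) : PolyBddNat fun q => f q + g q := by
  simpa only [PolyBddNat, Nat.cast_add] using PolyBdd.add hf hg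

lemma mul (hf : PolyBddNat f) (hg : PolyBddNat g) : PolyBddNat fun q => f q * g q := by
  simpa only [PolyBddNat, Nat.cast_mul] using PolyBdd.mul hf hg fun q => Nat.cast_nonneg _

lemma const (c : ℕ) : PolyBddNat fun _ => c := PolyBdd.const c

lemma pow (hf : PolyBddNat f) (n : ℕ) : PolyBddNat fun q => f q ^ n := by
  simpa only [PolyBddNat, Nat.cast_pow] using PolyBdd.pow hf (fun q => Nat.cast_nonneg _) n

lemma eval_comp {σ : Type*} {v : Scale → σ → ℕ} (hv : ∀ i, PolyBddNat fun q => v q i)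
    (p : MvPolynomial σ ℕ) : PolyBddNat fun q => eval (v q) p := by
  have h := PolyBdd.aeval_comp (v := fun q i => (v q i : ℝ)) hv (fun q i => Nat.cast_nonneg _) p
  refine h.mono fun q => le_of_eq ?_
  have h1 := eval₂_comp_left (Nat.castRingHom ℝ) (RingHom.id ℕ) (v q) p
  rw [aeval_def]
  exact h1

end PolyBddNat

end Poly

end LBC
end

noncomputable section
namespace LBC

/-! ### Resource bounds -/

namespace Costed

variable {α β σ : Type*}

/-- The computation draws at most `s` episodes and takes at most `k` steps. -/
def Within (m : Costed α) (s k : ℕ) : Prop := m.samples ≤ s ∧ m.steps ≤ k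

lemma within_ret (a : α) : (ret a).Within 0 0 := ⟨le_rfl, le_rfl⟩

lemma Within.mono {m : Costed α} {s k s' k' : ℕ} (h : m.Within s k) (hs : s ≤ s') (hk : k ≤ k') :
    m.Within s' k' := ⟨h.1.trans hs, h.2.trans hk⟩

lemma Within.bind {m : Costed α} {f : α → Costed β} {s k s' k' : ℕ} (h : m.Within s k)
    (h' : (f m.val).Within s' k') : (m.bind f).Within (s + s') (k + k') :=
  ⟨add_le_add h.1 h'.1, add_le_add h.2 h'.2⟩

lemma Within.tick {m : Costed α} {s k : ℕ} (h : m.Within s k) (n : ℕ) :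
    (m.tick n).Within s (k + n) := ⟨h.1, Nat.add_le_add_right h.2 n⟩

lemma Within.draw {m : Costed α} {s k : ℕ} (h : m.Within s k) (n : ℕ) :
    (m.draw n).Within (s + n) k := ⟨Nat.add_le_add_right h.1 n, h.2⟩

/-- A loop with an invariant `I` that bounds the cost of each round. -/
lemma within_iter {f : ℕ → σ → Costed σ} {I : ℕ → σ → Prop} {n s k : ℕ} {x : σ} (h0 : I 0 x)
    (hf : ∀ i < n, ∀ y, I i y → (f i y).Within s k ∧ I (i + 1) (f i y).val) :
    (iter f n x).Within (n * s) (n * k) ∧ I n (iter f n x).val := by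
  induction n with
  | zero => exact ⟨(within_ret x).mono (by simp) (by simp), h0⟩
  | succ n ih =>
    obtain ⟨h1, h2⟩ := ih fun i hi => hf i (by omega)
    obtain ⟨h3, h4⟩ := hf n (by omega) _ h2
    exact ⟨(h1.bind h3).mono (by rw [Nat.succ_mul]) (by rw [Nat.succ_mul]), h4⟩

end Costed

open Costed

section SpannerCost

variable {Z : Type*} {d : ℕ} {linOpt : ℕ → Vec d → Costed Z} {vec : ℕ → Z → Costed (Vec d)}
  {s k : ℕ}

lemma within_probes (h : ∀ c u, (probe linOpt vec c u).Within s k) (st : SpanState Z d)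
    (i : Fin d) : (probes linOpt vec st i).Within (2 * s) (2 * k + cofactorCost d) :=
  ((h _ _).bind ((h _ _).bind ((within_ret _).tick _))).mono (by omega) (by omega)

lemma within_spanInits (h : ∀ c u, (probe linOpt vec c u).Within s k) (η : ℝ) (l : List (Fin d))
    (st : SpanState Z d) : (spanInits linOpt vec η l st).Within (l.length * (2 * s))
      (l.length * (2 * k + cofactorCost d)) := by
  induction l generalizing st with
  | nil => exact (within_ret _).mono (by simp) (by simp)
  | cons i is ih =>
    rw [spanInits]
    have h1 : (spanInit linOpt vec η i st).Within (2 * s) (2 * k + cofactorCost d) :=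
      (within_probes h st i).bind (within_ret _)
    refine (h1.bind (ih _)).mono ?_ ?_
    · exact le_of_eq (by rw [List.length_cons]; ring)
    · exact le_of_eq (by rw [List.length_cons]; ring)

lemma within_spanScan (h : ∀ c u, (probe linOpt vec c u).Within s k) (C η : ℝ) (l : List (Fin d))
    (st : SpanState Z d) : (spanScan linOpt vec C η l st).Within (l.length * (2 * s))
      (l.length * (2 * k + cofactorCost d)) := by
  induction l generalizing st with
  | nil => exact (within_ret _).mono (by simp) (by simp)
  | cons i is ih =>
    rw [spanScan]
    refine ((within_probes h st i).bind (s' := is.length * (2 * s))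
      (k' := is.length * (2 * k + cofactorCost d)) ?_).mono ?_ ?_
    · dsimp only
      split_ifs
      · exact (within_ret _).mono (Nat.zero_le _) (Nat.zero_le _)
      · exact (within_ret _).mono (Nat.zero_le _) (Nat.zero_le _)
      · exact ih _
    · exact le_of_eq (by rw [List.length_cons]; ring)
    · exact le_of_eq (by rw [List.length_cons]; ring)

lemma within_spanLoop (h : ∀ c u, (probe linOpt vec c u).Within s k) (C η : ℝ) (fuel : ℕ)
    (st : SpanState Z d) : (spanLoop linOpt vec C η fuel st).Within (fuel * (d * (2 * s)))
      (fuel * (d * (2 * k + cofactorCost d))) := by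
  induction fuel generalizing st with
  | zero => exact (within_ret _).mono (by simp) (by simp)
  | succ n ih =>
    rw [spanLoop]
    have h1 := within_spanScan h C η (List.finRange d) st
    rw [List.length_finRange] at h1
    refine (h1.bind (s' := n * (d * (2 * s))) (k' := n * (d * (2 * k + cofactorCost d))) ?_).mono
      ?_ ?_
    · split_ifs
      · exact ih _
      · exact (within_ret _).mono (Nat.zero_le _) (Nat.zero_le _)
    · exact le_of_eq (by ring)
    · exact le_of_eq (by ring)

lemma within_robustSpanner (h : ∀ c u, (probe linOpt vec c u).Within s k) (z₀ : Z) (C η : ℝ)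
    (fuel : ℕ) : (robustSpanner linOpt vec z₀ C η fuel).Within ((d + d * fuel) * (2 * s))
      ((d + d * fuel) * (2 * k + cofactorCost d)) := by
  have h1 := within_spanInits h η (List.finRange d)
    ⟨fun i => EuclideanSpace.single i (1 : ℝ), fun _ => z₀, 0⟩
  rw [List.length_finRange] at h1
  refine (h1.bind (within_spanLoop h C η fuel _)).mono ?_ ?_
  · exact le_of_eq (by ring)
  · exact le_of_eq (by ring)

end SpannerCost

namespace Env

variable {X A Ξ : Type*} [MeasurableSpace X] [MeasurableSpace Ξ] [Fintype A] {d : ℕ}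
  {E : Env X A Ξ d}

lemma rolloutCost_le {π : ImplPolicy X A} {G : ℕ} (h : ∀ l, π.cost l ≤ G) (n : ℕ) :
    rolloutCost π n ≤ n * (G + 1) := by
  have := Finset.sum_le_card_nsmul (Finset.range n) (fun l => π.cost l + 1) (G + 1)
    fun l _ => Nat.add_le_add_right (h l) 1
  simpa [rolloutCost] using this

lemma greedyCost_mono (hlp : ∀ k, Monotone (E.lp k)) : Monotone E.greedyCost := by
  intro m m' h
  have h1 := hlp d (Nat.mul_le_mul_left 2 h)
  unfold greedyCost
  gcongr

lemma boundsCost_mono (hlp : ∀ k, Monotone (E.lp k)) : Monotone E.boundsCost := by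
  intro m m' h
  have h1 := hlp d (Nat.mul_le_mul_left 2 h)
  have h2 := hlp (d + 1) (Nat.add_le_add_right (Nat.mul_le_mul_left 2 h) (Fintype.card A))
  unfold boundsCost
  gcongr

variable (E) in
/-- A bound on the number of steps of OCP with `T` episodes. -/
def ocpSteps (T : ℕ) : ℕ :=
  T * (E.H * (E.greedyCost (T * E.H) + E.boundsCost (T * E.H) + 4 * d + 10)) +
    T * (T * (E.H * (E.greedyCost (T * E.H) + 1) + E.H * (3 * d + 2)) + 2)

lemma within_ocp [Nonempty A] (hlp : ∀ k, Monotone (E.lp k)) (r : ℕ → X → A → ℝ) (B : ℝ) (T : ℕ)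
    (τ : ℕ → Seed X Ξ) : (E.ocp r B T τ).Within (T + T * T) (E.ocpSteps T) ∧
      ∀ h, (E.ocp r B T τ).val.cost h ≤ E.greedyCost (T * E.H) := by
  set G := E.greedyCost (T * E.H) with hG
  set D := E.boundsCost (T * E.H) with hD
  rw [ocp_eq]
  obtain ⟨h1, h2⟩ := within_iter (f := E.exploreStep r B τ) (n := T) (s := 1)
    (k := E.H * (G + D + 4 * d + 10))
    (x := (([], fun _ => somePolicy X A) : List (Row d) × (ℕ → ImplPolicy X A)))
    (I := fun j y => y.1.length = j * E.H ∧ ∀ i h, (y.2 i).cost h ≤ G)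
    ⟨by simp, fun _ _ => Nat.zero_le _⟩ (by
      intro j hj y hy
      obtain ⟨h1, h2, h3⟩ := within_iter (f := E.ocpLayer r B) (n := E.H) (s := 0)
        (k := G + D + 4 * d + 10) (x := ⟨(τ j).1, y.1, somePolicy X A⟩)
        (I := fun h y => y.rows.length = j * E.H + h ∧ ∀ l, y.pol.cost l ≤ G)
        ⟨hy.1, fun _ => Nat.zero_le _⟩ (by
          rintro h hh z ⟨hz, hz'⟩
          have hm : z.rows.length ≤ T * E.H := by
            have : (j + 1) * E.H ≤ T * E.H := Nat.mul_le_mul_right _ hj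
            rw [hz]; linarith
          have hg : E.greedyCost z.rows.length ≤ G := greedyCost_mono hlp hm
          have hb : E.boundsCost z.rows.length ≤ D := boundsCost_mono hlp hm
          refine ⟨((within_ret _).tick _).mono le_rfl ?_, ?_, fun l => ?_⟩
          · split_ifs <;> omega
          · simp only [ocpLayer, tick_val, ret_val, List.length_cons, hz]; rfl
          · simp only [ocpLayer, tick_val, ret_val, Function.update_apply]
            split_ifs
            · exact hg
            · exact hz' l)
      refine ⟨((h1.draw 1).bind (within_ret _)).mono (by simp) (by simp), ?_, fun i h => ?_⟩
      · simp only [exploreStep, bind_val, draw_val, ret_val, h2]; ring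
      · simp only [exploreStep, bind_val, draw_val, ret_val, Function.update_apply]
        split_ifs
        · exact h3 h
        · exact hy.2 i h)
  set p := (Costed.iter (E.exploreStep r B τ) T ([], fun _ => somePolicy X A)).val
  obtain ⟨h3, h4⟩ := within_iter (f := E.selectStep r T τ p.2) (n := T) (s := T)
    (k := T * (E.H * (G + 1) + E.H * (3 * d + 2)) + 2) (x := (⊥, somePolicy X A))
    (I := fun _ y => ∀ h, y.2.cost h ≤ G) (fun _ => Nat.zero_le _) (by
      intro i _ y hy
      have hr := rolloutCost_le (h2.2 i) E.H
      refine ⟨(((within_ret _).draw T).tick _).mono (by simp) ?_, fun h => ?_⟩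
      · rw [zero_add]; gcongr
      · simp only [selectStep, tick_val, draw_val, ret_val]
        split_ifs
        · exact h2.2 i h
        · exact hy h)
  refine ⟨(h1.bind (h3.bind (within_ret _))).mono (by simp) ?_, h4⟩
  rw [ocpSteps, ← hG, ← hD]
  omega

lemma within_vecEval {G : ℕ} {π : ImplPolicy X A} (h : ∀ l, π.cost l ≤ G) {l : ℕ} (hl : l < E.H)
    (n : ℕ) (τ : ℕ → Seed X Ξ) :
    (E.vecEval l π n τ).Within n (n * (E.H * (G + 1) + 2 * d) + d) := by
  refine (((within_ret _).draw n).tick _).mono (by simp) ?_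
  have h1 := (rolloutCost_le h (l + 1)).trans (Nat.mul_le_mul_right (G + 1) hl)
  rw [zero_add]
  gcongr

lemma within_ridge {G : ℕ} {γ : Fin d → ImplPolicy X A} (h : ∀ j l, (γ j).cost l ≤ G) {l : ℕ}
    (hl : l < E.H) (ω : Tape X Ξ) (n : ℕ) (lam : ℝ) : (E.ridge ω γ n lam l).Within (d * n)
      (d * (n * (E.H * (G + 1) + 5 * (d + 1) ^ 2)) + 10 * (d + 1) ^ 3) := by
  refine (((within_ret _).draw (d * n)).tick _).mono (by simp) ?_
  rw [zero_add]
  gcongr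
  have := Finset.sum_le_card_nsmul Finset.univ
    (fun j : Fin d => n * (rolloutCost (γ j) (l + 1) + 5 * (d + 1) ^ 2))
    (n * (E.H * (G + 1) + 5 * (d + 1) ^ 2)) fun j _ => by
      have h1 := (rolloutCost_le (h j) (l + 1)).trans (Nat.mul_le_mul_right (G + 1) hl)
      gcongr
  simpa using this

variable (E) in
/-- A bound on the number of steps of one call of OCP followed by vector estimation. -/
def probeSteps (T nv : ℕ) : ℕ :=
  E.ocpSteps T + (nv * (E.H * (E.greedyCost (T * E.H) + 1) + 2 * d) + d)

lemma within_computeSpanner [Nonempty A] (hlp : ∀ k, Monotone (E.lp k)) (ω : Tape X Ξ) (fuel : ℕ)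
    (c : ℝ) (p : MvPolynomial (Fin 5) ℕ) (ε δ : ℝ) {T nv : ℕ} (hT : E.numEpisodes p ε δ = T)
    (hnv : numVec d E.H c ε δ = nv) : (E.computeSpanner ω fuel c p ε δ).Within
      (E.H * ((d + d * fuel) * (2 * (T + T * T + nv))))
      (E.H * ((d + d * fuel) * (2 * E.probeSteps T nv + cofactorCost d))) := by
  refine (within_iter (I := fun _ _ => True) trivial fun h hh y _ => ⟨?_, trivial⟩).1
  rcases y with _ | Γ
  · exact (within_ret _).mono (Nat.zero_le _) (Nat.zero_le _)
  · refine (Within.bind ?_ (within_ret _))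
    rw [spannerLayer, hT, hnv]
    refine within_robustSpanner (fun k u => ?_) _ _ _ _
    obtain ⟨h1, h2⟩ := within_ocp hlp (E.intrinsic h u) E.H T fun m => ω (h, k, m)
    exact (h1.bind ((within_vecEval h2 hh nv _).bind (within_ret _))).mono le_rfl le_rfl

/-- The first phase returns the policies found at each layer. -/
lemma computeSpanner_val [Nonempty A] {ω : Tape X Ξ} {fuel : ℕ} {c : ℝ}
    {p : MvPolynomial (Fin 5) ℕ} {ε δ : ℝ} {γ : ℕ → Fin d → ImplPolicy X A}
    (h : ∀ l < E.H, (E.spannerLayer ω fuel c p ε δ l).val = some (γ l)) :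
    (E.computeSpanner ω fuel c p ε δ).val =
      some fun l => if l < E.H then γ l else fun _ => somePolicy X A := by
  have key : ∀ n ≤ E.H, (Costed.iter (fun h (s : Option (ℕ → Fin d → ImplPolicy X A)) =>
      match s with
      | none => Costed.ret none
      | some Γ => (E.spannerLayer ω fuel c p ε δ h).bind fun o =>
          Costed.ret (o.map fun γ => Function.update Γ h γ))
      n (some fun _ _ => somePolicy X A)).val =
        some fun l => if l < n then γ l else fun _ => somePolicy X A := by
    intro n
    induction n with
    | zero => intro _; simp [Costed.iter, Costed.ret]
    | succ n ih =>
      intro hn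
      rw [iter_succ, bind_val, ih (by omega)]
      simp only [bind_val, h n hn, ret_val, Option.map_some, Option.some.injEq]
      funext l
      rcases lt_trichotomy l n with h1 | h1 | h1
      · rw [Function.update_of_ne h1.ne, if_pos h1, if_pos (by omega)]
      · subst h1; simp
      · rw [Function.update_of_ne h1.ne', if_neg (by omega), if_neg (by omega)]
  exact key E.H le_rfl

/-- The loop over ridge regressions in the second phase. -/
lemma ridge_iter_val (ω : Tape X Ξ) (Γ : ℕ → Fin d → ImplPolicy X A) (n : ℕ) (lam : ℝ) (N : ℕ) :
    (Costed.iter (fun l (w : ℕ → Vec d) =>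
      (E.ridge ω (Γ l) n lam l).bind fun v => Costed.ret (Function.update w l v)) N
      fun _ => 0).val = fun l => if l < N then (E.ridge ω (Γ l) n lam l).val else 0 := by
  induction N with
  | zero => simp [Costed.iter, Costed.ret]
  | succ N ih =>
    rw [iter_succ, bind_val, ih]
    funext l
    simp only [bind_val, ret_val]
    rcases lt_trichotomy l N with h1 | h1 | h1
    · rw [Function.update_of_ne h1.ne, if_pos h1, if_pos (by omega)]
    · subst h1; simp
    · rw [Function.update_of_ne h1.ne', if_neg (by omega), if_neg (by omega)]

lemma within_policyOpt [Nonempty A] (hlp : ∀ k, Monotone (E.lp k)) (ω : Tape X Ξ)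
    {Γ : ℕ → Fin d → ImplPolicy X A} {G : ℕ} (hΓ : ∀ l j h, (Γ l j).cost h ≤ G) (n : ℕ) (lam : ℝ)
    (p : MvPolynomial (Fin 5) ℕ) (ε δ : ℝ) {T : ℕ} (hT : E.numEpisodes p ε δ = T) :
    (E.policyOpt ω Γ n lam p ε δ).Within (E.H * (d * n) + (T + T * T))
      (E.H * (d * (n * (E.H * (G + 1) + 5 * (d + 1) ^ 2)) + 10 * (d + 1) ^ 3) +
        (E.ocpSteps T + (E.H * (2 * d + 2) + 1))) := by
  have h1 := (within_iter (f := fun l (w : ℕ → Vec d) =>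
      (E.ridge ω (Γ l) n lam l).bind fun v => Costed.ret (Function.update w l v)) (n := E.H)
    (x := fun _ => 0) (I := fun _ _ => True) trivial fun l hl y _ =>
      ⟨(within_ridge (hΓ l) hl ω n lam).bind (within_ret _), trivial⟩).1
  refine h1.bind ?_
  rw [hT]
  exact (within_ocp hlp _ _ T _).1.tick _

end Env
end LBC
end

noncomputable section
namespace LBC

/-! ### The parameters of the procedure are polynomially bounded -/

section Sizes

open MvPolynomial

lemma PolyBdd.comp {f : Scale → ℝ} (hf : PolyBdd f) {g : Scale → Scale}
    (hg : ∀ i, PolyBdd fun q => (g q).args i) : PolyBdd fun q => f (g q) := by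
  obtain ⟨P, hP⟩ := hf
  exact (PolyBdd.aeval_comp hg (fun q => (g q).args_nonneg) P).mono fun q => hP (g q)

lemma PolyBddNat.comp {f : Scale → ℕ} (hf : PolyBddNat f) {g : Scale → Scale}
    (hg : ∀ i, PolyBdd fun q => (g q).args i) : PolyBddNat fun q => f (g q) :=
  PolyBdd.comp hf hg

lemma polyBdd_logFactor : PolyBdd fun q => Env.logFactor q.d q.H q.ε q.δ := by
  refine (((PolyBdd.d.add (PolyBdd.d.mul PolyBdd.H fun q => Nat.cast_nonneg _)).add
    PolyBdd.log_δ).add PolyBdd.inv_ε).mono fun q => ?_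
  have h1 : (0 : ℝ) < q.d := by exact_mod_cast q.d_pos
  have h2 : (0 : ℝ) < q.H := by exact_mod_cast q.H_pos
  have h3 := q.ε_pos
  have h4 := q.δ_pos
  have e : (q.d : ℝ) * q.H / (q.δ * q.ε) = q.d * q.H * (1 / q.δ) * (1 / q.ε) := by field_simp
  rw [Env.logFactor, e, Real.log_mul (by positivity) (by positivity),
    Real.log_mul (by positivity) (by positivity)]
  have h5 := Real.log_le_self (by positivity : (0 : ℝ) ≤ q.d * q.H)
  have h6 := Real.log_le_self (by positivity : (0 : ℝ) ≤ 1 / q.ε)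
  linarith

/-- The accuracy and confidence requested from the first phase. -/
def Scale.inner (c₀ : ℝ) (hc₀ : 1000000 ≤ c₀) (q : Scale) : Scale where
  a := q.a
  d := q.d
  H := q.H
  ε := q.ε / (c₀ * q.d * q.H * Env.logFactor q.d q.H q.ε q.δ)
  δ := q.δ / 2
  a_pos := q.a_pos
  d_pos := q.d_pos
  H_pos := q.H_pos
  ε_pos := by
    have h1 : (0 : ℝ) < q.d := by exact_mod_cast q.d_pos
    have h2 : (0 : ℝ) < q.H := by exact_mod_cast q.H_pos
    have h3 := le_logFactor q.d_pos q.H_pos q.ε_pos q.ε_lt q.δ_pos q.δ_lt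
    have h4 := q.ε_pos
    have h5 : 0 < Env.logFactor q.d q.H q.ε q.δ := h1.trans_le h3
    have h6 : 0 < c₀ := by linarith
    positivity
  ε_lt := by
    have h1 : (1 : ℝ) ≤ q.d := by exact_mod_cast q.d_pos
    have h2 : (1 : ℝ) ≤ q.H := by exact_mod_cast q.H_pos
    have h3 := le_logFactor q.d_pos q.H_pos q.ε_pos q.ε_lt q.δ_pos q.δ_lt
    have h5 : 1 ≤ Env.logFactor q.d q.H q.ε q.δ := h1.trans h3
    have h6 : 1 ≤ c₀ := by linarith
    have h7 : 1 ≤ c₀ * q.d * q.H * Env.logFactor q.d q.H q.ε q.δ :=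
      one_le_mul_of_one_le_of_one_le (one_le_mul_of_one_le_of_one_le
        (one_le_mul_of_one_le_of_one_le h6 h1) h2) h5
    rw [div_lt_one (by linarith)]
    linarith [q.ε_lt]
  δ_pos := half_pos q.δ_pos
  δ_lt := by linarith [q.δ_pos, q.δ_lt]

lemma polyBdd_args_inner {c₀ : ℝ} (hc₀ : 1000000 ≤ c₀) (i : Fin 5) :
    PolyBdd fun q => (q.inner c₀ hc₀).args i := by
  fin_cases i
  · exact PolyBdd.a
  · exact PolyBdd.d
  · exact PolyBdd.H
  · have h := ((((PolyBdd.const c₀).mul PolyBdd.d fun q => Nat.cast_nonneg _).mul PolyBdd.H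
      fun q => Nat.cast_nonneg _).mul polyBdd_logFactor fun q => (Nat.cast_nonneg q.d).trans
        (le_logFactor q.d_pos q.H_pos q.ε_pos q.ε_lt q.δ_pos q.δ_lt)).mul PolyBdd.inv_ε
        fun q => (one_div_pos.2 q.ε_pos).le
    refine h.mono fun q => le_of_eq ?_
    change 1 / (q.ε / (c₀ * q.d * q.H * Env.logFactor q.d q.H q.ε q.δ)) = _
    rw [one_div_div]
    ring
  · refine ((PolyBdd.const 1).add PolyBdd.log_δ).mono fun q => ?_
    change Real.log (1 / (q.δ / 2)) ≤ _
    have h := q.δ_pos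
    rw [one_div_div, show 2 / q.δ = 2 * (1 / q.δ) by ring,
      Real.log_mul (by norm_num) (by positivity)]
    have := Real.log_two_lt_d9
    linarith

lemma PolyBddNat.d : PolyBddNat fun q => q.d := PolyBdd.d
lemma PolyBddNat.H : PolyBddNat fun q => q.H := PolyBdd.H
lemma PolyBddNat.a : PolyBddNat fun q => q.a := PolyBdd.a

lemma PolyBdd.inv_ε_pow (n : ℕ) : PolyBdd fun q => 1 / q.ε ^ n :=
  (PolyBdd.inv_ε.pow (fun q => (one_div_pos.2 q.ε_pos).le) n).mono fun q => by
    rw [div_pow, one_pow]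

lemma polyBddNat_numIter : PolyBddNat fun q => Env.numIter q.d q.ε := by
  refine ((PolyBdd.d).add ((PolyBdd.d.mul (((PolyBdd.const 400).mul PolyBdd.d
    fun q => Nat.cast_nonneg _).mul (PolyBdd.inv_ε_pow 2) fun q => by positivity)
      fun q => by positivity).add (PolyBdd.const 1))).mono fun q => ?_
  refine (numIter_le q.ε_pos q.ε_lt q.d_pos).trans (le_of_eq ?_)
  ring

lemma polyBdd_log_callDelta :
    PolyBdd fun q => Real.log (1 / callDelta q.d q.H q.ε q.δ) := by
  refine ((((PolyBdd.const 16).mul PolyBdd.H fun q => Nat.cast_nonneg _).mul polyBddNat_numIter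
    fun q => Nat.cast_nonneg _).add PolyBdd.log_δ).mono fun q => ?_
  have h1 : (0 : ℝ) < q.H := by exact_mod_cast q.H_pos
  have h2 : (0 : ℝ) < Env.numIter q.d q.ε := by exact_mod_cast one_le_numIter q.d_pos q.ε
  have h3 := q.δ_pos
  rw [callDelta, one_div_div, show 16 * q.H * Env.numIter q.d q.ε / q.δ =
    16 * q.H * Env.numIter q.d q.ε * (1 / q.δ) by ring, Real.log_mul (by positivity) (by positivity)]
  have h5 := Real.log_le_self (by positivity : (0 : ℝ) ≤ 16 * q.H * Env.numIter q.d q.ε)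
  linarith

lemma log_callDelta_nonneg (q : Scale) : 0 ≤ Real.log (1 / callDelta q.d q.H q.ε q.δ) := by
  have h := callDelta_pos q.d_pos q.H_pos (e := q.ε) q.δ_pos
  have h1 := callDelta_le q.d_pos q.H_pos (e := q.ε) q.δ_lt
  exact Real.log_nonneg (by rw [le_div_iff₀ h]; linarith)

lemma polyBddNat_numVec (c : ℝ) : PolyBddNat fun q => Env.numVec q.d q.H c q.ε q.δ := by
  have h := (((PolyBdd.const c).mul (PolyBdd.d.pow (fun q => Nat.cast_nonneg _) 2)
    fun q => by positivity).mul (PolyBdd.inv_ε_pow 2) fun q => by positivity).mul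
      polyBdd_log_callDelta log_callDelta_nonneg
  refine PolyBdd.mono h.natCeil fun q => le_of_eq ?_
  have e : c * (q.d : ℝ) ^ 2 / q.ε ^ 2 = c * (q.d : ℝ) ^ 2 * (1 / q.ε ^ 2) := by ring
  rw [← e]
  rfl

/-- The number of OCP episodes prescribed by a polynomial. -/
def Scale.episodes (p : MvPolynomial (Fin 5) ℕ) (q : Scale) : ℕ := ⌈aeval q.args p⌉₊

lemma polyBddNat_episodes (p : MvPolynomial (Fin 5) ℕ) : PolyBddNat (Scale.episodes p) :=
  PolyBdd.natCeil (f := fun q => aeval q.args p) ⟨p, fun _ => le_rfl⟩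

/-- The number of regression episodes for each policy of the first phase. -/
def Scale.regression (c₁ : ℝ) (q : Scale) : ℕ :=
  ⌈c₁ * (q.d : ℝ) ^ 2 * (q.H : ℝ) ^ 2 * Env.logFactor q.d q.H q.ε q.δ ^ 2 / q.ε ^ 2⌉₊

lemma Scale.logFactor_nonneg (q : Scale) : 0 ≤ Env.logFactor q.d q.H q.ε q.δ :=
  (Nat.cast_nonneg _).trans (le_logFactor q.d_pos q.H_pos q.ε_pos q.ε_lt q.δ_pos q.δ_lt)

lemma polyBddNat_regression (c₁ : ℝ) : PolyBddNat (Scale.regression c₁) := by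
  have h := ((((PolyBdd.const c₁).mul (PolyBdd.d.pow (fun q => Nat.cast_nonneg _) 2)
    fun q => by positivity).mul (PolyBdd.H.pow (fun q => Nat.cast_nonneg _) 2)
    fun q => by positivity).mul (polyBdd_logFactor.pow Scale.logFactor_nonneg 2)
    fun q => by positivity).mul (PolyBdd.inv_ε_pow 2) fun q => by positivity
  refine PolyBdd.mono h.natCeil fun q => le_of_eq ?_
  rw [Scale.regression]
  congr 2
  ring

lemma polyBdd_ocpNeed {x Λ : Scale → ℝ} (hx : PolyBdd x) (hx0 : ∀ q, 0 ≤ x q) (hΛ : PolyBdd Λ)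
    (hΛ0 : ∀ q, 0 ≤ Λ q) : PolyBdd fun q => ocpNeed q.d q.H (x q) (Λ q) := by
  have c := PolyBdd.const
  have hd0 : ∀ q : Scale, (0 : ℝ) ≤ q.d := fun q => Nat.cast_nonneg _
  have hH0 : ∀ q : Scale, (0 : ℝ) ≤ q.H := fun q => Nat.cast_nonneg _
  have hx2 := hx.pow hx0 2
  exact (((c 4).mul hx hx0).mul (((PolyBdd.H.mul PolyBdd.d hd0).add hΛ).add (c 1)) fun q =>
    add_nonneg (add_nonneg (mul_nonneg (hH0 q) (hd0 q)) (hΛ0 q)) zero_le_one).add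
      ((((c 4).mul hx2 fun q => sq_nonneg _)).mul (((c 16).mul hx2 fun q => sq_nonneg _).add hΛ)
        fun q => add_nonneg (by positivity) (hΛ0 q))

/-- Polynomially many episodes make OCP accurate enough for the first phase. -/
lemma polyBdd_firstNeed : PolyBdd fun q =>
    ocpNeed q.d q.H (24 * q.H / q.ε) (2 * Real.log (1 / callDelta q.d q.H q.ε q.δ)) + 1 := by
  refine (polyBdd_ocpNeed ?_ (fun q => ?_) ((PolyBdd.const 2).mul polyBdd_log_callDelta
    log_callDelta_nonneg) fun q => mul_nonneg zero_le_two (log_callDelta_nonneg q)).add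
      (PolyBdd.const 1)
  · refine (((PolyBdd.const 24).mul PolyBdd.H fun q => Nat.cast_nonneg _).mul PolyBdd.inv_ε
      fun q => (one_div_pos.2 q.ε_pos).le).mono fun q => le_of_eq ?_
    ring
  · have := q.ε_pos
    positivity

/-- Polynomially many episodes make OCP accurate enough for the second phase. -/
lemma polyBdd_secondNeed (c₁ : ℝ) : PolyBdd fun q =>
    ocpNeed q.d q.H (6 * (q.H * (q.d * q.regression c₁)) / q.ε) (Real.log (4 / q.δ)) + 1 := by
  refine (polyBdd_ocpNeed ?_ (fun q => ?_) ?_ fun q => ?_).add (PolyBdd.const 1)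
  · refine (((PolyBdd.const 6).mul (PolyBdd.H.mul (PolyBdd.d.mul (polyBddNat_regression c₁)
      fun q => Nat.cast_nonneg _) fun q => by positivity) fun q => by positivity).mul PolyBdd.inv_ε
      fun q => (one_div_pos.2 q.ε_pos).le).mono fun q => le_of_eq ?_
    ring
  · have := q.ε_pos
    positivity
  · refine ((PolyBdd.const 4).add PolyBdd.log_δ).mono fun q => ?_
    have h := q.δ_pos
    rw [show 4 / q.δ = 4 * (1 / q.δ) by ring, Real.log_mul (by norm_num) (by positivity)]
    have := Real.log_le_self (by norm_num : (0 : ℝ) ≤ 4)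
    linarith
  · refine Real.log_nonneg ?_
    rw [le_div_iff₀ q.δ_pos]
    linarith [q.δ_lt]

/-! ### Polynomial bounds on the resources -/

section Resources

variable (κ : MvPolynomial (Fin 2) ℕ)

/-- `greedyCost` for linear programs of price `κ`. -/
def greedySteps (a d m : ℕ) : ℕ := a * (d + eval ![d, 2 * m] κ + 1)

/-- `boundsCost` for linear programs of price `κ`. -/
def boundsSteps (a d m : ℕ) : ℕ :=
  greedySteps κ a d m + a * d + eval ![d + 1, 2 * m + a] κ

/-- `ocpSteps` for linear programs of price `κ`. -/
def ocpStepCount (a d H T : ℕ) : ℕ :=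
  T * (H * (greedySteps κ a d (T * H) + boundsSteps κ a d (T * H) + 4 * d + 10)) +
    T * (T * (H * (greedySteps κ a d (T * H) + 1) + H * (3 * d + 2)) + 2)

lemma polyBddNat_greedySteps {m : Scale → ℕ} (hm : PolyBddNat m) :
    PolyBddNat fun q => greedySteps κ q.a q.d (m q) := by
  have h := PolyBddNat.eval_comp (v := fun q => ![q.d, 2 * m q]) (fun i => by
    fin_cases i
    · exact PolyBddNat.d
    · exact (PolyBddNat.const 2).mul hm) κ
  exact PolyBddNat.a.mul ((PolyBddNat.d.add h).add (PolyBddNat.const 1))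

lemma polyBddNat_boundsSteps {m : Scale → ℕ} (hm : PolyBddNat m) :
    PolyBddNat fun q => boundsSteps κ q.a q.d (m q) := by
  have h := PolyBddNat.eval_comp (v := fun q => ![q.d + 1, 2 * m q + q.a]) (fun i => by
    fin_cases i
    · exact PolyBddNat.d.add (PolyBddNat.const 1)
    · exact ((PolyBddNat.const 2).mul hm).add PolyBddNat.a) κ
  exact ((polyBddNat_greedySteps κ hm).add (PolyBddNat.a.mul PolyBddNat.d)).add h

lemma polyBddNat_ocpStepCount {T : Scale → ℕ} (hT : PolyBddNat T) :
    PolyBddNat fun q => ocpStepCount κ q.a q.d q.H (T q) := by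
  have hG := polyBddNat_greedySteps κ (hT.mul PolyBddNat.H)
  have hB := polyBddNat_boundsSteps κ (hT.mul PolyBddNat.H)
  have c := PolyBddNat.const
  exact (hT.mul (PolyBddNat.H.mul (((hG.add hB).add ((c 4).mul PolyBddNat.d)).add (c 10)))).add
    (hT.mul ((hT.mul ((PolyBddNat.H.mul (hG.add (c 1))).add
      (PolyBddNat.H.mul (((c 3).mul PolyBddNat.d).add (c 2))))).add (c 2)))

/-- A bound on the number of episodes drawn by the procedure with `T` and `T₂` episodes of OCP, `N`
rounds of RobustSpanner, `nv` episodes of vector estimation and `n` of regression. -/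
def sampleCount (d H T nv N n T₂ : ℕ) : ℕ :=
  H * (N * (2 * (T + T * T + nv))) + (H * (d * n) + (T₂ + T₂ * T₂))

/-- A bound on the number of steps of the procedure. -/
def stepCount (a d H T nv N n T₂ : ℕ) : ℕ :=
  H * (N * (2 * (ocpStepCount κ a d H T +
    (nv * (H * (greedySteps κ a d (T * H) + 1) + 2 * d) + d)) + cofactorCost d)) +
  (H * (d * (n * (H * (greedySteps κ a d (T * H) + 1) + 5 * (d + 1) ^ 2)) + 10 * (d + 1) ^ 3) +
    (ocpStepCount κ a d H T₂ + (H * (2 * d + 2) + 1)))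

variable {T nv N n T₂ : Scale → ℕ} (hT : PolyBddNat T) (hnv : PolyBddNat nv) (hN : PolyBddNat N)
  (hn : PolyBddNat n) (hT₂ : PolyBddNat T₂)
include hT hnv hN hn hT₂

lemma polyBddNat_sampleCount : PolyBddNat fun q =>
    sampleCount q.d q.H (T q) (nv q) (N q) (n q) (T₂ q) :=
  (PolyBddNat.H.mul (hN.mul ((PolyBddNat.const 2).mul ((hT.add (hT.mul hT)).add hnv)))).add
    ((PolyBddNat.H.mul (PolyBddNat.d.mul hn)).add (hT₂.add (hT₂.mul hT₂)))

lemma polyBddNat_stepCount : PolyBddNat fun q =>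
    stepCount κ q.a q.d q.H (T q) (nv q) (N q) (n q) (T₂ q) := by
  have hG := polyBddNat_greedySteps κ (hT.mul PolyBddNat.H)
  have hO := polyBddNat_ocpStepCount κ hT
  have hO₂ := polyBddNat_ocpStepCount κ hT₂
  have c := PolyBddNat.const
  have hd := PolyBddNat.d
  have hH := PolyBddNat.H
  have hd1 := hd.add (c 1)
  have hcof : PolyBddNat fun q => cofactorCost q.d :=
    (hd1.mul (hd1.pow 3)).add ((c 20).mul hd1)
  have hroll := hH.mul (hG.add (c 1))
  exact (hH.mul (hN.mul (((c 2).mul (hO.add ((hnv.mul (hroll.add ((c 2).mul hd))).add hd))).add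
    hcof))).add ((hH.mul ((hd.mul (hn.mul (hroll.add ((c 5).mul (hd1.pow 2))))).add
      ((c 10).mul (hd1.pow 3)))).add (hO₂.add ((hH.mul (((c 2).mul hd).add (c 2))).add (c 1))))

end Resources

end Sizes

end LBC
end

noncomputable section
namespace LBC

/-! ### The whole procedure -/

namespace Env

variable {X A Ξ : Type*} [MeasurableSpace X] [MeasurableSpace Ξ] [Fintype A] [Nonempty A] {d : ℕ}

/-- The accuracy `ε/(c₀ d H L)` requested from the first phase. -/
def firstAccuracy (d H : ℕ) (c₀ ε δ : ℝ) : ℝ := ε / (c₀ * d * H * logFactor d H ε δ)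

/-- The parameters with which the procedure runs. -/
def plan (E : Env X A Ξ d) (fuel : ℕ) (c₀ c₁ c₂ : ℝ) (p₁ p₂ : MvPolynomial (Fin 5) ℕ) (ε δ : ℝ) :
    Plan where
  T := E.numEpisodes p₁ (firstAccuracy d E.H c₀ ε δ) (δ / 2)
  nv := numVec d E.H c₂ (firstAccuracy d E.H c₀ ε δ) (δ / 2)
  η := firstAccuracy d E.H c₀ ε δ / 2
  N := d + d * fuel
  n := ⌈c₁ * (d : ℝ) ^ 2 * (E.H : ℝ) ^ 2 * logFactor d E.H ε δ ^ 2 / ε ^ 2⌉₊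
  T₂ := E.numEpisodes p₂ ε δ

variable {E : Env X A Ξ d}

lemma cost_slotPol_le (hlp : ∀ k, Monotone (E.lp k)) {T : ℕ} (hT : 0 < T) (nv : ℕ) (η : ℝ)
    (h N : ℕ) (ξ : ℕ × ℕ × ℕ → X) (i : Fin d) (l : ℕ) :
    (E.slotPol T nv η h N ξ i).cost l ≤ E.greedyCost (T * E.H) := by
  have key : ∀ b, b < T → (if l < E.H then E.greedyCost (b * E.H + l) else 0) ≤
      E.greedyCost (T * E.H) := by
    intro b hb
    split_ifs with hl
    · refine greedyCost_mono hlp ?_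
      have : (b + 1) * E.H ≤ T * E.H := Nat.mul_le_mul_right _ hb
      linarith
    · exact Nat.zero_le _
  exact key _ (bestIdx_lt _ hT)

lemma greedyCost_eq {κ : MvPolynomial (Fin 2) ℕ}
    (hκ : ∀ k m : ℕ, E.lp k m = MvPolynomial.eval ![k, m] κ) (m : ℕ) :
    E.greedyCost m = greedySteps κ (Fintype.card A) d m := by
  rw [greedyCost, greedySteps, hκ]

lemma ocpSteps_eq {κ : MvPolynomial (Fin 2) ℕ}
    (hκ : ∀ k m : ℕ, E.lp k m = MvPolynomial.eval ![k, m] κ) (T : ℕ) :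
    E.ocpSteps T = ocpStepCount κ (Fintype.card A) d E.H T := by
  have h : ∀ m, E.boundsCost m = boundsSteps κ (Fintype.card A) d m := fun m => by
    rw [boundsSteps, ← greedyCost_eq hκ, ← hκ]; rfl
  rw [ocpSteps, ocpStepCount, greedyCost_eq hκ, h]

lemma monotone_lp {κ : MvPolynomial (Fin 2) ℕ}
    (hκ : ∀ k m : ℕ, E.lp k m = MvPolynomial.eval ![k, m] κ) (k : ℕ) : Monotone (E.lp k) := by
  intro m m' h
  rw [hκ, hκ]
  refine eval_mono (fun i => ?_) κ
  fin_cases i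
  · exact le_rfl
  · exact h

variable [MeasurableSpace A] [DiscreteMeasurableSpace A]

section

variable (hφ : E.UnitFeatures) (hφm : E.MeasFeatures) (hL : E.LinearBellmanComplete E.φ)
  (hH : 0 < E.H)
include hφ hL

variable {fuel : ℕ} {c₀ c₁ c₂ : ℝ} {p₁ p₂ : MvPolynomial (Fin 5) ℕ} {ε δ : ℝ} {ω : Tape X Ξ}
  {P : Plan} (hP : E.plan fuel c₀ c₁ c₂ p₁ p₂ ε δ = P)
include hP

lemma policyOpt_val {Γ : ℕ → Fin d → ImplPolicy X A}
    (hΓ : ∀ l < E.H, Γ l = E.basePol P l fun i => (ω i).1) (hT₂ : 0 < P.T₂) :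
    (E.policyOpt ω Γ P.n 1 p₂ ε δ).val =
      E.finalPol P (fun i => (ω i).1) (fun i => (ω i).2) := by
  set ξ : ℕ × ℕ × ℕ → X := fun i => (ω i).1
  set ζ : ℕ × ℕ × ℕ → ℕ → Ξ := fun i => (ω i).2
  have hw : (Costed.iter (fun l (w : ℕ → Vec d) =>
      (E.ridge ω (Γ l) P.n 1 l).bind fun v => Costed.ret (Function.update w l v)) E.H
      fun _ => 0).val = E.rewardEst P ξ ζ := by
    rw [ridge_iter_val]
    funext l
    rw [rewardEst]
    split_ifs with hl
    · rw [hΓ l hl]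
    · rfl
  obtain ⟨θ, hθ, hb⟩ := (boundedVal_finalBound (P := P) hφ ξ ζ).realizable hL hφ
  have hT : E.numEpisodes p₂ ε δ = P.T₂ := by rw [← hP]; rfl
  rw [policyOpt, Costed.bind_val, hw, hT]
  exact ocp_val hθ hb hT₂ _

/-- When RobustSpanner stops at each layer with the policies expected, the procedure stops with the
policy expected, within the stated resources. -/
lemma procedure_spec {κ : MvPolynomial (Fin 2) ℕ}
    (hκ : ∀ k m : ℕ, E.lp k m = MvPolynomial.eval ![k, m] κ)
    (hspan : ∀ l < E.H, (E.spannerLayer ω fuel c₂ p₁ (firstAccuracy d E.H c₀ ε δ) (δ / 2) l).val =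
      some (E.basePol P l fun i => (ω i).1)) (hT : 0 < P.T) (hT₂ : 0 < P.T₂) :
    (E.procedure ω fuel c₀ c₁ c₂ p₁ p₂ ε δ).val =
      some (E.finalPol P (fun i => (ω i).1) (fun i => (ω i).2)) ∧
    (E.procedure ω fuel c₀ c₁ c₂ p₁ p₂ ε δ).Within
      (sampleCount d E.H P.T P.nv P.N P.n P.T₂)
      (stepCount κ (Fintype.card A) d E.H P.T P.nv P.N P.n P.T₂) := by
  have hlp := monotone_lp hκ
  set Γ : ℕ → Fin d → ImplPolicy X A := fun l => if l < E.H then E.basePol P l fun i => (ω i).1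
    else fun _ => somePolicy X A with hΓdef
  have hΓ : ∀ l < E.H, Γ l = E.basePol P l fun i => (ω i).1 := fun l hl => if_pos hl
  have hval : (E.computeSpanner ω fuel c₂ p₁ (firstAccuracy d E.H c₀ ε δ) (δ / 2)).val = some Γ :=
    computeSpanner_val hspan
  have hproc : E.procedure ω fuel c₀ c₁ c₂ p₁ p₂ ε δ =
      (E.computeSpanner ω fuel c₂ p₁ (firstAccuracy d E.H c₀ ε δ) (δ / 2)).bind fun o =>
        match o with
        | none => Costed.ret none
        | some Γ => (E.policyOpt ω Γ P.n 1 p₂ ε δ).bind fun π => Costed.ret (some π) := by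
    rw [← hP]; rfl
  have hcost : ∀ l j h, (Γ l j).cost h ≤ E.greedyCost (P.T * E.H) := by
    intro l j h
    simp only [hΓdef]
    split_ifs
    · exact cost_slotPol_le hlp hT _ _ _ _ _ _ _
    · exact Nat.zero_le _
  rw [hproc]
  constructor
  · rw [Costed.bind_val, hval]
    simp only [Costed.bind_val, Costed.ret_val]
    rw [policyOpt_val hφ hL hP hΓ hT₂]
  · have h1 := within_computeSpanner hlp ω fuel c₂ p₁ (firstAccuracy d E.H c₀ ε δ) (δ / 2)
      (T := P.T) (nv := P.nv) (by rw [← hP]; rfl) (by rw [← hP]; rfl)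
    have h2 := within_policyOpt hlp ω hcost P.n 1 p₂ ε δ (T := P.T₂) (by rw [← hP]; rfl)
    have hN : P.N = d + d * fuel := by rw [← hP]; rfl
    rw [probeSteps, ocpSteps_eq hκ, greedyCost_eq hκ, ← hN] at h1
    rw [ocpSteps_eq hκ, greedyCost_eq hκ] at h2
    refine h1.bind ?_
    rw [hval]
    exact h2.bind (Costed.within_ret _)

end

/-- The procedure succeeds with probability at least `1 - δ`, if both phases use enough episodes of
OCP. -/
theorem measure_not_succeeds_le (hφ : E.UnitFeatures) (hφm : E.MeasFeatures)
    (hL : E.LinearBellmanComplete E.φ) (hd : 0 < d) (hH : 0 < E.H) {w : ℕ → Vec d}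
    (hw : E.RewardParam w) {c₀ c₁ c₂ ε δ : ℝ} (hc₀ : 1000000 ≤ c₀) (hc₁ : 1000000 ≤ c₁)
    (hc₂ : 1000000 ≤ c₂) (hε : 0 < ε) (hε1 : ε < 1) (hδ : 0 < δ) (hδ1 : δ < 1)
    {p₁ p₂ : MvPolynomial (Fin 5) ℕ} {κ : MvPolynomial (Fin 2) ℕ}
    (hκ : ∀ k m : ℕ, E.lp k m = MvPolynomial.eval ![k, m] κ) {e S K : ℝ} {fuel : ℕ} {P : Plan}
    (he : firstAccuracy d E.H c₀ ε δ = e) (he0 : 0 < e) (he1 : e < 1)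
    (hfuel : fuel = 2 * numIter d e)
    (hP : E.plan fuel c₀ c₁ c₂ p₁ p₂ ε δ = P)
    (hneed₁ : ocpNeed d E.H (24 * E.H / e) (2 * Real.log (1 / callDelta d E.H e (δ / 2))) + 1 ≤ P.T)
    (hneed₂ : ocpNeed d E.H (6 * (E.H * (d * P.n)) / ε) (Real.log (4 / δ)) + 1 ≤ P.T₂)
    (hS : (sampleCount d E.H P.T P.nv P.N P.n P.T₂ : ℝ) ≤ S)
    (hK : (stepCount κ (Fintype.card A) d E.H P.T P.nv P.N P.n P.T₂ : ℝ) ≤ K) :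
    E.tapeLaw {ω | ¬ E.Succeeds c₀ c₁ c₂ p₁ p₂ ε δ S K ω} ≤ ENNReal.ofReal δ := by
  have hd' : (1 : ℝ) ≤ d := by exact_mod_cast hd
  have hH' : (1 : ℝ) ≤ E.H := by exact_mod_cast hH
  have hδ2 : 0 < δ / 2 := half_pos hδ
  have hδ21 : δ / 2 < 1 := by linarith
  set q := callDelta d E.H e (δ / 2) with hq
  have hq0 : 0 < q := callDelta_pos hd hH hδ2
  have hq1 : q ≤ 1 / 16 := callDelta_le hd hH hδ21
  have hlogq : 0 ≤ Real.log (1 / q) :=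
    Real.log_nonneg (by rw [le_div_iff₀ hq0]; linarith)
  have hlog4 : 0 ≤ Real.log (4 / δ) := Real.log_nonneg (by rw [le_div_iff₀ hδ]; linarith)
  have hPη : P.η = e / 2 := by rw [← hP, ← he]; rfl
  have hPN : P.N = d + d * fuel := by rw [← hP]; rfl
  have hPnv : P.nv = numVec d E.H c₂ e (δ / 2) := by rw [← hP, ← he]; rfl
  have hPT : E.numEpisodes p₁ e (δ / 2) = P.T := by rw [← hP, ← he]; rfl
  have hLpos : 0 < logFactor d E.H ε δ := by
    have := le_logFactor hd hH hε hε1 hδ hδ1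
    linarith
  have hPn : c₁ * (d : ℝ) ^ 2 * (E.H : ℝ) ^ 2 * logFactor d E.H ε δ ^ 2 / ε ^ 2 ≤ P.n := by
    rw [← hP]; exact Nat.le_ceil _
  have hn : 0 < P.n := by
    have : 0 < c₁ * (d : ℝ) ^ 2 * (E.H : ℝ) ^ 2 * logFactor d E.H ε δ ^ 2 / ε ^ 2 := by
      have : 0 < c₁ := by linarith
      positivity
    exact_mod_cast this.trans_le hPn
  have hnr : (0 : ℝ) < P.n := by exact_mod_cast hn
  have hnv : 0 < P.nv := by
    rw [hPnv]; exact numVec_pos hd hH (by linarith) he0 hδ2 hδ21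
  have hneed0 : ∀ x Λ : ℝ, 0 ≤ x → 0 ≤ Λ → 0 ≤ ocpNeed d E.H x Λ := by
    intro x Λ hx hΛ
    rw [ocpNeed]; positivity
  have hT : 0 < P.T := by
    have h := hneed0 (24 * E.H / e) (2 * Real.log (1 / q)) (by positivity) (by positivity)
    have : (0 : ℝ) < P.T := by linarith
    exact_mod_cast this
  have hT₂ : 0 < P.T₂ := by
    have h := hneed0 (6 * (E.H * (d * P.n)) / ε) (Real.log (4 / δ)) (by positivity) hlog4
    have : (0 : ℝ) < P.T₂ := by linarith
    exact_mod_cast this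
  have hfail₁ : ocpFail d E.H E.H (e / 24) P.T ≤ q ^ 2 := by
    refine ocpFail_le (by linarith) (by positivity) (by positivity) (by nlinarith) ?_
    have e1 : (E.H : ℝ) / (e / 24) = 24 * E.H / e := by field_simp
    have e2 : Real.log (1 / q ^ 2) = 2 * Real.log (1 / q) := by
      rw [show 1 / q ^ 2 = (1 / q) ^ 2 by rw [div_pow, one_pow], Real.log_pow]; norm_num
    rw [e1, e2]
    linarith
  have hfail₂ : ocpFail d E.H (E.H * (d * P.n)) (ε / 6) P.T₂ ≤ δ / 4 := by
    refine ocpFail_le (by positivity) (by positivity) (by positivity) (by linarith) ?_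
    have e1 : (E.H * (d * P.n) : ℝ) / (ε / 6) = 6 * (E.H * (d * P.n)) / ε := by field_simp
    rw [e1, one_div_div]
    linarith
  have hphase : (Measure.infinitePi fun _ : ℕ × ℕ × ℕ => E.init)
      {ξ | ¬ E.GoodPhase P.T P.nv P.η (3 * (e / 24)) (e / 8) P.N ξ} ≤ ENNReal.ofReal (δ / 4) := by
    refine (measure_not_goodPhase_le hφ hφm hL hH (by positivity) (by positivity) hT hnv P.N hfail₁
      (by rw [hPnv]; exact exp_numVec_le hd hH (by linarith) he0 hδ2 hδ21)).trans ?_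
    refine ENNReal.ofReal_le_ofReal ?_
    have h := sum_callDelta_le hd hH (e := e) hδ2 hδ21
    rw [hPN, hfuel]
    linarith
  set t := deviation d E.H δ with ht
  have ht0 : 0 ≤ t := deviation_nonneg hd hH hδ hδ1
  have hτ : (P.n : ℝ) * (√t / √P.n) ^ 2 = t := by
    rw [div_pow, Real.sq_sqrt ht0, Real.sq_sqrt hnr.le]
    field_simp
  have hgood := measure_not_good_le hφ hφm hL hH hd hw (P := P) (δ₁ := 3 * (e / 24)) (δ₂ := e / 8)
    (α := ε / 6) (t := t) (τ := √t / √P.n) (p₁ := δ / 4) (p₂ := δ / (8 * d * E.H)) (p₃ := δ / 4)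
    (by positivity) (by positivity) hn hT₂ (by positivity) hphase
    (exp_deviation hd hH hδ).le (by rw [hτ]; exact (exp_deviation hd hH hδ).le) hfail₂
  refine (measure_mono ?_).trans (hgood.trans (ENNReal.ofReal_le_ofReal ?_))
  · intro ω hω hcon
    refine hω ?_
    obtain ⟨h1, h2, h3, h4⟩ := hcon
    have hrs : ∀ l < E.H, _ := fun l hl => GoodPhase.robustSpanner hφ hφm hL hd hH hT hl (ω := ω)
      (nv := P.nv) (η := P.η) (fuel := fuel) (by rw [hPη]; positivity) (by rw [hPη]; linarith)
      (by rw [hPη, hfuel]; exact factorial_mul_lt hd he0 he1) (by rw [← hPN]; exact h1)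
      (by rw [hPη]; linarith)
    obtain ⟨hval, hwithin⟩ := procedure_spec hφ hL hP (ω := ω) hκ (fun l hl => by
      have h := (hrs l hl).1
      rw [← hPN] at h
      rw [spannerLayer, he, hPT, ← hPnv, ← hPη]
      exact h) hT hT₂
    refine ⟨fuel, _, hval, ?_, (Nat.cast_le.2 hwithin.1).trans hS,
      (Nat.cast_le.2 hwithin.2).trans hK⟩
    refine isEpsOptimal_finalPol hφ hφm hL hH hw (D := ε / 4) (fun π hπ => ?_) h4 (by linarith)
    refine (abs_meanVal_sub_le hφ hφm hL hH (β := √t + √d) (τ := √t / √P.n) (e := e / 2 + e / 8)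
      (by positivity) (by positivity) hn (fun l hl π hπ Δ => ?_) h2 h3 hπ).trans
      (estimation_error_le hd hH hε hε1 hδ hδ1 hc₀ hc₁ hPn he.symm rfl rfl)
    have h := (hrs l hl).2 π hπ Δ
    rw [← hPN] at h
    rw [← hPη]
    exact h
  · have h : (E.H : ℝ) * ((1 + d) * (δ / (8 * d * E.H))) = (1 + d) * δ / (8 * d) := by
      field_simp
    have h' : (1 + d) * δ / (8 * d) ≤ δ / 4 := by
      rw [div_le_div_iff₀ (by positivity) (by norm_num)]
      nlinarith
    rw [h]
    linarith

end Env
end LBC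
end

noncomputable section
namespace LBC

/-- Polynomials bounding the numbers of OCP episodes needed in the two phases. -/
lemma exists_need {c₀ : ℝ} (hc₀ : 1000000 ≤ c₀) (c₁ : ℝ) :
    ∃ P : MvPolynomial (Fin 5) ℕ, ∀ q : Scale,
      ocpNeed q.d q.H (24 * q.H / (q.inner c₀ hc₀).ε) (2 * Real.log (1 / callDelta q.d q.H
        (q.inner c₀ hc₀).ε (q.δ / 2))) + 1 ≤ MvPolynomial.aeval (q.inner c₀ hc₀).args P ∧
      ocpNeed q.d q.H (6 * (q.H * (q.d * q.regression c₁)) / q.ε) (Real.log (4 / q.δ)) + 1 ≤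
        MvPolynomial.aeval q.args P := by
  obtain ⟨P₁, h₁⟩ := polyBdd_firstNeed
  obtain ⟨P₂, h₂⟩ := polyBdd_secondNeed c₁
  refine ⟨P₁ + P₂, fun q => ⟨?_, ?_⟩⟩
  · rw [map_add]
    exact (h₁ (q.inner c₀ hc₀)).trans (le_add_of_nonneg_right (aeval_nonneg (Scale.args_nonneg _) _))
  · rw [map_add]
    exact (h₂ q).trans (le_add_of_nonneg_left (aeval_nonneg (Scale.args_nonneg _) _))

end LBC
end

theorem mainTheorem2 :
    ∃ C : ℝ, 0 < C ∧ ∀ c₀ c₁ c₂ : ℝ, C ≤ c₀ → C ≤ c₁ → C ≤ c₂ →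
    -- `T` in either phase is any polynomial that is sufficiently large, i.e. dominates `P`
    ∃ P : MvPolynomial (Fin 5) ℕ, ∀ p₁ p₂ : MvPolynomial (Fin 5) ℕ,
      (∀ v : Fin 5 → ℝ, (∀ i, 0 ≤ v i) →
        MvPolynomial.aeval v P ≤ MvPolynomial.aeval v p₁ ∧
        MvPolynomial.aeval v P ≤ MvPolynomial.aeval v p₂) →
    -- any polynomial price of a linear program
    ∀ κ : MvPolynomial (Fin 2) ℕ,
    ∃ S K : MvPolynomial (Fin 5) ℕ,
      ∀ (X A Ξ : Type*) [MeasurableSpace X] [MeasurableSpace Ξ] [Fintype A] [Nonempty A]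
        (d : ℕ) (E : LBC.Env X A Ξ d) (ε δ : ℝ),
        0 < d → 0 < E.H → 0 < ε → ε < 1 → 0 < δ → δ < 1 →
        (∀ k m : ℕ, E.lp k m = MvPolynomial.eval ![k, m] κ) →
        E.LinearBellmanComplete E.φ → E.BoundedLinear E.φ →
        E.tapeLaw {ω | ¬ E.Succeeds c₀ c₁ c₂ p₁ p₂ ε δ
          (MvPolynomial.aeval (LBC.sizes A d E.H ε δ) S)
          (MvPolynomial.aeval (LBC.sizes A d E.H ε δ) K) ω} ≤ ENNReal.ofReal δ := by
  refine ⟨1000000, by norm_num, fun c₀ c₁ c₂ hc₀ hc₁ hc₂ => ?_⟩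
  obtain ⟨P, hP⟩ := LBC.exists_need hc₀ c₁
  refine ⟨P, fun p₁ p₂ hp κ => ?_⟩
  have hinner := LBC.polyBdd_args_inner hc₀
  have hT := (LBC.polyBddNat_episodes p₁).comp hinner
  have hnv := (LBC.polyBddNat_numVec c₂).comp hinner
  have hfuel := (LBC.PolyBddNat.const 2).mul (LBC.polyBddNat_numIter.comp hinner)
  have hN := LBC.PolyBddNat.d.add (LBC.PolyBddNat.d.mul hfuel)
  have hn := LBC.polyBddNat_regression c₁
  have hT₂ := LBC.polyBddNat_episodes p₂
  obtain ⟨S, hS⟩ := LBC.polyBddNat_sampleCount hT hnv hN hn hT₂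
  obtain ⟨K, hK⟩ := LBC.polyBddNat_stepCount κ hT hnv hN hn hT₂
  refine ⟨S, K, ?_⟩
  intro X A Ξ _ _ _ _ d E ε δ hd hH hε hε1 hδ hδ1 hκ hL hB
  let q : LBC.Scale := ⟨Fintype.card A, d, E.H, ε, δ, Fintype.card_pos, hd, hH, hε, hε1, hδ, hδ1⟩
  let _ : MeasurableSpace A := ⊤
  have : DiscreteMeasurableSpace A := ⟨fun _ => trivial⟩
  obtain ⟨w, hw⟩ := LBC.Env.exists_rewardParam hB
  refine LBC.Env.measure_not_succeeds_le hB.2.1 hB.1 hL hd hH hw hc₀ hc₁ hc₂ hε hε1 hδ hδ1 hκ rfl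
    (q.inner c₀ hc₀).ε_pos (q.inner c₀ hc₀).ε_lt rfl rfl ?_ ?_ (hS q) (hK q)
  · exact (hP q).1.trans (((hp _ (q.inner c₀ hc₀).args_nonneg).1).trans (Nat.le_ceil _))
  · exact (hP q).2.trans (((hp _ q.args_nonneg).2).trans (Nat.le_ceil _))
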